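/- All manifolds and maps between them are smooth. Let $F$ be a closed orientable surface of genus $g\ge 1$, let $\pi\colon X\to F$ be a fibre bundle with fibre the torus $T^2$, and let $T=\pi^{-1}(b)$ be a fibre. Let $K\subset S^3$ be a knot with closed tubular neighbourhood $\nu(K)$, let $N=S^3\setminus\nu^{\circ}(K)$ be its exterior (where $\nu^\circ$ denotes the interior of $\nu$), let $N_0=S^3_0(K)\supset N$ be the $0$-surgery on $K$, and let $K'\subset N_0$ be the dual knot of the surgery, i.e. the core of the solid torus $N_0\setminus \operatorname{int} N$. Let $f\colon S^1\times K'\to T$ be a diffeomorphism, and let $X_K=X\#_f(S^1\times N_0)$ be a normal connected sum of $(S^1\times N_0,S^1\times K')$ and $(X,T)$ along $f$: for $F_1=S^1\times K'\subset X_1=S^1\times N_0$ and $F_2=T\subset X_2=X$ choose tubular neighbourhoods $\nu(F_i)\subset \operatorname{int}N(F_i)$ (trivial disk bundles), put $W_i=N(F_i)\setminus\nu^\circ(F_i)$, choose a diffeomorphism $\bar f\colon W_1\to W_2$ of annulus bundles that covers $f$ and satisfies $\bar f(\partial N(F_1))=\partial\nu(F_2)$, and glue $X_1\setminus\nu^\circ(F_1)$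 and $X_2\setminus\nu^\circ(F_2)$ together via $\bar f$. Let $\alpha\colon\pi_1(N_0)\to G$ be an epimorphism onto a finite group $G$, let $p_0\colon\widetilde N_0\to N_0$ be the connected covering corresponding to $\ker\alpha$, and let $\widetilde N=p_0^{-1}(N)$. Suppose that $p_0^{-1}(K')$ has $r$ components. Then the restrictions of $p_0$ to the components of $p_0^{-1}(K')$ are coverings of $K'$ of one and the same degree $l$, and there exists a connected $rl^3$-fold covering $\widetilde X_K\to X_K$ such that $\widetilde X_K$ contains a submanifold diffeomorphic to $S^1\times\widetilde N$ and $\widetilde X_K$ admits a retraction onto (a subspace homeomorphic to) the complete bipartite graph $K_{r,l}$. -/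

import Mathlib

open Set
open scoped Manifold ContDiff

universe u₁ u₂ u₃ u₄ u₅ u₆

/-- The unit sphere `S³ ⊂ ℝ⁴`. -/
abbrev Sphere3 : Type := Metric.sphere (0 : EuclideanSpace ℝ (Fin (3 + 1))) 1

/-! ### Closed oriented surfaces of genus `g ≥ 1` -/

/-- The boundary of the closed unit disk is divided into `4 * g` sides;
`polygonSide g j s` is the point at time `s ∈ [0, 1]` of the `j`-th side. -/
noncomputable def polygonSide (g j : ℕ) (s : unitInterval) :
    Metric.closedBall (0 : ℂ) 1 :=
  ⟨(Circle.exp (2 * Real.pi * ((j + (s : ℝ)) / (4 * g))) : ℂ),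
    mem_closedBall_zero_iff.2 (Circle.norm_coe _).le⟩

/-- The side pairing of the `4g`-gon with boundary word
`a₁ b₁ a₁⁻¹ b₁⁻¹ ⋯ a_g b_g a_g⁻¹ b_g⁻¹`. -/
inductive PolygonGlue (g : ℕ) :
    Metric.closedBall (0 : ℂ) 1 → Metric.closedBall (0 : ℂ) 1 → Prop
  | a (k : ℕ) (hk : k < g) (s : unitInterval) :
      PolygonGlue g (polygonSide g (4 * k) s) (polygonSide g (4 * k + 2) (unitInterval.symm s))
  | b (k : ℕ) (hk : k < g) (s : unitInterval) :
      PolygonGlue g (polygonSide g (4 * k + 1) s) (polygonSide g (4 * k + 3) (unitInterval.symm s))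

/-- The standard closed orientable surface of genus `g ≥ 1`, as a topological space: the quotient
of the `4g`-gon by the equivalence relation generated by its side pairing, with the
quotient topology. (For `g = 0` this is a disk; only `g ≥ 1` is used.) -/
def GenusSurface (g : ℕ) : Type := Quot (PolygonGlue g)

instance (g : ℕ) : TopologicalSpace (GenusSurface g) :=
  inferInstanceAs (TopologicalSpace (Quot (PolygonGlue g)))

/-! ### Embeddings between manifolds of the same dimension -/

section CodimZero

variable {E₁ H₁ M₁ E₂ H₂ M₂ : Type*}
  [NormedAddCommGroup E₁] [NormedSpace ℝ E₁] [TopologicalSpace H₁]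
  [NormedAddCommGroup E₂] [NormedSpace ℝ E₂] [TopologicalSpace H₂]
  [TopologicalSpace M₁] [ChartedSpace H₁ M₁] [TopologicalSpace M₂] [ChartedSpace H₂ M₂]

/-- `φ` restricts to an injective map on `s` that is, near every point of `s`, a smooth local
diffeomorphism of the ambient manifolds (the values of `φ` away from `s` are irrelevant).
If `s` is open this says that `φ` is a diffeomorphism of `s` onto an open subset; if `s` is a
compact codimension zero submanifold with boundary it says that `φ` is a diffeomorphism of `s`
onto a codimension zero submanifold with boundary. -/
def SmoothEmbOn (I₁ : ModelWithCorners ℝ E₁ H₁) (I₂ : ModelWithCorners ℝ E₂ H₂)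
    (φ : M₁ → M₂) (s : Set M₁) : Prop :=
  InjOn φ s ∧ IsLocalDiffeomorphOn I₁ I₂ ∞ φ s

/-- A smooth covering map. -/
def IsSmoothCovering (I₁ : ModelWithCorners ℝ E₁ H₁) (I₂ : ModelWithCorners ℝ E₂ H₂)
    (p : M₁ → M₂) : Prop :=
  IsCoveringMap p ∧ IsLocalDiffeomorph I₁ I₂ ∞ p

end CodimZero

/-! ### Torus bundles over surfaces -/

/-- `π : X → F` is a smooth fibre bundle with fibre the torus `S¹ × S¹`: over a neighbourhood `U`
of each point there is a diffeomorphism `ψ : U × T² → π⁻¹(U)` commuting with the projections. -/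
def IsTorusBundle {F X : Type*}
    [TopologicalSpace F] [ChartedSpace (EuclideanSpace ℝ (Fin 2)) F]
    [TopologicalSpace X] [ChartedSpace (EuclideanSpace ℝ (Fin 4)) X] (π : X → F) : Prop :=
  ContMDiff (𝓡 4) (𝓡 2) ∞ π ∧
  ∀ b : F, ∃ U : Set F, IsOpen U ∧ b ∈ U ∧
    ∃ ψ : F × (Circle × Circle) → X,
      SmoothEmbOn ((𝓡 2).prod ((𝓡 1).prod (𝓡 1))) (𝓡 4) ψ (U ×ˢ univ) ∧
      ψ '' (U ×ˢ univ) = π ⁻¹' U ∧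
      ∀ x ∈ U, ∀ t, π (ψ (x, t)) = x

/-! ### Zero surgery on a knot -/

/-- The loop `z ↦ c z` lies in the complement of `A` and is null-homologous there: its class in
`H₁ = π₁ / [π₁, π₁]` of the complement vanishes. -/
def NullHomologousOff {M : Type*} [TopologicalSpace M] (A : Set M) (c : Circle → M) : Prop :=
  ∃ (x : (Aᶜ : Set M)) (γ : Path x x),
    (∀ t : unitInterval, (γ t : M) = c (Circle.exp (2 * Real.pi * (t : ℝ)))) ∧
    FundamentalGroup.fromPath (Path.Homotopic.Quotient.mk γ) ∈
      commutator (FundamentalGroup (Aᶜ : Set M) x)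

section ZeroSurgery

variable {N₀ : Type*} [TopologicalSpace N₀] [ChartedSpace (EuclideanSpace ℝ (Fin 3)) N₀]

/-- The core curve `S¹ × 0` of a solid torus `σ : S¹ × ℂ → N₀`. -/
def dualKnot (σ : Circle × ℂ → N₀) : Set N₀ := range fun z => σ (z, 0)

/-- The complement of the open solid torus `σ(S¹ × {|v| < 1})`. -/
def solidTorusExterior (σ : Circle × ℂ → N₀) : Set N₀ := (σ '' {p | ‖p.2‖ < 1})ᶜ

/-- `N₀` is the result of `0`-surgery on the knot `K ⊂ S³`, and `σ : S¹ × ℂ → N₀` is an open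
tubular neighbourhood of the dual knot, which is its core.

Here `τ : S¹ × ℂ → S³` is an open tubular neighbourhood of `K` whose parallel `τ(S¹ × 1)` is the
Seifert longitude, i.e. is null-homologous in `S³ ∖ K`. The manifold `N₀` is the union of the copy
`j(S³ ∖ K)` of the knot complement and of the solid torus `σ(S¹ × ℂ)`; the circle
`σ(z × {|v| = ρ})`, a meridian of the solid torus, is identified with the longitude
`τ(S¹ × ρ z)` of `K`. The knot exterior `S³ ∖ τ(S¹ × {|v| < 1})` is identified by `j` with
`solidTorusExterior σ`. -/
def IsZeroSurgery (K : Circle → Sphere3) (σ : Circle × ℂ → N₀) : Prop :=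
  ∃ (τ : Circle × ℂ → Sphere3) (j : Sphere3 → N₀),
    SmoothEmbOn ((𝓡 1).prod 𝓘(ℝ, ℂ)) (𝓡 3) τ univ ∧
    (∀ z, τ (z, 0) = K z) ∧
    NullHomologousOff (range K) (fun z => τ (z, 1)) ∧
    SmoothEmbOn (𝓡 3) (𝓡 3) j (range K)ᶜ ∧
    SmoothEmbOn ((𝓡 1).prod 𝓘(ℝ, ℂ)) (𝓡 3) σ univ ∧
    j '' (range K)ᶜ = (dualKnot σ)ᶜ ∧
    ∀ (z w : Circle) (ρ : ℝ), 0 < ρ → σ (z, ρ * w) = j (τ (w, ρ * z))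

end ZeroSurgery

/-! ### Normal connected sums -/

section NormalSum

variable {ES HS S E₁ H₁ M₁ E₂ H₂ M₂ E H : Type*}
  [NormedAddCommGroup ES] [NormedSpace ℝ ES] [TopologicalSpace HS]
  [NormedAddCommGroup E₁] [NormedSpace ℝ E₁] [TopologicalSpace H₁]
  [NormedAddCommGroup E₂] [NormedSpace ℝ E₂] [TopologicalSpace H₂]
  [NormedAddCommGroup E] [NormedSpace ℝ E] [TopologicalSpace H]
  [TopologicalSpace S] [ChartedSpace HS S]
  [TopologicalSpace M₁] [ChartedSpace H₁ M₁] [TopologicalSpace M₂] [ChartedSpace H₂ M₂]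

/-- The trivial closed annulus bundle `W = {(x, v) | 1 ≤ |v| ≤ 2}` over `S`. -/
def annulusBundle (S : Type*) : Set (S × ℂ) := {p | 1 ≤ ‖p.2‖ ∧ ‖p.2‖ ≤ 2}

/-- `(x, v) ↦ (x, h (x, v))` is a diffeomorphism of the annulus bundle `W` over `S` to itself
that covers the identity of `S` and exchanges the two boundary components of `W`. -/
def IsAnnulusFlip (IS : ModelWithCorners ℝ ES HS) (h : S × ℂ → ℂ) : Prop :=
  ContMDiffOn (IS.prod 𝓘(ℝ, ℂ)) 𝓘(ℝ, ℂ) ∞ h (annulusBundle S) ∧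
  (∃ h' : S × ℂ → ℂ,
    ContMDiffOn (IS.prod 𝓘(ℝ, ℂ)) 𝓘(ℝ, ℂ) ∞ h' (annulusBundle S) ∧
    ∀ p ∈ annulusBundle S,
      (p.1, h p) ∈ annulusBundle S ∧ h' (p.1, h p) = p.2 ∧
      (p.1, h' p) ∈ annulusBundle S ∧ h (p.1, h' p) = p.2) ∧
  ∀ p : S × ℂ, (‖p.2‖ = 2 → ‖h p‖ = 1) ∧ (‖p.2‖ = 1 → ‖h p‖ = 2)

/-- `Z` is a normal connected sum of `(M₁, e₁(S))` and `(M₂, e₂(S))`, where the closed surface `S`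
is embedded in `M₁`, `M₂` by `e₁`, `e₂` with trivial normal bundle and `e₁(S)` is identified with
`e₂(S)` by `f = e₂ ∘ e₁⁻¹`.

Here `tᵢ` gives the tubular neighbourhoods `νᵢ = tᵢ(|v| ≤ 1) ⊂ Nᵢ = tᵢ(|v| ≤ 2)`, and
`Wᵢ = tᵢ(1 ≤ |v| ≤ 2)`. The manifolds `Mᵢ ∖ int νᵢ` are glued along the bundle map
`t₁(x, v) ↦ t₂(x, h(x, v))` from `W₁` to `W₂`, which covers `f` and takes the outer boundary of
`W₁` to the inner boundary of `W₂`. Since every point of the boundary of one of the two pieces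
is identified with an interior point of the other piece, the glued manifold is the union of the
open pieces `Mᵢ ∖ νᵢ`, embedded in `Z` by `jᵢ`, and these meet exactly in the interior of
`W₁ = W₂`. -/
def IsNormalSum (IS : ModelWithCorners ℝ ES HS) (I₁ : ModelWithCorners ℝ E₁ H₁)
    (I₂ : ModelWithCorners ℝ E₂ H₂) (I : ModelWithCorners ℝ E H)
    (e₁ : S → M₁) (e₂ : S → M₂) (Z : Type*) [TopologicalSpace Z] [ChartedSpace H Z] : Prop :=
  ∃ (t₁ : S × ℂ → M₁) (t₂ : S × ℂ → M₂) (h : S × ℂ → ℂ) (j₁ : M₁ → Z) (j₂ : M₂ → Z),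
    SmoothEmbOn (IS.prod 𝓘(ℝ, ℂ)) I₁ t₁ univ ∧ (∀ x, t₁ (x, 0) = e₁ x) ∧
    SmoothEmbOn (IS.prod 𝓘(ℝ, ℂ)) I₂ t₂ univ ∧ (∀ x, t₂ (x, 0) = e₂ x) ∧
    IsAnnulusFlip IS h ∧
    SmoothEmbOn I₁ I j₁ (t₁ '' {p | ‖p.2‖ ≤ 1})ᶜ ∧
    SmoothEmbOn I₂ I j₂ (t₂ '' {p | ‖p.2‖ ≤ 1})ᶜ ∧
    j₁ '' (t₁ '' {p | ‖p.2‖ ≤ 1})ᶜ ∪ j₂ '' (t₂ '' {p | ‖p.2‖ ≤ 1})ᶜ = univ ∧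
    ∀ p ∈ (t₁ '' {p | ‖p.2‖ ≤ 1})ᶜ, ∀ q ∈ (t₂ '' {p | ‖p.2‖ ≤ 1})ᶜ,
      j₁ p = j₂ q ↔ ∃ (x : S) (v : ℂ), 1 < ‖v‖ ∧ ‖v‖ < 2 ∧ p = t₁ (x, v) ∧ q = t₂ (x, h (x, v))

end NormalSum

/-! ### Graphs and retractions -/

/-- The geometric realization of a graph with finite vertex set `V` in `ℝ^V`: the basis vectors,
and for each edge the segment between the basis vectors of its end points. -/
noncomputable def graphRealization {V : Type*} [DecidableEq V] (G : SimpleGraph V) :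
    Set (V → ℝ) :=
  (range fun v : V => Pi.single v (1 : ℝ)) ∪
    {x | ∃ v w : V, G.Adj v w ∧ x ∈ segment ℝ (Pi.single v (1 : ℝ)) (Pi.single w (1 : ℝ))}

/-- `Y` admits a retraction onto a subspace that is homeomorphic to `A`. -/
def RetractsOntoCopy (Y A : Type*) [TopologicalSpace Y] [TopologicalSpace A] : Prop :=
  ∃ (i : A → Y) (ρ : Y → A), Continuous i ∧ Continuous ρ ∧ ∀ a, ρ (i a) = a

/-!
The covering of `X_K` is assembled from coverings of the two summands. Over `S¹ × N₀` one takes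
`(z, n) ↦ (z ^ l, p₀ n)`. The preimage of `S¹ × K'` consists of `r` tori, each of which covers
`S¹ × K'` by the `l`-th power map of the torus, because every component of the preimage of `K'` is
an `l`-fold covering of `K'` (`exists_dualKnot_lift`; the common degree `l` is the order of the
image under `α` of the class of `K'`). Over `X` one needs a connected covering of degree `l³` for which
the preimage of the fibre `T` consists of `l` tori, each covering `T` by the `l`-th power map
(`exists_torusBundle_covering`). Removing the tori and gluing `l` copies of the first covering and
`r` copies of the second one in the pattern of the complete bipartite graph, one copy of a torus
for each edge, gives a covering of `X_K` (`exists_glued_covering`); it has `r` copies of degree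
`l³` over the points of `X`. One copy of `S¹ × Ñ` lies in each of the pieces over `S¹ × N₀`.

The covering of `X`. Cut `F` into a `4g`-gon, over which the bundle is trivial. The bundle is then
given by the gluing maps of the torus along the sides, and these lift along the `l`-th power map.
The lifts satisfy the relation at the vertex up to a translation by an `l`-torsion point `ε`.
Changing the lifts by torsion translations changes `ε` by any element which vanishes in the
coinvariants of `(ℤ/l)²` (`exists_twist_handleProd_eq_one`, a computation with Fox derivatives).
To make `ε` vanish in the coinvariants one passes to an `l`-fold covering of `F`, constructed as a
tower along the prime factors of `l` (`exists_subgroup_const_mem`): in a group over `ℤ²`, some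
element acts trivially on `(ℤ/p)²` and is not divisible by `p` in `ℤ²`, since `p²` does not divide
the order of `GL₂(𝔽_p)`; the transfer to the index `p` subgroup that it defines is divisible by
`p`. This uses `g ≥ 1`. The lifted gluing maps define a closed equivalence relation on the product
of the disk, the torus and the `l` sheets, and its quotient is the covering (`EdgeGluing`,
`quotient_isCoveringMap`).

The gluing of the normal sum. The diffeomorphism of the annulus bundles is absorbed into the
choice of tubular neighbourhoods: after pushing the summands off the cores, `X_K` is the union of
the complements of the two cores, glued along open tubes by inversion in the unit circle
(`IsNormalSum.exists_normalForm`). Tubes lift to tubes (`IsCoveringMap.exists_lift_tube`).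

The retraction. Each piece contains a star, a union of arcs from a common point to the boundary
tori that are disjoint otherwise. In `S¹ × Ñ₀` the arcs are kept disjoint by the circle coordinate
(`exists_isStarToCores_circle_prod`), in the covering of `X` they are lifts of arcs in a surface
(`LocallyTrivial.exists_isStarToCores`). Tietze's theorem gives functions on the piece, with
pairwise zero products, which are the coordinates of the arms on the star and are constantly `1`
on the tori (`IsStarToTubes.exists_coordinates`); they fit together to the retraction onto the
union of the stars, which is the graph (`retractsOntoCopy_of_stars`).
-/

/-! ### Solving the surface relation after a twist -/

section SurfaceRelation

/-- The block `u⁻¹ w' u' w⁻¹` read off at one handle while going once around the vertex of the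
`4g`-gon: `u`, `u'` are the gluing maps of the first pair of sides at its two ends, `w`, `w'` those
of the second pair. -/
def handleBlock {G : Type*} [Group G] (u u' w w' : G) : G := u⁻¹ * w' * u' * w⁻¹

/-- The product of the first `k` handle blocks. -/
def handleProd {G : Type*} [Group G] (u u' w w' : ℕ → G) : ℕ → G
  | 0 => 1
  | k + 1 => handleProd u u' w w' k * handleBlock (u k) (u' k) (w k) (w' k)

theorem handleProd_congr {G : Type*} [Group G] {u u' w w' v v' x x' : ℕ → G} (k : ℕ)
    (h : ∀ i < k, u i = v i ∧ u' i = v' i ∧ w i = x i ∧ w' i = x' i) :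
    handleProd u u' w w' k = handleProd v v' x x' k := by
  induction k with
  | zero => rfl
  | succ k ih =>
    obtain ⟨h1, h2, h3, h4⟩ := h k (Nat.lt_succ_self k)
    rw [handleProd, handleProd, ih fun i hi => h i (hi.trans (Nat.lt_succ_self k)), h1, h2, h3, h4]

theorem map_handleProd {G G' : Type*} [Group G] [Group G'] (f : G →* G') (u u' w w' : ℕ → G)
    (k : ℕ) : f (handleProd u u' w w' k) =
      handleProd (f ∘ u) (f ∘ u') (f ∘ w) (f ∘ w') k := by
  induction k with
  | zero => simp [handleProd]
  | succ k ih => simp [handleProd, handleBlock, ih]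

variable {R M : Type*} [Ring R] [AddCommGroup M] [Module R M]

/-- The automorphisms of `M` that act trivially modulo `N`. No invariance of `N` is needed
for this to be a group. -/
def trivialModulo (N : AddSubgroup M) : Subgroup (M ≃ₗ[R] M) where
  carrier := {θ | ∀ m, θ m - m ∈ N}
  mul_mem' {a b} ha hb m := by
    have := N.add_mem (ha (b m)) (hb m)
    simpa using this
  one_mem' m := by simp
  inv_mem' {a} ha m := by
    have := N.neg_mem (ha (a⁻¹ m))
    have h2 : a (a⁻¹ m) = m := by
      change (a * a⁻¹) m = m
      simp
    rw [h2] at this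
    simpa using this

theorem trivialModulo_mono {N N' : AddSubgroup M} (h : N ≤ N') :
    trivialModulo (R := R) N ≤ trivialModulo N' := fun _ hθ m => h (hθ m)

/-- The change of the handle block when the gluing maps are twisted by `a` and `b`
(a Fox derivative). -/
def foxHom (θu θw : M ≃ₗ[R] M) : M × M →+ M where
  toFun p := -p.1 + (θu⁻¹ * θw) p.2 + (θu⁻¹ * θw * θu) (p.1 - p.2)
  map_zero' := by simp
  map_add' p q := by
    simp only [Prod.fst_add, Prod.snd_add, map_add, map_sub]
    abel

/-- The changes of the product of the first `k` blocks that twisting can achieve. -/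
def foxImage (θu θw : ℕ → M ≃ₗ[R] M) : ℕ → AddSubgroup M
  | 0 => ⊥
  | k + 1 => foxImage θu θw k ⊔
      ((foxHom (θu k) (θw k)).range.map
        (handleProd θu θu θw θw k : M ≃ₗ[R] M).toAddEquiv.toAddMonoidHom)

/-- The Fox derivatives of the surface relator generate the whole augmentation submodule;
this is where Poincaré duality of the surface enters. -/
theorem mem_trivialModulo_foxImage (θu θw : ℕ → M ≃ₗ[R] M) (k : ℕ) :
    ∀ i < k, θu i ∈ trivialModulo (foxImage θu θw k) ∧ θw i ∈ trivialModulo (foxImage θu θw k) := by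
  induction k with
  | zero => intro i hi; omega
  | succ k ih =>
    have hmono : foxImage θu θw k ≤ foxImage θu θw (k + 1) := le_sup_left
    have ih' : ∀ i < k, θu i ∈ trivialModulo (foxImage θu θw (k + 1)) ∧
        θw i ∈ trivialModulo (foxImage θu θw (k + 1)) := fun i hi =>
      ⟨trivialModulo_mono hmono (ih i hi).1, trivialModulo_mono hmono (ih i hi).2⟩
    set T := trivialModulo (R := R) (foxImage θu θw (k + 1)) with hT
    have hC : ∀ n ≤ k, handleProd θu θu θw θw n ∈ T := by
      intro n
      induction n with
      | zero => intro _; exact T.one_mem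
      | succ n ihn =>
        intro hn
        have h1 := (ih' n (by omega)).1
        have h2 := (ih' n (by omega)).2
        exact T.mul_mem (ihn (by omega)) (T.mul_mem (T.mul_mem (T.mul_mem (T.inv_mem h1) h2) h1)
          (T.inv_mem h2))
    have hx : ∀ p, foxHom (θu k) (θw k) p ∈ foxImage θu θw (k + 1) := by
      intro p
      have h1 : (handleProd θu θu θw θw k) (foxHom (θu k) (θw k) p) ∈ foxImage θu θw (k + 1) :=
        le_sup_right (a := foxImage θu θw k) ⟨_, ⟨p, rfl⟩, rfl⟩
      have h2 := hC k le_rfl (foxHom (θu k) (θw k) p)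
      simpa using AddSubgroup.sub_mem _ h1 h2
    have hy : (θu k)⁻¹ * θw k * θu k ∈ T := by
      intro m
      have := hx (m, 0)
      simpa [foxHom, sub_eq_neg_add] using this
    have hu : (θu k)⁻¹ ∈ T := by
      intro m
      have h1 := hx (0, m)
      have h2 := hy ((θu k)⁻¹ m)
      have h3 := hy m
      have h4 : ((θu k)⁻¹ * θw k * θu k) ((θu k)⁻¹ m) = ((θu k)⁻¹ * θw k) m := by
        rw [← LinearEquiv.mul_apply]; simp
      rw [h4] at h2
      simp only [foxHom, AddMonoidHom.coe_mk, ZeroHom.coe_mk, neg_zero, zero_add, zero_sub,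
        map_neg] at h1
      have := AddSubgroup.add_mem _ (AddSubgroup.sub_mem _ h1 h2) h3
      convert this using 1
      abel
    have hu' : θu k ∈ T := by simpa using T.inv_mem hu
    have hw' : θw k ∈ T := by
      have := T.mul_mem (T.mul_mem hu' hy) hu
      convert this using 1
      group
    intro i hi
    rcases Nat.lt_succ_iff_lt_or_eq.mp hi with h | rfl
    · exact ih' i h
    · exact ⟨hu', hw'⟩

variable {G : Type*} [Group G] (φ : Multiplicative M →* G)

theorem handleProd_mul_hom {u u' w w' : ℕ → G} {θu θw : ℕ → M ≃ₗ[R] M}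
    (hu : ∀ k m, u k * φ (.ofAdd m) = φ (.ofAdd (θu k m)) * u k)
    (hu' : ∀ k m, u' k * φ (.ofAdd m) = φ (.ofAdd (θu k m)) * u' k)
    (hw : ∀ k m, w k * φ (.ofAdd m) = φ (.ofAdd (θw k m)) * w k)
    (hw' : ∀ k m, w' k * φ (.ofAdd m) = φ (.ofAdd (θw k m)) * w' k) (k : ℕ) (m : M) :
    handleProd u u' w w' k * φ (.ofAdd m) =
      φ (.ofAdd (handleProd θu θu θw θw k m)) * handleProd u u' w w' k := by
  have inv : ∀ {g : G} {θ : M ≃ₗ[R] M}, (∀ m, g * φ (.ofAdd m) = φ (.ofAdd (θ m)) * g) →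
      ∀ m, g⁻¹ * φ (.ofAdd m) = φ (.ofAdd (θ⁻¹ m)) * g⁻¹ := by
    intro g θ h m
    rw [inv_mul_eq_iff_eq_mul, ← mul_assoc, h, mul_assoc, mul_inv_cancel, mul_one,
      ← LinearEquiv.mul_apply, mul_inv_cancel]
    rfl
  induction k generalizing m with
  | zero => simp [handleProd]
  | succ k ih =>
    simp only [handleProd, handleBlock, mul_assoc]
    rw [inv (hw k), ← mul_assoc (u' k), hu', mul_assoc, ← mul_assoc (w' k), hw', mul_assoc,
      ← mul_assoc (u k)⁻¹, inv (hu k), mul_assoc, ← mul_assoc (handleProd _ _ _ _ _), ih]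
    simp [mul_assoc]

/-- Every element of `foxImage` is the change of the product under some twist. -/
theorem exists_twist_of_mem_foxImage {u u' w w' : ℕ → G} {θu θw : ℕ → M ≃ₗ[R] M}
    (hu : ∀ k m, u k * φ (.ofAdd m) = φ (.ofAdd (θu k m)) * u k)
    (hu' : ∀ k m, u' k * φ (.ofAdd m) = φ (.ofAdd (θu k m)) * u' k)
    (hw : ∀ k m, w k * φ (.ofAdd m) = φ (.ofAdd (θw k m)) * w k)
    (hw' : ∀ k m, w' k * φ (.ofAdd m) = φ (.ofAdd (θw k m)) * w' k) (k : ℕ) :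
    ∀ n ∈ foxImage θu θw k, ∃ α β : ℕ → M,
      handleProd (fun i => u i * φ (.ofAdd (α i))) (fun i => u' i * φ (.ofAdd (α i)))
        (fun i => w i * φ (.ofAdd (β i))) (fun i => w' i * φ (.ofAdd (β i))) k =
      φ (.ofAdd n) * handleProd u u' w w' k := by
  have inv : ∀ {g : G} {θ : M ≃ₗ[R] M}, (∀ m, g * φ (.ofAdd m) = φ (.ofAdd (θ m)) * g) →
      ∀ m, g⁻¹ * φ (.ofAdd m) = φ (.ofAdd (θ⁻¹ m)) * g⁻¹ := by
    intro g θ h m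
    rw [inv_mul_eq_iff_eq_mul, ← mul_assoc, h, mul_assoc, mul_inv_cancel, mul_one,
      ← LinearEquiv.mul_apply, mul_inv_cancel]
    rfl
  induction k with
  | zero =>
    intro n hn
    have : n = 0 := by simpa [foxImage] using hn
    subst this
    exact ⟨0, 0, by simp [handleProd]⟩
  | succ k ih =>
    intro n hn
    obtain ⟨n₁, hn₁, n₂, ⟨_, ⟨⟨a, b⟩, rfl⟩, rfl⟩, rfl⟩ := AddSubgroup.mem_sup.mp hn
    obtain ⟨α, β, h⟩ := ih n₁ hn₁
    refine ⟨Function.update α k a, Function.update β k b, ?_⟩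
    have hc : handleProd (fun i => u i * φ (.ofAdd (Function.update α k a i)))
        (fun i => u' i * φ (.ofAdd (Function.update α k a i)))
        (fun i => w i * φ (.ofAdd (Function.update β k b i)))
        (fun i => w' i * φ (.ofAdd (Function.update β k b i))) k =
        φ (.ofAdd n₁) * handleProd u u' w w' k := by
      rw [← h]
      refine handleProd_congr k fun i hi => ?_
      simp [Function.update_of_ne hi.ne]
    have hblock : handleBlock (u k * φ (.ofAdd a)) (u' k * φ (.ofAdd a)) (w k * φ (.ofAdd b))
        (w' k * φ (.ofAdd b)) = φ (.ofAdd (foxHom (θu k) (θw k) (a, b))) *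
          handleBlock (u k) (u' k) (w k) (w' k) := by
      have e1 : handleBlock (u k * φ (.ofAdd a)) (u' k * φ (.ofAdd a)) (w k * φ (.ofAdd b))
        (w' k * φ (.ofAdd b)) = φ (.ofAdd (-a)) * ((u k)⁻¹ * (w' k * φ (.ofAdd b))) *
          (u' k * φ (.ofAdd (a - b))) * (w k)⁻¹ := by
        simp only [handleBlock, mul_inv_rev, ← map_inv, ofAdd_neg, ofAdd_sub, map_mul,
          div_eq_mul_inv, mul_assoc]
      rw [e1, hw', hu', ← mul_assoc (u k)⁻¹, inv (hu k)]
      have e2 : ∀ x y z : M, φ (.ofAdd x) * (φ (.ofAdd y) * (u k)⁻¹ * w' k) *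
          (φ (.ofAdd z) * u' k) * (w k)⁻¹ =
          φ (.ofAdd (x + y + ((θu k)⁻¹ * θw k) z)) * handleBlock (u k) (u' k) (w k) (w' k) := by
        intro x y z
        simp only [mul_assoc, handleBlock]
        rw [← mul_assoc (w' k), hw', mul_assoc, ← mul_assoc (u k)⁻¹, inv (hu k)]
        simp [ofAdd_add, mul_assoc]
      rw [e2]
      rfl
    rw [handleProd, hc]
    simp only [Function.update_self]
    rw [hblock, handleProd, mul_assoc, ← mul_assoc (handleProd u u' w w' k),
      handleProd_mul_hom φ hu hu' hw hw']
    simp [ofAdd_add, mul_assoc]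

/-- If the product of all blocks is `φ ε` and `ε` dies in the coinvariants of `M`, the gluing maps
can be twisted so that the surface relation holds. -/
theorem exists_twist_handleProd_eq_one {u u' w w' : ℕ → G} {θu θw : ℕ → M ≃ₗ[R] M}
    (hu : ∀ k m, u k * φ (.ofAdd m) = φ (.ofAdd (θu k m)) * u k)
    (hu' : ∀ k m, u' k * φ (.ofAdd m) = φ (.ofAdd (θu k m)) * u' k)
    (hw : ∀ k m, w k * φ (.ofAdd m) = φ (.ofAdd (θw k m)) * w k)
    (hw' : ∀ k m, w' k * φ (.ofAdd m) = φ (.ofAdd (θw k m)) * w' k) (g : ℕ) (ε : M)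
    (hε : handleProd u u' w w' g = φ (.ofAdd ε))
    (hN : ∀ N : AddSubgroup M, (∀ k < g, θu k ∈ trivialModulo N ∧ θw k ∈ trivialModulo N) →
      ε ∈ N) :
    ∃ α β : ℕ → M,
      handleProd (fun i => u i * φ (.ofAdd (α i))) (fun i => u' i * φ (.ofAdd (α i)))
        (fun i => w i * φ (.ofAdd (β i))) (fun i => w' i * φ (.ofAdd (β i))) g = 1 := by
  have hmem := hN _ (mem_trivialModulo_foxImage θu θw g)
  obtain ⟨α, β, h⟩ := exists_twist_of_mem_foxImage φ hu hu' hw hw' g (-ε) (neg_mem hmem)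
  exact ⟨α, β, by rw [h, hε, ← map_mul, ← ofAdd_add]; simp⟩

end SurfaceRelation

/-! ### Killing the obstruction in a cover pulled back from the torus -/

section Transfer

theorem not_sq_dvd_card_GL_two (p : ℕ) [hp : Fact p.Prime] :
    ¬ p ^ 2 ∣ Nat.card (GL (Fin 2) (ZMod p)) := by
  rw [Matrix.card_GL_field]
  simp only [Fin.prod_univ_two, ZMod.card, Fin.val_zero, Fin.val_one, pow_zero, pow_one]
  obtain ⟨q, hq⟩ : ∃ q, p = q + 1 := ⟨p - 1, by have := hp.out.pos; omega⟩
  have h1 : (p ^ 2 - 1) * (p ^ 2 - p) = p * (q * q * (q + 2)) := by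
    have e1 : p ^ 2 - 1 = q * (q + 2) := by rw [hq]; exact Nat.sub_eq_of_eq_add (by ring)
    have e2 : p ^ 2 - p = q * (q + 1) := by rw [hq]; exact Nat.sub_eq_of_eq_add (by ring)
    rw [e1, e2, hq]; ring
  rw [h1, pow_two]
  intro h
  have h2 := Nat.dvd_of_mul_dvd_mul_left hp.out.pos h
  have hpq : ¬ p ∣ q := fun h3 => by
    have : p ∣ 1 := by rw [hq] at h3 ⊢; exact (Nat.dvd_add_right h3).mp dvd_rfl
    exact hp.out.one_lt.ne' (Nat.dvd_one.mp this)
  rcases (hp.out.dvd_mul).mp h2 with h3 | h3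
  · rcases (hp.out.dvd_mul).mp h3 with h4 | h4 <;> exact hpq h4
  · have : p ∣ 1 := by
      have h5 : q + 2 = p + 1 := by omega
      rw [h5] at h3
      exact (Nat.dvd_add_right dvd_rfl).mp h3
    exact hp.out.one_lt.ne' (Nat.dvd_one.mp this)

/-- Reduction modulo `p ∣ l` of an automorphism of `(ℤ/l)²`. -/
noncomputable def reduceAut {l p : ℕ} (h : p ∣ l) :
    ((Fin 2 → ZMod l) ≃ₗ[ZMod l] (Fin 2 → ZMod l)) →* GL (Fin 2) (ZMod p) :=
  (Units.map ((ZMod.castHom h (ZMod p)).mapMatrix.toMonoidHom)).comp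
    ((Matrix.GeneralLinearGroup.toLin (R := ZMod l) (n := Fin 2)).symm.toMonoidHom.comp
      (LinearMap.GeneralLinearGroup.generalLinearEquiv (ZMod l) (Fin 2 → ZMod l)).symm.toMonoidHom)

theorem exists_eq_mul_of_castHom_eq_zero {l p : ℕ} [NeZero l] (h : p ∣ l) {x : ZMod l}
    (hx : ZMod.castHom h (ZMod p) x = 0) : ∃ c : ZMod l, x = p * c := by
  have hx' : ((x.val : ℕ) : ZMod p) = 0 := by
    rw [← hx, ← map_natCast (ZMod.castHom h (ZMod p)), ZMod.natCast_zmod_val]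
  obtain ⟨c, hc⟩ := (ZMod.natCast_eq_zero_iff _ _).mp hx'
  exact ⟨c, by rw [← ZMod.natCast_zmod_val x, hc]; push_cast; rfl⟩

theorem exists_sub_eq_smul_of_reduceAut_eq_one {l p : ℕ} [NeZero l] (h : p ∣ l)
    {θ : (Fin 2 → ZMod l) ≃ₗ[ZMod l] (Fin 2 → ZMod l)} (hθ : reduceAut h θ = 1)
    (a : Fin 2 → ZMod l) : ∃ b, θ a - a = p • b := by
  have hM : ∀ i j, ZMod.castHom h (ZMod p) (LinearMap.toMatrix' θ.toLinearMap i j) =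
      (1 : Matrix (Fin 2) (Fin 2) (ZMod p)) i j := by
    intro i j
    have h1 := congrArg (fun g : GL (Fin 2) (ZMod p) => g.1 i j) hθ
    exact h1
  have hc : ∀ i j, ∃ c : ZMod l, LinearMap.toMatrix' θ.toLinearMap i j -
      (1 : Matrix (Fin 2) (Fin 2) (ZMod l)) i j = p * c := by
    intro i j
    apply exists_eq_mul_of_castHom_eq_zero h
    rw [map_sub, hM, Matrix.one_apply, Matrix.one_apply]
    split_ifs <;> simp only [map_one, map_zero, sub_self]
  choose c hc using hc
  refine ⟨fun i => ∑ j, c i j * a j, ?_⟩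
  funext i
  have h2 : θ a = (LinearMap.toMatrix' θ.toLinearMap).mulVec a := by
    rw [LinearMap.toMatrix'_mulVec]; rfl
  have h3 : (θ a - a) i = ∑ j, (LinearMap.toMatrix' θ.toLinearMap i j -
      (1 : Matrix (Fin 2) (Fin 2) (ZMod l)) i j) * a j := by
    rw [h2, Pi.sub_apply]
    simp only [sub_mul, Finset.sum_sub_distrib]
    congr 1
    simp [Matrix.one_apply]
  rw [h3]
  simp only [hc, Pi.smul_apply, nsmul_eq_mul, Finset.mul_sum, mul_assoc]

variable {π : Type*} [Group π] {l : ℕ} (ρ : π →* ((Fin 2 → ZMod l) ≃ₗ[ZMod l] (Fin 2 → ZMod l)))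

/-- The translate by `γ` of an `(ℤ/l)²`-valued function on a `π`-set; the coefficients are twisted
by `ρ`. -/
def twistedTranslate {S : Type*} [MulAction π S] (γ : π) (f : S → Fin 2 → ZMod l) :
    S → Fin 2 → ZMod l := fun x => ρ γ (f (γ⁻¹ • x))

/-- `H` contains an element that acts trivially on `(ℤ/p)²` and whose image in `ℤ²` is not
divisible by `p`: otherwise `(ℤ/p)²` would be a subquotient of `GL₂(𝔽_p)`. -/
theorem exists_mem_reduceAut_eq_one {p : ℕ} [hp : Fact p.Prime] (hpl : p ∣ l) (H : Subgroup π)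
    (η : H →* Multiplicative (ℤ × ℤ)) (hη : Function.Surjective η) :
    ∃ τ : H, reduceAut hpl (ρ τ) = 1 ∧
      ¬ ((p : ℤ) ∣ (η τ).toAdd.1 ∧ (p : ℤ) ∣ (η τ).toAdd.2) := by
  by_contra hcon
  push Not at hcon
  let f : H →* GL (Fin 2) (ZMod p) := (reduceAut hpl).comp (ρ.comp H.subtype)
  let red : ℤ × ℤ →+ ZMod p × ZMod p :=
    (Int.castAddHom (ZMod p)).prodMap (Int.castAddHom (ZMod p))
  let k : H →* Multiplicative (ZMod p × ZMod p) := (AddMonoidHom.toMultiplicative red).comp η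
  have hk : Function.Surjective k := by
    change Function.Surjective ((AddMonoidHom.toMultiplicative red) ∘ η)
    refine Function.Surjective.comp ?_ hη
    intro y
    obtain ⟨a, ha⟩ := ZMod.intCast_surjective y.toAdd.1
    obtain ⟨b, hb⟩ := ZMod.intCast_surjective y.toAdd.2
    exact ⟨.ofAdd (a, b), by
      change Multiplicative.ofAdd ((a : ZMod p), (b : ZMod p)) = y
      rw [ha, hb]; rfl⟩
  have hle : f.ker ≤ k.ker := by
    intro τ hτ
    obtain ⟨h1, h2⟩ := hcon τ hτ
    rw [MonoidHom.mem_ker]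
    change Multiplicative.ofAdd (((η τ).toAdd.1 : ZMod p), ((η τ).toAdd.2 : ZMod p)) = 1
    rw [(ZMod.intCast_zmod_eq_zero_iff_dvd _ p).mpr h1,
      (ZMod.intCast_zmod_eq_zero_iff_dvd _ p).mpr h2]
    rfl
  have h1 : k.ker.index = p ^ 2 := by
    rw [Subgroup.index_ker, MonoidHom.range_eq_top.mpr hk, Subgroup.card_top]
    change Nat.card (ZMod p × ZMod p) = _
    simp [pow_two]
  have h2 : k.ker.index ∣ f.ker.index := Subgroup.index_dvd_of_le hle
  rw [h1, Subgroup.index_ker] at h2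
  exact not_sq_dvd_card_GL_two p (h2.trans (Subgroup.card_subgroup_dvd_card _))

variable [NeZero l]

/-- One step of the tower: a subgroup of index `p` such that every function pulled back to its
cosets is divisible by `p` modulo differences of translates. -/
theorem exists_subgroup_pullback_divisible {p : ℕ} [hp : Fact p.Prime] (hpl : p ∣ l)
    (H : Subgroup π) (η : H →* Multiplicative (ℤ × ℤ)) (hη : Function.Surjective η)
    (hc : ∀ c ∈ commutator π, ∃ h : c ∈ H, η ⟨c, h⟩ = 1) :
    ∃ (H' : Subgroup π) (hle : H' ≤ H) (η' : H' →* Multiplicative (ℤ × ℤ)),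
      Function.Surjective η' ∧ (∀ c ∈ commutator π, ∃ h : c ∈ H', η' ⟨c, h⟩ = 1) ∧
      H'.index = p * H.index ∧
      ∀ N : AddSubgroup (π ⧸ H' → Fin 2 → ZMod l),
        (∀ γ f, twistedTranslate ρ γ f - f ∈ N) → ∀ y : π ⧸ H → Fin 2 → ZMod l,
          ∃ n ∈ N, ∃ z : π ⧸ H' → Fin 2 → ZMod l,
            y ∘ Subgroup.quotientMapOfLE hle = n + p • z := by
  obtain ⟨τ, hτ1, hτ2⟩ := exists_mem_reduceAut_eq_one ρ hpl H η hη
  -- after exchanging the two coordinates of `ℤ²`, the first coordinate of `η τ` is prime to `p`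
  obtain ⟨κ, hκ, hκc, hκτ⟩ : ∃ κ : H →* Multiplicative (ℤ × ℤ), Function.Surjective κ ∧
      (∀ h, η h = 1 → κ h = 1) ∧ ¬ (p : ℤ) ∣ (κ τ).toAdd.1 := by
    by_cases h1 : (p : ℤ) ∣ (η τ).toAdd.1
    · let sw : Multiplicative (ℤ × ℤ) ≃* Multiplicative (ℤ × ℤ) :=
        AddEquiv.toMultiplicative AddEquiv.prodComm
      refine ⟨sw.toMonoidHom.comp η, sw.surjective.comp hη, fun h hh => ?_, fun h2 =>
        hτ2 ⟨h1, h2⟩⟩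
      simp [hh]
    · exact ⟨η, hη, fun _ h => h, h1⟩
  let χ : H →* Multiplicative (ZMod p) := (AddMonoidHom.toMultiplicative
    ((Int.castAddHom (ZMod p)).comp (AddMonoidHom.fst ℤ ℤ))).comp κ
  have hχ_apply : ∀ h, (χ h).toAdd = (((κ h).toAdd.1 : ℤ) : ZMod p) := fun _ => rfl
  have hχ : Function.Surjective χ := by
    change Function.Surjective ((AddMonoidHom.toMultiplicative
      ((Int.castAddHom (ZMod p)).comp (AddMonoidHom.fst ℤ ℤ))) ∘ κ)
    refine Function.Surjective.comp ?_ hκ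
    intro y
    obtain ⟨a, ha⟩ := ZMod.intCast_surjective y.toAdd
    exact ⟨.ofAdd (a, 0), by
      change Multiplicative.ofAdd (a : ZMod p) = y
      rw [ha]; rfl⟩
  let H' : Subgroup π := χ.ker.map H.subtype
  have hle : H' ≤ H := Subgroup.map_subtype_le _
  have hmem : ∀ h : H, (h : π) ∈ H' ↔ (p : ℤ) ∣ (κ h).toAdd.1 := by
    intro h
    rw [← ZMod.intCast_zmod_eq_zero_iff_dvd, ← hχ_apply]
    constructor
    · rintro ⟨h', hh', he⟩
      have : h' = h := Subtype.ext he
      rw [← this, MonoidHom.mem_ker.mp hh']; rfl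
    · intro hh
      exact ⟨h, hh, rfl⟩
  have hdvd : ∀ h : H', (p : ℤ) ∣ (κ ⟨h, hle h.2⟩).toAdd.1 := fun h =>
    (hmem ⟨h, hle h.2⟩).mp h.2
  have hp0 : (p : ℤ) ≠ 0 := by exact_mod_cast hp.out.ne_zero
  let η' : H' →* Multiplicative (ℤ × ℤ) :=
    { toFun := fun h => .ofAdd ((κ ⟨h, hle h.2⟩).toAdd.1 / p, (κ ⟨h, hle h.2⟩).toAdd.2)
      map_one' := by
        have : κ ⟨1, H.one_mem⟩ = 1 := κ.map_one
        change Multiplicative.ofAdd ((κ ⟨1, H.one_mem⟩).toAdd.1 / (p : ℤ),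
          (κ ⟨1, H.one_mem⟩).toAdd.2) = 1
        rw [this]; simp
      map_mul' := fun a b => by
        have : κ ⟨a * b, hle (a * b).2⟩ = κ ⟨a, hle a.2⟩ * κ ⟨b, hle b.2⟩ := by
          rw [← map_mul]; rfl
        simp only [Subgroup.coe_mul, this, toAdd_mul, Prod.fst_add, Prod.snd_add,
          Int.add_ediv_of_dvd_left (hdvd a)]
        rfl }
  have hcκ : ∀ c ∈ commutator π, ∃ h : c ∈ H, κ ⟨c, h⟩ = 1 := fun c h =>
    let ⟨h1, h2⟩ := hc c h
    ⟨h1, hκc _ h2⟩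
  have hc' : ∀ c ∈ commutator π, ∃ h : c ∈ H', η' ⟨c, h⟩ = 1 := by
    intro c h
    obtain ⟨h1, h2⟩ := hcκ c h
    have h3 : c ∈ H' := (hmem ⟨c, h1⟩).mpr (by rw [h2]; simp)
    refine ⟨h3, ?_⟩
    change Multiplicative.ofAdd ((κ ⟨c, h1⟩).toAdd.1 / (p : ℤ), (κ ⟨c, h1⟩).toAdd.2) = 1
    rw [h2]; simp
  have hcomm : ∀ a b : π, a⁻¹ * b⁻¹ * a * b ∈ commutator π := fun a b => by
    have := Subgroup.commutator_mem_commutator (Subgroup.mem_top a⁻¹) (Subgroup.mem_top b⁻¹)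
    simpa [commutatorElement_def, mul_assoc] using! this
  refine ⟨H', hle, η', ?_, hc', ?_, ?_⟩
  · intro y
    obtain ⟨h, hh⟩ := hκ (.ofAdd (p * y.toAdd.1, y.toAdd.2))
    have h3 : (h : π) ∈ H' := (hmem h).mpr (by rw [hh]; exact ⟨y.toAdd.1, rfl⟩)
    refine ⟨⟨h, h3⟩, ?_⟩
    change Multiplicative.ofAdd ((κ h).toAdd.1 / (p : ℤ), (κ h).toAdd.2) = y
    rw [hh, toAdd_ofAdd, Int.mul_ediv_cancel_left _ hp0]
    rfl
  · rw [← Subgroup.relIndex_mul_index hle]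
    congr 1
    have : H'.subgroupOf H = χ.ker := by
      change (χ.ker.map H.subtype).subgroupOf H = _
      exact Subgroup.comap_map_eq_self_of_injective H.subtype_injective _
    rw [Subgroup.relIndex, this, Subgroup.index_ker, MonoidHom.range_eq_top.mpr hχ,
      Subgroup.card_top]
    exact Nat.card_zmod p
  · intro N hN y
    set pr := Subgroup.quotientMapOfLE hle with hpr
    -- `sheet i x` says that `x` is the translate by `τ ^ i` of the chosen lift of its image
    let s : π ⧸ H → π ⧸ H' := fun x => ((Quotient.out x : π) : π ⧸ H')
    have htriv : ∀ (i : ℕ) (x : π ⧸ H), ((τ : π) ^ i)⁻¹ • x = x := by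
      intro i x
      induction x using QuotientGroup.induction_on with
      | H g =>
        rw [MulAction.Quotient.smul_mk, QuotientGroup.eq, smul_eq_mul]
        have h1 : (((τ : π) ^ i)⁻¹ * g)⁻¹ * g = ((τ : π) ^ i) *
            (((τ : π) ^ i)⁻¹ * g⁻¹ * ((τ : π) ^ i) * g) := by group
        rw [h1]
        exact H.mul_mem (H.pow_mem τ.2 i) (hc _ (hcomm _ _)).1
    have hequiv : ∀ (γ : π) (x : π ⧸ H'), pr (γ • x) = γ • pr x := by
      intro γ x
      induction x using QuotientGroup.induction_on with
      | H g => rfl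
    classical
    let z : ℕ → π ⧸ H' → Fin 2 → ZMod l := fun i x =>
      if x = ((τ : π) ^ i) • s (pr x) then y (pr x) else 0
    have hsum : y ∘ pr = ∑ i ∈ Finset.range p, z i := by
      funext x
      rw [Finset.sum_apply]
      have : ∃! i, i ∈ Finset.range p ∧ x = ((τ : π) ^ i) • s (pr x) := by
        induction x using QuotientGroup.induction_on with
        | H g =>
          set t : π := Quotient.out ((g : π) : π ⧸ H) with ht
          have htg : t⁻¹ * g ∈ H := by
            rw [← QuotientGroup.eq]; exact Quotient.out_eq _
          have key : ∀ i : ℕ, ((g : π) : π ⧸ H') = ((τ : π) ^ i) • s (pr g) ↔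
              (i : ZMod p) * (χ τ).toAdd = (χ ⟨_, htg⟩).toAdd := by
            intro i
            have h0 : ((τ : π) ^ i) • s (pr g) = (((τ : π) ^ i * t : π) : π ⧸ H') := rfl
            rw [h0, eq_comm, QuotientGroup.eq]
            have h1 : ((τ : π) ^ i * t)⁻¹ * g = (t⁻¹ * (((τ : π) ^ i)⁻¹) * t * ((τ : π) ^ i)) *
                (((τ : π) ^ i)⁻¹ * (t⁻¹ * g)) := by group
            have hcm : t⁻¹ * (((τ : π) ^ i)⁻¹) * t * ((τ : π) ^ i) ∈ H' :=
              (hc' _ (hcomm _ _)).1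
            rw [h1, H'.mul_mem_cancel_left hcm]
            have h2 : ((τ : π) ^ i)⁻¹ * (t⁻¹ * g) = ((τ ^ i)⁻¹ * ⟨t⁻¹ * g, htg⟩ : H) := rfl
            rw [h2, hmem, ← ZMod.intCast_zmod_eq_zero_iff_dvd, ← hχ_apply, map_mul, map_inv,
              map_pow, toAdd_mul, toAdd_inv, toAdd_pow, neg_add_eq_zero, nsmul_eq_mul]
          have hne : (χ τ).toAdd ≠ 0 := by
            rw [hχ_apply, Ne, ZMod.intCast_zmod_eq_zero_iff_dvd]; exact hκτ
          refine ⟨((χ ⟨_, htg⟩).toAdd / (χ τ).toAdd).val, ⟨Finset.mem_range.mpr (ZMod.val_lt _),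
            (key _).mpr ?_⟩, ?_⟩
          · rw [ZMod.natCast_zmod_val, div_mul_cancel₀ _ hne]
          · rintro j ⟨hj, hj'⟩
            rw [key] at hj'
            rw [← hj', mul_div_cancel_right₀ _ hne, ZMod.val_cast_of_lt (Finset.mem_range.mp hj)]
      obtain ⟨i, ⟨hi, hix⟩, huniq⟩ := this
      rw [Finset.sum_eq_single i]
      · simp only [Function.comp, z]; rw [if_pos hix]
      · intro j hj hji
        simp only [z]
        rw [if_neg]
        exact fun h => hji (huniq j ⟨hj, h⟩)
      · exact fun h => absurd hi h
    have htrans : ∀ i, ∃ b, twistedTranslate ρ ((τ : π) ^ i) (z 0) = z i + p • b := by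
      intro i
      have h1 : reduceAut hpl (ρ ((τ : π) ^ i)) = 1 := by
        rw [map_pow, map_pow, hτ1, one_pow]
      choose b hb using fun a => exists_sub_eq_smul_of_reduceAut_eq_one hpl h1 a
      refine ⟨fun x => b (z i x), ?_⟩
      funext x
      have h2 : z 0 (((τ : π) ^ i)⁻¹ • x) = z i x := by
        simp only [z, hequiv, htriv, pow_zero, one_smul, inv_smul_eq_iff]
      change ρ ((τ : π) ^ i) (z 0 (((τ : π) ^ i)⁻¹ • x)) = z i x + p • b (z i x)
      rw [h2, ← hb]; abel
    choose b hb using htrans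
    refine ⟨∑ i ∈ Finset.range p, (twistedTranslate ρ ((τ : π) ^ i) (z 0) - z 0),
      sum_mem fun i _ => hN _ _, z 0 - ∑ i ∈ Finset.range p, b i, ?_⟩
    rw [hsum, Finset.sum_sub_distrib]
    simp only [hb, Finset.sum_add_distrib, Finset.sum_const, Finset.card_range, smul_sub,
      Finset.smul_sum]
    abel

/-- The tower of subgroups, climbed along the prime factors of `m`: on the cosets of the subgroup of
index `m`, the constant functions are divisible by `m` modulo differences of translates. -/
theorem exists_subgroup_const_mem_add_smul (ψ : π →* Multiplicative (ℤ × ℤ))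
    (hψ : Function.Surjective ψ) (m : ℕ) (hm : m ∣ l) :
    ∃ (H : Subgroup π) (η : H →* Multiplicative (ℤ × ℤ)), Function.Surjective η ∧
      (∀ c ∈ commutator π, ∃ h : c ∈ H, η ⟨c, h⟩ = 1) ∧ H.index = m ∧
      ∀ N : AddSubgroup (π ⧸ H → Fin 2 → ZMod l),
        (∀ γ f, twistedTranslate ρ γ f - f ∈ N) →
          ∀ e : Fin 2 → ZMod l, ∃ n ∈ N, ∃ z : π ⧸ H → Fin 2 → ZMod l,
            (fun _ => e) = n + m • z := by
  induction m using induction_on_primes with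
  | zero => exact absurd (Nat.eq_zero_of_zero_dvd hm) (NeZero.ne l)
  | one =>
    refine ⟨⊤, ψ.comp (Subgroup.subtype ⊤), hψ.comp fun x => ⟨⟨x, trivial⟩, rfl⟩, fun c h =>
      ⟨trivial, ?_⟩, by simp, fun N _ e => ⟨0, N.zero_mem, fun _ => e, by simp⟩⟩
    exact (Abelianization.commutator_subset_ker ψ h : _)
  | prime_mul p a hp ih =>
    have : Fact p.Prime := ⟨hp⟩
    obtain ⟨H, η, hη, hc, hi, hN⟩ := ih ((dvd_mul_left a p).trans hm)
    obtain ⟨H', hle, η', hη', hc', hi', hN'⟩ :=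
      exists_subgroup_pullback_divisible ρ ((dvd_mul_right p a).trans hm) H η hη hc
    refine ⟨H', η', hη', hc', by rw [hi', hi], fun N hNinv e => ?_⟩
    let pull : (π ⧸ H → Fin 2 → ZMod l) →+ (π ⧸ H' → Fin 2 → ZMod l) :=
      { toFun := fun f => f ∘ Subgroup.quotientMapOfLE hle
        map_zero' := rfl
        map_add' := fun _ _ => rfl }
    have hinv : ∀ γ f, twistedTranslate ρ γ f - f ∈ N.comap pull := by
      intro γ f
      have := hNinv γ (pull f)
      rw [AddSubgroup.mem_comap]
      convert this using 1
      funext x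
      induction x using QuotientGroup.induction_on with
      | H g => rfl
    obtain ⟨n, hn, y, hy⟩ := hN (N.comap pull) hinv e
    obtain ⟨n', hn', z, hz⟩ := hN' N hNinv y
    refine ⟨pull n + a • n', N.add_mem hn (N.nsmul_mem hn' a), z, ?_⟩
    have h1 : (fun _ => e : π ⧸ H' → Fin 2 → ZMod l) = pull (fun _ => e) := rfl
    have h2 : pull y = n' + p • z := hz
    rw [h1, hy, map_add, map_nsmul, h2, smul_add, smul_smul, mul_comm a p, add_assoc]

/-- For every group `π` over `ℤ²` acting on `(ℤ/l)²` there is a subgroup of index `l`, containing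
all commutators, such that the constant functions on its cosets vanish in the coinvariants:
the transfer of every class of `H₀(π; (ℤ/l)²)` to this subgroup is zero. -/
theorem exists_subgroup_const_mem (ψ : π →* Multiplicative (ℤ × ℤ))
    (hψ : Function.Surjective ψ) :
    ∃ H : Subgroup π, commutator π ≤ H ∧ H.index = l ∧
      ∀ N : AddSubgroup (π ⧸ H → Fin 2 → ZMod l),
        (∀ γ f, twistedTranslate ρ γ f - f ∈ N) →
          ∀ e : Fin 2 → ZMod l, (fun _ => e) ∈ N := by
  obtain ⟨H, η, -, hc, hi, hN⟩ := exists_subgroup_const_mem_add_smul ρ ψ hψ l dvd_rfl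
  refine ⟨H, fun c h => (hc c h).1, hi, fun N hNinv e => ?_⟩
  obtain ⟨n, hn, z, hz⟩ := hN N hNinv e
  have : l • z = 0 := by funext x i; simp
  rw [hz, this, add_zero]
  exact hn

end Transfer

/-! ### Descent of finite coverings along closed quotient maps -/

section Descent

theorem t2Space_quotient_of_isClosed {Z : Type*} [TopologicalSpace Z] [CompactSpace Z] [T2Space Z]
    (S : Setoid Z) (hS : IsClosed {p : Z × Z | S p.1 p.2}) : T2Space (Quotient S) := by
  have hcl : IsClosedMap (Quotient.mk S) := by
    intro C hC
    refine isQuotientMap_quotient_mk'.isClosed_preimage.mp ?_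
    change IsClosed (Quotient.mk S ⁻¹' _)
    have : Quotient.mk S ⁻¹' (Quotient.mk S '' C) =
        Prod.snd '' ({p : Z × Z | S p.1 p.2} ∩ C ×ˢ univ) := by
      ext z
      constructor
      · rintro ⟨c, hc, h⟩
        exact ⟨(c, z), ⟨Quotient.exact h, hc, trivial⟩, rfl⟩
      · rintro ⟨⟨c, z'⟩, ⟨h, hc, -⟩, rfl⟩
        exact ⟨c, hc, Quotient.sound h⟩
    rw [this]
    exact ((hS.inter (hC.prod isClosed_univ)).isCompact.image continuous_snd).isClosed
  have hsing : ∀ q : Quotient S, IsClosed (Quotient.mk S ⁻¹' {q}) := by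
    intro q
    induction q using Quotient.inductionOn with
    | h z =>
      have := hcl {z} isClosed_singleton
      rw [image_singleton] at this
      exact this.preimage continuous_quotient_mk'
  refine ⟨fun a b hab => ?_⟩
  have hd : Disjoint (Quotient.mk S ⁻¹' {a}) (Quotient.mk S ⁻¹' {b}) := by
    rw [Set.disjoint_left]
    rintro z rfl hz
    exact hab hz
  obtain ⟨U, V, hU, hV, hAU, hBV, hUV⟩ := normal_separation (hsing a) (hsing b) hd
  refine ⟨(Quotient.mk S '' Uᶜ)ᶜ, (Quotient.mk S '' Vᶜ)ᶜ, (hcl _ hU.isClosed_compl).isOpen_compl,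
    (hcl _ hV.isClosed_compl).isOpen_compl, ?_, ?_, ?_⟩
  · rintro ⟨z, hz, h⟩
    exact hz (hAU h)
  · rintro ⟨z, hz, h⟩
    exact hz (hBV h)
  · rw [Set.disjoint_left]
    intro q hq hq'
    obtain ⟨z, rfl⟩ := Quotient.exists_rep q
    have h1 : z ∈ U := by_contra fun h => hq ⟨z, h, rfl⟩
    have h2 : z ∈ V := by_contra fun h => hq' ⟨z, h, rfl⟩
    exact Set.disjoint_left.mp hUV h1 h2

/-- An open map with finite fibres of constant cardinality from a compact Hausdorff space to a
Hausdorff space is a covering map. -/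
theorem isCoveringMap_of_isOpenMap_of_encard {Y X : Type*} [TopologicalSpace Y] [T2Space Y]
    [CompactSpace Y] [TopologicalSpace X] [T2Space X] {P : Y → X} (hc : Continuous P)
    (ho : IsOpenMap P) (n : ℕ) (hn : ∀ x, (P ⁻¹' {x}).encard = n) : IsCoveringMap P := by
  rw [← isLocalHomeomorph_iff_isCoveringMap, isLocalHomeomorph_iff_isOpenEmbedding_restrict]
  intro y
  have hfin : ∀ x, (P ⁻¹' {x}).Finite := fun x => finite_of_encard_eq_coe (hn x)
  obtain ⟨V, hV, hdisj⟩ := (hfin (P y)).t2_separation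
  let O : Set X := ⋂ z ∈ P ⁻¹' {P y}, P '' V z
  have hO : IsOpen O := (hfin (P y)).isOpen_biInter fun z _ => ho _ (hV z).2
  have hyO : P y ∈ O := mem_iInter₂.mpr fun z hz => ⟨z, (hV z).1, hz⟩
  have hU : IsOpen (V y ∩ P ⁻¹' O) := (hV y).2.inter (hO.preimage hc)
  refine ⟨V y ∩ P ⁻¹' O, hU.mem_nhds ⟨(hV y).1, hyO⟩, ?_⟩
  refine .of_continuous_injective_isOpenMap (hc.comp continuous_subtype_val) ?_
    (ho.comp hU.isOpenMap_subtype_val)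
  rintro ⟨a, haV, haO⟩ ⟨b, hbV, -⟩ (hab : P a = P b)
  -- one preimage in each neighbourhood exhausts the fibre over `P a`
  have hch : ∀ z : P ⁻¹' {P y}, ∃ c ∈ V z, P c = P a := fun z => mem_iInter₂.mp haO z z.2
  choose c hcV hcP using hch
  have hcinj : Function.Injective c := by
    intro z z' h
    by_contra hne
    exact Set.disjoint_left.mp (hdisj z.2 z'.2 fun h' => hne (Subtype.ext h')) (hcV z)
      (h ▸ hcV z')
  have hrange : range c = P ⁻¹' {P a} := by
    refine (hfin (P a)).eq_of_subset_of_encard_le' ?_ ?_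
    · rintro _ ⟨z, rfl⟩; exact hcP z
    · rw [hn, ← hn (P y), ← image_univ, hcinj.injOn.encard_image, encard_univ]
      rfl
  have hy : y ∈ P ⁻¹' {P y} := rfl
  have huniq : ∀ d ∈ V y, P d = P a → d = c ⟨y, hy⟩ := by
    intro d hd hPd
    obtain ⟨z, rfl⟩ := hrange.symm ▸ (show d ∈ P ⁻¹' {P a} from hPd)
    congr 1
    by_contra hne
    exact Set.disjoint_left.mp (hdisj z.2 hy fun h' => hne (Subtype.ext h')) (hcV z) hd
  exact Subtype.ext ((huniq a haV rfl).trans (huniq b hbV hab.symm).symm)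

variable {Z E X : Type*} [TopologicalSpace Z] [CompactSpace Z] [T2Space Z]
  [TopologicalSpace E] [CompactSpace E] [TopologicalSpace X] [T2Space X]

/-- Descent of finite coverings: if a closed equivalence relation on the total space of an `n`-fold
covering `pr : Z → E` transports the fibres of `pr` bijectively along the fibres of the
quotient map `q : E → X`, then the quotient is an `n`-fold covering of `X`. -/
theorem quotient_isCoveringMap (S : Setoid Z) (hS : IsClosed {p : Z × Z | S p.1 p.2})
    {pr : Z → E} (hpr : Continuous pr) (hpro : IsOpenMap pr) {q : E → X} (hq : Continuous q)
    (hqs : Function.Surjective q) (n : ℕ) (hcard : ∀ e, (pr ⁻¹' {e}).encard = n)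
    (hSq : ∀ a b, S a b → q (pr a) = q (pr b)) (huniq : ∀ a b, S a b → pr a = pr b → a = b)
    (hex : ∀ a e, q (pr a) = q e → ∃ b, S a b ∧ pr b = e) :
    IsCoveringMap (Quotient.lift (fun z => q (pr z)) hSq : Quotient S → X) ∧
      ∀ x, ((Quotient.lift (fun z => q (pr z)) hSq : Quotient S → X) ⁻¹' {x}).encard = n := by
  have := t2Space_quotient_of_isClosed S hS
  set P : Quotient S → X := Quotient.lift (fun z => q (pr z)) hSq with hP
  have hPc : Continuous P := (hq.comp hpr).quotient_lift hSq
  have hfib : ∀ x, (P ⁻¹' {x}).encard = n := by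
    intro x
    obtain ⟨e, rfl⟩ := hqs x
    rw [← hcard e]
    have : P ⁻¹' {q e} = Quotient.mk S '' (pr ⁻¹' {e}) := by
      ext y
      constructor
      · obtain ⟨a, rfl⟩ := Quotient.exists_rep y
        intro h
        obtain ⟨b, hab, hb⟩ := hex a e h
        exact ⟨b, hb, (Quotient.sound hab).symm⟩
      · rintro ⟨b, rfl, rfl⟩
        rfl
    rw [this, InjOn.encard_image]
    intro a ha b hb hab
    exact huniq a b (Quotient.exact hab) (ha.trans hb.symm)
  refine ⟨isCoveringMap_of_isOpenMap_of_encard hPc ?_ n hfib, hfib⟩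
  intro V hV
  rw [isOpen_iff_mem_nhds]
  rintro _ ⟨y, hy, rfl⟩
  obtain ⟨z, rfl⟩ := Quotient.exists_rep y
  let W : Set E := pr '' (Quotient.mk S ⁻¹' V)
  have hW : IsOpen W := hpro _ (hV.preimage continuous_quotient_mk')
  have hfibW : q ⁻¹' {P (Quotient.mk S z)} ⊆ W := by
    intro e he
    obtain ⟨b, hab, hb⟩ := hex z e (Eq.symm he)
    refine ⟨b, ?_, hb⟩
    change Quotient.mk S b ∈ V
    rwa [← Quotient.sound hab]
  refine Filter.mem_of_superset ((hq.isClosedMap _ hW.isClosed_compl).isOpen_compl.mem_nhds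
    (?_ : P (Quotient.mk S z) ∈ _)) ?_
  · rintro ⟨e, he, h⟩
    exact he (hfibW h)
  · intro x hx
    obtain ⟨e, rfl⟩ := hqs x
    have he : e ∈ W := by_contra fun h => hx ⟨e, h, rfl⟩
    obtain ⟨b, hb, rfl⟩ := he
    exact ⟨Quotient.mk S b, hb, rfl⟩

end Descent

/-! ### Gluing bundles over the polygon -/

section Polygon

variable {g : ℕ}

theorem polygonSide_eq_iff (hg : 1 ≤ g) {j j' : ℕ} {s s' : unitInterval} :
    polygonSide g j s = polygonSide g j' s' ↔
      ∃ n : ℤ, (j : ℝ) + s = j' + s' + n * (4 * g) := by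
  have hg' : (0 : ℝ) < 4 * g := by positivity
  rw [polygonSide, polygonSide, Subtype.mk.injEq, Circle.coe_inj, Circle.exp_eq_exp]
  refine exists_congr fun n => ?_
  have hpi := Real.pi_pos
  constructor
  · intro h
    field_simp at h
    nlinarith [h]
  · intro h
    rw [h]
    field_simp

theorem polygonSide_one (hg : 1 ≤ g) (j : ℕ) : polygonSide g j 1 = polygonSide g (j + 1) 0 := by
  rw [polygonSide_eq_iff hg]
  exact ⟨0, by simp⟩

theorem polygonSide_last (hg : 1 ≤ g) : polygonSide g (4 * g) 0 = polygonSide g 0 0 := by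
  rw [polygonSide_eq_iff hg]
  exact ⟨1, by simp⟩

theorem polygonSide_inj_of_interior (hg : 1 ≤ g) {j j' : ℕ} (hj : j < 4 * g) (hj' : j' < 4 * g)
    {s s' : unitInterval} (hs : 0 < s) (hs1 : s < 1)
    (h : polygonSide g j s = polygonSide g j' s') : j = j' ∧ s = s' := by
  obtain ⟨n, hn⟩ := (polygonSide_eq_iff hg).mp h
  have a0 : (0 : ℝ) < s := hs
  have a1 : (s : ℝ) < 1 := hs1
  have a2 : (0 : ℝ) ≤ s' := s'.2.1
  have a3 : (s' : ℝ) ≤ 1 := s'.2.2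
  have b1 : (j : ℝ) + 1 ≤ 4 * g := by exact_mod_cast hj
  have b2 : (j' : ℝ) + 1 ≤ 4 * g := by exact_mod_cast hj'
  have c1 : (0 : ℝ) ≤ j := j.cast_nonneg
  have c2 : (0 : ℝ) ≤ j' := j'.cast_nonneg
  have hn0 : n = 0 := by
    by_contra hne
    rcases lt_or_gt_of_ne hne with h1 | h1
    · have : (n : ℝ) ≤ -1 := by exact_mod_cast Int.le_sub_one_of_lt h1
      nlinarith
    · have : (1 : ℝ) ≤ n := by exact_mod_cast h1
      nlinarith
  subst hn0
  simp only [Int.cast_zero, zero_mul, add_zero] at hn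
  rcases lt_trichotomy j j' with h1 | rfl | h1
  · have : (j : ℝ) + 1 ≤ j' := by exact_mod_cast h1
    linarith
  · exact ⟨rfl, Subtype.ext (by linarith)⟩
  · have : (j' : ℝ) + 1 ≤ j := by exact_mod_cast h1
    linarith

theorem polygonSide_zero_inj (hg : 1 ≤ g) {m m' : ℕ} (hm : m < 4 * g) (hm' : m' < 4 * g)
    (h : polygonSide g m 0 = polygonSide g m' 0) : m = m' := by
  obtain ⟨n, hn⟩ := (polygonSide_eq_iff hg).mp h
  simp only [Set.Icc.coe_zero, add_zero] at hn
  have hn' : (m : ℤ) = m' + n * (4 * g) := by exact_mod_cast hn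
  have hn0 : n = 0 := by
    by_contra hne
    rcases lt_or_gt_of_ne hne with h1 | h1
    · have : n ≤ -1 := by omega
      nlinarith
    · have : 1 ≤ n := by omega
      nlinarith
  subst hn0
  omega

theorem continuous_polygonSide (g j : ℕ) : Continuous (polygonSide g j) := by
  unfold polygonSide
  fun_prop

/-- Gluing maps for the product of the `4g`-gon with `V`: `map j s` identifies the fibre over the
point at time `s` of the side `j` (where `j` is `4k` or `4k + 1`) with the fibre over the
point of the side `j + 2` with which it is paired. The last field says that going once
around the vertex of the polygon gives the identity of `V`. -/
structure EdgeGluing (g : ℕ) (V : Type*) [TopologicalSpace V] where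
  map : ℕ → unitInterval → Equiv.Perm V
  continuous_map : ∀ j, Continuous fun p : unitInterval × V => map j p.1 p.2
  handleProd_eq_one : handleProd (fun k => map (4 * k) 0) (fun k => map (4 * k) 1)
    (fun k => map (4 * k + 1) 0) (fun k => map (4 * k + 1) 1) g = 1

namespace EdgeGluing

variable {V : Type*} [TopologicalSpace V] (Γ : EdgeGluing g V)

/-- The identification of the fibre over the `m`-th corner of the polygon with the fibre over the
corner `0`. -/
def frame (m : ℕ) : Equiv.Perm V :=
  handleProd (fun k => Γ.map (4 * k) 0) (fun k => Γ.map (4 * k) 1)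
    (fun k => Γ.map (4 * k + 1) 0) (fun k => Γ.map (4 * k + 1) 1) (m / 4) *
    (if m % 4 = 0 then 1
      else if m % 4 = 3 then (Γ.map (4 * (m / 4)) 0)⁻¹
      else if m % 4 = 2 then (Γ.map (4 * (m / 4)) 0)⁻¹ * Γ.map (4 * (m / 4) + 1) 1
      else (Γ.map (4 * (m / 4)) 0)⁻¹ * Γ.map (4 * (m / 4) + 1) 1 * Γ.map (4 * (m / 4)) 1)

theorem frame_zero : Γ.frame 0 = 1 := by simp [frame, handleProd]

theorem frame_last : Γ.frame (4 * g) = 1 := by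
  have h1 : 4 * g / 4 = g := by omega
  have h2 : 4 * g % 4 = 0 := by omega
  rw [frame, h1, h2, Γ.handleProd_eq_one]; simp

theorem frame_four_mul (k : ℕ) : Γ.frame (4 * k) =
    handleProd (fun k => Γ.map (4 * k) 0) (fun k => Γ.map (4 * k) 1)
      (fun k => Γ.map (4 * k + 1) 0) (fun k => Γ.map (4 * k + 1) 1) k := by
  have h1 : 4 * k / 4 = k := by omega
  have h2 : 4 * k % 4 = 0 := by omega
  rw [frame, h1, h2]; simp

theorem frame_three (k : ℕ) : Γ.frame (4 * k + 3) = Γ.frame (4 * k) * (Γ.map (4 * k) 0)⁻¹ := by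
  have h1 : (4 * k + 3) / 4 = k := by omega
  have h2 : (4 * k + 3) % 4 = 3 := by omega
  rw [frame_four_mul, frame, h1, h2]; simp

theorem frame_two (k : ℕ) :
    Γ.frame (4 * k + 2) = Γ.frame (4 * k) * (Γ.map (4 * k) 0)⁻¹ * Γ.map (4 * k + 1) 1 := by
  have h1 : (4 * k + 2) / 4 = k := by omega
  have h2 : (4 * k + 2) % 4 = 2 := by omega
  rw [frame_four_mul, frame, h1, h2]; simp [mul_assoc]

theorem frame_one (k : ℕ) : Γ.frame (4 * k + 1) =
    Γ.frame (4 * k) * (Γ.map (4 * k) 0)⁻¹ * Γ.map (4 * k + 1) 1 * Γ.map (4 * k) 1 := by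
  have h1 : (4 * k + 1) / 4 = k := by omega
  have h2 : (4 * k + 1) % 4 = 1 := by omega
  rw [frame_four_mul, frame, h1, h2]; simp [mul_assoc]

theorem frame_four (k : ℕ) :
    Γ.frame (4 * k + 4) = Γ.frame (4 * k + 1) * (Γ.map (4 * k + 1) 0)⁻¹ := by
  rw [show 4 * k + 4 = 4 * (k + 1) by ring, frame_four_mul, frame_one, frame_four_mul, handleProd,
    handleBlock]
  simp [mul_assoc]

theorem frame_mul_map_zero {j : ℕ} (hj : j % 4 < 2) :
    Γ.frame (j + 3) * Γ.map j 0 = Γ.frame j := by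
  obtain ⟨k, rfl | rfl⟩ : ∃ k, j = 4 * k ∨ j = 4 * k + 1 := ⟨j / 4, by omega⟩
  · rw [frame_three]; simp
  · rw [show 4 * k + 1 + 3 = 4 * k + 4 by ring, frame_four]; simp

theorem frame_mul_map_one {j : ℕ} (hj : j % 4 < 2) :
    Γ.frame (j + 2) * Γ.map j 1 = Γ.frame (j + 1) := by
  obtain ⟨k, rfl | rfl⟩ : ∃ k, j = 4 * k ∨ j = 4 * k + 1 := ⟨j / 4, by omega⟩
  · rw [frame_two, frame_one]
  · rw [show 4 * k + 1 + 2 = 4 * k + 3 by ring, show 4 * k + 1 + 1 = 4 * k + 2 by ring,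
      frame_three, frame_two]

/-- `p` and `p'` are identified across an edge, at a time `s` with `Q s`. -/
def EdgeRel (Q : unitInterval → Prop) (p p' : Metric.closedBall (0 : ℂ) 1 × V) : Prop :=
  ∃ j < 4 * g, j % 4 < 2 ∧ ∃ s, Q s ∧ p.1 = polygonSide g j s ∧
    p'.1 = polygonSide g (j + 2) (unitInterval.symm s) ∧ p'.2 = Γ.map j s p.2

/-- `p` and `p'` lie over corners and are identified there. -/
def VertexRel (p p' : Metric.closedBall (0 : ℂ) 1 × V) : Prop :=
  ∃ m < 4 * g, ∃ m' < 4 * g, p.1 = polygonSide g m 0 ∧ p'.1 = polygonSide g m' 0 ∧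
    Γ.frame m p.2 = Γ.frame m' p'.2

/-- The equivalence relation on the product of the polygon with `V` given by the gluing maps. -/
def Rel (p p' : Metric.closedBall (0 : ℂ) 1 × V) : Prop :=
  p = p' ∨ Γ.EdgeRel (fun _ => True) p p' ∨ Γ.EdgeRel (fun _ => True) p' p ∨ Γ.VertexRel p p'

theorem vertexRel_symm {p p' : Metric.closedBall (0 : ℂ) 1 × V} (h : Γ.VertexRel p p') :
    Γ.VertexRel p' p := by
  obtain ⟨m, hm, m', hm', h1, h2, h3⟩ := h
  exact ⟨m', hm', m, hm, h2, h1, h3.symm⟩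

theorem rel_symm {p p' : Metric.closedBall (0 : ℂ) 1 × V} (h : Γ.Rel p p') : Γ.Rel p' p := by
  rcases h with h | h | h | h
  · exact .inl h.symm
  · exact .inr (.inr (.inl h))
  · exact .inr (.inl h)
  · exact .inr (.inr (.inr (Γ.vertexRel_symm h)))

theorem edgeRel_interior_or_vertexRel (hg : 1 ≤ g) {p p' : Metric.closedBall (0 : ℂ) 1 × V}
    (h : Γ.EdgeRel (fun _ => True) p p') :
    Γ.EdgeRel (fun s => 0 < s ∧ s < 1) p p' ∨ Γ.VertexRel p p' := by
  obtain ⟨j, hj, hj4, s, -, h1, h2, h3⟩ := h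
  rcases (unitInterval.nonneg s).eq_or_lt with h0 | h0
  · right
    replace h0 : s = 0 := (Subtype.ext h0).symm
    subst h0
    rw [unitInterval.symm_zero, polygonSide_one hg] at h2
    have hf := congrArg (fun e => e p.2) (Γ.frame_mul_map_zero hj4)
    simp only [Equiv.Perm.mul_apply] at hf
    rw [← h3] at hf
    by_cases h4 : j + 2 + 1 = 4 * g
    · refine ⟨j, hj, 0, by omega, h1, ?_, ?_⟩
      · rw [h2, h4, polygonSide_last hg]
      · rw [← hf, show j + 3 = 4 * g from h4, frame_last, frame_zero]
    · exact ⟨j, hj, j + 2 + 1, by omega, h1, h2, hf.symm⟩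
  rcases (unitInterval.le_one' (t := s)).eq_or_lt with h0' | h0'
  · right
    subst h0'
    rw [unitInterval.symm_one] at h2
    rw [polygonSide_one hg] at h1
    have hf := congrArg (fun e => e p.2) (Γ.frame_mul_map_one hj4)
    simp only [Equiv.Perm.mul_apply] at hf
    rw [← h3] at hf
    exact ⟨j + 1, by omega, j + 2, by omega, h1, h2, hf.symm⟩
  · exact .inl ⟨j, hj, hj4, s, ⟨h0, h0'⟩, h1, h2, h3⟩

theorem rel_cases (hg : 1 ≤ g) {p p' : Metric.closedBall (0 : ℂ) 1 × V} (h : Γ.Rel p p') :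
    p = p' ∨ Γ.EdgeRel (fun s => 0 < s ∧ s < 1) p p' ∨ Γ.EdgeRel (fun s => 0 < s ∧ s < 1) p' p ∨
      Γ.VertexRel p p' := by
  rcases h with h | h | h | h
  · exact .inl h
  · rcases Γ.edgeRel_interior_or_vertexRel hg h with h | h
    · exact .inr (.inl h)
    · exact .inr (.inr (.inr h))
  · rcases Γ.edgeRel_interior_or_vertexRel hg h with h | h
    · exact .inr (.inr (.inl h))
    · exact .inr (.inr (.inr (Γ.vertexRel_symm h)))
  · exact .inr (.inr (.inr h))

theorem symm_pos_lt {s : unitInterval} (h : 0 < s ∧ s < 1) :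
    0 < unitInterval.symm s ∧ unitInterval.symm s < 1 := by
  have h1 : (0 : ℝ) < s := h.1
  have h2 : (s : ℝ) < 1 := h.2
  constructor <;> rw [← Subtype.coe_lt_coe] <;> simp [h1, h2]

/-- Only one side pairing applies to an interior point of a side, and all vertices are related
through their frames; this is why the relation is already transitive. -/
theorem rel_trans (hg : 1 ≤ g) {p p' p'' : Metric.closedBall (0 : ℂ) 1 × V} (h : Γ.Rel p p')
    (h' : Γ.Rel p' p'') : Γ.Rel p p'' := by
  rcases Γ.rel_cases hg h with rfl | h | h | h
  · exact h'
  · obtain ⟨j, hj, hj4, s, hs, h1, h2, h3⟩ := h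
    rcases Γ.rel_cases hg h' with rfl | h' | h' | h'
    · exact .inr (.inl ⟨j, hj, hj4, s, trivial, h1, h2, h3⟩)
    · obtain ⟨i, hi, hi4, t, ht, k1, k2, k3⟩ := h'
      obtain ⟨e1, -⟩ := polygonSide_inj_of_interior hg (by omega) hi (symm_pos_lt hs).1
        (symm_pos_lt hs).2 (h2.symm.trans k1)
      omega
    · obtain ⟨i, hi, hi4, t, ht, k1, k2, k3⟩ := h'
      obtain ⟨e1, e2⟩ := polygonSide_inj_of_interior hg (by omega) (by omega) (symm_pos_lt hs).1
        (symm_pos_lt hs).2 (h2.symm.trans k2)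
      obtain rfl : j = i := by omega
      obtain rfl : s = t := unitInterval.symm_bijective.1 e2
      exact .inl (Prod.ext (h1.trans k1.symm) ((Γ.map j s).injective (h3.symm.trans k3)))
    · obtain ⟨m, hm, m', hm', k1, k2, k3⟩ := h'
      obtain ⟨-, e2⟩ := polygonSide_inj_of_interior hg (by omega) hm (symm_pos_lt hs).1
        (symm_pos_lt hs).2 (h2.symm.trans k1)
      exact absurd e2 (symm_pos_lt hs).1.ne'
  · obtain ⟨j, hj, hj4, s, hs, h1, h2, h3⟩ := h
    rcases Γ.rel_cases hg h' with rfl | h' | h' | h'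
    · exact .inr (.inr (.inl ⟨j, hj, hj4, s, trivial, h1, h2, h3⟩))
    · obtain ⟨i, hi, hi4, t, ht, k1, k2, k3⟩ := h'
      obtain ⟨rfl, rfl⟩ := polygonSide_inj_of_interior hg hj hi hs.1 hs.2 (h1.symm.trans k1)
      exact .inl (Prod.ext (h2.trans k2.symm) (h3.trans k3.symm))
    · obtain ⟨i, hi, hi4, t, ht, k1, k2, k3⟩ := h'
      obtain ⟨e1, -⟩ := polygonSide_inj_of_interior hg hj (by omega) hs.1 hs.2 (h1.symm.trans k2)
      omega
    · obtain ⟨m, hm, m', hm', k1, k2, k3⟩ := h'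
      obtain ⟨-, e2⟩ := polygonSide_inj_of_interior hg hj hm hs.1 hs.2 (h1.symm.trans k1)
      exact absurd e2 hs.1.ne'
  · obtain ⟨m, hm, m', hm', k1, k2, k3⟩ := h
    rcases Γ.rel_cases hg h' with rfl | h' | h' | h'
    · exact .inr (.inr (.inr ⟨m, hm, m', hm', k1, k2, k3⟩))
    · obtain ⟨j, hj, hj4, s, hs, h1, h2, h3⟩ := h'
      obtain ⟨-, e2⟩ := polygonSide_inj_of_interior hg hj hm' hs.1 hs.2 (h1.symm.trans k2)
      exact absurd e2 hs.1.ne'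
    · obtain ⟨j, hj, hj4, s, hs, h1, h2, h3⟩ := h'
      obtain ⟨-, e2⟩ := polygonSide_inj_of_interior hg (by omega) hm' (symm_pos_lt hs).1
        (symm_pos_lt hs).2 (h2.symm.trans k2)
      exact absurd e2 (symm_pos_lt hs).1.ne'
    · obtain ⟨n, hn, n', hn', h1, h2, h3⟩ := h'
      obtain rfl := polygonSide_zero_inj hg hm' hn (k2.symm.trans h1)
      exact .inr (.inr (.inr ⟨m, hm, n', hn', k1, h2, k3.trans h3⟩))

/-- The gluing relation as a setoid. -/
def setoid (hg : 1 ≤ g) : Setoid (Metric.closedBall (0 : ℂ) 1 × V) where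
  r := Γ.Rel
  iseqv := ⟨fun _ => .inl rfl, Γ.rel_symm, Γ.rel_trans hg⟩

/-- Different points over the same point of the disk are never identified. -/
theorem rel_unique (hg : 1 ≤ g) {p p' : Metric.closedBall (0 : ℂ) 1 × V} (h : Γ.Rel p p')
    (h' : p.1 = p'.1) : p = p' := by
  have edge : ∀ {p p' : Metric.closedBall (0 : ℂ) 1 × V},
      Γ.EdgeRel (fun s => 0 < s ∧ s < 1) p p' → p.1 ≠ p'.1 := by
    rintro p p' ⟨j, hj, hj4, s, hs, h1, h2, -⟩ h
    obtain ⟨e, -⟩ := polygonSide_inj_of_interior hg hj (by omega) hs.1 hs.2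
      (h1.symm.trans (h.trans h2))
    omega
  rcases Γ.rel_cases hg h with h | h | h | h
  · exact h
  · exact absurd h' (edge h)
  · exact absurd h'.symm (edge h)
  · obtain ⟨m, hm, m', hm', k1, k2, k3⟩ := h
    obtain rfl := polygonSide_zero_inj hg hm hm' (k1.symm.trans (h'.trans k2))
    exact Prod.ext h' ((Γ.frame m).injective k3)

/-- Points of the disk that are identified in the surface have identified fibres. -/
theorem exists_rel_of_eqvGen (hg : 1 ≤ g) {d d' : Metric.closedBall (0 : ℂ) 1}
    (h : Relation.EqvGen (PolygonGlue g) d d') : ∀ y : V, ∃ y', Γ.Rel (d, y) (d', y') := by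
  have key : ∀ d d', Relation.EqvGen (PolygonGlue g) d d' →
      (∀ y : V, ∃ y', Γ.Rel (d, y) (d', y')) ∧ (∀ y : V, ∃ y', Γ.Rel (d', y) (d, y')) := by
    intro d d' h
    induction h with
    | rel d d' h =>
      rcases h with ⟨k, hk, s⟩ | ⟨k, hk, s⟩
      · refine ⟨fun y => ⟨Γ.map (4 * k) s y, .inr (.inl
          ⟨4 * k, by omega, by omega, s, trivial, rfl, rfl, rfl⟩)⟩,
          fun y => ⟨(Γ.map (4 * k) s).symm y, .inr (.inr (.inl
          ⟨4 * k, by omega, by omega, s, trivial, rfl, rfl, by simp⟩))⟩⟩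
      · refine ⟨fun y => ⟨Γ.map (4 * k + 1) s y, .inr (.inl
          ⟨4 * k + 1, by omega, by omega, s, trivial, rfl, rfl, rfl⟩)⟩,
          fun y => ⟨(Γ.map (4 * k + 1) s).symm y, .inr (.inr (.inl
          ⟨4 * k + 1, by omega, by omega, s, trivial, rfl, rfl, by simp⟩))⟩⟩
    | refl d => exact ⟨fun y => ⟨y, .inl rfl⟩, fun y => ⟨y, .inl rfl⟩⟩
    | symm d d' _ ih => exact ⟨ih.2, ih.1⟩
    | trans d d' d'' _ _ ih ih' =>
      refine ⟨fun y => ?_, fun y => ?_⟩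
      · obtain ⟨y', h⟩ := ih.1 y
        obtain ⟨y'', h'⟩ := ih'.1 y'
        exact ⟨y'', Γ.rel_trans hg h h'⟩
      · obtain ⟨y', h⟩ := ih'.2 y
        obtain ⟨y'', h'⟩ := ih.2 y'
        exact ⟨y'', Γ.rel_trans hg h h'⟩
  exact (key d d' h).1

/-- A property of pairs of points that is preserved across edges and composition holds for all
identified points: the corner identifications are composites of edge identifications. -/
theorem rel_induction (hg : 1 ≤ g) {C : (p p' : Metric.closedBall (0 : ℂ) 1 × V) → Prop}
    (hrefl : ∀ p, C p p) (hsymm : ∀ p p', C p p' → C p' p)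
    (htrans : ∀ p p' p'', C p p' → C p' p'' → C p p'')
    (hedge : ∀ p p', Γ.EdgeRel (fun _ => True) p p' → C p p')
    {p p' : Metric.closedBall (0 : ℂ) 1 × V} (h : Γ.Rel p p') : C p p' := by
  have e0 : ∀ {j : ℕ}, j < 4 * g → j % 4 < 2 → ∀ y,
      C (polygonSide g j 0, y) (polygonSide g (j + 3) 0, Γ.map j 0 y) := by
    intro j hj hj4 y
    refine hedge _ _ ⟨j, hj, hj4, 0, trivial, rfl, ?_, rfl⟩
    rw [unitInterval.symm_zero, polygonSide_one hg]
  have e1 : ∀ {j : ℕ}, j < 4 * g → j % 4 < 2 → ∀ y,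
      C (polygonSide g (j + 1) 0, y) (polygonSide g (j + 2) 0, Γ.map j 1 y) := by
    intro j hj hj4 y
    refine hedge _ _ ⟨j, hj, hj4, 1, trivial, ?_, ?_, rfl⟩
    · rw [polygonSide_one hg]
    · rw [unitInterval.symm_one]
  have hb : ∀ k < g, ∀ i ≤ 4, ∀ y, C (polygonSide g (4 * k + i) 0, y) (polygonSide g (4 * k) 0,
      (Γ.frame (4 * k))⁻¹ (Γ.frame (4 * k + i) y)) := by
    intro k hk
    have c3 : ∀ y, C (polygonSide g (4 * k + 3) 0, y) (polygonSide g (4 * k) 0,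
        (Γ.frame (4 * k))⁻¹ (Γ.frame (4 * k + 3) y)) := by
      intro y
      have := hsymm _ _ (e0 (j := 4 * k) (by omega) (by omega) ((Γ.map (4 * k) 0)⁻¹ y))
      rw [Equiv.Perm.inv_def, Equiv.apply_symm_apply] at this
      rw [frame_three]
      simpa using this
    have c2 : ∀ y, C (polygonSide g (4 * k + 2) 0, y) (polygonSide g (4 * k) 0,
        (Γ.frame (4 * k))⁻¹ (Γ.frame (4 * k + 2) y)) := by
      intro y
      refine htrans _ _ _ (e1 (j := 4 * k + 1) (by omega) (by omega) y) ?_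
      have := c3 (Γ.map (4 * k + 1) 1 y)
      rw [frame_two]
      rw [frame_three] at this
      simpa using this
    have c1 : ∀ y, C (polygonSide g (4 * k + 1) 0, y) (polygonSide g (4 * k) 0,
        (Γ.frame (4 * k))⁻¹ (Γ.frame (4 * k + 1) y)) := by
      intro y
      refine htrans _ _ _ (e1 (j := 4 * k) (by omega) (by omega) y) ?_
      have := c2 (Γ.map (4 * k) 1 y)
      rw [frame_one]
      rw [frame_two] at this
      simpa using this
    intro i hi y
    interval_cases i
    · simpa using hrefl _
    · exact c1 y
    · exact c2 y
    · exact c3 y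
    · have h1 := hsymm _ _ (e0 (j := 4 * k + 1) (by omega) (by omega)
        ((Γ.map (4 * k + 1) 0)⁻¹ y))
      rw [Equiv.Perm.inv_def, Equiv.apply_symm_apply] at h1
      refine htrans _ _ _ h1 ?_
      rw [frame_four]
      exact c1 _
  have hblock : ∀ k ≤ g, ∀ y, C (polygonSide g (4 * k) 0, y)
      (polygonSide g 0 0, Γ.frame (4 * k) y) := by
    intro k
    induction k with
    | zero => intro _ y; simpa [frame_zero] using hrefl _
    | succ k ih =>
      intro hk y
      have := htrans _ _ _ (hb k (by omega) 4 le_rfl y) (ih (by omega) _)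
      rw [Equiv.Perm.inv_def, Equiv.apply_symm_apply] at this
      exact this
  have hvert : ∀ m < 4 * g, ∀ y, C (polygonSide g m 0, y) (polygonSide g 0 0, Γ.frame m y) := by
    intro m hm y
    have hk : m / 4 < g := by omega
    have h1 := hb (m / 4) hk (m % 4) (by omega) y
    rw [Nat.div_add_mod] at h1
    have h2 := htrans _ _ _ h1 (hblock (m / 4) hk.le _)
    rwa [Equiv.Perm.inv_def, Equiv.apply_symm_apply] at h2
  rcases h with rfl | h | h | ⟨m, hm, m', hm', h1, h2, h3⟩
  · exact hrefl _
  · exact hedge _ _ h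
  · exact hsymm _ _ (hedge _ _ h)
  · obtain ⟨d, y⟩ := p
    obtain ⟨d', y'⟩ := p'
    simp only at h1 h2 h3
    subst h1 h2
    have := hvert m' hm' y'
    rw [← h3] at this
    exact htrans _ _ _ (hvert m hm y) (hsymm _ _ this)

theorem continuous_perm_inv {V : Type*} [TopologicalSpace V] [CompactSpace V] [T2Space V]
    {e : Equiv.Perm V} (h : Continuous e) : Continuous ⇑e⁻¹ :=
  h.continuous_symm_of_equiv_compact_to_t2

theorem continuous_map_apply (j : ℕ) (s : unitInterval) : Continuous (Γ.map j s) :=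
  (Γ.continuous_map j).comp (.prodMk_right s)

variable [CompactSpace V] [T2Space V]

theorem continuous_frame (m : ℕ) : Continuous (Γ.frame m) := by
  have hmul : ∀ {a b : Equiv.Perm V}, Continuous a → Continuous b →
      Continuous fun v => (a * b) v :=
    fun ha hb => ha.comp hb
  have hp : ∀ k, Continuous ⇑(handleProd (fun k => Γ.map (4 * k) 0) (fun k => Γ.map (4 * k) 1)
      (fun k => Γ.map (4 * k + 1) 0) (fun k => Γ.map (4 * k + 1) 1) k : Equiv.Perm V) := by
    intro k
    induction k with
    | zero => exact continuous_id
    | succ k ih =>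
      exact hmul ih (hmul (hmul (hmul (continuous_perm_inv (Γ.continuous_map_apply _ _))
        (Γ.continuous_map_apply _ _)) (Γ.continuous_map_apply _ _))
        (continuous_perm_inv (Γ.continuous_map_apply _ _)))
  refine hmul (hp _) ?_
  split_ifs
  · exact continuous_id
  · exact continuous_perm_inv (Γ.continuous_map_apply _ _)
  · exact hmul (continuous_perm_inv (Γ.continuous_map_apply _ _)) (Γ.continuous_map_apply _ _)
  · exact hmul (hmul (continuous_perm_inv (Γ.continuous_map_apply _ _))
      (Γ.continuous_map_apply _ _)) (Γ.continuous_map_apply _ _)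

theorem isClosed_rel : IsClosed {p : (Metric.closedBall (0 : ℂ) 1 × V) ×
    (Metric.closedBall (0 : ℂ) 1 × V) | Γ.Rel p.1 p.2} := by
  have hE : IsClosed {p : (Metric.closedBall (0 : ℂ) 1 × V) ×
      (Metric.closedBall (0 : ℂ) 1 × V) | Γ.EdgeRel (fun _ => True) p.1 p.2} := by
    have : {p : (Metric.closedBall (0 : ℂ) 1 × V) ×
        (Metric.closedBall (0 : ℂ) 1 × V) | Γ.EdgeRel (fun _ => True) p.1 p.2} =
        ⋃ j ∈ {j : ℕ | j < 4 * g ∧ j % 4 < 2}, range fun z : unitInterval × V =>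
          ((polygonSide g j z.1, z.2),
            (polygonSide g (j + 2) (unitInterval.symm z.1), Γ.map j z.1 z.2)) := by
      ext ⟨⟨d, y⟩, ⟨d', y'⟩⟩
      simp only [mem_ofPred_eq, mem_iUnion, mem_range, exists_prop, EdgeRel]
      constructor
      · rintro ⟨j, hj, hj4, s, -, h1, h2, h3⟩
        subst h1 h2 h3
        exact ⟨j, ⟨hj, hj4⟩, (s, y), rfl⟩
      · rintro ⟨j, ⟨hj, hj4⟩, ⟨s, y0⟩, h⟩
        simp only [Prod.mk.injEq] at h
        obtain ⟨⟨rfl, rfl⟩, rfl, rfl⟩ := h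
        exact ⟨j, hj, hj4, s, trivial, rfl, rfl, rfl⟩
    rw [this]
    refine (Set.Finite.subset (Set.finite_lt_nat (4 * g)) fun j hj => hj.1).isClosed_biUnion ?_
    intro j _
    refine (isCompact_range ?_).isClosed
    exact (((continuous_polygonSide g j).comp continuous_fst).prodMk continuous_snd).prodMk
      (((continuous_polygonSide g (j + 2)).comp
        (unitInterval.continuous_symm.comp continuous_fst)).prodMk (Γ.continuous_map j))
  have hV : IsClosed {p : (Metric.closedBall (0 : ℂ) 1 × V) ×
      (Metric.closedBall (0 : ℂ) 1 × V) | Γ.VertexRel p.1 p.2} := by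
    have : {p : (Metric.closedBall (0 : ℂ) 1 × V) ×
        (Metric.closedBall (0 : ℂ) 1 × V) | Γ.VertexRel p.1 p.2} =
        ⋃ m ∈ {m : ℕ | m < 4 * g}, ⋃ m' ∈ {m : ℕ | m < 4 * g},
          {p : (Metric.closedBall (0 : ℂ) 1 × V) × (Metric.closedBall (0 : ℂ) 1 × V) |
            p.1.1 = polygonSide g m 0 ∧ p.2.1 = polygonSide g m' 0 ∧
              Γ.frame m p.1.2 = Γ.frame m' p.2.2} := by
      ext p
      simp only [mem_ofPred_eq, mem_iUnion, exists_prop, VertexRel]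
    rw [this]
    refine (Set.finite_lt_nat (4 * g)).isClosed_biUnion fun m _ =>
      (Set.finite_lt_nat (4 * g)).isClosed_biUnion fun m' _ => ?_
    refine (isClosed_eq (by fun_prop) continuous_const).inter
      ((isClosed_eq (by fun_prop) continuous_const).inter (isClosed_eq ?_ ?_))
    · exact (Γ.continuous_frame m).comp (by fun_prop)
    · exact (Γ.continuous_frame m').comp (by fun_prop)
  exact isClosed_diagonal.union (hE.union ((hE.preimage continuous_swap).union hV))

end EdgeGluing

end Polygon

/-! ### Trivializing bundles with compact fibre over squares and disks -/

section Trivialization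

/-- The point of a compact fibre at which a fibrewise injective map takes a given value depends
continuously on parameters. -/
theorem continuous_fibreCoordinate {A B T X : Type*} [TopologicalSpace A] [TopologicalSpace B]
    [TopologicalSpace T] [CompactSpace T] [TopologicalSpace X] [T2Space X] {Ψ : B × T → X}
    (hΨ : Continuous Ψ) (hinj : ∀ d, Function.Injective fun t => Ψ (d, t)) {b : A → B}
    (hb : Continuous b) {f : A → X} (hf : Continuous f) {u : A → T}
    (hu : ∀ a, Ψ (b a, u a) = f a) : Continuous u := by
  rw [continuous_iff_isClosed]
  intro C hC
  have : u ⁻¹' C = Prod.fst '' {p : A × T | p.2 ∈ C ∧ Ψ (b p.1, p.2) = f p.1} := by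
    ext a
    constructor
    · exact fun h => ⟨(a, u a), ⟨h, hu a⟩, rfl⟩
    · rintro ⟨⟨a, t⟩, ⟨h1, h2⟩, rfl⟩
      have : t = u a := hinj (b a) (h2.trans (hu a).symm)
      exact this ▸ h1
  rw [this]
  refine isClosedMap_fst_of_compactSpace _ ((hC.preimage continuous_snd).inter ?_)
  exact isClosed_eq (hΨ.comp (by fun_prop)) (by fun_prop)

theorem continuousOn_fibreCoordinate {A B T X : Type*} [TopologicalSpace A] [TopologicalSpace B]
    [TopologicalSpace T] [CompactSpace T] [TopologicalSpace X] [T2Space X] {Ψ : B × T → X}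
    {S : Set B} (hΨ : ContinuousOn Ψ (S ×ˢ univ))
    (hinj : ∀ d ∈ S, Function.Injective fun t => Ψ (d, t)) {D : Set A} {b : A → B}
    (hb : ContinuousOn b D) (hbS : MapsTo b D S) {f : A → X} (hf : ContinuousOn f D) {u : A → T}
    (hu : ∀ a ∈ D, Ψ (b a, u a) = f a) : ContinuousOn u D := by
  rw [continuousOn_iff_continuous_domRestrict] at *
  refine continuous_fibreCoordinate (Ψ := fun p : S × T => Ψ (p.1, p.2)) (b := fun a : D =>
    (⟨b a, hbS a.2⟩ : S)) ?_ (fun d => hinj d d.2) (hb.subtype_mk _) hf fun a => hu a a.2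
  exact hΨ.comp (f := fun p : S × T => (⟨(p.1, p.2), p.1.2, trivial⟩ : (S ×ˢ (univ : Set T))))
    (by fun_prop)

variable {F X B T : Type*} [TopologicalSpace X] [TopologicalSpace B] [TopologicalSpace T]

/-- The pullback of `π : X → F` along `φ : B → F` is a trivial bundle with fibre `T` over the
set `S`. -/
def TrivialOver (T : Type*) [TopologicalSpace T] (π : X → F) (φ : B → F) (S : Set B) : Prop :=
  ∃ Ψ : B × T → X, ContinuousOn Ψ (S ×ˢ univ) ∧
    ∀ d ∈ S, Function.Injective (fun t => Ψ (d, t)) ∧ range (fun t => Ψ (d, t)) = π ⁻¹' {φ d}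

/-- Trivializations over closed sets `S₁`, `S₂` can be glued if `S₁ ∩ S₂` is a retract of `S₂`. -/
theorem TrivialOver.union [T2Space X] [CompactSpace T] {π : X → F} {φ : B → F} {S₁ S₂ : Set B}
    (h₁ : TrivialOver T π φ S₁) (h₂ : TrivialOver T π φ S₂) (hS₁ : IsClosed S₁)
    (hS₂ : IsClosed S₂) {ρ : B → B} (hρ : ContinuousOn ρ S₂) (hm : MapsTo ρ S₂ (S₁ ∩ S₂))
    (hid : ∀ d ∈ S₁ ∩ S₂, ρ d = d) : TrivialOver T π φ (S₁ ∪ S₂) := by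
  classical
  obtain ⟨Ψ₁, hc₁, hb₁⟩ := h₁
  obtain ⟨Ψ₂, hc₂, hb₂⟩ := h₂
  have hex : ∀ p : B × T, ∃ u, p.1 ∈ S₁ ∩ S₂ → Ψ₂ (p.1, u) = Ψ₁ p := by
    rintro ⟨d, t⟩
    by_cases hd : d ∈ S₁ ∩ S₂
    · have h : Ψ₁ (d, t) ∈ range fun t => Ψ₂ (d, t) := by
        rw [(hb₂ d hd.2).2, ← (hb₁ d hd.1).2]
        exact ⟨t, rfl⟩
      exact ⟨h.choose, fun _ => h.choose_spec⟩
    · exact ⟨t, fun h => absurd h hd⟩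
  choose u hu using hex
  have huc : ContinuousOn u ((S₁ ∩ S₂) ×ˢ univ) :=
    continuousOn_fibreCoordinate hc₂ (fun d hd => (hb₂ d hd).1) (b := Prod.fst)
      continuous_fst.continuousOn (fun p hp => hp.1.2)
      (hc₁.mono (prod_mono_left inter_subset_left)) fun p hp => hu p hp.1
  have hueq : ∀ d ∈ S₁ ∩ S₂, ∀ t, Ψ₂ (d, u (d, t)) = Ψ₁ (d, t) := fun d hd t => hu (d, t) hd
  refine ⟨fun p => if p.1 ∈ S₁ then Ψ₁ p else Ψ₂ (p.1, u (ρ p.1, p.2)), ?_, ?_⟩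
  · rw [union_prod]
    refine ContinuousOn.union_of_isClosed ?_ ?_ (hS₁.prod isClosed_univ)
      (hS₂.prod isClosed_univ)
    · exact hc₁.congr fun p hp => if_pos hp.1
    · have : ContinuousOn (fun p : B × T => Ψ₂ (p.1, u (ρ p.1, p.2))) (S₂ ×ˢ univ) := by
        refine hc₂.comp (continuous_fst.continuousOn.prodMk (huc.comp
          ((hρ.comp continuous_fst.continuousOn fun p hp => hp.1).prodMk
            continuous_snd.continuousOn) fun p hp => ⟨hm hp.1, trivial⟩)) fun p hp =>
          ⟨hp.1, trivial⟩
      refine this.congr fun p hp => ?_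
      dsimp only
      split_ifs with h
      · rw [hid _ ⟨h, hp.1⟩, hueq _ ⟨h, hp.1⟩]
      · rfl
  · intro d hd
    by_cases h : d ∈ S₁
    · simpa [h] using hb₁ d h
    · have hd2 : d ∈ S₂ := hd.resolve_left h
      simp only [h, if_false]
      have he := hm hd2
      have hbij : Function.Bijective fun t => u (ρ d, t) := by
        constructor
        · intro t t' htt
          refine (hb₁ _ he.1).1 ?_
          have htt' : u (ρ d, t) = u (ρ d, t') := htt
          change Ψ₁ (ρ d, t) = Ψ₁ (ρ d, t')
          rw [← hueq _ he, ← hueq _ he, htt']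
        · intro v
          have : Ψ₂ (ρ d, v) ∈ range fun t => Ψ₁ (ρ d, t) := by
            rw [(hb₁ _ he.1).2, ← (hb₂ _ he.2).2]
            exact ⟨v, rfl⟩
          obtain ⟨t, ht⟩ := this
          exact ⟨t, (hb₂ _ he.2).1 ((hueq _ he t).trans ht)⟩
      refine ⟨(hb₂ d hd2).1.comp hbij.1, ?_⟩
      rw [← (hb₂ d hd2).2]
      exact hbij.2.range_comp (fun t => Ψ₂ (d, t))

theorem TrivialOver.mono {π : X → F} {φ : B → F} {S S' : Set B} (h : TrivialOver T π φ S)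
    (hS : S' ⊆ S) : TrivialOver T π φ S' := by
  obtain ⟨Ψ, hc, hb⟩ := h
  exact ⟨Ψ, hc.mono (prod_mono_left hS), fun d hd => hb d (hS hd)⟩

theorem TrivialOver.comp {C : Type*} [TopologicalSpace C] {π : X → F} {φ : B → F} {S : Set B}
    (h : TrivialOver T π φ S) {ψ : C → B} {S' : Set C} (hψ : ContinuousOn ψ S')
    (hm : MapsTo ψ S' S) : TrivialOver T π (φ ∘ ψ) S' := by
  obtain ⟨Ψ, hc, hb⟩ := h
  refine ⟨fun p => Ψ (ψ p.1, p.2), hc.comp (((hψ.comp continuous_fst.continuousOn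
    fun p hp => hp.1)).prodMk continuous_snd.continuousOn) fun p hp => ⟨hm hp.1, trivial⟩,
    fun d hd => hb _ (hm hd)⟩

/-- A locally trivial bundle with fibre `T`. -/
def LocallyTrivial [TopologicalSpace F] (T : Type*) [TopologicalSpace T] (π : X → F) : Prop :=
  ∀ b : F, ∃ U : Set F, IsOpen U ∧ b ∈ U ∧ TrivialOver T π id U

/-- Bundles with compact fibre pull back to trivial bundles over the square. -/
theorem LocallyTrivial.trivialOver_square [TopologicalSpace F] [T2Space X] [CompactSpace T]
    {π : X → F} (hπ : LocallyTrivial T π) {φ : unitInterval × unitInterval → F}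
    (hφ : Continuous φ) : TrivialOver T π φ univ := by
  choose U hU hbU hT using hπ
  obtain ⟨t, ht0, htm, ⟨n, hn⟩, ht⟩ :=
    exists_monotone_Icc_subset_open_cover_unitInterval_prod_self
      (c := fun b => φ ⁻¹' U b) (fun b => (hU b).preimage hφ)
      fun p _ => mem_iUnion.mpr ⟨φ p, hbU _⟩
  have hsmall : ∀ i j, TrivialOver T π φ (Icc (t i) (t (i + 1)) ×ˢ Icc (t j) (t (j + 1))) := by
    intro i j
    obtain ⟨b, hb⟩ := ht i j
    exact (hT b).comp (ψ := φ) hφ.continuousOn hb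
  have hIcc : ∀ i, Icc 0 (t (i + 1)) = Icc 0 (t i) ∪ Icc (t i) (t (i + 1)) := fun i =>
    (Icc_union_Icc_eq_Icc unitInterval.nonneg' (htm i.le_succ)).symm
  have hrow : ∀ j i, TrivialOver T π φ (Icc 0 (t (i + 1)) ×ˢ Icc (t j) (t (j + 1))) := by
    intro j i
    induction i with
    | zero => simpa [ht0] using hsmall 0 j
    | succ i ih =>
      rw [hIcc (i + 1), union_prod]
      refine ih.union (hsmall _ _) (isClosed_Icc.prod isClosed_Icc)
        (isClosed_Icc.prod isClosed_Icc) (ρ := fun p => (t (i + 1), p.2)) (by fun_prop) ?_ ?_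
      · exact fun p hp => ⟨⟨⟨unitInterval.nonneg', le_rfl⟩, hp.2⟩,
          ⟨⟨le_rfl, htm (Nat.le_succ _)⟩, hp.2⟩⟩
      · exact fun p hp => Prod.ext (le_antisymm hp.2.1.1 hp.1.1.2) rfl
  have hall : ∀ j, TrivialOver T π φ (univ ×ˢ Icc 0 (t (j + 1))) := by
    have hfull : ∀ j, TrivialOver T π φ (univ ×ˢ Icc (t j) (t (j + 1))) := by
      intro j
      refine (hrow j n).mono (prod_mono_left fun x _ => ⟨unitInterval.nonneg', ?_⟩)
      rw [hn _ n.le_succ]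
      exact unitInterval.le_one'
    intro j
    induction j with
    | zero => simpa [ht0] using hfull 0
    | succ j ih =>
      rw [hIcc (j + 1), prod_union]
      refine ih.union (hfull _) (isClosed_univ.prod isClosed_Icc)
        (isClosed_univ.prod isClosed_Icc) (ρ := fun p => (p.1, t (j + 1))) (by fun_prop) ?_ ?_
      · exact fun p hp => ⟨⟨trivial, unitInterval.nonneg', le_rfl⟩,
          ⟨trivial, le_rfl, htm (Nat.le_succ _)⟩⟩
      · exact fun p hp => Prod.ext rfl (le_antisymm hp.2.2.1 hp.1.2.2)
  refine (hall n).mono fun p _ => ⟨trivial, unitInterval.nonneg', ?_⟩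
  rw [hn _ n.le_succ]
  exact unitInterval.le_one'

/-- Bundles with compact fibre pull back to trivial bundles over the closed disk, which is a retract
of a square. -/
theorem LocallyTrivial.trivialOver_disk [TopologicalSpace F] [T2Space X] [CompactSpace T]
    {π : X → F} (hπ : LocallyTrivial T π) {φ : Metric.closedBall (0 : ℂ) 1 → F}
    (hφ : Continuous φ) : TrivialOver T π φ univ := by
  let e : unitInterval × unitInterval → ℂ := fun p => ⟨2 * p.1 - 1, 2 * p.2 - 1⟩
  have he : Continuous e := by
    have : e = fun p => ((2 * (p.1 : ℝ) - 1 : ℝ) : ℂ) + ((2 * (p.2 : ℝ) - 1 : ℝ) : ℂ) *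
        Complex.I := by
      funext p; apply Complex.ext <;> simp [e]
    rw [this]
    fun_prop
  let ρ : ℂ → Metric.closedBall (0 : ℂ) 1 := fun v => ⟨(max 1 ‖v‖ : ℝ)⁻¹ • v, by
    rw [mem_closedBall_zero_iff, norm_smul, norm_inv, Real.norm_of_nonneg (by positivity),
      inv_mul_le_iff₀ (by positivity), mul_one]
    exact le_max_right _ _⟩
  have hρ : Continuous ρ := by
    have h : Continuous fun v : ℂ => (max 1 ‖v‖ : ℝ)⁻¹ :=
      (continuous_const.max continuous_norm).inv₀ fun v => by positivity
    exact (h.smul continuous_id).subtype_mk _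
  let s : Metric.closedBall (0 : ℂ) 1 → unitInterval × unitInterval := fun d =>
    (projIcc 0 1 zero_le_one ((d.1.re + 1) / 2), projIcc 0 1 zero_le_one ((d.1.im + 1) / 2))
  have hs : Continuous s := by
    refine (continuous_projIcc.comp ?_).prodMk (continuous_projIcc.comp ?_)
    · exact ((Complex.continuous_re.comp continuous_subtype_val).add continuous_const).div_const _
    · exact ((Complex.continuous_im.comp continuous_subtype_val).add continuous_const).div_const _
  have hes : ∀ d, ρ (e (s d)) = d := by
    rintro ⟨d, hd⟩
    have hd' : ‖d‖ ≤ 1 := mem_closedBall_zero_iff.mp hd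
    have h1 := abs_le.mp ((Complex.abs_re_le_norm d).trans hd')
    have h2 := abs_le.mp ((Complex.abs_im_le_norm d).trans hd')
    have : e (s ⟨d, hd⟩) = d := by
      apply Complex.ext
      · simp only [e, s]
        rw [projIcc_of_mem zero_le_one
          (⟨by linarith, by linarith⟩ : (d.re + 1) / 2 ∈ Icc (0 : ℝ) 1)]
        ring
      · simp only [e, s]
        rw [projIcc_of_mem zero_le_one
          (⟨by linarith, by linarith⟩ : (d.im + 1) / 2 ∈ Icc (0 : ℝ) 1)]
        ring
    rw [this]
    apply Subtype.ext
    simp [ρ, max_eq_left hd']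
  have h := (hπ.trivialOver_square (hφ.comp (hρ.comp he))).comp (ψ := s) (S' := univ)
    hs.continuousOn (mapsTo_univ _ _)
  have h2 : (φ ∘ ρ ∘ e) ∘ s = φ := by
    funext d
    simp only [Function.comp_apply, hes]
  rwa [h2] at h

end Trivialization

/-! ### Lifting homeomorphisms of the torus to finite coverings -/

section TorusLift

/-- Every continuous map `I × T² → S¹` has an `l`-th root after the base change along the `l`-th
power map of the torus. -/
theorem exists_circle_root {l : ℕ} (hl : l ≠ 0) {f : unitInterval × Circle × Circle → Circle}
    (hf : Continuous f) : ∃ h : unitInterval × Circle × Circle → Circle, Continuous h ∧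
      ∀ s z, h (s, z) ^ l = f (s, z ^ l) := by
  have hpi := Real.pi_pos
  obtain ⟨F, hF⟩ : ∃ F : C(unitInterval × ℝ × ℝ, ℝ), ∀ s x y,
      Circle.exp (F (s, x, y)) = f (s, Circle.exp x, Circle.exp y) := by
    let k : C(ℝ × ℝ × ℝ, Circle) :=
      ⟨fun p => f (projIcc 0 1 zero_le_one p.1, Circle.exp p.2.1, Circle.exp p.2.2), by
        have := continuous_projIcc (a := (0 : ℝ)) (b := 1) (h := zero_le_one)
        fun_prop⟩
    obtain ⟨e₀, he₀⟩ := Circle.exp_surjective (k 0)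
    obtain ⟨F, ⟨-, hF⟩, -⟩ := Circle.isCoveringMap_exp.existsUnique_continuousMap_lifts k 0 e₀ he₀
    refine ⟨⟨fun p => F (p.1, p.2), by fun_prop⟩, fun s x y => ?_⟩
    have := congrFun hF ((s : ℝ), x, y)
    simpa [k] using this
  have hper : ∀ v : ℝ × ℝ, Circle.exp v.1 = 1 → Circle.exp v.2 = 1 → ∃ a : ℤ, ∀ s x y,
      F (s, x + v.1, y + v.2) = F (s, x, y) + a * (2 * Real.pi) := by
    intro v h1 h2
    have hc : ∀ p q : unitInterval × ℝ × ℝ, F (p.1, p.2.1 + v.1, p.2.2 + v.2) - F p =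
        F (q.1, q.2.1 + v.1, q.2.2 + v.2) - F q := by
      refine Circle.isCoveringMap_exp.const_of_comp (g := fun p : unitInterval × ℝ × ℝ =>
        F (p.1, p.2.1 + v.1, p.2.2 + v.2) - F p) (by fun_prop) ?_
      rintro ⟨s, x, y⟩ ⟨s', x', y'⟩
      simp [Circle.exp_sub, hF, Circle.exp_add, h1, h2]
    have h0 : Circle.exp (F (0, 0 + v.1, 0 + v.2)) = Circle.exp (F (0, 0, 0)) := by
      simp [hF, h1, h2]
    obtain ⟨a, ha⟩ := Circle.exp_eq_exp.mp h0
    refine ⟨a, fun s x y => ?_⟩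
    have := hc (s, x, y) (0, 0, 0)
    simp only at this
    linarith
  have hmul : ∀ v : ℝ × ℝ, Circle.exp v.1 = 1 → Circle.exp v.2 = 1 → ∃ a : ℤ, ∀ s x y,
      F (s, x + l * v.1, y + l * v.2) = F (s, x, y) + l * (a * (2 * Real.pi)) := by
    intro v h1 h2
    obtain ⟨a, ha⟩ := hper v h1 h2
    refine ⟨a, fun s x y => ?_⟩
    clear hl
    induction l with
    | zero => simp
    | succ l ih =>
      push_cast
      rw [show x + (l + 1 : ℝ) * v.1 = (x + l * v.1) + v.1 by ring,
        show y + (l + 1 : ℝ) * v.2 = (y + l * v.2) + v.2 by ring, ha, ih]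
      ring
  let G : unitInterval × ℝ × ℝ → Circle := fun p => Circle.exp (F (p.1, l * p.2.1, l * p.2.2) / l)
  have hG : Continuous G := by fun_prop
  have hl' : (l : ℝ) ≠ 0 := by exact_mod_cast hl
  have hGper : ∀ v : ℝ × ℝ, Circle.exp v.1 = 1 → Circle.exp v.2 = 1 → ∀ s x y,
      G (s, x + v.1, y + v.2) = G (s, x, y) := by
    intro v h1 h2 s x y
    obtain ⟨a, ha⟩ := hmul v h1 h2
    simp only [G, mul_add]
    rw [ha, Circle.exp_eq_exp]
    exact ⟨a, by field_simp⟩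
  let E : unitInterval × ℝ × ℝ → unitInterval × Circle × Circle :=
    Prod.map id (Prod.map Circle.exp Circle.exp)
  have hexp : IsOpenQuotientMap Circle.exp :=
    ⟨Circle.exp_surjective, Circle.exp.continuous,
      Circle.isCoveringMap_exp.isLocalHomeomorph.isOpenMap⟩
  have hE : IsOpenQuotientMap E := .prodMap .id (.prodMap hexp hexp)
  let h : unitInterval × Circle × Circle → Circle := fun p =>
    G (p.1, Complex.arg p.2.1, Complex.arg p.2.2)
  have hE' : ∀ p, h (E p) = G p := by
    rintro ⟨s, x, y⟩
    simp only [h, E, Prod.map, id]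
    have := hGper (x - Complex.arg (Circle.exp x), y - Complex.arg (Circle.exp y))
      (by rw [Circle.exp_sub, Circle.exp_arg, div_self']) (by
        rw [Circle.exp_sub, Circle.exp_arg, div_self']) s
      (Complex.arg (Circle.exp x)) (Complex.arg (Circle.exp y))
    simpa using this.symm
  refine ⟨h, ?_, ?_⟩
  · rw [hE.isQuotientMap.continuous_iff]
    exact hG.congr fun p => (hE' p).symm
  · rintro s ⟨z, w⟩
    obtain ⟨x, rfl⟩ := Circle.exp_surjective z
    obtain ⟨y, rfl⟩ := Circle.exp_surjective w
    rw [show (s, Circle.exp x, Circle.exp y) = E (s, x, y) from rfl, hE']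
    simp only [G, Prod.pow_mk, ← Circle.exp_natCast_mul]
    rw [← hF, mul_div_cancel₀ _ hl']

/-- The inclusion of `(ℤ/l)²` as the group of `l`-torsion points of the torus. -/
noncomputable def torusTorsion (l : ℕ) [NeZero l] :
    Multiplicative (Fin 2 → ZMod l) →* Circle × Circle where
  toFun m := (ZMod.toCircle (m.toAdd 0), ZMod.toCircle (m.toAdd 1))
  map_one' := by simp
  map_mul' a b := by simp [AddChar.map_add_eq_mul]

variable {l : ℕ} [NeZero l]

theorem injective_torusTorsion : Function.Injective (torusTorsion l) := by
  intro a b h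
  have h' := Prod.ext_iff.mp h
  refine Multiplicative.toAdd.injective (funext fun i => ?_)
  fin_cases i
  · exact ZMod.injective_toCircle h'.1
  · exact ZMod.injective_toCircle h'.2

theorem torusTorsion_pow (m : Multiplicative (Fin 2 → ZMod l)) : torusTorsion l m ^ l = 1 := by
  rw [← map_pow]
  have : m ^ l = 1 := by
    refine Multiplicative.toAdd.injective ?_
    funext i
    simp
  rw [this, map_one]

theorem exists_toCircle_eq {z : Circle} (hz : z ^ l = 1) : ∃ a : ZMod l, ZMod.toCircle a = z := by
  obtain ⟨x, rfl⟩ := Circle.exp_surjective z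
  rw [← Circle.exp_natCast_mul, Circle.exp_eq_one] at hz
  obtain ⟨n, hn⟩ := hz
  refine ⟨n, Circle.ext ?_⟩
  have hl : (l : ℂ) ≠ 0 := by exact_mod_cast NeZero.ne l
  have hn' : (l : ℂ) * x = n * (2 * Real.pi) := by exact_mod_cast hn
  rw [ZMod.toCircle_intCast, Circle.coe_exp]
  congr 1
  rw [div_eq_iff hl]
  linear_combination -Complex.I * hn'

theorem exists_torusTorsion_eq {z : Circle × Circle} (hz : z ^ l = 1) :
    ∃ a, torusTorsion l a = z := by
  have hz' := Prod.ext_iff.mp hz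
  obtain ⟨a, ha⟩ := exists_toCircle_eq (l := l) hz'.1
  obtain ⟨b, hb⟩ := exists_toCircle_eq (l := l) hz'.2
  exact ⟨.ofAdd ![a, b], Prod.ext ha hb⟩

theorem finite_torus_pow_eq_one : {z : Circle × Circle | z ^ l = 1}.Finite :=
  (finite_range (torusTorsion l)).subset fun _ hz => exists_torusTorsion_eq hz

theorem torus_pow_eq_pow_iff {z w : Circle × Circle} :
    z ^ l = w ^ l ↔ ∃ a, z = torusTorsion l a * w := by
  constructor
  · intro h
    obtain ⟨a, ha⟩ := exists_torusTorsion_eq (l := l) (z := z / w) (by rw [div_pow, h, div_self'])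
    exact ⟨a, by rw [ha, div_mul_cancel]⟩
  · rintro ⟨a, rfl⟩
    rw [mul_pow, torusTorsion_pow, one_mul]

theorem circle_pow_surjective : Function.Surjective fun z : Circle => z ^ l := by
  intro z
  obtain ⟨x, rfl⟩ := Circle.exp_surjective z
  refine ⟨Circle.exp (x / l), ?_⟩
  have hl : (l : ℝ) ≠ 0 := by exact_mod_cast NeZero.ne l
  dsimp only
  rw [← Circle.exp_natCast_mul, mul_div_cancel₀ _ hl]

theorem torus_pow_surjective : Function.Surjective fun z : Circle × Circle => z ^ l := by
  rintro ⟨z, w⟩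
  obtain ⟨z, rfl⟩ := circle_pow_surjective (l := l) z
  obtain ⟨w, rfl⟩ := circle_pow_surjective (l := l) w
  exact ⟨(z, w), rfl⟩

/-- Two continuous maps to the torus with the same `l`-th power differ by a torsion translation. -/
theorem exists_eq_torusTorsion_mul {A : Type*} [TopologicalSpace A] [PreconnectedSpace A]
    [Nonempty A] {h h' : A → Circle × Circle} (hc : Continuous h) (hc' : Continuous h')
    (hpow : ∀ a, h a ^ l = h' a ^ l) : ∃ m, ∀ a, h a = torusTorsion l m * h' a := by
  obtain ⟨a₀⟩ := ‹Nonempty A›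
  obtain ⟨m, hm⟩ := torus_pow_eq_pow_iff.mp (hpow a₀)
  refine ⟨m, fun a => ?_⟩
  have hsub : (range fun a => h a / h' a).Subsingleton := by
    rw [← not_nontrivial_iff]
    intro hn
    refine ((isPreconnected_range (hc.div' hc')).infinite_of_nontrivial hn)
      ((finite_torus_pow_eq_one (l := l)).subset ?_)
    rintro _ ⟨a, rfl⟩
    change (h a / h' a) ^ l = 1
    rw [div_pow, hpow, div_self']
  have := hsub ⟨a, rfl⟩ ⟨a₀, rfl⟩
  dsimp only at this
  rw [hm, mul_div_cancel_right, div_eq_iff_eq_mul] at this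
  exact this

instance connectedSpace_circle : ConnectedSpace Circle :=
  Circle.exp_surjective.connectedSpace Circle.exp.continuous

/-- A family of homeomorphisms of the torus lifts through the `l`-th power map. -/
theorem exists_torus_lift {H : unitInterval → Equiv.Perm (Circle × Circle)}
    (hH : Continuous fun p : unitInterval × Circle × Circle => H p.1 p.2) :
    ∃ K : unitInterval → Equiv.Perm (Circle × Circle),
      (Continuous fun p : unitInterval × Circle × Circle => K p.1 p.2) ∧
      ∀ s z, K s z ^ l = H s (z ^ l) := by
  have hlift : ∀ f : unitInterval × Circle × Circle → Circle × Circle, Continuous f →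
      ∃ h : unitInterval × Circle × Circle → Circle × Circle, Continuous h ∧
        ∀ s z, h (s, z) ^ l = f (s, z ^ l) := by
    intro f hf
    obtain ⟨h₁, hc₁, hh₁⟩ := exists_circle_root (NeZero.ne l) (continuous_fst.comp hf)
    obtain ⟨h₂, hc₂, hh₂⟩ := exists_circle_root (NeZero.ne l) (continuous_snd.comp hf)
    exact ⟨fun p => (h₁ p, h₂ p), hc₁.prodMk hc₂, fun s z => Prod.ext (hh₁ s z) (hh₂ s z)⟩
  have hHinv : Continuous fun p : unitInterval × Circle × Circle => (H p.1).symm p.2 :=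
    continuous_fibreCoordinate hH (fun d => (H d).injective) continuous_fst continuous_snd
      fun p => (H p.1).apply_symm_apply p.2
  obtain ⟨h, hc, hh⟩ := hlift _ hH
  obtain ⟨k, kc, hk⟩ := hlift _ hHinv
  have hcomp : ∀ h k : unitInterval × Circle × Circle → Circle × Circle, Continuous h →
      Continuous k → (∀ s z, k (s, h (s, z)) ^ l = z ^ l) → ∃ m, ∀ s z,
        k (s, h (s, z)) = torusTorsion l m * z := by
    intro h k hc kc hkh
    obtain ⟨m, hm⟩ := exists_eq_torusTorsion_mul (l := l)
      (h := fun p : unitInterval × Circle × Circle => k (p.1, h p)) (h' := Prod.snd)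
      (by fun_prop) continuous_snd fun p => hkh p.1 p.2
    exact ⟨m, fun s z => hm (s, z)⟩
  obtain ⟨m, hm⟩ := hcomp h k hc kc fun s z => by rw [hk, hh]; simp
  obtain ⟨n, hn⟩ := hcomp k h kc hc fun s z => by rw [hh, hk]; simp
  have hbij : ∀ s, Function.Bijective fun z => h (s, z) := by
    intro s
    constructor
    · intro z w hzw
      have h1 : k (s, h (s, z)) = k (s, h (s, w)) := congrArg (fun v => k (s, v)) hzw
      rw [hm, hm] at h1
      exact mul_left_cancel h1
    · intro w
      refine ⟨k (s, (torusTorsion l n)⁻¹ * w), ?_⟩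
      dsimp only
      rw [hn, mul_inv_cancel_left]
  exact ⟨fun s => Equiv.ofBijective _ (hbij s), hc, hh⟩

/-- A homeomorphism of the torus that lifts a homeomorphism through the `l`-th power map
normalizes the torsion translations. The induced automorphism of `(ℤ/l)²` is the same for
all members of a family. -/
theorem exists_torsion_conj {K H : unitInterval → Equiv.Perm (Circle × Circle)}
    (hK : Continuous fun p : unitInterval × Circle × Circle => K p.1 p.2)
    (hKH : ∀ s z, K s z ^ l = H s (z ^ l)) :
    ∃ θ : (Fin 2 → ZMod l) ≃ₗ[ZMod l] (Fin 2 → ZMod l), ∀ s m z,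
      K s (torusTorsion l (.ofAdd m) * z) = torusTorsion l (.ofAdd (θ m)) * K s z := by
  have hex : ∀ m : Fin 2 → ZMod l, ∃ m' : Multiplicative (Fin 2 → ZMod l), ∀ s z,
      K s (torusTorsion l (.ofAdd m) * z) = torusTorsion l m' * K s z := by
    intro m
    obtain ⟨m', hm'⟩ := exists_eq_torusTorsion_mul (l := l)
      (h := fun p : unitInterval × Circle × Circle => K p.1 (torusTorsion l (.ofAdd m) * p.2))
      (h' := fun p => K p.1 p.2)
      (hK.comp (continuous_fst.prodMk (continuous_const.mul continuous_snd))) hK fun p => by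
        rw [hKH, hKH, mul_pow, torusTorsion_pow, one_mul]
    exact ⟨m', fun s z => hm' (s, z)⟩
  choose θ hθ using hex
  have hinj : Function.Injective θ := by
    intro a b hab
    have h1 := hθ a 0 1
    rw [hab, ← hθ b 0 1] at h1
    exact injective_torusTorsion (mul_right_cancel ((K 0).injective h1))
  let θ₀ : (Fin 2 → ZMod l) →+ (Fin 2 → ZMod l) := AddMonoidHom.mk' (fun m => (θ m).toAdd) (by
    intro a b
    refine Multiplicative.ofAdd.injective (injective_torusTorsion (l := l) ?_)
    have h1 := hθ (a + b) 0 1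
    rw [ofAdd_add, map_mul (torusTorsion l), mul_assoc, hθ a, hθ b, ← mul_assoc,
      ← map_mul (torusTorsion l)] at h1
    exact (mul_right_cancel h1).symm)
  refine ⟨LinearEquiv.ofBijective (AddMonoidHom.toZModLinearMap l θ₀)
    (Finite.injective_iff_bijective.mp hinj), fun s m z => hθ m s z⟩

end TorusLift

/-! ### Finite coverings of torus bundles over surfaces -/

section SurfaceBundle

theorem handleProd_mem {G : Type*} [Group G] (S : Subgroup G) {u u' w w' : ℕ → G}
    (hu : ∀ k, u k ∈ S) (hu' : ∀ k, u' k ∈ S) (hw : ∀ k, w k ∈ S) (hw' : ∀ k, w' k ∈ S) (k : ℕ) :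
    handleProd u u' w w' k ∈ S := by
  induction k with
  | zero => exact S.one_mem
  | succ k ih => exact S.mul_mem ih (S.mul_mem (S.mul_mem (S.mul_mem (S.inv_mem (hu k)) (hw' k))
      (hu' k)) (S.inv_mem (hw k)))

theorem handleProd_mem_commutator {G : Type*} [Group G] (u w : ℕ → G) (k : ℕ) :
    handleProd u u w w k ∈ commutator G := by
  have : Abelianization.of (handleProd u u w w k) = 1 := by
    rw [map_handleProd]
    induction k with
    | zero => rfl
    | succ k ih =>
      rw [handleProd, ih, handleBlock, one_mul]
      simp only [Function.comp_apply]
      rw [mul_comm (Abelianization.of (u k))⁻¹, inv_mul_cancel_right, mul_inv_cancel]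
  rwa [← MonoidHom.mem_ker, Abelianization.ker_of] at this

variable {g : ℕ} {X : Type*}

/-- If the fibres over all boundary points of the polygon are identified with `T` compatibly with a
map `Ψ`, the product of the gluing maps around the vertex is trivial. -/
theorem handleProd_gluing_eq_one {T : Type*} (hg : 1 ≤ g) {Ψ : Metric.closedBall (0 : ℂ) 1 × T → X}
    (hinj : ∀ d, Function.Injective fun t => Ψ (d, t)) {A : ℕ → unitInterval → Equiv.Perm T}
    (hA : ∀ j < 4 * g, j % 4 < 2 → ∀ s t, Ψ (polygonSide g j s, t) =
      Ψ (polygonSide g (j + 2) (unitInterval.symm s), A j s t)) :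
    handleProd (fun k => A (4 * k) 0) (fun k => A (4 * k) 1)
      (fun k => A (4 * k + 1) 0) (fun k => A (4 * k + 1) 1) g = 1 := by
  have e0 : ∀ {j : ℕ}, j < 4 * g → j % 4 < 2 → ∀ t,
      Ψ (polygonSide g j 0, (A j 0)⁻¹ t) = Ψ (polygonSide g (j + 3) 0, t) := by
    intro j hj hj4 t
    have := hA j hj hj4 0 ((A j 0)⁻¹ t)
    rwa [unitInterval.symm_zero, polygonSide_one hg, Equiv.Perm.inv_def, Equiv.apply_symm_apply]
      at this
  have e1 : ∀ {j : ℕ}, j < 4 * g → j % 4 < 2 → ∀ t,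
      Ψ (polygonSide g (j + 1) 0, t) = Ψ (polygonSide g (j + 2) 0, A j 1 t) := by
    intro j hj hj4 t
    have := hA j hj hj4 1 t
    rwa [polygonSide_one hg, unitInterval.symm_one] at this
  have key : ∀ k ≤ g, ∀ t, Ψ (polygonSide g (4 * k) 0, t) = Ψ (polygonSide g 0 0,
      handleProd (fun k => A (4 * k) 0) (fun k => A (4 * k) 1)
        (fun k => A (4 * k + 1) 0) (fun k => A (4 * k + 1) 1) k t) := by
    intro k
    induction k with
    | zero => intro _ t; simp [handleProd]
    | succ k ih =>
      intro hk t
      rw [handleProd, Equiv.Perm.mul_apply, ← ih (by omega), handleBlock]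
      simp only [Equiv.Perm.mul_apply]
      rw [e0 (j := 4 * k) (by omega) (by omega)]
      have h1 := e1 (j := 4 * k + 1) (by omega) (by omega) (A (4 * k) 1 ((A (4 * k + 1) 0)⁻¹ t))
      have h2 := e1 (j := 4 * k) (by omega) (by omega) ((A (4 * k + 1) 0)⁻¹ t)
      have h3 := e0 (j := 4 * k + 1) (by omega) (by omega) t
      exact h3.symm.trans (h2.trans h1)
  ext1 t
  have := key g le_rfl t
  rw [polygonSide_last hg] at this
  exact (hinj _ this).symm

variable {l : ℕ}

/-- The translate of functions on a `π`-set by the elements of `π`, as a representation. -/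
def twistedTranslateHom {π : Type*} [Group π]
    (ρ : π →* ((Fin 2 → ZMod l) ≃ₗ[ZMod l] (Fin 2 → ZMod l))) (J : Type*) [MulAction π J] :
    π →* ((J → Fin 2 → ZMod l) ≃ₗ[ZMod l] (J → Fin 2 → ZMod l)) :=
  MonoidHom.toHomUnits (G := π) (M := Module.End (ZMod l) (J → Fin 2 → ZMod l))
    { toFun := fun γ =>
        { toFun := twistedTranslate ρ γ
          map_add' := fun a b => by funext x; simp [twistedTranslate]
          map_smul' := fun c a => by funext x; simp [twistedTranslate] }
      map_one' := by ext1 f; funext x; simp [twistedTranslate]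
      map_mul' := fun a b => by
        apply LinearMap.ext; intro f; funext x; simp [twistedTranslate, mul_smul] } |>
    fun h => (LinearMap.GeneralLinearGroup.generalLinearEquiv (ZMod l) _).toMonoidHom.comp h

theorem twistedTranslateHom_apply {π : Type*} [Group π]
    (ρ : π →* ((Fin 2 → ZMod l) ≃ₗ[ZMod l] (Fin 2 → ZMod l))) (J : Type*) [MulAction π J] (γ : π)
    (f : J → Fin 2 → ZMod l) : twistedTranslateHom ρ J γ f = twistedTranslate ρ γ f := rfl

variable [NeZero l]

/-- A permutation of `T² × J` that translates the torus over `x ∈ J` by a torsion point `m x`. -/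
noncomputable def fibreTranslation (J : Type*) :
    Multiplicative (J → Fin 2 → ZMod l) →* Equiv.Perm ((Circle × Circle) × J) where
  toFun m :=
    { toFun := fun v => (torusTorsion l (.ofAdd (m.toAdd v.2)) * v.1, v.2)
      invFun := fun v => ((torusTorsion l (.ofAdd (m.toAdd v.2)))⁻¹ * v.1, v.2)
      left_inv := fun v => by simp
      right_inv := fun v => by simp }
  map_one' := by ext1 v; simp
  map_mul' a b := by ext1 v; simp [mul_assoc]

theorem fibreTranslation_apply (J : Type*) (m : J → Fin 2 → ZMod l) (v : (Circle × Circle) × J) :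
    fibreTranslation J (.ofAdd m) v = (torusTorsion l (.ofAdd (m v.2)) * v.1, v.2) := rfl

/-- A permutation of the torus and a group element acting on `J` act on `T² × J`. -/
def prodAction (π J : Type*) [Group π] [MulAction π J] :
    Equiv.Perm (Circle × Circle) × π →* Equiv.Perm ((Circle × Circle) × J) where
  toFun p := Equiv.prodCongr p.1 (MulAction.toPerm p.2)
  map_one' := Equiv.ext fun v => Prod.ext rfl (one_smul π v.2)
  map_mul' a b := Equiv.ext fun v => Prod.ext rfl (mul_smul a.2 b.2 v.2)

theorem prodAction_apply {π J : Type*} [Group π] [MulAction π J]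
    (p : Equiv.Perm (Circle × Circle) × π) (v : (Circle × Circle) × J) :
    prodAction π J p v = (p.1 v.1, p.2 • v.2) := rfl

/-- Lifts of the gluing maps of a torus bundle over the polygon to the `l`-th power covering
of the torus, after passing to an `l`-fold covering of the surface with set of sheets `J`. -/
theorem exists_edgeGluing_lift [TopologicalSpace X] [T2Space X] (hg : 1 ≤ g)
    {Ψ : Metric.closedBall (0 : ℂ) 1 × (Circle × Circle) → X} (hΨ : Continuous Ψ)
    (hinj : ∀ d, Function.Injective fun t => Ψ (d, t))
    (hglue : ∀ d d', PolygonGlue g d d' → range (fun t => Ψ (d, t)) = range fun t => Ψ (d', t)) :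
    ∃ (J : Type) (_ : TopologicalSpace J) (_ : DiscreteTopology J) (_ : Finite J)
      (Γ : EdgeGluing g ((Circle × Circle) × J)) (Δ : EdgeGluing g J), Nat.card J = l ∧
      (∀ j s v, (Γ.map j s v).2 = Δ.map j s v.2) ∧
      (∀ j < 4 * g, j % 4 < 2 → ∀ s v, Ψ (polygonSide g j s, v.1 ^ l) =
        Ψ (polygonSide g (j + 2) (unitInterval.symm s), (Γ.map j s v).1 ^ l)) ∧
      ∀ R : J → J → Prop, Equivalence R →
        (∀ j < 4 * g, j % 4 < 2 → ∀ x, ∃ s, R x (Δ.map j s x)) → ∀ x y, R x y := by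
  classical
  have hdata : ∀ j, ∃ (A K : unitInterval → Equiv.Perm (Circle × Circle))
      (θ : (Fin 2 → ZMod l) ≃ₗ[ZMod l] (Fin 2 → ZMod l)),
      (Continuous fun p : unitInterval × Circle × Circle => K p.1 p.2) ∧
      (∀ s z, K s z ^ l = A s (z ^ l)) ∧
      (∀ s m z, K s (torusTorsion l (.ofAdd m) * z) = torusTorsion l (.ofAdd (θ m)) * K s z) ∧
      (j < 4 * g → j % 4 < 2 → ∀ s t, Ψ (polygonSide g j s, t) =
        Ψ (polygonSide g (j + 2) (unitInterval.symm s), A s t)) ∧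
      (¬ (j < 4 * g ∧ j % 4 < 2) → θ = 1) := by
    intro j
    by_cases hj : j < 4 * g ∧ j % 4 < 2
    · have hran : ∀ s, range (fun t => Ψ (polygonSide g j s, t)) =
          range fun t => Ψ (polygonSide g (j + 2) (unitInterval.symm s), t) := by
        intro s
        apply hglue
        obtain ⟨k, rfl | rfl⟩ : ∃ k, j = 4 * k ∨ j = 4 * k + 1 := ⟨j / 4, by omega⟩
        · exact .a k (by omega) s
        · exact .b k (by omega) s
      have hA : ∀ s, ∃ A : Equiv.Perm (Circle × Circle), ∀ t, Ψ (polygonSide g j s, t) =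
          Ψ (polygonSide g (j + 2) (unitInterval.symm s), A t) := by
        intro s
        have h1 : ∀ t, ∃ u, Ψ (polygonSide g (j + 2) (unitInterval.symm s), u) =
            Ψ (polygonSide g j s, t) := by
          intro t
          have : Ψ (polygonSide g j s, t) ∈ range fun t => Ψ (polygonSide g j s, t) := ⟨t, rfl⟩
          rwa [hran] at this
        choose u hu using h1
        refine ⟨Equiv.ofBijective u ⟨fun t t' h => hinj (polygonSide g j s) ?_, fun v => ?_⟩,
          fun t => (hu t).symm⟩
        · exact (hu t).symm.trans ((congrArg (fun v =>
            Ψ (polygonSide g (j + 2) (unitInterval.symm s), v)) h).trans (hu t'))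
        · have : Ψ (polygonSide g (j + 2) (unitInterval.symm s), v) ∈ range fun t =>
              Ψ (polygonSide g (j + 2) (unitInterval.symm s), t) := ⟨v, rfl⟩
          rw [← hran] at this
          obtain ⟨t, ht⟩ := this
          exact ⟨t, hinj _ ((hu t).trans ht)⟩
      choose A hA using hA
      have hAc : Continuous fun p : unitInterval × Circle × Circle => A p.1 p.2 := by
        refine continuous_fibreCoordinate (f := fun p => Ψ (polygonSide g j p.1, p.2)) hΨ hinj
          (((continuous_polygonSide g (j + 2)).comp unitInterval.continuous_symm).comp
            continuous_fst) (hΨ.comp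
          (((continuous_polygonSide g j).comp continuous_fst).prodMk continuous_snd)) ?_
        exact fun p => (hA _ _).symm
      obtain ⟨K, hK, hKA⟩ := exists_torus_lift (l := l) hAc
      obtain ⟨θ, hθ⟩ := exists_torsion_conj hK hKA
      exact ⟨A, K, θ, hK, hKA, hθ, fun _ _ => hA, fun h => absurd hj h⟩
    · exact ⟨fun _ => 1, fun _ => 1, 1, continuous_snd, fun _ _ => rfl, fun _ _ _ => rfl,
        fun h h' => absurd ⟨h, h'⟩ hj, fun _ => rfl⟩
  choose A K θ hK hKA hθ hA hθ1 using hdata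
  -- the surface group is replaced by the free group on the pairs of sides
  let π := FreeGroup (Fin g × Bool)
  let idx : Fin g × Bool → ℕ := fun p => 4 * p.1 + if p.2 then 0 else 1
  let gen : ℕ → π := fun j => if h : j < 4 * g ∧ j % 4 < 2 then
    FreeGroup.of (⟨j / 4, by omega⟩, decide (j % 4 = 0)) else 1
  have hgen : ∀ p, gen (idx p) = FreeGroup.of p := by
    rintro ⟨i, c⟩
    have hi := i.2
    have h : idx (i, c) < 4 * g ∧ idx (i, c) % 4 < 2 := by
      cases c <;> simp only [idx, if_true] <;> constructor <;> norm_num <;> omega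
    have h4 : idx (i, c) / 4 = i := by
      cases c <;> simp only [idx, if_true] <;> norm_num <;> omega
    simp only [gen, dif_pos h]
    congr 1
    refine Prod.ext (Fin.ext h4) ?_
    cases c
    · simp [idx, Nat.add_mod]
    · simp [idx]
  let ρ : π →* ((Fin 2 → ZMod l) ≃ₗ[ZMod l] (Fin 2 → ZMod l)) := FreeGroup.lift fun p => θ (idx p)
  have hidx : ∀ j, j < 4 * g ∧ j % 4 < 2 → ∃ p, idx p = j := by
    rintro j ⟨h1, h2⟩
    refine ⟨(⟨j / 4, by omega⟩, decide (j % 4 = 0)), ?_⟩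
    by_cases h : j % 4 = 0 <;> simp only [idx, h] <;> norm_num <;> omega
  have hρ : ∀ j, ρ (gen j) = θ j := by
    intro j
    by_cases h : j < 4 * g ∧ j % 4 < 2
    · obtain ⟨p, rfl⟩ := hidx j h
      rw [hgen]
      exact FreeGroup.lift_apply_of
    · simp only [gen, dif_neg h, map_one]
      exact (hθ1 j h).symm
  let ψ : π →* Multiplicative (ℤ × ℤ) := FreeGroup.lift fun p =>
    .ofAdd (if p.2 then (1, 0) else (0, 1))
  have hψ : Function.Surjective ψ := by
    intro v
    let i : Fin g := ⟨0, hg⟩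
    refine ⟨FreeGroup.of (i, true) ^ v.toAdd.1 * FreeGroup.of (i, false) ^ v.toAdd.2, ?_⟩
    have hof : ∀ p, ψ (FreeGroup.of p) = .ofAdd (if p.2 then (1, 0) else (0, 1)) :=
      fun p => FreeGroup.lift_apply_of
    rw [map_mul, map_zpow, map_zpow, hof, hof]
    refine Multiplicative.toAdd.injective ?_
    simp
  obtain ⟨H, hcomm, hindex, hH⟩ := exists_subgroup_const_mem ρ ψ hψ
  let J := π ⧸ H
  have : Finite J := by
    have : H.index ≠ 0 := hindex ▸ NeZero.ne l
    have : H.FiniteIndex := ⟨this⟩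
    exact Subgroup.finite_quotient_of_finiteIndex
  let _ : TopologicalSpace J := ⊥
  have : DiscreteTopology J := ⟨rfl⟩
  have htriv : ∀ c ∈ commutator π, ∀ x : J, c • x = x := by
    intro c hc x
    obtain ⟨y, rfl⟩ := QuotientGroup.mk_surjective x
    change ((c * y : π) : π ⧸ H) = (y : π ⧸ H)
    refine (QuotientGroup.eq.mpr ?_).symm
    have h := (inferInstance : (commutator π).Normal).conj_mem c hc y⁻¹
    rw [inv_inv] at h
    rw [← mul_assoc]
    exact hcomm h
  -- the lifted gluing maps
  let U : ℕ → unitInterval → Equiv.Perm ((Circle × Circle) × J) := fun j s =>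
    prodAction π J (K j s, gen j)
  have hU : ∀ j s (m : J → Fin 2 → ZMod l), U j s * fibreTranslation J (.ofAdd m) =
      fibreTranslation J (.ofAdd (twistedTranslateHom ρ J (gen j) m)) * U j s := by
    intro j s m
    ext1 v
    simp only [U, Equiv.Perm.mul_apply, fibreTranslation_apply, prodAction_apply, hθ,
      twistedTranslateHom_apply, twistedTranslate, inv_smul_smul, hρ]
  have hpair : ∃ e, handleProd (fun k => K (4 * k) 0) (fun k => K (4 * k) 1)
      (fun k => K (4 * k + 1) 0) (fun k => K (4 * k + 1) 1) g =
      MulAction.toPerm (torusTorsion l e) := by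
    let S : Subgroup (Equiv.Perm (Circle × Circle) × Equiv.Perm (Circle × Circle)) :=
      { carrier := {p | Continuous p.1 ∧ ∀ z, p.1 z ^ l = p.2 (z ^ l)}
        mul_mem' := fun {a b} ha hb => ⟨ha.1.comp hb.1, fun z => (ha.2 _).trans
          (congrArg a.2 (hb.2 z))⟩
        one_mem' := ⟨continuous_id, fun z => rfl⟩
        inv_mem' := fun {a} ha => ⟨EdgeGluing.continuous_perm_inv ha.1, fun z => by
          have := ha.2 (a.1.symm z)
          rw [Equiv.apply_symm_apply] at this
          change a.1.symm z ^ l = a.2.symm (z ^ l)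
          rw [this, Equiv.symm_apply_apply]⟩ }
    have hmem : ∀ j s, (K j s, A j s) ∈ S := fun j s =>
      ⟨(hK j).comp (.prodMk_right s), hKA j s⟩
    have hprod := handleProd_mem S (fun k => hmem (4 * k) 0) (fun k => hmem (4 * k) 1)
      (fun k => hmem (4 * k + 1) 0) (fun k => hmem (4 * k + 1) 1) g
    have h1 := map_handleProd (MonoidHom.fst _ _) (fun k => (K (4 * k) 0, A (4 * k) 0))
      (fun k => (K (4 * k) 1, A (4 * k) 1)) (fun k => (K (4 * k + 1) 0, A (4 * k + 1) 0))
      (fun k => (K (4 * k + 1) 1, A (4 * k + 1) 1)) g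
    have h2 := map_handleProd (MonoidHom.snd _ _) (fun k => (K (4 * k) 0, A (4 * k) 0))
      (fun k => (K (4 * k) 1, A (4 * k) 1)) (fun k => (K (4 * k + 1) 0, A (4 * k + 1) 0))
      (fun k => (K (4 * k + 1) 1, A (4 * k + 1) 1)) g
    have h3 := handleProd_gluing_eq_one hg hinj hA
    obtain ⟨hc, hp⟩ := hprod
    change Continuous
      (MonoidHom.fst (Equiv.Perm (Circle × Circle)) (Equiv.Perm (Circle × Circle)) _ :
      Equiv.Perm (Circle × Circle)) at hc
    rw [h1] at hc
    have hp' : ∀ z : Circle × Circle, (MonoidHom.fst _ _ _ : Equiv.Perm (Circle × Circle)) z ^ l =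
      (MonoidHom.snd _ _ _ : Equiv.Perm (Circle × Circle)) (z ^ l) := hp
    rw [h1, h2] at hp'
    have h2' : handleProd ((MonoidHom.snd _ _) ∘ fun k => (K (4 * k) 0, A (4 * k) 0))
      ((MonoidHom.snd _ _) ∘ fun k => (K (4 * k) 1, A (4 * k) 1))
      ((MonoidHom.snd _ _) ∘ fun k => (K (4 * k + 1) 0, A (4 * k + 1) 0))
      ((MonoidHom.snd _ _) ∘ fun k => (K (4 * k + 1) 1, A (4 * k + 1) 1)) g = 1 := h3
    rw [h2'] at hp'
    obtain ⟨m, hm⟩ := exists_eq_torusTorsion_mul (l := l) hc continuous_id hp'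
    exact ⟨m, Equiv.ext hm⟩
  obtain ⟨e, he⟩ := hpair
  have hε : handleProd (fun k => U (4 * k) 0) (fun k => U (4 * k) 1)
      (fun k => U (4 * k + 1) 0) (fun k => U (4 * k + 1) 1) g =
      fibreTranslation J (.ofAdd fun _ => e.toAdd) := by
    have h1 := map_handleProd (MonoidHom.fst _ _) (fun k => (K (4 * k) 0, gen (4 * k)))
      (fun k => (K (4 * k) 1, gen (4 * k))) (fun k => (K (4 * k + 1) 0, gen (4 * k + 1)))
      (fun k => (K (4 * k + 1) 1, gen (4 * k + 1))) g
    have h2 := map_handleProd (MonoidHom.snd _ _) (fun k => (K (4 * k) 0, gen (4 * k)))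
      (fun k => (K (4 * k) 1, gen (4 * k))) (fun k => (K (4 * k + 1) 0, gen (4 * k + 1)))
      (fun k => (K (4 * k + 1) 1, gen (4 * k + 1))) g
    have h3 := map_handleProd (prodAction π J) (fun k => (K (4 * k) 0, gen (4 * k)))
      (fun k => (K (4 * k) 1, gen (4 * k))) (fun k => (K (4 * k + 1) 0, gen (4 * k + 1)))
      (fun k => (K (4 * k + 1) 1, gen (4 * k + 1))) g
    refine h3.symm.trans ?_
    ext1 v
    rw [prodAction_apply, fibreTranslation_apply]
    refine Prod.ext ?_ ?_
    · change (MonoidHom.fst _ _ _ : Equiv.Perm (Circle × Circle)) v.1 = _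
      rw [h1]
      exact congrArg (fun p => p v.1) he
    · change (MonoidHom.snd _ _ _ : π) • v.2 = _
      rw [h2]
      exact htriv _ (handleProd_mem_commutator (fun k => gen (4 * k))
        (fun k => gen (4 * k + 1)) g) _
  obtain ⟨α, β, hαβ⟩ := exists_twist_handleProd_eq_one (R := ZMod l) (fibreTranslation J)
    (θu := fun k => twistedTranslateHom ρ J (gen (4 * k)))
    (θw := fun k => twistedTranslateHom ρ J (gen (4 * k + 1)))
    (fun k => hU (4 * k) 0) (fun k => hU (4 * k) 1) (fun k => hU (4 * k + 1) 0)
    (fun k => hU (4 * k + 1) 1) g _ hε (by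
      intro N hN
      refine hH N ?_ _
      have hall : ∀ γ, γ ∈ (trivialModulo (R := ZMod l) N).comap (twistedTranslateHom ρ J) := by
        intro γ
        have hof : ∀ p, FreeGroup.of p ∈
            (trivialModulo (R := ZMod l) N).comap (twistedTranslateHom ρ J) := by
          rintro ⟨i, c⟩
          rw [← hgen]
          have := hN i i.2
          cases c
          · exact this.2
          · exact this.1
        induction γ using FreeGroup.induction_on with
        | C1 => exact one_mem _
        | of p => exact hof p
        | inv_of p _ => exact inv_mem (hof p)
        | mul a b ha hb => exact mul_mem ha hb
      exact fun γ f => hall γ f)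
  let δ : ℕ → J → Fin 2 → ZMod l := fun j => if j % 4 = 0 then α (j / 4) else β (j / 4)
  have hδ0 : ∀ k, δ (4 * k) = α k := fun k => by simp [δ]
  have hδ1 : ∀ k, δ (4 * k + 1) = β k := fun k => by
    have h1 : (4 * k + 1) % 4 = 1 := by omega
    have h2 : (4 * k + 1) / 4 = k := by omega
    simp only [δ, h1, h2]
    simp
  have hdisc : ∀ f : J → Circle × Circle, Continuous f := fun f => continuous_of_discreteTopology
  have hdisc' : ∀ f : J → J, Continuous f := fun f => continuous_of_discreteTopology
  refine ⟨J, inferInstance, inferInstance, inferInstance,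
    ⟨fun j s => U j s * fibreTranslation J (.ofAdd (δ j)), fun j => ?_, ?_⟩,
    ⟨fun j s => MulAction.toPerm (gen j), fun j => ?_, ?_⟩, hindex, ?_, ?_, ?_⟩
  · change Continuous fun p : unitInterval × (Circle × Circle) × J =>
      (K j p.1 (torusTorsion l (.ofAdd (δ j p.2.2)) * p.2.1), gen j • p.2.2)
    refine Continuous.prodMk ((hK j).comp (continuous_fst.prodMk (Continuous.mul ?_ (by fun_prop))))
      ((hdisc' fun x => gen j • x).comp (by fun_prop))
    exact (hdisc fun x => torusTorsion l (.ofAdd (δ j x))).comp (by fun_prop)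
  · simpa only [hδ0, hδ1] using hαβ
  · exact (hdisc' fun x => gen j • x).comp continuous_snd
  · have h := map_handleProd (MulAction.toPermHom π J) (fun k => gen (4 * k))
      (fun k => gen (4 * k)) (fun k => gen (4 * k + 1)) (fun k => gen (4 * k + 1)) g
    refine h.symm.trans ?_
    ext1 x
    exact htriv _ (handleProd_mem_commutator _ _ g) x
  · exact fun j s v => rfl
  · intro j hj hj4 s v
    change _ = Ψ (_, (K j s (torusTorsion l (.ofAdd (δ j v.2)) * v.1)) ^ l)
    rw [hKA, mul_pow, torusTorsion_pow, one_mul]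
    exact hA j hj hj4 s _
  · intro R hR hstep x y
    have hall : ∀ (γ : π) (x : J), R x (γ • x) := by
      intro γ
      have hof : ∀ (p : Fin g × Bool) (x : J), R x ((FreeGroup.of p : π) • x) := by
        intro p x
        have h : idx p < 4 * g ∧ idx p % 4 < 2 := by
          obtain ⟨i, c⟩ := p
          have hi := i.2
          cases c <;> simp only [idx, if_true] <;> constructor <;> norm_num <;> omega
        obtain ⟨s, hs⟩ := hstep (idx p) h.1 h.2 x
        rwa [← hgen]
      induction γ using FreeGroup.induction_on with
      | C1 => intro x; rw [one_smul]; exact hR.refl x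
      | of p => exact hof p
      | inv_of p _ =>
        intro x
        have := hof p ((FreeGroup.of p : π)⁻¹ • x)
        rw [smul_inv_smul] at this
        exact hR.symm this
      | mul a b ha hb =>
        intro x
        rw [mul_smul]
        exact hR.trans (hb x) (ha _)
    obtain ⟨γ, rfl⟩ := MulAction.exists_smul_eq π x y
    exact hall γ x

end SurfaceBundle

section SurfaceBundle

instance compactSpace_disk : CompactSpace (Metric.closedBall (0 : ℂ) 1) :=
  isCompact_iff_compactSpace.mp (isCompact_closedBall 0 1)

instance connectedSpace_disk : ConnectedSpace (Metric.closedBall (0 : ℂ) 1) :=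
  Subtype.connectedSpace ((convex_closedBall 0 1).isConnected ⟨0, by simp⟩)

theorem isOpenMap_circle_pow {l : ℕ} (hl : l ≠ 0) : IsOpenMap fun z : Circle => z ^ l := by
  have hl' : (l : ℝ) ≠ 0 := by exact_mod_cast hl
  intro U hU
  have : (fun z : Circle => z ^ l) '' U =
      Circle.exp '' ((fun x : ℝ => l * x) '' (Circle.exp ⁻¹' U)) := by
    rw [image_image]
    simp only [Circle.exp_natCast_mul]
    rw [← image_image (fun z : Circle => z ^ l) Circle.exp,
      image_preimage_eq _ Circle.exp_surjective]
  rw [this]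
  exact isLocalHomeomorph_circleExp.isOpenMap _
    ((Homeomorph.mulLeft₀ (l : ℝ) hl').isOpenMap _ (hU.preimage Circle.exp.continuous))

theorem isOpenMap_torus_pow {l : ℕ} (hl : l ≠ 0) : IsOpenMap fun z : Circle × Circle => z ^ l :=
  (isOpenMap_circle_pow hl).prodMap (isOpenMap_circle_pow hl)

theorem encard_torus_pow_fibre {l : ℕ} [NeZero l] (t : Circle × Circle) :
    {z : Circle × Circle | z ^ l = t}.encard = l ^ 2 := by
  obtain ⟨z₀, rfl⟩ := torus_pow_surjective (l := l) t
  have : {z : Circle × Circle | z ^ l = z₀ ^ l} =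
      range fun m : Multiplicative (Fin 2 → ZMod l) => torusTorsion l m * z₀ := by
    ext z
    rw [mem_ofPred_eq, torus_pow_eq_pow_iff]
    exact exists_congr fun a => eq_comm
  rw [this, ← image_univ, InjOn.encard_image, encard_univ]
  · rw [ENat.card_eq_coe_natCard, Nat.card_congr Multiplicative.toAdd, Nat.card_fun]
    simp
  · exact (fun a _ b _ h => injective_torusTorsion (mul_right_cancel h))

/-- For every `l ≥ 1` a torus bundle over a closed orientable surface of positive genus has a
connected `l³`-fold covering that lies over an `l`-fold covering `Ft` of the surface and restricts
to the `l`-th power map of the torus on every fibre. -/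
theorem exists_torusBundle_covering {F X : Type*} [TopologicalSpace F] [T2Space F]
    [TopologicalSpace X] [T2Space X] {g : ℕ} (hg : 1 ≤ g) (e : F ≃ₜ GenusSurface g) {π : X → F}
    (hπ : LocallyTrivial (Circle × Circle) π) (l : ℕ) [NeZero l] :
    ∃ (Xt Ft : Type) (_ : TopologicalSpace Xt) (_ : TopologicalSpace Ft) (P : Xt → X)
      (p : Ft → F) (ϖ : Xt → Ft), CompactSpace Xt ∧ T2Space Xt ∧ ConnectedSpace Xt ∧
      CompactSpace Ft ∧ T2Space Ft ∧ ConnectedSpace Ft ∧ IsCoveringMap P ∧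
      (∀ x, (P ⁻¹' {x}).encard = (l ^ 3 : ℕ)) ∧ IsCoveringMap p ∧
      (∀ x, (p ⁻¹' {x}).encard = l) ∧ Continuous ϖ ∧ (∀ y, p (ϖ y) = π (P y)) ∧
      ∀ (b : F) (f : Circle × Circle → X), Continuous f → Function.Injective f →
        range f = π ⁻¹' {b} → ∀ y ∈ p ⁻¹' {b}, ∃ Θ : Circle × Circle → Xt, Continuous Θ ∧
          Function.Injective Θ ∧ range Θ = ϖ ⁻¹' {y} ∧ ∀ z, P (Θ z) = f (z ^ l) := by
  have hl : l ≠ 0 := NeZero.ne l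
  let q : Metric.closedBall (0 : ℂ) 1 → F := fun d => e.symm (Quot.mk _ d)
  have hq : Continuous q := e.symm.continuous.comp continuous_quot_mk
  have hqs : Function.Surjective q := e.symm.surjective.comp Quot.mk_surjective
  have hqeq : ∀ d d', q d = q d' → Relation.EqvGen (PolygonGlue g) d d' := fun d d' h =>
    Quot.eqvGen_exact (e.symm.injective h)
  obtain ⟨Ψ, hΨ, hΨf⟩ := hπ.trivialOver_disk hq
  have hΨc : Continuous Ψ := by rwa [univ_prod_univ, continuousOn_univ] at hΨ
  have hinj : ∀ d, Function.Injective fun t => Ψ (d, t) := fun d => (hΨf d trivial).1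
  have hran : ∀ d, range (fun t => Ψ (d, t)) = π ⁻¹' {q d} := fun d => (hΨf d trivial).2
  have hπΨ : ∀ d t, π (Ψ (d, t)) = q d := fun d t => by
    have : Ψ (d, t) ∈ π ⁻¹' {q d} := hran d ▸ ⟨t, rfl⟩
    exact this
  have hΨs : Function.Surjective Ψ := by
    intro x
    obtain ⟨d, hd⟩ := hqs (π x)
    have : x ∈ range fun t => Ψ (d, t) := by rw [hran, hd]; rfl
    obtain ⟨t, ht⟩ := this
    exact ⟨(d, t), ht⟩
  have hglue : ∀ d d', PolygonGlue g d d' → q d = q d' := fun d d' h =>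
    congrArg e.symm (Quot.sound h)
  obtain ⟨J, _, _, _, Γ, Δ, hcard, hΓΔ, hΓ, htrans⟩ := exists_edgeGluing_lift (l := l) hg hΨc hinj
    fun d d' h => by rw [hran, hran, hglue d d' h]
  have hJ : (univ : Set J).encard = l := by
    rw [encard_univ, ENat.card_eq_coe_natCard, hcard]
  let pr : Metric.closedBall (0 : ℂ) 1 × (Circle × Circle) × J →
      Metric.closedBall (0 : ℂ) 1 × Circle × Circle := fun v => (v.1, v.2.1 ^ l)
  have hprc : Continuous pr := by fun_prop
  have hpro : IsOpenMap pr :=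
    IsOpenMap.id.prodMap ((isOpenMap_torus_pow hl).comp isOpenMap_fst)
  have hprcard : ∀ t, (pr ⁻¹' {t}).encard = (l ^ 3 : ℕ) := by
    rintro ⟨d, t⟩
    have : pr ⁻¹' {(d, t)} = {d} ×ˢ ({z : Circle × Circle | z ^ l = t} ×ˢ (univ : Set J)) := by
      ext ⟨d', z, x⟩
      simp [pr]
    rw [this, encard_prod, encard_prod, encard_torus_pow_fibre, hJ, encard_singleton, one_mul]
    push_cast
    ring
  have hS : ∀ a b, Γ.Rel a b → Ψ (pr a) = Ψ (pr b) := fun a b h =>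
    Γ.rel_induction hg (C := fun a b => Ψ (pr a) = Ψ (pr b)) (fun _ => rfl)
      (fun _ _ h => h.symm) (fun _ _ _ h h' => h.trans h') (by
        rintro ⟨d, v⟩ ⟨d', v'⟩ ⟨j, hj, hj4, s, -, h1, h2, h3⟩
        simp only at h1 h2 h3
        subst h1 h2 h3
        exact hΓ j hj hj4 s v) h
  have hex : ∀ a e, Ψ (pr a) = Ψ e → ∃ b, Γ.Rel a b ∧ pr b = e := by
    rintro ⟨d, v⟩ ⟨d', t⟩ h
    have hd : q d = q d' := by rw [← hπΨ d (v.1 ^ l), ← hπΨ d' t]; exact congrArg π h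
    obtain ⟨v', hv'⟩ := Γ.exists_rel_of_eqvGen hg (hqeq d d' hd) v
    refine ⟨(d', v'), hv', Prod.ext rfl (hinj d' ?_)⟩
    exact (hS _ _ hv').symm.trans h
  obtain ⟨hPcov, hPcard⟩ := quotient_isCoveringMap (Γ.setoid hg) Γ.isClosed_rel hprc hpro hΨc hΨs
    (l ^ 3) hprcard hS (fun a b h h' => Γ.rel_unique hg h (congrArg Prod.fst h' : _)) hex
  have hS' : ∀ a b, Δ.Rel a b → q a.1 = q b.1 := fun a b h =>
    Δ.rel_induction hg (C := fun a b => q a.1 = q b.1) (fun _ => rfl)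
      (fun _ _ h => h.symm) (fun _ _ _ h h' => h.trans h') (by
        rintro ⟨d, v⟩ ⟨d', v'⟩ ⟨j, hj, hj4, s, -, h1, h2, h3⟩
        simp only at h1 h2
        subst h1 h2
        rw [← hπΨ _ 1, ← hπΨ (polygonSide g (j + 2) (unitInterval.symm s))]
        obtain ⟨x⟩ : Nonempty J := ⟨v⟩
        have := hΓ j hj hj4 s (1, v)
        rw [one_pow] at this
        rw [this]) h
  have hex' : ∀ (a : Metric.closedBall (0 : ℂ) 1 × J) (e : Metric.closedBall (0 : ℂ) 1),
      q a.1 = q e → ∃ b, Δ.Rel a b ∧ b.1 = e := by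
    rintro ⟨d, v⟩ d' h
    obtain ⟨v', hv'⟩ := Δ.exists_rel_of_eqvGen hg (hqeq d d' h) v
    exact ⟨(d', v'), hv', rfl⟩
  obtain ⟨hpcov, hpcard⟩ := quotient_isCoveringMap (Δ.setoid hg) Δ.isClosed_rel
    (pr := Prod.fst) continuous_fst isOpenMap_fst hq hqs l (fun d => by
      have : (Prod.fst ⁻¹' {d} : Set (Metric.closedBall (0 : ℂ) 1 × J)) = {d} ×ˢ univ := by
        ext ⟨d', x⟩; simp
      rw [this, encard_prod, hJ, encard_singleton, one_mul]) hS'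
    (fun a b h h' => Δ.rel_unique hg h h') hex'
  have hΓΔrel : ∀ a b, Γ.Rel a b → Δ.Rel (a.1, a.2.2) (b.1, b.2.2) := fun a b h =>
    Γ.rel_induction hg (C := fun a b => Δ.Rel (a.1, a.2.2) (b.1, b.2.2)) (fun _ => .inl rfl)
      (fun _ _ h => Δ.rel_symm h) (fun _ _ _ h h' => Δ.rel_trans hg h h') (by
        rintro ⟨d, v⟩ ⟨d', v'⟩ ⟨j, hj, hj4, s, -, h1, h2, h3⟩
        refine .inr (.inl ⟨j, hj, hj4, s, trivial, h1, h2, ?_⟩)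
        simp only at h3
        subst h3
        exact hΓΔ j s v) h
  let ϖ : Quotient (Γ.setoid hg) → Quotient (Δ.setoid hg) :=
    Quotient.map (fun a => (a.1, a.2.2)) hΓΔrel
  have hϖ : Continuous ϖ := 
    Continuous.quotient_lift (s := Γ.setoid hg)
      (f := fun a => Quotient.mk (Δ.setoid hg) (a.1, a.2.2))
      (continuous_quotient_mk'.comp (by fun_prop)) fun a b h => Quotient.sound (hΓΔrel a b h)
  have hϖs : Function.Surjective ϖ := by
    intro y
    obtain ⟨⟨d, x⟩, rfl⟩ := Quotient.exists_rep y
    exact ⟨Quotient.mk _ (d, 1, x), rfl⟩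
  have hne : Nonempty J := by
    rw [← not_isEmpty_iff]
    intro h
    rw [Nat.card_of_isEmpty] at hcard
    exact hl hcard.symm
  have hconn : ConnectedSpace (Quotient (Γ.setoid hg)) := by
    obtain ⟨x₀⟩ := hne
    let c : J → Quotient (Γ.setoid hg) := fun x => Quotient.mk _ (0, 1, x)
    have hc : ∀ x d z, (Quotient.mk _ (d, z, x) : Quotient (Γ.setoid hg)) ∈
        connectedComponent (c x) := by
      intro x d z
      have h1 : IsPreconnected (range fun p : Metric.closedBall (0 : ℂ) 1 × Circle × Circle =>
          (Quotient.mk _ (p.1, p.2, x) : Quotient (Γ.setoid hg))) :=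
        isPreconnected_range (continuous_quotient_mk'.comp (by fun_prop))
      exact h1.subset_connectedComponent ⟨(0, 1), rfl⟩ ⟨(d, z), rfl⟩
    have hall : ∀ x y, connectedComponent (c x) = connectedComponent (c y) := by
      refine htrans _ ⟨fun _ => rfl, Eq.symm, Eq.trans⟩ fun j hj hj4 x => ⟨0, ?_⟩
      have h1 := hc x (polygonSide g j 0) 1
      have h2 := hc (Δ.map j 0 x) (polygonSide g (j + 2) (unitInterval.symm 0)) (Γ.map j 0 (1, x)).1
      have h3 : (Quotient.mk _ (polygonSide g j 0, 1, x) : Quotient (Γ.setoid hg)) =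
          Quotient.mk _ (polygonSide g (j + 2) (unitInterval.symm 0), (Γ.map j 0 (1, x)).1,
            Δ.map j 0 x) :=
        Quotient.sound (.inr (.inl ⟨j, hj, hj4, 0, trivial, rfl, rfl,
          Prod.ext rfl (hΓΔ j 0 (1, x)).symm⟩))
      rw [h3] at h1
      exact (connectedComponent_eq h1).trans (connectedComponent_eq h2).symm
    refine connectedSpace_iff_connectedComponent.mpr ⟨c x₀, eq_univ_of_forall fun y => ?_⟩
    obtain ⟨⟨d, z, x⟩, rfl⟩ := Quotient.exists_rep y
    rw [hall x₀ x]
    exact hc x d z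
  have hpϖ : ∀ y, (Quotient.lift (fun a => q a.1) hS' : Quotient (Δ.setoid hg) → F) (ϖ y) =
      π ((Quotient.lift (fun a => Ψ (pr a)) hS : Quotient (Γ.setoid hg) → X) y) := by
    intro y
    obtain ⟨⟨d, z, x⟩, rfl⟩ := Quotient.exists_rep y
    exact (hπΨ _ _).symm
  refine ⟨Quotient (Γ.setoid hg), Quotient (Δ.setoid hg), inferInstance, inferInstance, _, _, ϖ,
    inferInstance, t2Space_quotient_of_isClosed _ Γ.isClosed_rel, hconn, inferInstance,
    t2Space_quotient_of_isClosed _ Δ.isClosed_rel, hϖs.connectedSpace hϖ, hPcov, hPcard, hpcov,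
    hpcard, hϖ, hpϖ, ?_⟩
  intro b f hf hfinj hfran y hy
  obtain ⟨d, rfl⟩ := hqs b
  obtain ⟨⟨d', x'⟩, rfl⟩ := Quotient.exists_rep y
  obtain ⟨⟨d'', x⟩, hrel, rfl⟩ := hex' (d', x') d hy
  have hΔ : (Quotient.mk _ (d', x') : Quotient (Δ.setoid hg)) = Quotient.mk _ (d'', x) :=
    Quotient.sound hrel
  -- the homeomorphism of the torus that compares `f` with the trivialization
  have hk : ∀ z, ∃ u, Ψ (d'', u) = f z := by
    intro z
    have : f z ∈ range f := ⟨z, rfl⟩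
    rwa [hfran, ← hran] at this
  choose k hk using hk
  have hkbij : Function.Bijective k := by
    constructor
    · intro z z' h
      exact hfinj ((hk z).symm.trans ((congrArg (fun u => Ψ (d'', u)) h).trans (hk z')))
    · intro u
      have : Ψ (d'', u) ∈ range fun t => Ψ (d'', t) := ⟨u, rfl⟩
      rw [hran, ← hfran] at this
      obtain ⟨z, hz⟩ := this
      exact ⟨z, hinj d'' ((hk z).trans hz)⟩
  have hkc : Continuous k := continuous_fibreCoordinate hΨc hinj
    (continuous_const (y := d'')) hf hk
  obtain ⟨K, hK, hKk⟩ := exists_torus_lift (l := l)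
    (H := fun _ => Equiv.ofBijective k hkbij) (hkc.comp continuous_snd)
  have hK0 : Continuous (K 0) := hK.comp (.prodMk_right 0)
  have hϖmem : ∀ z, ϖ (Quotient.mk _ (d'', K 0 z, x)) = Quotient.mk _ (d', x') :=
    fun z => hΔ.symm
  refine ⟨fun z => Quotient.mk _ (d'', K 0 z, x), continuous_quotient_mk'.comp (by fun_prop), ?_,
    ?_, ?_⟩
  · intro z z' h
    have := Γ.rel_unique hg (Quotient.exact h) rfl
    simpa using this
  · ext y
    constructor
    · rintro ⟨z, rfl⟩
      exact hϖmem z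
    · intro h
      obtain ⟨⟨d₁, z₁, x₁⟩, rfl⟩ := Quotient.exists_rep y
      have h1 : Δ.Rel (d₁, x₁) (d'', x) := Quotient.exact (s := Δ.setoid hg) (Eq.trans h hΔ)
      have hd : q d₁ = q d'' := hS' _ _ h1
      obtain ⟨⟨z₂, x₂⟩, hv⟩ := Γ.exists_rel_of_eqvGen hg (hqeq d₁ d'' hd) (z₁, x₁)
      have h2 := Δ.rel_trans hg (Δ.rel_symm (hΓΔrel _ _ hv)) h1
      have h3 := Δ.rel_unique hg h2 rfl
      simp only [Prod.mk.injEq, true_and] at h3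
      subst h3
      refine ⟨(K 0).symm z₂, ?_⟩
      simp only [Equiv.apply_symm_apply]
      exact (Quotient.sound (s := Γ.setoid hg) hv).symm
  · intro z
    change Ψ (d'', (K 0 z) ^ l) = f (z ^ l)
    rw [hKk]
    exact hk _

end SurfaceBundle

/-! ### Coverings, tubes and preimages of knots -/

section Coverings

open Topology

/-- Removing a closed set does not disconnect a connected open set if it does not disconnect some
open neighbourhood of the closed set. -/
theorem isPreconnected_diff_of_subset {M : Type*} [TopologicalSpace M] {S U C : Set M}
    (hS : IsPreconnected S) (hSo : IsOpen S) (hU : IsOpen U) (hC : IsClosed C) (hUS : U ⊆ S)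
    (hCU : C ⊆ U) (hUC : IsPreconnected (U \ C)) :
    IsPreconnected (S \ C) := by
  rw [isPreconnected_iff_subset_of_disjoint]
  intro A B hA hB hAB hdisj
  have key : ∀ A B : Set M, IsOpen A → IsOpen B → S \ C ⊆ A ∪ B → (S \ C) ∩ (A ∩ B) = ∅ →
      U \ C ⊆ A → S \ C ⊆ A ∨ S \ C ⊆ B := by
    intro A B hA hB hAB hdisj hUA
    have hA' : IsOpen ((A ∩ S) ∪ U) := (hA.inter hSo).union hU
    have hB' : IsOpen ((B ∩ S) \ C) := (hB.inter hSo).sdiff hC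
    have hd : ∀ x ∈ S, x ∈ A → x ∈ B → x ∉ C → False := fun x hxS hxA hxB hxC => by
      have : x ∈ (S \ C) ∩ (A ∩ B) := ⟨⟨hxS, hxC⟩, hxA, hxB⟩
      rw [hdisj] at this
      exact this
    have h := isPreconnected_iff_subset_of_disjoint.mp hS _ _ hA' hB' ?_ ?_
    · rcases h with h | h
      · left
        rintro x ⟨hxS, hxC⟩
        rcases h hxS with h1 | h1
        · exact h1.1
        · exact hUA ⟨h1, hxC⟩
      · right
        exact fun x hx => (h hx.1).1.1
    · intro x hx
      by_cases hxC : x ∈ C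
      · exact .inl (.inr (hCU hxC))
      · rcases hAB ⟨hx, hxC⟩ with h1 | h1
        · exact .inl (.inl ⟨h1, hx⟩)
        · exact .inr ⟨⟨h1, hx⟩, hxC⟩
    · rw [eq_empty_iff_forall_notMem]
      rintro x ⟨hxS, h1 | h1, ⟨hxB, -⟩, hxC⟩
      · exact hd x hxS h1.1 hxB hxC
      · exact hd x hxS (hUA ⟨h1, hxC⟩) hxB hxC
  have hUAB : U \ C ⊆ A ∪ B := (sdiff_subset_sdiff_left hUS).trans hAB
  rcases isPreconnected_iff_subset_of_disjoint.mp hUC A B hA hB hUAB (by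
    rw [eq_empty_iff_forall_notMem] at hdisj ⊢
    exact fun x hx => hdisj x ⟨⟨hUS hx.1.1, hx.1.2⟩, hx.2⟩) with h | h
  · exact key A B hA hB hAB hdisj h
  · exact (key B A hB hA (by rwa [union_comm]) (by rwa [inter_comm B]) h).symm

/-- A covering of a compact space with finite fibres has compact total space. -/
theorem IsCoveringMap.compactSpace_of_finite {E M : Type*} [TopologicalSpace E] [TopologicalSpace M]
    [CompactSpace M] {p : E → M} (hp : IsCoveringMap p) (hfin : ∀ x, (p ⁻¹' {x}).Finite) :
    CompactSpace E := by
  refine ⟨isCompact_iff_ultrafilter_le_nhds.mpr fun 𝒰 _ => ?_⟩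
  obtain ⟨x, -, hx⟩ := isCompact_iff_ultrafilter_le_nhds.mp (isCompact_univ (X := M)) (𝒰.map p)
    (by simp)
  obtain ⟨hdisc, U, hxU, hU, hpU, H, hH⟩ := hp x
  have hUm : p ⁻¹' U ∈ 𝒰 := hx (hU.mem_nhds hxU)
  have : Finite (p ⁻¹' {x}) := hfin x
  -- one of the finitely many sheets belongs to the ultrafilter
  have hcov : p ⁻¹' U = ⋃ i : p ⁻¹' {x}, {e | ∃ h : e ∈ p ⁻¹' U, (H ⟨e, h⟩).2 = i} := by
    ext e
    simp only [mem_iUnion, mem_ofPred_eq]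
    exact ⟨fun h => ⟨_, h, rfl⟩, fun ⟨_, h, _⟩ => h⟩
  rw [hcov, ← biUnion_univ, Ultrafilter.finite_biUnion_mem_iff finite_univ] at hUm
  obtain ⟨i, -, hi⟩ := hUm
  refine ⟨H.symm (⟨x, hxU⟩, i), trivial, ?_⟩
  have hs : Filter.Tendsto (fun y : U => (H.symm (y, i) : E)) (𝓝 ⟨x, hxU⟩)
      (𝓝 (H.symm (⟨x, hxU⟩, i))) :=
    Continuous.tendsto (by fun_prop : Continuous fun y : U => (H.symm (y, i) : E)) _
  intro V hV
  have hV' := hs hV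
  rw [Filter.mem_map, mem_nhds_subtype] at hV'
  obtain ⟨W, hW, hWV⟩ := hV'
  have h1 : p ⁻¹' W ∈ 𝒰 := hx hW
  filter_upwards [h1, hi] with e he ⟨h, hei⟩
  have h2 : (⟨p e, h⟩ : U) ∈ Subtype.val ⁻¹' W := he
  have h3 := hWV h2
  have h4 : H.symm (⟨p e, h⟩, i) = ⟨e, h⟩ := by
    rw [Homeomorph.symm_apply_eq]
    exact Prod.ext (Subtype.ext (hH ⟨e, h⟩).symm) hei.symm
  rw [mem_preimage, h4] at h3
  exact h3

theorem IsLocalHomeomorph.prodMap_of {A B C D : Type*} [TopologicalSpace A] [TopologicalSpace B]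
    [TopologicalSpace C] [TopologicalSpace D] {f : A → B} {h : C → D} (hf : IsLocalHomeomorph f)
    (hh : IsLocalHomeomorph h) : IsLocalHomeomorph (Prod.map f h) := by
  refine IsLocalHomeomorph.mk _ fun x => ?_
  obtain ⟨e, hxe, rfl⟩ := hf x.1
  obtain ⟨e', hxe', rfl⟩ := hh x.2
  exact ⟨e.prod e', ⟨hxe, hxe'⟩, fun _ _ => rfl⟩

theorem isLocalHomeomorph_circle_pow {l : ℕ} (hl : l ≠ 0) :
    IsLocalHomeomorph fun z : Circle => z ^ l := by
  have hl' : (l : ℝ) ≠ 0 := by exact_mod_cast hl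
  have h : IsLocalHomeomorph ((fun z : Circle => z ^ l) ∘ Circle.exp) := by
    have : (fun z : Circle => z ^ l) ∘ Circle.exp =
        Circle.exp ∘ Homeomorph.mulLeft₀ (l : ℝ) hl' := by
      funext x
      simp [Circle.exp_natCast_mul]
    rw [this]
    exact isLocalHomeomorph_circleExp.comp (Homeomorph.isLocalHomeomorph _)
  have h2 := (h.isLocalHomeomorphOn (s := univ)).of_comp_right
    (isLocalHomeomorph_circleExp.isLocalHomeomorphOn (s := univ))
  rw [image_univ, Circle.exp_surjective.range_eq] at h2
  exact isLocalHomeomorph_iff_isLocalHomeomorphOn_univ.mpr h2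

/-- Tubes lift along coverings: a lift of the core of a tube `t` (along a local homeomorphism `c` of
the parameter spaces) extends to a tube that lifts `t`. -/
theorem IsCoveringMap.exists_lift_tube {Mt M Bt B : Type*} [TopologicalSpace Mt]
    [TopologicalSpace M] [TopologicalSpace Bt] [TopologicalSpace B] {p : Mt → M}
    (hp : IsCoveringMap p) {t : B × ℂ → M} (ht : IsOpenEmbedding t) {c : Bt → B}
    (hc : IsLocalHomeomorph c) {Θ₀ : Bt → Mt} (hΘ₀ : Continuous Θ₀)
    (hinj : Function.Injective Θ₀) (hlift : ∀ β, p (Θ₀ β) = t (c β, 0))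
    (hran : ∀ y b, p y = t (b, 0) → y ∈ range Θ₀) :
    ∃ Θ : Bt × ℂ → Mt, IsOpenEmbedding Θ ∧ (∀ β v, p (Θ (β, v)) = t (c β, v)) ∧
      (∀ β, Θ (β, 0) = Θ₀ β) ∧ range Θ = p ⁻¹' range t := by
  have hcc := hc.continuous
  have htc := ht.continuous
  let H : C(unitInterval × (Bt × ℂ), M) :=
    ⟨fun q => t (c q.2.1, ((q.1 : ℝ) : ℂ) * q.2.2), by fun_prop⟩
  let f : C(Bt × ℂ, Mt) := ⟨fun q => Θ₀ q.1, by fun_prop⟩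
  have h0 : ∀ a, H (0, a) = p (f a) := fun a => by simp [H, f, hlift]
  let L := hp.liftHomotopy H f h0
  have hL : ∀ s β v, p (L (s, β, v)) = t (c β, ((s : ℝ) : ℂ) * v) := fun s β v =>
    congrFun (hp.liftHomotopy_lifts H f h0) (s, β, v)
  have hL0 : ∀ a, L (0, a) = f a := hp.liftHomotopy_zero H f h0
  let Θ : Bt × ℂ → Mt := fun q => L (1, q)
  have hΘc : Continuous Θ := by fun_prop
  have hpΘ : ∀ β v, p (Θ (β, v)) = t (c β, v) := fun β v => by simp [Θ, hL]
  have hΘ0 : ∀ β, Θ (β, 0) = Θ₀ β := by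
    intro β
    have := hp.const_of_comp (g := fun s : unitInterval => L (s, β, 0)) (by fun_prop)
      (fun s s' => by simp [hL]) 1 0
    exact this.trans (hL0 _)
  -- two lifts of a ray that agree at its end agree at its origin
  have hray : ∀ (k k' : ℂ → Mt), Continuous k → Continuous k' → (∀ v, p (k v) = p (k' v)) →
      ∀ v, k v = k' v → k 0 = k' 0 := fun k k' hk hk' hpk v hv =>
    congrFun (hp.eq_of_comp_eq hk hk' (funext hpk) v hv) 0
  have hΘinj : Function.Injective Θ := by
    rintro ⟨β, v⟩ ⟨β', v'⟩ h
    have h1 := congrArg p h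
    rw [hpΘ, hpΘ] at h1
    have h2 := ht.injective h1
    simp only [Prod.mk.injEq] at h2
    obtain ⟨h2, rfl⟩ := h2
    have h3 := hray (fun w => Θ (β, w)) (fun w => Θ (β', w)) (by fun_prop) (by fun_prop)
      (fun w => by rw [hpΘ, hpΘ, h2]) v h
    simp only [hΘ0] at h3
    rw [hinj h3]
  have hloc : IsLocalHomeomorph Θ := by
    refine IsLocalHomeomorph.of_comp (g := p) ?_ hp.isLocalHomeomorph hΘc
    have : p ∘ Θ = t ∘ Prod.map c id := funext fun q => hpΘ q.1 q.2
    rw [this]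
    exact ht.isLocalHomeomorph.comp (hc.prodMap_of (Homeomorph.refl ℂ).isLocalHomeomorph)
  refine ⟨Θ, hloc.isOpenEmbedding_of_injective hΘinj, hpΘ, hΘ0, ?_⟩
  ext y
  constructor
  · rintro ⟨⟨β, v⟩, rfl⟩
    exact ⟨(c β, v), (hpΘ β v).symm⟩
  · rintro ⟨⟨b, v⟩, hv⟩
    let γ : C(unitInterval, M) := ⟨fun s => t (b, ((1 - s : ℝ) : ℂ) * v), by fun_prop⟩
    have hγ0 : γ 0 = p y := by simp [γ, hv]
    let G := hp.liftPath γ y hγ0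
    have hG : ∀ s, p (G s) = t (b, ((1 - s : ℝ) : ℂ) * v) := fun s =>
      congrFun (hp.liftPath_lifts γ y hγ0) s
    obtain ⟨β, hβ⟩ := hran (G 1) b (by simp [hG])
    have hcβ : c β = b := by
      have h1 := congrArg p hβ
      rw [hlift, hG] at h1
      have := ht.injective h1
      simp only [Prod.mk.injEq] at this
      exact this.1
    have h2 := hp.eq_of_comp_eq (g₁ := G) (g₂ := fun s : unitInterval =>
      Θ (β, ((1 - s : ℝ) : ℂ) * v)) (by fun_prop) (by fun_prop) (funext fun s => by
        rw [Function.comp_apply, Function.comp_apply, hG, hpΘ, hcβ]) 1 (by simp [hΘ0, hβ])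
    refine ⟨(β, v), ?_⟩
    have h3 := congrFun h2 0
    rw [show G 0 = y from hp.liftPath_zero γ y hγ0] at h3
    simpa using h3.symm

/-- Fibre transport along a path, in terms of an explicit lift. -/
theorem IsCoveringMap.monodromy_mk {E M : Type*} [TopologicalSpace E] [TopologicalSpace M]
    {p : E → M} (hp : IsCoveringMap p) {x y : M} (γ : Path x y) (e : p ⁻¹' {x})
    (Γ : unitInterval → E)
    (hΓ : Continuous Γ) (h : ∀ s, p (Γ s) = γ s) (h0 : Γ 0 = e) :
    (hp.monodromy (Path.Homotopic.Quotient.mk γ) e : E) = Γ 1 := by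
  have : Γ = hp.liftPath γ e (γ.source.trans e.2.symm) :=
    (hp.eq_liftPath_iff _).mpr ⟨hΓ, funext h, h0⟩
  rw [this]
  rfl

section Normal

variable {E M : Type*} [TopologicalSpace E] [TopologicalSpace M] {p : C(E, M)}
  (hp : IsCoveringMap p) (x₀ : E)

theorem monodromy_eq_self_of_mem_range {γ : FundamentalGroup M (p x₀)}
    (h : γ ∈ (FundamentalGroup.map p x₀).range) :
    hp.monodromy (FundamentalGroup.toPath γ) ⟨x₀, rfl⟩ = ⟨x₀, rfl⟩ := by
  obtain ⟨Γ, rfl⟩ := h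
  exact hp.monodromy_map (FundamentalGroup.toPath Γ)

theorem mem_range_of_monodromy_eq_self {γ : FundamentalGroup M (p x₀)}
    (h : hp.monodromy (FundamentalGroup.toPath γ) ⟨x₀, rfl⟩ = ⟨x₀, rfl⟩) :
    γ ∈ (FundamentalGroup.map p x₀).range := by
  have key : ∀ (e : p ⁻¹' {p x₀}) (L : Path.Homotopic.Quotient x₀ (e : E)), e = ⟨x₀, rfl⟩ →
      L.map p = (FundamentalGroup.toPath γ).cast rfl e.2 →
      γ ∈ (FundamentalGroup.map p x₀).range := by
    rintro e L rfl h
    exact ⟨FundamentalGroup.fromPath L, h.trans (Path.Homotopic.Quotient.cast_rfl_rfl _)⟩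
  exact key _ (hp.liftPathQuotient (FundamentalGroup.toPath γ) ⟨x₀, rfl⟩) h
    (hp.map_liftPathQuotient _ _)

theorem monodromy_symm_monodromy {x y : M} (γ : Path.Homotopic.Quotient x y) (e : p ⁻¹' {x}) :
    hp.monodromy γ.symm (hp.monodromy γ e) = e := by
  rw [← hp.monodromy_trans_apply, Path.Homotopic.Quotient.trans_symm, hp.monodromy_refl]
  rfl

theorem exists_monodromy_eq [PathConnectedSpace E] {y : M} (e : p ⁻¹' {y}) :
    ∃ γ : Path.Homotopic.Quotient (p x₀) y, hp.monodromy γ ⟨x₀, rfl⟩ = e :=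
  ⟨((Path.Homotopic.Quotient.mk (PathConnectedSpace.somePath x₀ e)).map p).cast rfl e.2.symm,
    hp.monodromy_eq_of_map_eq (.mk (PathConnectedSpace.somePath x₀ e)) rfl⟩

/-- In a normal covering a loop lifts to a closed loop from every point of the fibre if it does so
from one point. -/
theorem monodromy_eq_self_of_normal [PathConnectedSpace E]
    (hN : (FundamentalGroup.map p x₀).range.Normal) {y : M}
    (δ : Path.Homotopic.Quotient y y) (e e' : p ⁻¹' {y}) (h : hp.monodromy δ e = e) :
    hp.monodromy δ e' = e' := by
  obtain ⟨a, ha⟩ := exists_monodromy_eq hp x₀ e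
  obtain ⟨b, hb⟩ := exists_monodromy_eq hp x₀ e'
  let ξ : Path.Homotopic.Quotient (p x₀) (p x₀) := (a.trans δ).trans a.symm
  let ζ : Path.Homotopic.Quotient (p x₀) (p x₀) := b.trans a.symm
  have hξ : FundamentalGroup.fromPath ξ ∈ (FundamentalGroup.map p x₀).range := by
    refine mem_range_of_monodromy_eq_self hp x₀ ?_
    change hp.monodromy ((a.trans δ).trans a.symm) _ = _
    rw [hp.monodromy_trans_apply, hp.monodromy_trans_apply, ha, h, ← ha,
      monodromy_symm_monodromy]
  have hconj := hN.conj_mem _ hξ (FundamentalGroup.fromPath ζ)⁻¹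
  have h1 := monodromy_eq_self_of_mem_range hp x₀ hconj
  rw [inv_inv] at h1
  have h2 : hp.monodromy (ζ.trans (ξ.trans ζ.symm)) ⟨x₀, rfl⟩ = ⟨x₀, rfl⟩ := h1
  have h3 := monodromy_symm_monodromy hp ζ ⟨x₀, rfl⟩
  rw [hp.monodromy_trans_apply, hp.monodromy_trans_apply] at h2
  have h4 := (hp.monodromy_bijective ζ.symm).1 (h2.trans h3.symm)
  have h5 : hp.monodromy ζ ⟨x₀, rfl⟩ = hp.monodromy a.symm e' := by
    rw [hp.monodromy_trans_apply, hb]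
  have h6 : hp.monodromy a (hp.monodromy a.symm e') = e' := by
    rw [← hp.monodromy_trans_apply, Path.Homotopic.Quotient.symm_trans, hp.monodromy_refl]
    rfl
  rw [h5, hp.monodromy_trans_apply, hp.monodromy_trans_apply, h6] at h4
  exact (hp.monodromy_bijective a.symm).1 h4

/-- A covering whose group is the kernel of a homomorphism to a finite group has finite fibres. -/
theorem finite_fibre_of_range_eq_ker [PathConnectedSpace E] [PathConnectedSpace M]
    (hp : IsCoveringMap p) (x₀ : E) {G : Type*} [Group G] [Finite G]
    (α : FundamentalGroup M (p x₀) →* G) (hker : (FundamentalGroup.map p x₀).range = α.ker)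
    (y : M) :
    (p ⁻¹' {y}).Finite := by
  have h0 : Finite (p ⁻¹' {p x₀}) := by
    choose γ hγ using fun e : p ⁻¹' {p x₀} => exists_monodromy_eq hp x₀ e
    refine Finite.of_injective (fun e => α (FundamentalGroup.fromPath (γ e))) fun e e' h => ?_
    have h1 : (FundamentalGroup.fromPath (γ e'))⁻¹ * FundamentalGroup.fromPath (γ e) ∈
        (FundamentalGroup.map p x₀).range := by
      rw [hker, MonoidHom.mem_ker, map_mul, map_inv]
      exact inv_mul_eq_one.mpr h.symm
    have h2 : hp.monodromy ((γ e).trans (γ e').symm) ⟨x₀, rfl⟩ = ⟨x₀, rfl⟩ :=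
      monodromy_eq_self_of_mem_range hp x₀ h1
    rw [hp.monodromy_trans_apply, hγ] at h2
    have h3 := monodromy_symm_monodromy hp (γ e') ⟨x₀, rfl⟩
    rw [hγ] at h3
    exact (hp.monodromy_bijective (γ e').symm).1 (h2.trans h3.symm)
  have h1 := hp.monodromy_bijective (.mk (PathConnectedSpace.somePath (p x₀) y))
  exact Finite.of_surjective _ h1.2

end Normal

end Coverings

section KnotPreimage

theorem encard_circle_pow_fibre {l : ℕ} [NeZero l] (t : Circle) :
    {z : Circle | z ^ l = t}.encard = l := by
  obtain ⟨z₀, rfl⟩ := circle_pow_surjective (l := l) t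
  have : {z : Circle | z ^ l = z₀ ^ l} = range fun m : ZMod l => ZMod.toCircle m * z₀ := by
    ext z
    simp only [mem_ofPred_eq, mem_range]
    constructor
    · intro h
      obtain ⟨a, ha⟩ := exists_toCircle_eq (l := l) (z := z / z₀) (by rw [div_pow, h, div_self'])
      exact ⟨a, by rw [ha, div_mul_cancel]⟩
    · rintro ⟨a, rfl⟩
      rw [mul_pow, ← AddChar.map_nsmul_eq_pow]
      simp
  rw [this, ← image_univ, InjOn.encard_image, encard_univ, ENat.card_eq_coe_natCard]
  · simp
  · exact fun a _ b _ h => ZMod.injective_toCircle (mul_right_cancel h)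

/-- The preimage of an embedded circle under a normal covering with finite fibres is a union of
circles, all of which cover it with the same degree `l`. -/
theorem exists_circle_components {E M : Type*} [TopologicalSpace E] [TopologicalSpace M]
    {p : E → M} (hp : IsCoveringMap p) {κ : Circle → M} (hκ : Continuous κ)
    (hκi : Function.Injective κ) (hfin : (p ⁻¹' {κ 1}).Finite)
    (hnorm : ∀ (δ : Path.Homotopic.Quotient (κ 1) (κ 1)) (e e' : p ⁻¹' {κ 1}),
      hp.monodromy δ e = e → hp.monodromy δ e' = e') (hne : (p ⁻¹' {κ 1}).Nonempty) :
    ∃ l : ℕ, l ≠ 0 ∧ ∃ (O : Set (p ⁻¹' {κ 1})) (Λ : O × Circle → E),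
      (∀ o, Continuous fun z => Λ (o, z)) ∧
      Function.Injective Λ ∧ range Λ = p ⁻¹' range κ ∧ ∀ o z, p (Λ (o, z)) = κ (z ^ l) := by
  have hpi := Real.pi_pos
  have : Finite (p ⁻¹' {κ 1}) := hfin
  have hL : ∀ e : p ⁻¹' {κ 1}, ∃ L : ℝ → E, Continuous L ∧ (∀ θ, p (L θ) = κ (Circle.exp θ)) ∧
      L 0 = e := by
    intro e
    let k : C(ℝ, M) := ⟨fun θ => κ (Circle.exp θ), by fun_prop⟩
    obtain ⟨L, ⟨h0, hL⟩, -⟩ := hp.existsUnique_continuousMap_lifts k 0 e (by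
      have h : p e = κ 1 := e.2
      simp [k, h])
    exact ⟨L, L.continuous, congrFun hL, h0⟩
  choose L hLc hLp hL0 using hL
  have hmem : ∀ e (n : ℤ), L e (n * (2 * Real.pi)) ∈ p ⁻¹' {κ 1} := fun e n => by
    rw [mem_preimage, hLp, Circle.exp_int_mul_two_pi]; rfl
  let m : p ⁻¹' {κ 1} → ℤ → p ⁻¹' {κ 1} := fun e n => ⟨L e (n * (2 * Real.pi)), hmem e n⟩
  -- lifts along translates of the line that agree somewhere agree everywhere
  have huniq : ∀ (e e' : p ⁻¹' {κ 1}) (n : ℤ) (θ : ℝ), L e' θ = L e (θ + n * (2 * Real.pi)) →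
      ∀ θ, L e' θ = L e (θ + n * (2 * Real.pi)) := by
    intro e e' n θ h
    have := hLc e
    refine congrFun (hp.eq_of_comp_eq (hLc e') (g₂ := fun θ => L e (θ + n * (2 * Real.pi)))
      (by fun_prop) (funext fun θ => ?_) θ h)
    simp only [Function.comp_apply, hLp, Circle.exp_add, Circle.exp_int_mul_two_pi, mul_one]
  have hshift : ∀ e n θ, L (m e n) θ = L e (θ + n * (2 * Real.pi)) := by
    intro e n
    exact huniq e (m e n) n 0 (by rw [hL0, zero_add])
  have hm0 : ∀ e, m e 0 = e := fun e => Subtype.ext (by simp [m, hL0])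
  have hmadd : ∀ e n n', m (m e n) n' = m e (n + n') := fun e n n' => Subtype.ext (by
    simp only [m]
    rw [hshift]
    congr 1
    push_cast
    ring)
  have hmono : ∀ e e' n, m e n = e → m e' n = e' := by
    intro e e' n h
    let δ : Path (κ 1) (κ 1) :=
      { toFun := fun s => κ (Circle.exp (s * (n * (2 * Real.pi))))
        continuous_toFun := by fun_prop
        source' := by simp
        target' := by simp }
    have hδ : ∀ e, hp.monodromy (Path.Homotopic.Quotient.mk δ) e = m e n := by
      intro e
      have := hLc e
      refine Subtype.ext ((hp.monodromy_mk δ e (fun s => L e (s * (n * (2 * Real.pi))))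
        (by fun_prop) (fun s => hLp _ _) (by simp [hL0])).trans ?_)
      simp [m]
    rw [← hδ]
    exact hnorm _ e e' ((hδ e).trans h)
  obtain ⟨e₀⟩ := hne.to_subtype
  -- the group of periods
  let Per : AddSubgroup ℤ :=
    { carrier := {n | m e₀ n = e₀}
      zero_mem' := hm0 e₀
      add_mem' := fun {a b} ha hb => by
        change m e₀ (a + b) = e₀
        rw [← hmadd, show m e₀ a = e₀ from ha]
        exact hb
      neg_mem' := fun {a} ha => by
        change m e₀ (-a) = e₀
        have h := hmadd e₀ a (-a)
        rwa [show m e₀ a = e₀ from ha, add_neg_cancel, hm0] at h }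
  obtain ⟨c, hc⟩ := Int.subgroup_cyclic Per
  have hper : ∀ e n, m e n = e ↔ (c.natAbs : ℤ) ∣ n := by
    intro e n
    have h1 : m e n = e ↔ n ∈ Per := ⟨fun h => hmono e e₀ n h, fun h => hmono e₀ e n h⟩
    rw [h1, hc, ← AddSubgroup.zmultiples_eq_closure, Int.mem_zmultiples_iff, Int.natAbs_dvd]
  let l := c.natAbs
  have hl : l ≠ 0 := by
    intro hl0
    obtain ⟨a, b, hab, h⟩ := Finite.exists_ne_map_eq_of_infinite (m e₀)
    have h1 : m e₀ (a + -b) = e₀ := by rw [← hmadd, h, hmadd, add_neg_cancel, hm0]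
    rw [hper, show (c.natAbs : ℤ) = ((l : ℕ) : ℤ) from rfl, hl0] at h1
    simp only [Nat.cast_zero, zero_dvd_iff] at h1
    omega
  have hl' : (l : ℝ) ≠ 0 := by exact_mod_cast hl
  -- one base point on each component
  let S : Setoid (p ⁻¹' {κ 1}) :=
    { r := fun e e' => ∃ n, m e n = e'
      iseqv := ⟨fun e => ⟨0, hm0 e⟩, fun {e e'} ⟨n, h⟩ => ⟨-n, by
          rw [← h, hmadd, add_neg_cancel, hm0]⟩,
        fun {a b c} ⟨n, h⟩ ⟨n', h'⟩ => ⟨n + n', by rw [← hmadd, h, h']⟩⟩ }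
  let O : Set (p ⁻¹' {κ 1}) := range (Quotient.out : Quotient S → _)
  have hO : ∀ e : p ⁻¹' {κ 1}, ∃ o : O, ∃ n, m o n = e := fun e =>
    ⟨⟨_, ⟨Quotient.mk S e, rfl⟩⟩, Quotient.mk_out (s := S) e⟩
  have hOuniq : ∀ (o o' : O) n, m o n = o' → o = o' := by
    rintro ⟨_, q, rfl⟩ ⟨_, q', rfl⟩ n h
    have h1 : S (Quotient.out q) (Quotient.out q') := ⟨n, h⟩
    have h2 := Quotient.sound h1
    rw [Quotient.out_eq, Quotient.out_eq] at h2
    exact Subtype.ext (congrArg Quotient.out h2)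
  have hLl : ∀ e (n : ℤ) θ, L e (l * (θ + n * (2 * Real.pi))) = L e (l * θ) := by
    intro e n θ
    have h1 : m e (l * n) = e := (hper e _).mpr (dvd_mul_right _ _)
    have h2 := hshift e (l * n) (l * θ)
    rw [h1] at h2
    rw [h2]
    congr 1
    push_cast
    ring
  let Λ : O × Circle → E := fun q => L q.1 (l * Complex.arg q.2)
  have hΛ : ∀ o θ, Λ (o, Circle.exp θ) = L o (l * θ) := by
    intro o θ
    obtain ⟨n, hn⟩ := Circle.exp_eq_exp.mp (Circle.exp_arg (Circle.exp θ))
    simp only [Λ]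
    rw [hn, hLl]
  refine ⟨l, hl, O, Λ, ?_, ?_, ?_, ?_⟩
  · intro o
    have hq : Topology.IsQuotientMap Circle.exp :=
      (isLocalHomeomorph_circleExp.isOpenMap.isQuotientMap Circle.exp.continuous
        Circle.exp_surjective)
    rw [hq.continuous_iff]
    have : (fun z => Λ (o, z)) ∘ Circle.exp = fun θ => L o (l * θ) := funext (hΛ o)
    rw [this]
    exact (hLc o).comp (by fun_prop)
  · rintro ⟨o, z⟩ ⟨o', z'⟩ h
    obtain ⟨θ, rfl⟩ := Circle.exp_surjective z
    obtain ⟨θ', rfl⟩ := Circle.exp_surjective z'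
    rw [hΛ, hΛ] at h
    have h1 := congrArg p h
    rw [hLp, hLp] at h1
    obtain ⟨n, hn⟩ := Circle.exp_eq_exp.mp (hκi h1)
    rw [hn] at h
    have h2 := huniq o o' n (l * θ') h.symm 0
    rw [hL0, zero_add] at h2
    have h3 : m o n = o' := Subtype.ext h2.symm
    obtain rfl := hOuniq o o' n h3
    obtain ⟨k, rfl⟩ := (hper o n).mp h3
    refine Prod.ext rfl (Circle.exp_eq_exp.mpr ⟨k, ?_⟩)
    have : (l : ℝ) * θ = l * (θ' + k * (2 * Real.pi)) := by
      rw [hn, Int.cast_mul, Int.cast_natCast]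
      ring
    exact mul_left_cancel₀ hl' this
  · ext y
    constructor
    · rintro ⟨⟨o, z⟩, rfl⟩
      exact ⟨_, (hLp _ _).symm⟩
    · rintro ⟨z, hz⟩
      obtain ⟨φ, rfl⟩ := Circle.exp_surjective z
      let k : C(ℝ, M) := ⟨fun θ => κ (Circle.exp θ), by fun_prop⟩
      obtain ⟨G, ⟨hG0, hG⟩, -⟩ := hp.existsUnique_continuousMap_lifts k φ y hz.symm
      have hG0' : G 0 ∈ p ⁻¹' {κ 1} := by
        have := congrFun hG 0
        simpa [k] using this
      have h1 : G = L ⟨G 0, hG0'⟩ := hp.eq_of_comp_eq G.continuous (hLc _)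
        (hG.trans (funext fun θ => (hLp _ θ).symm)) 0 (hL0 ⟨G 0, hG0'⟩).symm
      obtain ⟨o, n, hon⟩ := hO ⟨G 0, hG0'⟩
      refine ⟨(o, Circle.exp ((φ + n * (2 * Real.pi)) / l)), ?_⟩
      rw [hΛ, mul_div_cancel₀ _ hl', ← hshift, hon, ← h1, hG0]
  · intro o z
    obtain ⟨θ, rfl⟩ := Circle.exp_surjective z
    rw [hΛ, hLp, Circle.exp_natCast_mul]

/-- The connected components of a disjoint union of circles. -/
theorem components_of_circles {E O : Type*} [TopologicalSpace E] [T2Space E] [Finite O]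
    {Λ : O × Circle → E} (hΛ : ∀ o, Continuous fun z => Λ (o, z)) (hinj : Function.Injective Λ)
    {A : Set E} (hA : range Λ = A) :
    (∀ o z, connectedComponentIn A (Λ (o, z)) = range fun w => Λ (o, w)) ∧
      Nonempty (ConnectedComponents A ≃ O) := by
  let _ : TopologicalSpace O := ⊥
  have : DiscreteTopology O := ⟨rfl⟩
  have hΛc : Continuous Λ := continuous_prod_of_discrete_left.mpr hΛ
  subst hA
  let Φ : O × Circle ≃ₜ range Λ :=
    (Equiv.ofInjective Λ hinj).toHomeomorphOfIsInducing
      (hΛc.isClosedEmbedding hinj).isEmbedding.toHomeomorph.isInducing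
  let f : range Λ → O := fun y => (Φ.symm y).1
  have hf : Continuous f := continuous_fst.comp Φ.symm.continuous
  have hfΛ : ∀ o z, f ⟨Λ (o, z), mem_range_self _⟩ = o := fun o z =>
    congrArg Prod.fst (Φ.symm_apply_apply (o, z))
  have hcomp : ∀ y : range Λ, connectedComponent y = f ⁻¹' {f y} := by
    intro y
    refine Subset.antisymm (fun x hx => ?_) ?_
    · exact isPreconnected_connectedComponent.constant hf.continuousOn hx mem_connectedComponent
    · have h1 : f ⁻¹' {f y} = range fun z => (⟨Λ (f y, z), mem_range_self _⟩ : range Λ) := by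
        ext x
        constructor
        · intro hx
          refine ⟨(Φ.symm x).2, ?_⟩
          have h2 : (f y, (Φ.symm x).2) = Φ.symm x := Prod.ext (Eq.symm hx) rfl
          have h3 : Φ (f y, (Φ.symm x).2) = x := by rw [h2, Φ.apply_symm_apply]
          exact h3
        · rintro ⟨z, rfl⟩
          exact hfΛ _ _
      have h2 : IsPreconnected (f ⁻¹' {f y}) := by
        rw [h1]
        exact isPreconnected_range ((hΛ _).subtype_mk _)
      exact h2.subset_connectedComponent rfl
  constructor
  · intro o z
    rw [connectedComponentIn_eq_image (mem_range_self _), hcomp, hfΛ]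
    ext x
    constructor
    · rintro ⟨⟨_, ⟨o', w⟩, rfl⟩, h, rfl⟩
      have : o' = o := (hfΛ o' w).symm.trans h
      exact ⟨w, by rw [this]⟩
    · rintro ⟨w, rfl⟩
      exact ⟨⟨Λ (o, w), mem_range_self _⟩, hfΛ o w, rfl⟩
  · have hs : ∀ x y : range Λ, (x : ConnectedComponents (range Λ)) = y ↔ f x = f y := by
      intro x y
      rw [ConnectedComponents.coe_eq_coe, hcomp, hcomp]
      constructor
      · intro h
        have : x ∈ f ⁻¹' {f x} := rfl
        rw [h] at this
        exact this
      · intro h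
        rw [h]
    refine ⟨Equiv.ofBijective (Quotient.lift f fun x y h => (hs x y).mp (Quotient.sound h))
      ⟨?_, fun o => ⟨(⟨Λ (o, 1), mem_range_self _⟩ : range Λ), hfΛ o 1⟩⟩⟩
    intro a b
    refine Quotient.inductionOn₂ a b fun x y h => (hs x y).mpr h

end KnotPreimage

/-! ### Codimension zero embeddings, zero surgeries and torus bundles, topologically -/

section Topological

open Topology

section SmoothEmb

variable {E₁ H₁ M₁ E₂ H₂ M₂ : Type*}
  [NormedAddCommGroup E₁] [NormedSpace ℝ E₁] [TopologicalSpace H₁]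
  [NormedAddCommGroup E₂] [NormedSpace ℝ E₂] [TopologicalSpace H₂]
  [TopologicalSpace M₁] [ChartedSpace H₁ M₁] [TopologicalSpace M₂] [ChartedSpace H₂ M₂]
  {I₁ : ModelWithCorners ℝ E₁ H₁} {I₂ : ModelWithCorners ℝ E₂ H₂} {φ : M₁ → M₂} {s : Set M₁}

theorem SmoothEmbOn.continuousOn (h : SmoothEmbOn I₁ I₂ φ s) : ContinuousOn φ s :=
  h.2.isLocalHomeomorphOn.continuousOn

theorem SmoothEmbOn.isOpenEmbedding (h : SmoothEmbOn I₁ I₂ φ univ) : IsOpenEmbedding φ :=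
  (isLocalHomeomorph_iff_isLocalHomeomorphOn_univ.mpr
    h.2.isLocalHomeomorphOn).isOpenEmbedding_of_injective (injOn_univ.mp h.1)

end SmoothEmb

theorem isPreconnected_compl_zero : IsPreconnected {v : ℂ | v ≠ 0} := by
  have : (1 : Cardinal) < Module.rank ℝ ℂ := by
    rw [Complex.rank_real_complex]
    exact Cardinal.one_lt_two
  exact (isConnected_compl_singleton_of_one_lt_rank this (0 : ℂ)).isPreconnected

instance connectedSpace_sphere3 : ConnectedSpace Sphere3 := by
  have : (1 : Cardinal) < Module.rank ℝ (EuclideanSpace ℝ (Fin (3 + 1))) := by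
    rw [← Module.finrank_eq_rank, finrank_euclideanSpace_fin]
    exact_mod_cast (by norm_num : 1 < 3 + 1)
  exact Subtype.connectedSpace (isConnected_sphere this 0 zero_le_one)

section ZeroSurgery

variable {N₀ : Type*} [TopologicalSpace N₀] [ChartedSpace (EuclideanSpace ℝ (Fin 3)) N₀]
  {K : Circle → Sphere3} {σ : Circle × ℂ → N₀}

theorem IsZeroSurgery.isOpenEmbedding (h : IsZeroSurgery K σ) : IsOpenEmbedding σ := by
  obtain ⟨τ, j, -, -, -, -, hσ, -⟩ := h
  exact hσ.isOpenEmbedding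

/-- `N₀` is the union of the knot complement in `S³`, which is connected, and of an open solid torus
that meets it. -/
theorem IsZeroSurgery.connectedSpace (h : IsZeroSurgery K σ) : ConnectedSpace N₀ := by
  obtain ⟨τ, j, hτ, hK, -, hj, hσ, hjr, hglue⟩ := h
  have hτo := hτ.isOpenEmbedding
  have hC : range K = range fun z => τ (z, 0) := congrArg range (funext fun z => (hK z).symm)
  have hS3 : IsPreconnected ((range K)ᶜ : Set Sphere3) := by
    rw [compl_eq_univ_sdiff]
    have hclosed : IsClosed (range K) := by
      rw [hC]
      have := hτo.continuous
      exact (isCompact_range (by fun_prop)).isClosed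
    refine isPreconnected_diff_of_subset (U := range τ) isPreconnected_univ isOpen_univ
      hτo.isOpen_range hclosed (subset_univ _) ?_ ?_
    · rw [hC]
      rintro _ ⟨z, rfl⟩
      exact mem_range_self _
    · have : range τ \ range K = τ '' (univ ×ˢ {v : ℂ | v ≠ 0}) := by
        rw [hC]
        ext x
        constructor
        · rintro ⟨⟨⟨z, v⟩, rfl⟩, hx⟩
          refine ⟨(z, v), ⟨trivial, ?_⟩, rfl⟩
          rintro rfl
          exact hx ⟨z, rfl⟩
        · rintro ⟨⟨z, v⟩, ⟨-, hv⟩, rfl⟩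
          refine ⟨mem_range_self _, ?_⟩
          rintro ⟨w, hw⟩
          have := hτo.injective hw
          simp only [Prod.mk.injEq] at this
          exact hv this.2.symm
      rw [this]
      exact (isPreconnected_univ.prod isPreconnected_compl_zero).image _ hτo.continuous.continuousOn
  have h1 : IsPreconnected (j '' (range K)ᶜ) := hS3.image _ hj.continuousOn
  have h2 : IsPreconnected (range σ) := isPreconnected_range hσ.isOpenEmbedding.continuous
  have hu : j '' (range K)ᶜ ∪ range σ = univ := by
    rw [hjr, eq_univ_iff_forall]
    intro x
    by_cases hx : x ∈ dualKnot σ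
    · obtain ⟨z, rfl⟩ := hx
      exact .inr (mem_range_self _)
    · exact .inl hx
  have hmem : σ (1, 1) ∈ j '' (range K)ᶜ := by
    rw [hjr]
    rintro ⟨z, hz⟩
    have := hσ.isOpenEmbedding.injective hz
    simp at this
  have : IsPreconnected (univ : Set N₀) := by
    rw [← hu]
    exact h1.union _ hmem (mem_range_self _) h2
  exact { isPreconnected_univ := this, toNonempty := ⟨σ (1, 1)⟩ }

/-- `N₀` is the union of the compact knot exterior and a compact solid torus. -/
theorem IsZeroSurgery.compactSpace (h : IsZeroSurgery K σ) : CompactSpace N₀ := by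
  obtain ⟨τ, j, hτ, hK, -, hj, hσ, hjr, hglue⟩ := h
  have hτo := hτ.isOpenEmbedding
  have hσo := hσ.isOpenEmbedding
  have hopen : IsOpen (τ '' {p | ‖p.2‖ < 1}) :=
    hτo.isOpenMap _ (isOpen_lt (by fun_prop) continuous_const)
  have hsub : (τ '' {p | ‖p.2‖ < 1})ᶜ ⊆ (range K)ᶜ := by
    rw [compl_subset_compl]
    rintro _ ⟨z, rfl⟩
    exact ⟨(z, 0), by simp, hK z⟩
  have h1 : IsCompact (j '' (τ '' {p | ‖p.2‖ < 1})ᶜ) :=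
    hopen.isClosed_compl.isCompact.image_of_continuousOn (hj.continuousOn.mono hsub)
  have h2 : IsCompact (σ '' (univ ×ˢ Metric.closedBall 0 1)) :=
    (isCompact_univ.prod (isCompact_closedBall _ _)).image hσo.continuous
  refine ⟨(h1.union h2).of_isClosed_subset isClosed_univ fun x _ => ?_⟩
  by_cases hx : x ∈ dualKnot σ
  · obtain ⟨z, rfl⟩ := hx
    exact .inr ⟨(z, 0), ⟨trivial, by simp⟩, rfl⟩
  · have hx' : x ∈ j '' (range K)ᶜ := by rw [hjr]; exact hx
    obtain ⟨y, hy, rfl⟩ := hx'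
    by_cases hyt : y ∈ τ '' {p | ‖p.2‖ < 1}
    · obtain ⟨⟨w, v⟩, hv, rfl⟩ := hyt
      have hv0 : v ≠ 0 := by
        rintro rfl
        exact hy ⟨w, (hK w).symm⟩
      have hv1 : ‖v‖ < 1 := hv
      have hpos : 0 < ‖v‖ := norm_pos_iff.mpr hv0
      let z : Circle := ⟨v / ‖v‖, by
        refine mem_sphere_zero_iff_norm.mpr ?_
        rw [norm_div, Complex.norm_real, norm_norm, div_self hpos.ne']⟩
      have hvz : v = ‖v‖ * (z : ℂ) := by
        simp only [z]
        rw [mul_div_cancel₀]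
        exact_mod_cast hpos.ne'
      refine .inr ⟨(z, ‖v‖ * (w : ℂ)), ⟨trivial, ?_⟩, ?_⟩
      · rw [mem_closedBall_zero_iff]
        rw [norm_mul, Complex.norm_real, norm_norm, Circle.norm_coe, mul_one]
        exact hv1.le
      · rw [hglue z w ‖v‖ hpos, ← hvz]
    · exact .inl ⟨y, hyt, rfl⟩

end ZeroSurgery

theorem IsTorusBundle.locallyTrivial {F X : Type*}
    [TopologicalSpace F] [ChartedSpace (EuclideanSpace ℝ (Fin 2)) F]
    [TopologicalSpace X] [ChartedSpace (EuclideanSpace ℝ (Fin 4)) X] {π : X → F}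
    (h : IsTorusBundle π) : LocallyTrivial (Circle × Circle) π := by
  intro b
  obtain ⟨U, hU, hb, ψ, hψ, him, hπ⟩ := h.2 b
  refine ⟨U, hU, hb, ψ, hψ.continuousOn, fun d hd => ⟨fun t t' htt => ?_, ?_⟩⟩
  · have := hψ.1 (⟨hd, trivial⟩ : (d, t) ∈ U ×ˢ univ) (⟨hd, trivial⟩ : (d, t') ∈ U ×ˢ univ) htt
    exact (Prod.mk.inj this).2
  · ext x
    constructor
    · rintro ⟨t, rfl⟩
      exact hπ d hd t
    · intro hx
      have : x ∈ π ⁻¹' U := by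
        rw [mem_preimage, show π x = d from hx]
        exact hd
      rw [← him] at this
      obtain ⟨⟨d', t⟩, ⟨hd', -⟩, rfl⟩ := this
      have h1 : d' = d := (hπ d' hd' t).symm.trans hx
      exact ⟨t, by rw [h1]⟩

/-- The covering of a zero surgery given by the kernel of a homomorphism to a finite group, over
the dual knot: since the covering is normal, the circles over the dual knot all have the same
degree. -/
theorem exists_dualKnot_lift {N₀ : Type*} [TopologicalSpace N₀] [T2Space N₀]
    [ChartedSpace (EuclideanSpace ℝ (Fin 3)) N₀] {K : Circle → Sphere3} {σ : Circle × ℂ → N₀}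
    (hσ : IsZeroSurgery K σ) {Nt₀ : Type*} [TopologicalSpace Nt₀] [T2Space Nt₀] [ConnectedSpace Nt₀]
    [ChartedSpace (EuclideanSpace ℝ (Fin 3)) Nt₀] {p₀ : C(Nt₀, N₀)} (hp₀ : IsCoveringMap p₀)
    {G : Type*} [Group G] [Finite G] (x₀ : Nt₀) (α : FundamentalGroup N₀ (p₀ x₀) →* G)
    (hker : (FundamentalGroup.map p₀ x₀).range = α.ker) {r : ℕ}
    (hr : ENat.card (ConnectedComponents (p₀ ⁻¹' dualKnot σ)) = r) :
    CompactSpace Nt₀ ∧ Function.Surjective p₀ ∧ r ≠ 0 ∧ ∃ l : ℕ, l ≠ 0 ∧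
      (∀ x ∈ p₀ ⁻¹' dualKnot σ, ∀ y ∈ dualKnot σ,
        {z | z ∈ connectedComponentIn (p₀ ⁻¹' dualKnot σ) x ∧ p₀ z = y}.encard = l) ∧
      ∃ Λ : Fin r × Circle → Nt₀, Continuous Λ ∧ Function.Injective Λ ∧
        range Λ = p₀ ⁻¹' dualKnot σ ∧ ∀ i z, p₀ (Λ (i, z)) = σ (z ^ l, 0) := by
  have := hσ.connectedSpace
  have := hσ.compactSpace
  have : LocallyPathConnectedSpace N₀ :=
    ChartedSpace.locallyPathConnectedSpace (EuclideanSpace ℝ (Fin 3)) N₀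
  have : LocallyPathConnectedSpace Nt₀ :=
    ChartedSpace.locallyPathConnectedSpace (EuclideanSpace ℝ (Fin 3)) Nt₀
  have : PathConnectedSpace N₀ := pathConnectedSpace_iff_connectedSpace.mpr inferInstance
  have : PathConnectedSpace Nt₀ := pathConnectedSpace_iff_connectedSpace.mpr inferInstance
  have hσo := hσ.isOpenEmbedding
  have hfin := finite_fibre_of_range_eq_ker hp₀ x₀ α hker
  have hsurj : Function.Surjective p₀ := by
    intro y
    have h := (hp₀.monodromy_bijective (.mk (PathConnectedSpace.somePath (p₀ x₀) y)))
    exact ⟨_, (hp₀.monodromy (.mk (PathConnectedSpace.somePath (p₀ x₀) y)) ⟨x₀, rfl⟩).2⟩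
  let κ : Circle → N₀ := fun z => σ (z, 0)
  have hκ : Continuous κ := hσo.continuous.comp (by fun_prop)
  have hκi : Function.Injective κ := fun z w h => (Prod.mk.inj (hσo.injective h)).1
  have hN : (FundamentalGroup.map p₀ x₀).range.Normal := hker ▸ MonoidHom.normal_ker α
  obtain ⟨l, hl, O, Λ, hΛ, hΛi, hΛr, hΛp⟩ := exists_circle_components hp₀ hκ hκi (hfin _)
    (monodromy_eq_self_of_normal hp₀ x₀ hN) (hsurj _)
  have : NeZero l := ⟨hl⟩
  have : Finite (p₀ ⁻¹' {κ 1}) := hfin _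
  obtain ⟨hcomp, ⟨eqv⟩⟩ := components_of_circles hΛ hΛi hΛr
  have hO : Nonempty (Fin r ≃ O) := by
    have h1 : ENat.card O = r := by rw [← hr]; exact (ENat.card_congr eqv).symm
    rw [ENat.card_eq_coe_natCard] at h1
    have h2 : Nat.card O = r := by exact_mod_cast h1
    exact ⟨(finCongr h2.symm).trans (Finite.equivFin O).symm⟩
  obtain ⟨eO⟩ := hO
  refine ⟨hp₀.compactSpace_of_finite hfin, hsurj, ?_, l, hl, ?_,
    fun q => Λ (eO q.1, q.2), ?_, ?_, ?_, fun i z => hΛp _ z⟩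
  · rintro rfl
    obtain ⟨e, he⟩ := hsurj (κ 1)
    have : e ∈ range Λ := by rw [hΛr]; exact ⟨1, he.symm⟩
    obtain ⟨⟨o, -⟩, -⟩ := this
    exact (eO.symm o).elim0
  · rintro x hx _ ⟨w, rfl⟩
    have : x ∈ range Λ := by rw [hΛr]; exact hx
    obtain ⟨⟨o, z⟩, rfl⟩ := this
    change {y | y ∈ connectedComponentIn (p₀ ⁻¹' range κ) (Λ (o, z)) ∧ p₀ y = κ w}.encard = l
    rw [hcomp, ← encard_circle_pow_fibre w]
    have : {y | (y ∈ range fun w => Λ (o, w)) ∧ p₀ y = κ w} =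
        (fun z => Λ (o, z)) '' {z | z ^ l = w} := by
      ext y
      constructor
      · rintro ⟨⟨ζ, rfl⟩, h⟩
        exact ⟨ζ, hκi ((hΛp o ζ).symm.trans h), rfl⟩
      · rintro ⟨ζ, hζ, rfl⟩
        refine ⟨⟨ζ, rfl⟩, (hΛp o ζ).trans ?_⟩
        rw [show ζ ^ l = w from hζ]
    rw [this, InjOn.encard_image]
    exact fun a _ b _ h => (Prod.mk.inj (hΛi h)).2
  · exact continuous_prod_of_discrete_left.mpr fun i => hΛ (eO i)
  · rintro ⟨i, z⟩ ⟨i', z'⟩ h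
    have := hΛi h
    simp only [Prod.mk.injEq, EmbeddingLike.apply_eq_iff_eq] at this
    exact Prod.ext this.1 this.2
  · rw [show p₀ ⁻¹' dualKnot σ = range Λ from hΛr.symm]
    ext y
    constructor
    · rintro ⟨q, rfl⟩; exact mem_range_self _
    · rintro ⟨⟨o, z⟩, rfl⟩
      exact ⟨(eO.symm o, z), by simp⟩

end Topological

/-! ### Moving points in manifolds -/

section Homogeneity

open Topology

/-- A self-homeomorphism of an open piece of a Hausdorff space, equal to the identity off a compact
set, extends by the identity. -/
theorem exists_homeomorph_extend {E M : Type*} [TopologicalSpace E] [TopologicalSpace M] [T2Space M]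
    {e : E → M} (he : IsOpenEmbedding e) (h : E ≃ₜ E) {C : Set E} (hC : IsCompact C)
    (hid : ∀ x ∉ C, h x = x) :
    ∃ H : M ≃ₜ M, (∀ x, H (e x) = e (h x)) ∧ ∀ m ∉ e '' C, H m = m := by
  have hid' : ∀ x ∉ C, h.symm x = x := fun x hx => by
    rw [Homeomorph.symm_apply_eq, hid x hx]
  have hclosed : IsClosed (e '' C) := (hC.image he.continuous).isClosed
  let ext : (E ≃ₜ E) → M → M := fun k => Function.extend e (e ∘ k) id
  have ext_apply : ∀ (k : E ≃ₜ E) x, ext k (e x) = e (k x) := fun k x =>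
    he.injective.extend_apply _ _ x
  have ext_off : ∀ (k : E ≃ₜ E), (∀ x ∉ C, k x = x) → ∀ m ∉ e '' C, ext k m = m := by
    intro k hk m hm
    by_cases hme : m ∈ range e
    · obtain ⟨x, rfl⟩ := hme
      rw [ext_apply, hk x fun hx => hm ⟨x, hx, rfl⟩]
    · exact Function.extend_apply' _ _ _ hme
  have ext_cont : ∀ (k : E ≃ₜ E), (∀ x ∉ C, k x = x) → Continuous (ext k) := by
    intro k hk
    rw [continuous_iff_continuousAt]
    intro m
    by_cases hm : m ∈ e '' C
    · obtain ⟨x, -, rfl⟩ := hm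
      rw [← he.continuousAt_iff]
      have : ext k ∘ e = e ∘ k := funext fun x => ext_apply k x
      rw [this]
      exact (he.continuous.comp k.continuous).continuousAt
    · refine continuousAt_id.congr ?_
      filter_upwards [hclosed.isOpen_compl.mem_nhds hm] with m' hm'
      exact (ext_off k hk m' hm').symm
  have inv : ∀ k k' : E ≃ₜ E, (∀ x, k' (k x) = x) → ∀ m, ext k' (ext k m) = m := by
    intro k k' hkk m
    by_cases hme : m ∈ range e
    · obtain ⟨x, rfl⟩ := hme
      rw [ext_apply, ext_apply, hkk]
    · have : ∀ k, ext k m = m := fun k => Function.extend_apply' _ _ _ hme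
      rw [this, this]
  exact ⟨⟨⟨ext h, ext h.symm, inv _ _ (by simp), inv _ _ (by simp)⟩, ext_cont _ hid,
    ext_cont _ hid'⟩, ext_apply h, ext_off h hid⟩

/-- Every point of `M` has arbitrarily small open neighbourhoods homeomorphic to `E`. -/
def LocallyModelled (E M : Type*) [Zero E] [TopologicalSpace E] [TopologicalSpace M] : Prop :=
  ∀ (m : M), ∀ U ∈ 𝓝 m, ∃ e : E → M, IsOpenEmbedding e ∧ e 0 = m ∧ range e ⊆ U

theorem locallyModelled_of_chartedSpace (E M : Type*) [NormedAddCommGroup E] [NormedSpace ℝ E]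
    [TopologicalSpace M] [ChartedSpace E M] : LocallyModelled E M := by
  intro m U hU
  let c := chartAt E m
  have hm : m ∈ c.source := mem_chart_source E m
  have h1 : c.symm ⁻¹' U ∩ c.target ∈ 𝓝 (c m) := by
    refine Filter.inter_mem ?_ (c.open_target.mem_nhds (c.map_source hm))
    refine (c.continuousAt_symm (c.map_source hm)).preimage_mem_nhds ?_
    rwa [c.left_inv hm]
  obtain ⟨ε, hε, hball⟩ := Metric.mem_nhds_iff.mp h1
  let u := OpenPartialHomeomorph.univBall (c m) ε
  have hu : u.source = univ := OpenPartialHomeomorph.univBall_source _ _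
  have hut : u.target = Metric.ball (c m) ε := OpenPartialHomeomorph.univBall_target _ hε
  have hmaps : ∀ x, u x ∈ c.symm ⁻¹' U ∩ c.target := fun x => hball <| by
    rw [← hut]; exact u.map_source (by rw [hu]; trivial)
  let d := u.trans c.symm
  have hd : d.source = univ := by
    rw [OpenPartialHomeomorph.trans_source, hu, univ_inter]
    exact eq_univ_of_forall fun x => (hmaps x).2
  refine ⟨d, d.isOpenEmbedding hd, ?_, ?_⟩
  · change c.symm (u 0) = m
    rw [OpenPartialHomeomorph.univBall_apply_zero, c.left_inv hm]
  · rintro _ ⟨x, rfl⟩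
    exact (hmaps x).1

theorem LocallyModelled.congr {E E' M : Type*} [NormedAddCommGroup E] [NormedSpace ℝ E]
    [NormedAddCommGroup E'] [NormedSpace ℝ E'] [TopologicalSpace M] (h : LocallyModelled E M)
    (L : E' ≃L[ℝ] E) : LocallyModelled E' M := by
  intro m U hU
  obtain ⟨e, he, h0, hr⟩ := h m U hU
  refine ⟨e ∘ L, he.comp L.toHomeomorph.isOpenEmbedding, by simp [h0], ?_⟩
  exact (range_comp_subset_range _ _).trans hr

theorem LocallyModelled.of_isLocalHomeomorph {E M M' : Type*} [NormedAddCommGroup E]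
    [NormedSpace ℝ E] [TopologicalSpace M] [TopologicalSpace M'] (h : LocallyModelled E M)
    {p : M' → M} (hp : IsLocalHomeomorph p) : LocallyModelled E M' := by
  intro m U hU
  obtain ⟨V, hVU, hV, hm⟩ := mem_nhds_iff.mp hU
  obtain ⟨φ, hφ, rfl⟩ := hp m
  have hφm := φ.map_source hφ
  have : φ.symm ⁻¹' V ∩ φ.target ∈ 𝓝 (φ m) := by
    refine Filter.inter_mem ?_ (φ.open_target.mem_nhds hφm)
    refine (φ.continuousAt_symm hφm).preimage_mem_nhds ?_
    rw [φ.left_inv hφ]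
    exact hV.mem_nhds hm
  obtain ⟨e, he, h0, hr⟩ := h _ _ this
  have hs : (he.toOpenPartialHomeomorph.trans φ.symm).source = univ := by
    rw [OpenPartialHomeomorph.trans_source, IsOpenEmbedding.toOpenPartialHomeomorph_source,
      univ_inter]
    exact eq_univ_of_forall fun x => (hr (mem_range_self x)).2
  refine ⟨_, OpenPartialHomeomorph.isOpenEmbedding _ hs, ?_, ?_⟩
  · change φ.symm (e 0) = m
    rw [h0, φ.left_inv hφ]
  · rintro _ ⟨x, rfl⟩
    exact hVU (hr (mem_range_self x)).1

variable {E M : Type*} [NormedAddCommGroup E] [NormedSpace ℝ E] [TopologicalSpace M] [T2Space M]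

theorem LocallyModelled.isPreconnected_diff_finite (hM : LocallyModelled E M)
    (hE : 1 < Module.rank ℝ E) {S B : Set M} (hS : IsPreconnected S) (hSo : IsOpen S)
    (hB : B.Finite) : IsPreconnected (S \ B) := by
  induction B, hB using Set.Finite.induction_on with
  | empty => rwa [sdiff_empty]
  | @insert b B _ hB ih =>
    have : S \ insert b B = (S \ B) \ {b} := by
      ext; simp only [mem_sdiff, mem_insert_iff, mem_singleton_iff]; tauto
    rw [this]
    have hopen : IsOpen (S \ B) := hSo.sdiff hB.isClosed
    by_cases hb : b ∈ S \ B
    · obtain ⟨e, he, h0, hr⟩ := hM b _ (hopen.mem_nhds hb)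
      refine isPreconnected_diff_of_subset ih hopen he.isOpen_range isClosed_singleton hr ?_ ?_
      · rw [singleton_subset_iff, ← h0]; exact mem_range_self _
      · have : range e \ {b} = e '' {0}ᶜ := by
          rw [image_compl_eq_range_sdiff_image he.injective, image_singleton, h0]
        rw [this]
        exact (isConnected_compl_singleton_of_one_lt_rank hE (0 : E)).isPreconnected.image _
          he.continuous.continuousOn
    · rwa [sdiff_singleton_eq_self hb]

/-- A perturbation of the identity by a map of Lipschitz constant less than one is a
homeomorphism. -/
theorem exists_homeomorph_of_lipschitzWith [CompleteSpace E] {f : E → E} {c : NNReal} (hc : c < 1)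
    (hf : LipschitzWith c f) : ∃ h : E ≃ₜ E, ∀ x, h x = x + f x := by
  rcases subsingleton_or_nontrivial E with hs | hn
  · exact ⟨Homeomorph.refl E, fun x => Subsingleton.elim _ _⟩
  have hf' : ApproximatesLinearOn (fun x => x + f x)
      ((ContinuousLinearEquiv.refl ℝ E : E ≃L[ℝ] E) : E →L[ℝ] E) univ c := by
    rw [ApproximatesLinearOn.approximatesLinearOn_iff_lipschitzOnWith]
    have : (fun x => x + f x) - ⇑((ContinuousLinearEquiv.refl ℝ E : E ≃L[ℝ] E) : E →L[ℝ] E) = f :=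
      funext fun x => by simp
    rw [this]
    exact hf.lipschitzOnWith
  have hc' : Subsingleton E ∨ c <
      ‖(((ContinuousLinearEquiv.refl ℝ E : E ≃L[ℝ] E).symm : E ≃L[ℝ] E) : E →L[ℝ] E)‖₊⁻¹ := by
    right
    have : ‖(((ContinuousLinearEquiv.refl ℝ E : E ≃L[ℝ] E).symm : E ≃L[ℝ] E) : E →L[ℝ] E)‖₊ = 1 :=
      NNReal.eq ContinuousLinearMap.norm_id
    rwa [this, inv_one]
  exact ⟨hf'.toHomeomorph _ hc', fun x => rfl⟩

/-- A homeomorphism supported in the unit ball that moves the origin to a given point of the open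
unit ball. -/
theorem exists_homeomorph_push [CompleteSpace E] {a : E} (ha : ‖a‖ < 1) :
    ∃ h : E ≃ₜ E, h 0 = a ∧ ∀ x ∉ Metric.closedBall (0 : E) 1, h x = x := by
  have hf : LipschitzWith ‖a‖₊ fun x : E => max 0 (1 - ‖x‖) • a := by
    refine LipschitzWith.of_dist_le_mul fun x y => ?_
    rw [dist_eq_norm, ← sub_smul, norm_smul, mul_comm, coe_nnnorm]
    gcongr
    rw [dist_eq_norm]
    calc ‖max 0 (1 - ‖x‖) - max 0 (1 - ‖y‖)‖ ≤ |(1 - ‖x‖) - (1 - ‖y‖)| := by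
          rw [Real.norm_eq_abs, max_comm 0, max_comm 0]
          exact abs_max_sub_max_le_abs _ _ _
      _ = |‖y‖ - ‖x‖| := by congr 1; ring
      _ ≤ ‖y - x‖ := abs_norm_sub_norm_le _ _
      _ = ‖x - y‖ := norm_sub_rev _ _
  obtain ⟨h, hh⟩ := exists_homeomorph_of_lipschitzWith (show ‖a‖₊ < 1 from ha) hf
  refine ⟨h, by simp [hh], fun x hx => ?_⟩
  rw [mem_closedBall_zero_iff, not_le] at hx
  rw [hh, max_eq_left (by linarith), zero_smul, add_zero]

/-- A homeomorphism supported in the ball of radius `4` that expands the ball of radius `2` by a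
definite factor. -/
theorem exists_homeomorph_expand [CompleteSpace E] :
    ∃ h : E ≃ₜ E, h 0 = 0 ∧ (∀ x ∉ Metric.closedBall (0 : E) 4, h x = x) ∧
      ∀ x, ‖h x‖ ≤ 2 → ‖x‖ ≤ 8 / 9 * ‖h x‖ := by
  have key : ∀ x y : E, ‖y‖ ≤ 4 →
      ‖max 0 (1 - ‖x‖ / 4) • x - max 0 (1 - ‖y‖ / 4) • y‖ ≤ 2 * ‖x - y‖ := by
    intro x y hy
    have h1 : max 0 (1 - ‖x‖ / 4) • x - max 0 (1 - ‖y‖ / 4) • y =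
        max 0 (1 - ‖x‖ / 4) • (x - y) + (max 0 (1 - ‖x‖ / 4) - max 0 (1 - ‖y‖ / 4)) • y := by
      module
    have h2 : ‖max 0 (1 - ‖x‖ / 4)‖ ≤ 1 := by
      rw [Real.norm_of_nonneg (le_max_left _ _)]
      exact max_le zero_le_one (by linarith [norm_nonneg x])
    have h3 : ‖max 0 (1 - ‖x‖ / 4) - max 0 (1 - ‖y‖ / 4)‖ ≤ ‖x - y‖ / 4 := by
      calc _ ≤ |(1 - ‖x‖ / 4) - (1 - ‖y‖ / 4)| := by
            rw [Real.norm_eq_abs, max_comm 0, max_comm 0]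
            exact abs_max_sub_max_le_abs _ _ _
        _ = |‖y‖ - ‖x‖| / 4 := by
            rw [← abs_of_pos (show (0 : ℝ) < 4 by norm_num), ← abs_div]
            congr 1
            rw [abs_of_pos (show (0 : ℝ) < 4 by norm_num)]
            ring
        _ ≤ ‖x - y‖ / 4 := by
            rw [norm_sub_rev]
            gcongr
            exact abs_norm_sub_norm_le _ _
    rw [h1]
    refine (norm_add_le _ _).trans ?_
    rw [norm_smul, norm_smul]
    calc _ ≤ 1 * ‖x - y‖ + ‖x - y‖ / 4 * 4 := by gcongr
      _ = _ := by ring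
  have hf : LipschitzWith (1 / 2) fun x : E => (1 / 4 : ℝ) • max 0 (1 - ‖x‖ / 4) • x := by
    refine LipschitzWith.of_dist_le_mul fun x y => ?_
    rw [dist_eq_norm, dist_eq_norm, ← smul_sub, norm_smul]
    have : ‖max 0 (1 - ‖x‖ / 4) • x - max 0 (1 - ‖y‖ / 4) • y‖ ≤ 2 * ‖x - y‖ := by
      by_cases hy : ‖y‖ ≤ 4
      · exact key x y hy
      by_cases hx : ‖x‖ ≤ 4
      · rw [norm_sub_rev, norm_sub_rev x]
        exact key y x hx
      · rw [max_eq_left (by linarith), max_eq_left (by linarith)]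
        simp
    norm_num
    linarith
  obtain ⟨h, hh⟩ := exists_homeomorph_of_lipschitzWith
    (show (1 / 2 : NNReal) < 1 from NNReal.half_lt_self one_ne_zero) hf
  have hnorm : ∀ x, ‖h x‖ = (1 + 1 / 4 * max 0 (1 - ‖x‖ / 4)) * ‖x‖ := by
    intro x
    have : h x = (1 + 1 / 4 * max 0 (1 - ‖x‖ / 4) : ℝ) • x := by
      rw [hh]
      module
    rw [this, norm_smul, Real.norm_of_nonneg (by positivity)]
  refine ⟨h, by simp [hh], fun x hx => ?_, fun x hx => ?_⟩
  · rw [mem_closedBall_zero_iff, not_le] at hx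
    rw [hh, max_eq_left (by linarith), zero_smul, smul_zero, add_zero]
  · have h0 := norm_nonneg x
    have h2 : ‖x‖ ≤ 2 := by
      rw [hnorm] at hx
      nlinarith [le_max_left 0 (1 - ‖x‖ / 4)]
    rw [hnorm, max_eq_right (by linarith)]
    nlinarith

/-- Any ball can be blown up to contain the ball of radius `2` by a compactly supported
homeomorphism. -/
theorem exists_homeomorph_blowup [CompleteSpace E] {ε : ℝ} (hε : 0 < ε) :
    ∃ h : E ≃ₜ E, h 0 = 0 ∧ (∀ x ∉ Metric.closedBall (0 : E) 4, h x = x) ∧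
      ∀ x, ‖h x‖ ≤ 2 → ‖x‖ < ε := by
  obtain ⟨h, h0, hid, hexp⟩ := exists_homeomorph_expand (E := E)
  have key : ∀ N : ℕ, ∃ k : E ≃ₜ E, k 0 = 0 ∧ (∀ x ∉ Metric.closedBall (0 : E) 4, k x = x) ∧
      ∀ x, ‖k x‖ ≤ 2 → ‖x‖ ≤ (8 / 9) ^ N * 2 := by
    intro N
    induction N with
    | zero => exact ⟨Homeomorph.refl E, rfl, fun x _ => rfl, fun x hx => by simpa using hx⟩
    | succ N ih =>
      obtain ⟨k, k0, kid, kexp⟩ := ih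
      refine ⟨h.trans k, by simp [h0, k0], fun x hx => ?_, fun x hx => ?_⟩
      · rw [Homeomorph.trans_apply, hid x hx, kid x hx]
      · have h1 := kexp (h x) hx
        have h2 : ((8 : ℝ) / 9) ^ N ≤ 1 := pow_le_one₀ (by norm_num) (by norm_num)
        have h3 := hexp x (by linarith)
        rw [pow_succ]
        linarith
  obtain ⟨N, hN⟩ := exists_pow_lt_of_lt_one (half_pos hε) (show (8 / 9 : ℝ) < 1 by norm_num)
  obtain ⟨k, k0, kid, kexp⟩ := key N
  exact ⟨k, k0, kid, fun x hx => by linarith [kexp x hx]⟩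

/-- In a connected manifold of dimension at least two, a point can be moved to any other by a
homeomorphism fixing given finitely many further points. -/
theorem LocallyModelled.exists_homeomorph_fixing [FiniteDimensional ℝ E] [ConnectedSpace M]
    (hM : LocallyModelled E M) (hE : 1 < Module.rank ℝ E) {B : Set M} (hB : B.Finite) {a c : M}
    (ha : a ∉ B) (hc : c ∉ B) :
    ∃ H : M ≃ₜ M, H a = c ∧ ∀ b ∈ B, H b = b := by
  have : CompleteSpace E := FiniteDimensional.complete ℝ E
  have : ProperSpace E := FiniteDimensional.proper ℝ E
  have hpre : IsPreconnected Bᶜ := by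
    rw [compl_eq_univ_sdiff]
    exact hM.isPreconnected_diff_finite hE isPreconnected_univ isOpen_univ hB
  refine hpre.induction₂ (fun a c => ∃ H : M ≃ₜ M, H a = c ∧ ∀ b ∈ B, H b = b) ?_ ?_ ?_ ha hc
  · intro x hx
    obtain ⟨e, he, h0, hr⟩ := hM x _ (hB.isClosed.isOpen_compl.mem_nhds hx)
    have hopen : e '' Metric.ball 0 1 ∈ 𝓝 x :=
      (he.isOpenMap _ Metric.isOpen_ball).mem_nhds ⟨0, by simp, h0⟩
    refine Filter.Eventually.filter_mono nhdsWithin_le_nhds ?_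
    filter_upwards [hopen]
    rintro _ ⟨y, hy, rfl⟩
    obtain ⟨h, hh0, hh⟩ := exists_homeomorph_push (mem_ball_zero_iff.mp hy)
    obtain ⟨H, hHe, hH⟩ := exists_homeomorph_extend he h (isCompact_closedBall _ _) hh
    refine ⟨H, by rw [← h0, hHe, hh0], fun b hb => hH b ?_⟩
    rintro ⟨z, -, rfl⟩
    exact hr (mem_range_self z) hb
  · rintro x y z - - - ⟨H, h1, h2⟩ ⟨H', h1', h2'⟩
    exact ⟨H.trans H', by simp [h1, h1'], fun b hb => by simp [h2 b hb, h2' b hb]⟩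
  · rintro x y - - ⟨H, h1, h2⟩
    exact ⟨H.symm, by rw [← h1]; simp, fun b hb => by rw [Homeomorph.symm_apply_eq, h2 b hb]⟩

/-- Connected manifolds of dimension at least two are homogeneous for finite families of points. -/
theorem LocallyModelled.exists_homeomorph_family [FiniteDimensional ℝ E] [ConnectedSpace M]
    (hM : LocallyModelled E M) (hE : 1 < Module.rank ℝ E) {n : ℕ} (a c : Fin n → M)
    (ha : Function.Injective a) (hc : Function.Injective c) :
    ∃ H : M ≃ₜ M, ∀ i, H (a i) = c i := by
  induction n with
  | zero => exact ⟨Homeomorph.refl M, fun i => i.elim0⟩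
  | succ n ih =>
    obtain ⟨H, hH⟩ := ih (a ∘ Fin.castSucc) (c ∘ Fin.castSucc)
      (ha.comp (Fin.castSucc_injective n)) (hc.comp (Fin.castSucc_injective n))
    obtain ⟨H', h1, h2⟩ := hM.exists_homeomorph_fixing hE (B := range (c ∘ Fin.castSucc))
      (finite_range _) (a := H (a (Fin.last n))) (c := c (Fin.last n)) (by
        rintro ⟨i, hi⟩
        rw [← hH i] at hi
        exact absurd (ha (H.injective hi)) (Fin.castSucc_lt_last i).ne) (by
        rintro ⟨i, hi⟩
        exact absurd (hc hi) (Fin.castSucc_lt_last i).ne)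
    refine ⟨H.trans H', fun i => ?_⟩
    induction i using Fin.lastCases with
    | last => exact h1
    | cast i =>
      have := hH i
      simp only [Function.comp] at this
      rw [Homeomorph.trans_apply, this]
      exact h2 _ ⟨i, rfl⟩

/-- In a connected surface there is a disc in which given finitely many points lie on distinct rays
from the centre. -/
theorem LocallyModelled.exists_rays [ConnectedSpace M] (hM : LocallyModelled ℂ M) {n : ℕ}
    (c : Fin n → M) (hc : Function.Injective c) :
    ∃ e : ℂ → M, IsOpenEmbedding e ∧ ∀ i : Fin n, e (1 + (i : ℕ) * Complex.I) = c i := by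
  obtain ⟨e, he, -⟩ := hM (Classical.arbitrary M) univ Filter.univ_mem
  have hrank : (1 : Cardinal) < Module.rank ℝ ℂ := by
    rw [Complex.rank_real_complex]
    exact Cardinal.one_lt_two
  obtain ⟨H, hH⟩ := hM.exists_homeomorph_family hrank
    (fun i : Fin n => e (1 + (i : ℕ) * Complex.I)) c (fun i j hij => by
      have := congrArg Complex.im (he.injective hij)
      simp at this
      exact Fin.ext this) hc
  exact ⟨H ∘ e, H.isOpenEmbedding.comp he, hH⟩

end Homogeneity

/-! ### Stars of arcs that end on the tubes -/

section Stars

open Topology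

variable {n : ℕ} {S M : Type*} [TopologicalSpace S] [TopologicalSpace M]

/-- A star with `n` arms in `M`: the arms `Γ i`, parametrized by the unit interval, have their
initial point in common and are disjoint otherwise. The values of `Γ i` off the unit interval are
irrelevant. -/
structure IsStar (Γ : Fin n → ℝ → M) : Prop where
  continuous : ∀ i, Continuous (Γ i)
  start : ∀ i k, Γ i 0 = Γ k 0
  inj : ∀ i k, ∀ s ∈ Icc (0 : ℝ) 1, ∀ t ∈ Icc (0 : ℝ) 1, Γ i s = Γ k t → s = t ∧ (i = k ∨ s = 0)

/-- The `i`-th arm of the star `Γ` ends on the core `Θ ((i, S), 0)` of the `i`-th tube, and the star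
does not meet the cores otherwise. -/
structure IsStarToCores (Θ : (Fin n × S) × ℂ → M) (Γ : Fin n → ℝ → M) : Prop extends IsStar Γ where
  last : ∀ i, ∃ x, Γ i 1 = Θ ((i, x), 0)
  avoid : ∀ i k x, ∀ s ∈ Icc (0 : ℝ) 1, Γ i s = Θ ((k, x), 0) → s = 1

/-- The `i`-th arm of the star `Γ` ends at the point `Θ ((i, x₀), 1)` of the boundary of the `i`-th
tube of radius one, and the star does not meet these tubes otherwise. -/
structure IsStarToTubes (Θ : (Fin n × S) × ℂ → M) (x₀ : S) (Γ : Fin n → ℝ → M) : Prop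
    extends IsStar Γ where
  last : ∀ i, Γ i 1 = Θ ((i, x₀), 1)
  avoid : ∀ i k x v, ∀ s ∈ Icc (0 : ℝ) 1, Γ i s = Θ ((k, x), v) → ‖v‖ ≤ 1 →
    i = k ∧ s = 1 ∧ x = x₀ ∧ v = 1

/-- Thin tubes about the cores meet the star in their own arms only, and off its initial point.
Instead of the tubes, the star is changed here, by a homeomorphism that blows the thin tubes up. -/
theorem IsStarToCores.exists_thin [CompactSpace S] [T2Space M] {Θ : (Fin n × S) × ℂ → M}
    (hΘ : IsOpenEmbedding Θ) {Γ : Fin n → ℝ → M} (h : IsStarToCores Θ Γ) :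
    ∃ Γ' : Fin n → ℝ → M, IsStarToCores Θ Γ' ∧
      ∀ i k x v, ∀ s ∈ Icc (0 : ℝ) 1, Γ' i s = Θ ((k, x), v) → ‖v‖ ≤ 2 → i = k ∧ s ≠ 0 := by
  have hinj := hΘ.injective
  -- off the core of the `k`-th tube: the initial point and the other arms
  let D : Fin n → Set M := fun k =>
    (⋃ i ∈ {i | i ≠ k}, Γ i '' Icc 0 1) ∪ ⋃ i, {Γ i 0}
  have hD : ∀ k, IsClosed (D k) := fun k => by
    refine IsClosed.union ?_ (isClosed_iUnion_of_finite fun i => isClosed_singleton)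
    exact (Set.toFinite _).isClosed_biUnion fun i _ =>
      (isCompact_Icc.image (h.continuous i)).isClosed
  have hO : IsOpen {p : (Fin n × S) × ℂ | Θ p ∉ D p.1.1} := by
    have : {p : (Fin n × S) × ℂ | Θ p ∉ D p.1.1} =
        ⋃ k, {p | p.1.1 = k} ∩ Θ ⁻¹' (D k)ᶜ := by
      ext p; simp
    rw [this]
    refine isOpen_iUnion fun k => IsOpen.inter ?_ ((hD k).isOpen_compl.preimage hΘ.continuous)
    exact (isOpen_discrete {k}).preimage (f := fun p : (Fin n × S) × ℂ => p.1.1) (by fun_prop)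
  have hcore : (univ : Set (Fin n × S)) ×ˢ {(0 : ℂ)} ⊆ {p : (Fin n × S) × ℂ | Θ p ∉ D p.1.1} := by
    rintro ⟨⟨k, x⟩, v⟩ ⟨-, rfl⟩ hmem
    rcases hmem with hmem | hmem
    · simp only [mem_iUnion] at hmem
      obtain ⟨i, hi, s, hs, hΓ⟩ := hmem
      have h1 := h.avoid i k x s hs hΓ
      obtain ⟨y, hy⟩ := h.last i
      rw [h1, hy] at hΓ
      have := hinj hΓ
      simp only [Prod.mk.injEq] at this
      exact hi this.1.1
    · simp only [mem_iUnion] at hmem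
      obtain ⟨i, hΓ⟩ := hmem
      exact zero_ne_one (h.avoid i k x 0 ⟨le_rfl, zero_le_one⟩ hΓ.symm)
  obtain ⟨A, V, -, hV, hA, h0V, hAV⟩ :=
    generalized_tube_lemma isCompact_univ isCompact_singleton hO hcore
  obtain ⟨ε, hε, hball⟩ := Metric.isOpen_iff.mp hV 0 (h0V rfl)
  obtain ⟨k, k0, kid, kblow⟩ := exists_homeomorph_blowup (E := ℂ) hε
  obtain ⟨H, hHΘ, -⟩ := exists_homeomorph_extend hΘ ((Homeomorph.refl (Fin n × S)).prodCongr k)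
    (isCompact_univ.prod (isCompact_closedBall (0 : ℂ) 4)) (by
      rintro ⟨q, v⟩ hq
      change (q, k v) = (q, v)
      rw [kid v fun hv => hq ⟨trivial, hv⟩])
  have hHΘ' : ∀ q v, H (Θ (q, v)) = Θ (q, k v) := fun q v => hHΘ (q, v)
  have hback : ∀ i s q v, H (Γ i s) = Θ (q, v) → Γ i s = Θ (q, k.symm v) := by
    intro i s q v hs
    apply H.injective
    rw [hs, hHΘ', k.apply_symm_apply]
  refine ⟨fun i s => H (Γ i s), ⟨⟨fun i => H.continuous.comp (h.continuous i),
    fun i j => congrArg H (h.start i j), fun i j s hs t ht hst =>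
      h.inj i j s hs t ht (H.injective hst)⟩, fun i => ?_, fun i j x s hs hst => ?_⟩, ?_⟩
  · obtain ⟨x, hx⟩ := h.last i
    exact ⟨x, by rw [hx, hHΘ', k0]⟩
  · refine h.avoid i j x s hs ?_
    rw [hback _ _ _ _ hst, show k.symm 0 = 0 by rw [Homeomorph.symm_apply_eq, k0]]
  · intro i j x v s hs hst hv
    have h1 := hback _ _ _ _ hst
    have h2 : ‖k.symm v‖ < ε := kblow _ (by rwa [k.apply_symm_apply])
    have h3 : Θ ((j, x), k.symm v) ∉ D j :=
      hAV (⟨hA trivial, hball (by rwa [mem_ball_zero_iff])⟩ :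
        ((j, x), k.symm v) ∈ A ×ˢ V)
    rw [← h1] at h3
    constructor
    · by_contra hij
      exact h3 (.inl (mem_iUnion₂.mpr ⟨i, hij, s, hs, rfl⟩))
    · rintro rfl
      exact h3 (.inr (mem_iUnion.mpr ⟨i, rfl⟩))

/-- A star ending on the cores of tubes gives one that ends at given points of the tubes: blow the
tubes up until the `i`-th one meets the `i`-th arm only, cut the arm where it enters the tube, and
continue it inside the tube with decreasing radius. -/
theorem IsStarToCores.exists_isStarToTubes [CompactSpace S] [PathConnectedSpace S] [T2Space M]
    {Θ : (Fin n × S) × ℂ → M} (hΘ : IsOpenEmbedding Θ) {Γ₀ : Fin n → ℝ → M}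
    (h₀ : IsStarToCores Θ Γ₀) (x₀ : S) :
    ∃ γ : Fin n → ℝ → M, IsStarToTubes Θ x₀ γ := by
  obtain ⟨Γ, h, hthin⟩ := h₀.exists_thin hΘ
  have hinj := hΘ.injective
  have hfirst : ∀ i, ∃ (s₀ : ℝ) (x : S) (v : ℂ), s₀ ∈ Ioc (0 : ℝ) 1 ∧ ‖v‖ = 2 ∧
      Γ i s₀ = Θ ((i, x), v) ∧ ∀ s, 0 ≤ s → s < s₀ → ∀ k x v, Γ i s = Θ ((k, x), v) → 2 < ‖v‖ := by
    intro i
    let A : Set M := Θ '' (({i} ×ˢ univ) ×ˢ Metric.closedBall 0 2)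
    have hA : IsClosed A :=
      (((isCompact_singleton.prod isCompact_univ).prod
        (isCompact_closedBall _ _)).image hΘ.continuous).isClosed
    have hcomp : IsCompact (Icc (0 : ℝ) 1 ∩ Γ i ⁻¹' A) :=
      isCompact_Icc.inter_right (hA.preimage (h.continuous i))
    have hne : (Icc (0 : ℝ) 1 ∩ Γ i ⁻¹' A).Nonempty := by
      obtain ⟨x, hx⟩ := h.last i
      exact ⟨1, ⟨zero_le_one, le_rfl⟩, ((i, x), 0), ⟨⟨rfl, trivial⟩, by simp⟩, hx.symm⟩
    obtain ⟨s₀, ⟨hs₀, ⟨⟨k, x⟩, v⟩, ⟨⟨rfl, -⟩, hv⟩, hΓ⟩, hleast⟩ := hcomp.exists_isLeast hne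
    rw [mem_closedBall_zero_iff] at hv
    have hpos : 0 < s₀ := lt_of_le_of_ne hs₀.1 (hthin _ _ _ _ _ hs₀ hΓ.symm hv).2.symm
    have hbefore : ∀ s, 0 ≤ s → s < s₀ → ∀ k' x v, Γ k s = Θ ((k', x), v) → 2 < ‖v‖ := by
      intro s hs hss k' x' v' hst
      by_contra! hv'
      have hs1 : s ∈ Icc (0 : ℝ) 1 := ⟨hs, hss.le.trans hs₀.2⟩
      obtain ⟨rfl, -⟩ := hthin _ _ _ _ _ hs1 hst hv'
      exact absurd (hleast ⟨hs1, ((k, x'), v'), ⟨⟨rfl, trivial⟩, by simpa using hv'⟩, hst.symm⟩)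
        (not_le.mpr hss)
    refine ⟨s₀, x, v, ⟨hpos, hs₀.2⟩, ?_, hΓ.symm, hbefore⟩
    by_contra hne2
    have hlt : ‖v‖ < 2 := lt_of_le_of_ne hv hne2
    have hopen : IsOpen (Θ '' (univ ×ˢ Metric.ball 0 2)) :=
      hΘ.isOpenMap _ (isOpen_univ.prod Metric.isOpen_ball)
    have hnear : ∀ᶠ s in 𝓝[<] s₀, Γ k s ∈ Θ '' (univ ×ˢ Metric.ball 0 2) :=
      ((h.continuous k).continuousAt.eventually_mem (hopen.mem_nhds
        ⟨_, ⟨trivial, by simpa using hlt⟩, hΓ⟩)).filter_mono nhdsWithin_le_nhds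
    have hnear2 : ∀ᶠ s in 𝓝[<] s₀, s ∈ Ioo 0 s₀ := Ioo_mem_nhdsLT hpos
    obtain ⟨s, ⟨⟨⟨k', x'⟩, v'⟩, ⟨-, hv'⟩, hs⟩, hs0, hss⟩ := (hnear.and hnear2).exists
    have := hbefore s hs0.le hss _ _ _ hs.symm
    rw [mem_ball_zero_iff] at hv'
    linarith
  choose s₀ x v hs₀ hv hΓ hbefore using hfirst
  have hunit : ∀ i, ∃ ζ : Circle, v i = 2 * (ζ : ℂ) := by
    intro i
    refine ⟨⟨v i / 2, mem_sphere_zero_iff_norm.mpr (by simp [hv i])⟩, ?_⟩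
    change v i = 2 * (v i / 2)
    ring
  choose ζ hζ using hunit
  let δ : ∀ i, Path (x i) x₀ := fun i => PathConnectedSpace.somePath _ _
  let η : ∀ i, Path (ζ i) 1 := fun i => PathConnectedSpace.somePath _ _
  let inner : Fin n → ℝ → M := fun i t =>
    Θ ((i, (δ i).extend (2 * t - 1)), ((3 - 2 * t : ℝ) : ℂ) * ((η i).extend (2 * t - 1) : ℂ))
  have hinner : ∀ i, Continuous (inner i) := fun i => by
    refine hΘ.continuous.comp ?_
    have h1 : Continuous fun t : ℝ => (δ i).extend (2 * t - 1) :=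
      (δ i).continuous_extend.comp (by fun_prop)
    have h2 : Continuous fun t : ℝ => (η i).extend (2 * t - 1) :=
      (η i).continuous_extend.comp (by fun_prop)
    fun_prop
  have hmid : ∀ i, inner i (1 / 2) = Γ i (s₀ i) := by
    intro i
    simp only [inner]
    norm_num
    rw [hΓ, hζ]
  have hnorm : ∀ i t, t ≤ 1 →
      ‖((3 - 2 * t : ℝ) : ℂ) * ((η i).extend (2 * t - 1) : ℂ)‖ = 3 - 2 * t := by
    intro i t ht
    rw [norm_mul, Complex.norm_real, Circle.norm_coe, mul_one, Real.norm_of_nonneg (by linarith)]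
  let γ : Fin n → ℝ → M := fun i t => if t ≤ 1 / 2 then Γ i (2 * s₀ i * t) else inner i t
  have hlow : ∀ i t, t ≤ 1 / 2 → γ i t = Γ i (2 * s₀ i * t) := fun i t ht => if_pos ht
  have hhigh : ∀ i t, 1 / 2 ≤ t → γ i t = inner i t := by
    intro i t ht
    rcases ht.eq_or_lt with rfl | ht
    · rw [hlow i _ le_rfl, hmid]
      congr 1
      ring
    · exact if_neg (not_le.mpr ht)
  have hrange : ∀ i, ∀ t ∈ Icc (0 : ℝ) 1, t ≤ 1 / 2 → 2 * s₀ i * t ∈ Icc (0 : ℝ) 1 := by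
    intro i t ht ht2
    have := hs₀ i
    have h1 : 0 ≤ 2 * s₀ i * t := mul_nonneg (by linarith [this.1]) ht.1
    exact ⟨h1, by nlinarith [this.1, this.2, ht.1]⟩
  have hlowtube : ∀ i t, 0 ≤ t → t < 1 / 2 → ∀ k x v, γ i t = Θ ((k, x), v) → 2 < ‖v‖ := by
    intro i t ht0 ht k x v hst
    rw [hlow i t ht.le] at hst
    have := (hs₀ i).1
    exact hbefore i _ (by positivity) (by nlinarith) _ _ _ hst
  have hcross : ∀ i k, ∀ s t : ℝ, 0 ≤ s → s < 1 / 2 → 1 / 2 ≤ t → t ≤ 1 → γ i s ≠ γ k t := by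
    intro i k s t hs hs2 ht ht1 hst
    rw [hhigh k t ht] at hst
    have := hlowtube i s hs hs2 _ _ _ hst
    rw [hnorm k t ht1] at this
    linarith
  refine ⟨γ, ⟨⟨fun i => ?_, fun i k => ?_, ?_⟩,
    fun i => ?_, ?_⟩⟩
  · refine Continuous.if_le ((h.continuous i).comp (by fun_prop)) (hinner i) continuous_id
      continuous_const ?_
    rintro t rfl
    rw [hmid]
    congr 1
    ring
  · rw [hlow i 0 (by norm_num), hlow k 0 (by norm_num), mul_zero, mul_zero]
    exact h.start i k
  · intro i k s hs t ht hst
    rcases lt_or_ge s (1 / 2) with hs2 | hs2 <;> rcases lt_or_ge t (1 / 2) with ht2 | ht2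
    · rw [hlow i s hs2.le, hlow k t ht2.le] at hst
      obtain ⟨h1, h2⟩ := h.inj i k _ (hrange i s hs hs2.le) _ (hrange k t ht ht2.le) hst
      rcases h2 with rfl | h2
      · have : 2 * s₀ i ≠ 0 := by linarith [(hs₀ i).1]
        exact ⟨mul_left_cancel₀ this h1, .inl rfl⟩
      · have hi : 2 * s₀ i ≠ 0 := by linarith [(hs₀ i).1]
        have hk : 2 * s₀ k ≠ 0 := by linarith [(hs₀ k).1]
        have hs0 : s = 0 := by simpa [hi] using h2
        have ht0 : t = 0 := by
          rw [h2] at h1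
          simpa [hk] using h1.symm
        exact ⟨by rw [hs0, ht0], .inr hs0⟩
    · exact absurd hst (hcross i k s t hs.1 hs2 ht2 ht.2)
    · exact absurd hst.symm (hcross k i t s ht.1 ht2 hs2 hs.2)
    · rw [hhigh i s hs2, hhigh k t ht2] at hst
      have := hinj hst
      simp only [Prod.mk.injEq] at this
      have hn := congrArg norm this.2
      rw [hnorm i s hs.2, hnorm k t ht.2] at hn
      exact ⟨by linarith, .inl this.1.1⟩
  · rw [hhigh i 1 (by norm_num)]
    simp only [inner]
    norm_num
  · intro i k y w s hs hst hw
    rcases lt_or_ge s (1 / 2) with hs2 | hs2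
    · linarith [hlowtube i s hs.1 hs2 _ _ _ hst]
    · rw [hhigh i s hs2] at hst
      have := hinj hst
      simp only [Prod.mk.injEq] at this
      obtain ⟨⟨h1, h2⟩, h3⟩ := this
      have hn := congrArg norm h3
      rw [hnorm i s hs.2] at hn
      have hs1 : s = 1 := by linarith [hs.2]
      subst hs1
      refine ⟨h1, rfl, ?_, ?_⟩
      · rw [← h2]; norm_num
      · rw [← h3]; norm_num

/-- Tietze extension of a function given on the image of a compact space. -/
theorem exists_extension_of_compactSpace {Z M : Type*} [TopologicalSpace Z] [CompactSpace Z]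
    [TopologicalSpace M] [CompactSpace M] [T2Space M] {f : Z → M} (hf : Continuous f) {u : Z → ℝ}
    (hu : Continuous u) (hu01 : ∀ z, u z ∈ Icc (0 : ℝ) 1) (huf : ∀ z z', f z = f z' → u z = u z') :
    ∃ U : C(M, ℝ), (∀ m, U m ∈ Icc (0 : ℝ) 1) ∧ ∀ z, U (f z) = u z := by
  let q : Z → range f := rangeFactorization f
  have hq : IsQuotientMap q :=
    (hf.subtype_mk _).isClosedMap.isQuotientMap (hf.subtype_mk _) rangeFactorization_surjective
  have hclosed : IsClosed (range f) := (isCompact_range hf).isClosed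
  have hqu : ∀ z z', q z = q z' → u z = u z' := fun z z' h => huf z z' (congrArg Subtype.val h)
  let g : C(range f, ℝ) := IsQuotientMap.lift (f := ⟨q, hq.continuous⟩) hq ⟨u, hu⟩ hqu
  have hg : ∀ z, g (q z) = u z := fun z =>
    DFunLike.congr_fun (IsQuotientMap.lift_comp (f := ⟨q, hq.continuous⟩) hq ⟨u, hu⟩ hqu) z
  obtain ⟨U, hU, hUg⟩ := g.exists_restrict_eq_forall_mem_of_closed (t := Icc (0 : ℝ) 1)
    (by rintro ⟨_, z, rfl⟩; exact (hg z) ▸ hu01 z) ⟨0, by simp⟩ hclosed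
  refine ⟨U, hU, fun z => ?_⟩
  rw [← hg z, ← hUg]
  rfl

/-- A star ending on tubes is a retract: there are coordinate functions on the whole space whose
pairwise products vanish and which restrict to the coordinates of the star. -/
theorem IsStarToTubes.exists_coordinates [CompactSpace S] [CompactSpace M] [T2Space M]
    {Θ : (Fin n × S) × ℂ → M} (hΘ : IsOpenEmbedding Θ) {x₀ : S} {γ : Fin n → ℝ → M}
    (h : IsStarToTubes Θ x₀ γ) :
    ∃ U : Fin n → C(M, ℝ), (∀ i m, U i m ∈ Icc (0 : ℝ) 1) ∧
      (∀ i k m, i ≠ k → U i m * U k m = 0) ∧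
      (∀ i k, ∀ s ∈ Icc (0 : ℝ) 1, U i (γ k s) = if i = k then s else 0) ∧
      ∀ i x v, ‖v‖ ≤ 1 → U i (Θ ((i, x), v)) = 1 := by
  let Z := (Fin n × unitInterval) ⊕ ((Fin n × S) × Metric.closedBall (0 : ℂ) 1)
  let f : Z → M := Sum.elim (fun p => γ p.1 p.2) (fun p => Θ (p.1, p.2))
  have hf : Continuous f := by
    refine Continuous.sumElim ?_ (hΘ.continuous.comp (by fun_prop))
    exact continuous_prod_of_discrete_left.mpr fun i =>
      (h.continuous i).comp continuous_subtype_val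
  have hx : ∀ i, ∃ x : C(M, ℝ), (∀ m, x m ∈ Icc (0 : ℝ) 1) ∧
      (∀ k, ∀ s ∈ Icc (0 : ℝ) 1, x (γ k s) = if i = k then s else 0) ∧
      ∀ k y v, ‖v‖ ≤ 1 → x (Θ ((k, y), v)) = if i = k then 1 else 0 := by
    intro i
    let u : Z → ℝ := Sum.elim (fun p => if i = p.1 then (p.2 : ℝ) else 0)
      (fun p => if i = p.1.1 then 1 else 0)
    have hu : Continuous u := by
      refine Continuous.sumElim ?_ ?_
      · refine continuous_prod_of_discrete_left.mpr fun k => ?_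
        by_cases hik : i = k
        · simpa [hik] using continuous_subtype_val
        · simpa [hik] using continuous_const
      · exact (continuous_of_discreteTopology (f := fun k : Fin n =>
          if i = k then (1 : ℝ) else 0)).comp (by fun_prop)
    have hcross : ∀ (p : Fin n × unitInterval) (q : (Fin n × S) × Metric.closedBall (0 : ℂ) 1),
        f (.inl p) = f (.inr q) → u (.inl p) = u (.inr q) := by
      rintro ⟨k, s⟩ ⟨⟨k', y⟩, v⟩ hp
      obtain ⟨rfl, hs, -⟩ := h.avoid k k' y v s s.2 hp (mem_closedBall_zero_iff.mp v.2)
      simp [u, hs]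
    obtain ⟨x, hx01, hxf⟩ := exists_extension_of_compactSpace hf hu (by
      rintro (⟨k, s⟩ | ⟨⟨k, y⟩, v⟩)
      · by_cases hik : i = k
        · simp [u, hik]
        · simp [u, hik]
      · by_cases hik : i = k <;> simp [u, hik]) (by
      rintro (⟨k, s⟩ | q) (⟨k', s'⟩ | q') hz
      · obtain ⟨h1, h2⟩ := h.inj k k' s s.2 s' s'.2 hz
        rcases h2 with rfl | h2
        · simp only [u, Sum.elim_inl, h1]
        · rw [h2] at h1
          simp [u, h2, ← h1]
      · exact hcross _ _ hz
      · exact (hcross _ _ hz.symm).symm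
      · have := congrArg (fun p : (Fin n × S) × ℂ => p.1.1) (hΘ.injective hz)
        simp only at this
        simp only [u, Sum.elim_inr, this])
    exact ⟨x, hx01, fun k s hs => hxf (.inl (k, ⟨s, hs⟩)),
      fun k y v hv => hxf (.inr ((k, y), ⟨v, mem_closedBall_zero_iff.mpr hv⟩))⟩
  choose x hx01 hxγ hxΘ using hx
  have hsum : ∀ i m, 0 ≤ ∑ k ∈ Finset.univ.erase i, x k m := fun i m =>
    Finset.sum_nonneg fun k _ => (hx01 k m).1
  have hval : ∀ i m, max 0 (x i m - ∑ k ∈ Finset.univ.erase i, x k m) ∈ Icc (0 : ℝ) 1 :=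
    fun i m => ⟨le_max_left _ _, max_le zero_le_one (by linarith [hsum i m, (hx01 i m).2])⟩
  refine ⟨fun i => ⟨fun m => max 0 (x i m - ∑ k ∈ Finset.univ.erase i, x k m), by fun_prop⟩,
    hval, ?_, ?_, ?_⟩
  · intro i k m hik
    have h1 : x k m ≤ ∑ j ∈ Finset.univ.erase i, x j m :=
      Finset.single_le_sum (f := fun j => x j m) (fun j _ => (hx01 j m).1)
        (Finset.mem_erase.mpr ⟨hik.symm, Finset.mem_univ k⟩)
    have h2 : x i m ≤ ∑ j ∈ Finset.univ.erase k, x j m :=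
      Finset.single_le_sum (f := fun j => x j m) (fun j _ => (hx01 j m).1)
        (Finset.mem_erase.mpr ⟨hik, Finset.mem_univ i⟩)
    change max 0 _ * max 0 _ = (0 : ℝ)
    rcases le_total (x i m) (x k m) with hle | hle
    · rw [max_eq_left (by linarith), zero_mul]
    · rw [max_eq_left (a := (0 : ℝ)) (b := x k m - _) (by linarith), mul_zero]
  · intro i k s hs
    change max 0 (x i (γ k s) - ∑ j ∈ Finset.univ.erase i, x j (γ k s)) = _
    simp only [hxγ _ k s hs]
    by_cases hik : i = k
    · subst hik
      rw [Finset.sum_eq_zero fun j hj => if_neg (Finset.ne_of_mem_erase hj)]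
      simp [hs.1]
    · have : 0 ≤ ∑ j ∈ Finset.univ.erase i, (if j = k then s else 0) :=
        Finset.sum_nonneg fun j _ => by split_ifs <;> [exact hs.1; exact le_rfl]
      rw [if_neg hik, max_eq_left (by linarith)]
  · intro i y v hv
    change max 0 (x i (Θ ((i, y), v)) - ∑ j ∈ Finset.univ.erase i, x j (Θ ((i, y), v))) = _
    simp only [hxΘ _ i y v hv]
    rw [Finset.sum_eq_zero fun j hj => if_neg (Finset.ne_of_mem_erase hj)]
    simp

end Stars

/-! ### Stars in the two kinds of pieces -/

section StarConstructions

open Topology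

/-- The cores have codimension two and do not separate. -/
theorem isPreconnected_compl_cores {n : ℕ} {S M : Type*} [TopologicalSpace S] [CompactSpace S]
    [PreconnectedSpace S] [TopologicalSpace M] [T2Space M] [PreconnectedSpace M]
    {Θ : (Fin n × S) × ℂ → M} (hΘ : IsOpenEmbedding Θ) :
    IsPreconnected (range fun q => Θ (q, 0))ᶜ := by
  have hcore : ∀ k, IsClosed (range fun x => Θ ((k, x), 0)) := fun k => by
    have := hΘ.continuous
    exact (isCompact_range (by fun_prop)).isClosed
  have key : ∀ B : Finset (Fin n),
      IsPreconnected (univ \ ⋃ k ∈ B, range fun x => Θ ((k, x), 0)) := by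
    intro B
    induction B using Finset.induction_on with
    | empty => simpa using isPreconnected_univ
    | insert k B hk ih =>
      rw [Finset.set_biUnion_insert, union_comm, ← sdiff_sdiff]
      refine isPreconnected_diff_of_subset (U := Θ '' (({k} ×ˢ univ) ×ˢ univ)) ih
        (isOpen_univ.sdiff (isClosed_biUnion_finset fun k _ => hcore k))
        (hΘ.isOpenMap _ (((isOpen_discrete _).prod isOpen_univ).prod isOpen_univ)) (hcore k)
        ?_ ?_ ?_
      · rintro _ ⟨⟨⟨k', x⟩, v⟩, ⟨⟨rfl, -⟩, -⟩, rfl⟩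
        refine ⟨trivial, fun hmem => ?_⟩
        simp only [mem_iUnion] at hmem
        obtain ⟨i, hi, y, hy⟩ := hmem
        have := hΘ.injective hy
        simp only [Prod.mk.injEq] at this
        exact hk (this.1.1 ▸ hi)
      · rintro _ ⟨x, rfl⟩
        exact ⟨((k, x), 0), ⟨⟨rfl, trivial⟩, trivial⟩, rfl⟩
      · have : Θ '' (({k} ×ˢ univ) ×ˢ univ) \ (range fun x => Θ ((k, x), 0)) =
            Θ '' (({k} ×ˢ univ) ×ˢ {v : ℂ | v ≠ 0}) := by
          ext m
          constructor
          · rintro ⟨⟨⟨⟨k', x⟩, v⟩, ⟨⟨rfl, -⟩, -⟩, rfl⟩, hm⟩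
            refine ⟨_, ⟨⟨rfl, trivial⟩, ?_⟩, rfl⟩
            rintro rfl
            exact hm ⟨x, rfl⟩
          · rintro ⟨⟨⟨k', x⟩, v⟩, ⟨⟨rfl, -⟩, hv⟩, rfl⟩
            refine ⟨⟨_, ⟨⟨rfl, trivial⟩, trivial⟩, rfl⟩, ?_⟩
            rintro ⟨y, hy⟩
            have := hΘ.injective hy
            simp only [Prod.mk.injEq] at this
            exact hv this.2.symm
        rw [this]
        exact ((isPreconnected_singleton.prod isPreconnected_univ).prod
          isPreconnected_compl_zero).image _ hΘ.continuous.continuousOn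
  convert key Finset.univ using 1
  ext m
  simp

/-- An arm from a point near which the other arms wait to the core of a tube. -/
theorem exists_path_to_core {n : ℕ} {S N : Type*} [TopologicalSpace S] [CompactSpace S]
    [ConnectedSpace S] [TopologicalSpace N] [T2Space N] [ConnectedSpace N]
    [LocallyPathConnectedSpace N] {E : Type*} [NormedAddCommGroup E] [NormedSpace ℝ E]
    (hN : LocallyModelled E N) (hE : 1 < Module.rank ℝ E) {ϑ : (Fin n × S) × ℂ → N}
    (hϑ : IsOpenEmbedding ϑ) (i : Fin n) {B : Set N} (hB : B.Finite)
    (hBϑ : ∀ q v, ‖v‖ ≤ 1 → ϑ (q, v) ∉ B) {m : N} (hm : m ∉ B) (hmϑ : ∀ q, ϑ (q, 0) ≠ m) :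
    ∃ g : ℝ → N, Continuous g ∧ g 0 = m ∧ (∃ x, g 1 = ϑ ((i, x), 0)) ∧
      ∀ t ∈ Icc (0 : ℝ) 1, g t ∉ B ∧ ∀ q, g t = ϑ (q, 0) → t = 1 := by
  obtain ⟨s₀⟩ : Nonempty S := inferInstance
  have hcores : IsClosed (range fun q => ϑ (q, 0)) := by
    have := hϑ.continuous
    exact (isCompact_range (by fun_prop)).isClosed
  have hopen : IsOpen ((range fun q => ϑ (q, 0))ᶜ \ B) := hcores.isOpen_compl.sdiff hB.isClosed
  have hpre : IsPreconnected ((range fun q => ϑ (q, 0))ᶜ \ B) :=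
    hN.isPreconnected_diff_finite hE (isPreconnected_compl_cores hϑ) hcores.isOpen_compl hB
  have hmV : m ∈ (range fun q => ϑ (q, 0))ᶜ \ B := ⟨by rintro ⟨q, hq⟩; exact hmϑ q hq, hm⟩
  have hpath : IsPathConnected ((range fun q => ϑ (q, 0))ᶜ \ B) :=
    hopen.isConnected_iff_isPathConnected.mp ⟨⟨m, hmV⟩, hpre⟩
  have htV : ϑ ((i, s₀), 1) ∈ (range fun q => ϑ (q, 0))ᶜ \ B := by
    refine ⟨?_, hBϑ _ _ (by simp)⟩
    rintro ⟨q, hq⟩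
    have := hϑ.injective hq
    simp at this
  obtain ⟨δ, hδ⟩ := hpath.joinedIn m hmV _ htV
  let g : ℝ → N := fun t =>
    if t ≤ 1 / 2 then δ.extend (2 * t) else ϑ ((i, s₀), ((2 - 2 * t : ℝ) : ℂ))
  have hgcore : g 1 = ϑ ((i, s₀), 0) := by
    simp only [g]
    norm_num
  refine ⟨g, ?_, ?_, ⟨s₀, hgcore⟩, fun t ht => ?_⟩
  · have := hϑ.continuous
    refine Continuous.if_le (δ.continuous_extend.comp (by fun_prop)) (by fun_prop) continuous_id
      continuous_const ?_
    rintro t rfl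
    norm_num
  · simp only [g]
    norm_num
  · by_cases ht2 : t ≤ 1 / 2
    · have hg : g t = δ.extend (2 * t) := if_pos ht2
      have h2 : 2 * t ∈ Icc (0 : ℝ) 1 := ⟨by linarith [ht.1], by linarith⟩
      rw [hg, δ.extend_apply h2]
      have := hδ ⟨2 * t, h2⟩
      exact ⟨this.2, fun q hq => absurd ⟨q, hq.symm⟩ this.1⟩
    · have hg : g t = ϑ ((i, s₀), ((2 - 2 * t : ℝ) : ℂ)) := if_neg ht2
      rw [hg]
      constructor
      · refine hBϑ _ _ ?_
        rw [Complex.norm_real, Real.norm_eq_abs, abs_le]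
        constructor <;> linarith [ht.2]
      · intro q hq
        have : ((2 - 2 * t : ℝ) : ℂ) = 0 := congrArg Prod.snd (hϑ.injective hq)
        have h0 : (2 - 2 * t : ℝ) = 0 := by exact_mod_cast this
        linarith

/-- A star in the product of a circle and a manifold, ending on the products of the circle with the
cores of tubes. The circle coordinate is used as a time: the projections of the arms to the
manifold leave a common point simultaneously along distinct segments, and then run to the cores one
after the other, avoiding the waiting points of the others. -/
theorem exists_isStarToCores_circle_prod {n : ℕ} {S N : Type*} [TopologicalSpace S]
    [CompactSpace S] [ConnectedSpace S] [TopologicalSpace N] [T2Space N] [ConnectedSpace N]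
    [LocallyPathConnectedSpace N] {E : Type*} [NormedAddCommGroup E] [NormedSpace ℝ E]
    (hN : LocallyModelled E N) (hE : 1 < Module.rank ℝ E) {ϑ : (Fin n × S) × ℂ → N}
    (hϑ : IsOpenEmbedding ϑ) {Θ : (Fin n × (Circle × S)) × ℂ → Circle × N}
    (hΘ : ∀ i z w, Θ ((i, (z, w)), 0) = (z, ϑ ((i, w), 0))) :
    ∃ Γ, IsStarToCores Θ Γ := by
  rcases Nat.eq_zero_or_pos n with rfl | hn
  · exact ⟨fun i => i.elim0, ⟨⟨fun i => i.elim0, fun i => i.elim0, fun i => i.elim0⟩,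
      fun i => i.elim0, fun i => i.elim0⟩⟩
  obtain ⟨s₀⟩ : Nonempty S := inferInstance
  have : Nontrivial E := by
    by_contra hE'
    rw [not_nontrivial_iff_subsingleton] at hE'
    rw [rank_subsingleton'] at hE
    exact absurd hE (by simp)
  obtain ⟨a, ha⟩ := exists_ne (0 : E)
  have hclosed : IsClosed (ϑ '' (univ ×ˢ Metric.closedBall 0 1)) :=
    ((isCompact_univ.prod (isCompact_closedBall _ _)).image hϑ.continuous).isClosed
  obtain ⟨e, he, -, her⟩ := hN (ϑ ((⟨0, hn⟩, s₀), 2)) _ (hclosed.isOpen_compl.mem_nhds (by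
    rintro ⟨⟨q, v⟩, ⟨-, hv⟩, h⟩
    have := congrArg Prod.snd (hϑ.injective h)
    simp only at this
    rw [mem_closedBall_zero_iff, this] at hv
    norm_num at hv))
  have heϑ : ∀ x q v, ‖v‖ ≤ 1 → ϑ (q, v) ≠ e x := fun x q v hv h =>
    her (mem_range_self x) ⟨(q, v), ⟨trivial, by simpa using hv⟩, h⟩
  let w : Fin n → ℝ → E := fun i t => (t * (i : ℕ)) • a
  have hw : ∀ i k s t, w i s = w k t → s * (i : ℕ) = t * (k : ℕ) := fun i k s t h =>
    smul_left_injective ℝ ha h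
  have hg : ∀ i : Fin n, ∃ g : ℝ → N, Continuous g ∧ g 0 = e (w i 1) ∧
      (∃ x, g 1 = ϑ ((i, x), 0)) ∧
      ∀ t ∈ Icc (0 : ℝ) 1, g t ∉ (fun k => e (w k 1)) '' {k | k ≠ i} ∧
        ∀ q, g t = ϑ (q, 0) → t = 1 := by
    intro i
    refine exists_path_to_core hN hE hϑ i ((Set.toFinite _).image _) ?_ ?_ ?_
    · rintro q v hv ⟨k, -, hk⟩
      exact heϑ _ _ _ hv hk.symm
    · rintro ⟨k, hk, hki⟩
      have := hw _ _ _ _ (he.injective hki)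
      simp only [one_mul, Nat.cast_inj] at this
      exact hk (Fin.ext this)
    · exact fun q => heϑ _ _ _ (by simp)
  choose g hgc hg0 hg1 hgavoid using hg
  let c : Fin n → ℝ → N := fun i θ =>
    if θ ≤ 1 + (i : ℕ) then e (w i (min θ 1)) else g i (θ - 1 - (i : ℕ))
  have hc1 : ∀ (i : Fin n) (θ : ℝ), θ ≤ 1 + (i : ℕ) → c i θ = e (w i (min θ 1)) :=
    fun i θ h => if_pos h
  have hc2 : ∀ (i : Fin n) (θ : ℝ), 1 + (i : ℕ) < θ → c i θ = g i (θ - 1 - (i : ℕ)) := fun i θ h =>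
    if_neg (not_le.mpr h)
  have hcc : ∀ i, Continuous (c i) := by
    intro i
    have h1 := he.continuous
    have h2 := hgc i
    refine Continuous.if_le (by fun_prop) (by fun_prop) continuous_id continuous_const ?_
    rintro θ rfl
    rw [min_eq_right (by simp), show (1 : ℝ) + (i : ℕ) - 1 - (i : ℕ) = 0 by ring, hg0]
  have hdisj : ∀ (i k : Fin n), i < k → ∀ θ : ℝ, 0 ≤ θ → θ ≤ 2 + (i : ℕ) →
      c i θ = c k θ → θ = 0 := by
    intro i k hik θ hθ0 hθ h
    have hik' : ((i : ℕ) : ℝ) + 1 ≤ (k : ℕ) := by exact_mod_cast hik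
    rw [hc1 k θ (by linarith)] at h
    rcases le_or_gt θ (1 + (i : ℕ)) with hi | hi
    · rw [hc1 i θ hi] at h
      have h1 := hw _ _ _ _ (he.injective h)
      by_contra hθ'
      have hpos : 0 < min θ 1 := lt_min (lt_of_le_of_ne hθ0 (Ne.symm hθ')) zero_lt_one
      nlinarith
    · rw [hc2 i θ hi, min_eq_right (by linarith [(Nat.cast_nonneg (i : ℕ) : (0 : ℝ) ≤ (i : ℕ))])]
        at h
      exact absurd ⟨k, hik.ne', h.symm⟩
        (hgavoid i (θ - 1 - (i : ℕ)) ⟨by linarith, by linarith⟩).1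
  let Γ : Fin n → ℝ → Circle × N := fun i s =>
    (Circle.exp ((2 + (i : ℕ)) * s / (n + 1)), c i ((2 + (i : ℕ)) * s))
  have htime : ∀ i k : Fin n, ∀ s ∈ Icc (0 : ℝ) 1, ∀ t ∈ Icc (0 : ℝ) 1,
      Circle.exp ((2 + (i : ℕ)) * s / (n + 1)) = Circle.exp ((2 + (k : ℕ)) * t / (n + 1)) →
      (2 + (i : ℕ)) * s = (2 + (k : ℕ)) * t := by
    have hb : ∀ i : Fin n, ∀ s ∈ Icc (0 : ℝ) 1, 0 ≤ (2 + (i : ℕ)) * s / (n + 1) ∧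
        (2 + (i : ℕ)) * s / (n + 1) ≤ 1 := by
      intro i s hs
      have hi : ((i : ℕ) : ℝ) + 1 ≤ n := by exact_mod_cast i.2
      refine ⟨by have := hs.1; positivity, ?_⟩
      rw [div_le_one (by positivity)]
      nlinarith [hs.1, hs.2, (Nat.cast_nonneg (i : ℕ) : (0 : ℝ) ≤ (i : ℕ))]
    intro i k s hs t ht h
    have h1 := congrArg (fun z : Circle => Complex.arg z) h
    have hpi := Real.pi_gt_three
    rw [Circle.arg_exp (by linarith [hb i s hs]) (by linarith [hb i s hs]),
      Circle.arg_exp (by linarith [hb k t ht]) (by linarith [hb k t ht])] at h1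
    field_simp at h1
    exact h1
  have hθ : ∀ (i : Fin n), ∀ s ∈ Icc (0 : ℝ) 1, 0 ≤ (2 + ((i : ℕ) : ℝ)) * s ∧
      (2 + ((i : ℕ) : ℝ)) * s ≤ 2 + (i : ℕ) := fun i s hs =>
    ⟨by have := hs.1; positivity,
      by nlinarith [hs.2, (Nat.cast_nonneg (i : ℕ) : (0 : ℝ) ≤ (i : ℕ))]⟩
  have hzero : ∀ (i : Fin n) (s : ℝ), (2 + (i : ℕ)) * s = 0 → s = 0 := fun i s h => by
    have : (2 + ((i : ℕ) : ℝ)) ≠ 0 := by positivity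
    simpa [this] using h
  refine ⟨Γ, ⟨⟨fun i => ?_, fun i k => ?_, fun i k s hs t ht h => ?_⟩, fun i => ?_, ?_⟩⟩
  · have := hcc i
    refine Continuous.prodMk ?_ (by fun_prop)
    exact Circle.exp.continuous.comp (by fun_prop)
  · have h0 : ∀ i : Fin n, c i 0 = e 0 := fun i => by
      rw [hc1 i 0 (by positivity)]
      simp [w]
    simp [Γ, h0]
  · have h1 := htime i k s hs t ht (congrArg Prod.fst h)
    have h2 : c i ((2 + (i : ℕ)) * s) = c k ((2 + (k : ℕ)) * t) := congrArg Prod.snd h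
    rcases lt_trichotomy i k with hik | rfl | hik
    · rw [← h1] at h2
      have h3 := hdisj i k hik _ (hθ i s hs).1 (hθ i s hs).2 h2
      have hs0 := hzero i s h3
      have ht0 := hzero k t (h1.symm.trans h3)
      exact ⟨by rw [hs0, ht0], .inr hs0⟩
    · have : (2 + ((i : ℕ) : ℝ)) ≠ 0 := by positivity
      exact ⟨mul_left_cancel₀ this h1, .inl rfl⟩
    · rw [h1] at h2
      have h3 := hdisj k i hik _ (hθ k t ht).1 (hθ k t ht).2 h2.symm
      have hs0 := hzero i s (h1.trans h3)
      have ht0 := hzero k t h3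
      exact ⟨by rw [hs0, ht0], .inr hs0⟩
  · obtain ⟨x, hx⟩ := hg1 i
    refine ⟨(Circle.exp ((2 + (i : ℕ)) * 1 / (n + 1)), x), ?_⟩
    rw [hΘ, ← hx]
    simp only [Γ]
    rw [hc2 i _ (by linarith)]
    congr 2
    ring
  · rintro i k ⟨z, x⟩ s hs h
    rw [hΘ] at h
    have h2 : c i ((2 + (i : ℕ)) * s) = ϑ ((k, x), 0) := congrArg Prod.snd h
    rcases le_or_gt ((2 + ((i : ℕ) : ℝ)) * s) (1 + (i : ℕ)) with hi | hi
    · rw [hc1 i _ hi] at h2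
      exact absurd h2.symm (heϑ _ _ _ (by simp))
    · rw [hc2 i _ hi] at h2
      have h3 := (hgavoid i _ ⟨by linarith, by linarith [(hθ i s hs).2]⟩).2 _ h2
      have : (2 + ((i : ℕ) : ℝ)) ≠ 0 := by positivity
      have h4 : (2 + ((i : ℕ) : ℝ)) * s = (2 + (i : ℕ)) * 1 := by linarith
      exact mul_left_cancel₀ this h4

section Bundle

variable {F X Ft Xt T : Type*} [TopologicalSpace F] [TopologicalSpace X] [T2Space X]
  [TopologicalSpace Ft] [TopologicalSpace Xt] [TopologicalSpace T] [CompactSpace T]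
  {π : X → F} {p : Ft → F} {P : Xt → X} {ϖ : Xt → Ft}

/-- Paths can be lifted along a map covered by a locally trivial bundle with compact fibre. -/
theorem LocallyTrivial.exists_lift_path (hπ : LocallyTrivial T π) (hp : IsCoveringMap p)
    (hP : IsCoveringMap P) (hϖ : Continuous ϖ) (hcomm : ∀ y, p (ϖ y) = π (P y))
    (c : C(unitInterval, Ft)) (y₀ : Xt) (hy₀ : ϖ y₀ = c 0) :
    ∃ L : C(unitInterval, Xt), L 0 = y₀ ∧ ∀ s, ϖ (L s) = c s := by
  have hpc := hp.continuous
  obtain ⟨Ψ, hΨ, hΨf⟩ := hπ.trivialOver_square (φ := fun d => p (c d.1)) (by fun_prop)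
  rw [univ_prod_univ, continuousOn_univ] at hΨ
  have h0 : P y₀ ∈ range fun t => Ψ (((0 : unitInterval), (0 : unitInterval)), t) := by
    rw [(hΨf (0, 0) trivial).2]
    change π (P y₀) = p (c 0)
    rw [← hcomm, hy₀]
  obtain ⟨t₀, ht₀⟩ := h0
  let a : C(unitInterval, X) := ⟨fun s => Ψ ((s, 0), t₀), by fun_prop⟩
  have ha : ∀ s, π (a s) = p (c s) := fun s => by
    have : Ψ ((s, 0), t₀) ∈ π ⁻¹' {p (c s)} := (hΨf (s, 0) trivial).2 ▸ ⟨t₀, rfl⟩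
    exact this
  have ha0 : a 0 = P y₀ := ht₀
  let L := hP.liftPath a y₀ ha0
  have hL : ∀ s, P (L s) = a s := fun s => congrFun (hP.liftPath_lifts a y₀ ha0) s
  refine ⟨L, hP.liftPath_zero a y₀ ha0, fun s => ?_⟩
  have : ϖ ∘ L = c := by
    refine hp.eq_of_comp_eq (hϖ.comp L.continuous) c.continuous ?_ 0 ?_
    · funext s
      simp only [Function.comp_apply, hcomm, hL, ha]
    · simp only [Function.comp_apply]
      rw [show L 0 = y₀ from hP.liftPath_zero a y₀ ha0, hy₀]
  exact congrFun this s

/-- A star in the total space of a bundle over a connected surface that ends on given fibres, as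
the lift of a star in the surface. -/
theorem LocallyTrivial.exists_isStarToCores [T2Space Ft] [ConnectedSpace Ft]
    (hπ : LocallyTrivial T π) (hFt : LocallyModelled ℂ Ft) (hp : IsCoveringMap p)
    (hP : IsCoveringMap P) (hϖ : Continuous ϖ) (hϖs : Function.Surjective ϖ)
    (hcomm : ∀ y, p (ϖ y) = π (P y)) {S : Type*} {n : ℕ} {y : Fin n → Ft}
    (hy : Function.Injective y) {Θ : (Fin n × S) × ℂ → Xt}
    (hΘ : ∀ j, (range fun x => Θ ((j, x), 0)) = ϖ ⁻¹' {y j}) :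
    ∃ Γ, IsStarToCores Θ Γ := by
  obtain ⟨e, he, hey⟩ := hFt.exists_rays y hy
  obtain ⟨y₀, hy₀⟩ := hϖs (e 0)
  let c : Fin n → C(unitInterval, Ft) := fun i =>
    ⟨fun s => e (((s : ℝ) : ℂ) * (1 + (i : ℕ) * Complex.I)), he.continuous.comp (by fun_prop)⟩
  have hc0 : ∀ i, ϖ y₀ = c i 0 := fun i => by simp [c, hy₀]
  choose L hL0 hL using fun i => hπ.exists_lift_path hp hP hϖ hcomm (c i) y₀ (hc0 i)
  have hLe : ∀ i s, ∀ hs : s ∈ Icc (0 : ℝ) 1, ϖ (L i (projIcc 0 1 zero_le_one s)) =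
      e ((s : ℂ) * (1 + (i : ℕ) * Complex.I)) := fun i s hs => by
    rw [hL, projIcc_of_mem _ hs]
    rfl
  have hinj : ∀ (i k : Fin n) (s t : ℝ), (s : ℂ) * (1 + (i : ℕ) * Complex.I) =
      t * (1 + (k : ℕ) * Complex.I) → s = t ∧ (i = k ∨ s = 0) := by
    intro i k s t h
    have h1 : s = t := by simpa using congrArg Complex.re h
    have h2 : s * (i : ℕ) = t * (k : ℕ) := by simpa using congrArg Complex.im h
    subst h1
    rw [mul_eq_mul_left_iff, Nat.cast_inj] at h2
    refine ⟨rfl, ?_⟩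
    rcases h2 with h2 | h2
    · exact .inl (Fin.ext h2)
    · exact .inr h2
  have hlast : ∀ i s, s = 1 → ϖ (L i (projIcc 0 1 zero_le_one s)) = y i := by
    rintro i _ rfl
    rw [hLe i 1 ⟨zero_le_one, le_rfl⟩, ← hey]
    simp
  refine ⟨fun i s => L i (projIcc 0 1 zero_le_one s), ⟨⟨fun i => ?_, fun i k => ?_, ?_⟩,
    fun i => ?_, ?_⟩⟩
  · exact (L i).continuous.comp continuous_projIcc
  · simp only [projIcc_left]
    exact (hL0 i).trans (hL0 k).symm
  · intro i k s hs t ht h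
    have := congrArg ϖ h
    rw [hLe i s hs, hLe k t ht] at this
    exact hinj i k s t (he.injective this)
  · have : L i (projIcc 0 1 zero_le_one 1) ∈ range fun x => Θ ((i, x), 0) := by
      rw [hΘ]
      exact hlast i 1 rfl
    obtain ⟨x, hx⟩ := this
    exact ⟨x, hx.symm⟩
  · intro i k x s hs h
    have h1 : ϖ (Θ ((k, x), 0)) = y k := by
      have : Θ ((k, x), 0) ∈ ϖ ⁻¹' {y k} := hΘ k ▸ ⟨x, rfl⟩
      exact this
    have h2 := congrArg ϖ h
    rw [h1, hLe i s hs, ← hey k] at h2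
    have h3 := he.injective h2
    refine (hinj i k s 1 ?_).1
    rw [h3]
    simp

end Bundle

end StarConstructions

/-! ### Local diffeomorphisms -/

section LocalDiffeo

open Topology

variable {E₁ H₁ M₁ E₂ H₂ M₂ E₃ H₃ M₃ E₄ H₄ M₄ : Type*}
  [NormedAddCommGroup E₁] [NormedSpace ℝ E₁] [TopologicalSpace H₁]
  [NormedAddCommGroup E₂] [NormedSpace ℝ E₂] [TopologicalSpace H₂]
  [NormedAddCommGroup E₃] [NormedSpace ℝ E₃] [TopologicalSpace H₃]
  [NormedAddCommGroup E₄] [NormedSpace ℝ E₄] [TopologicalSpace H₄]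
  [TopologicalSpace M₁] [ChartedSpace H₁ M₁] [TopologicalSpace M₂] [ChartedSpace H₂ M₂]
  [TopologicalSpace M₃] [ChartedSpace H₃ M₃] [TopologicalSpace M₄] [ChartedSpace H₄ M₄]
  {I₁ : ModelWithCorners ℝ E₁ H₁} {I₂ : ModelWithCorners ℝ E₂ H₂}
  {I₃ : ModelWithCorners ℝ E₃ H₃} {I₄ : ModelWithCorners ℝ E₄ H₄}

theorem isLocalDiffeomorphAt_of_inverse {f : M₁ → M₂} {g : M₂ → M₁} {x : M₁} {U : Set M₁}
    {V : Set M₂} (hU : IsOpen U) (hV : IsOpen V) (hxU : x ∈ U) (hxV : f x ∈ V)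
    (hf : ContMDiffOn I₁ I₂ ∞ f U) (hg : ContMDiffOn I₂ I₁ ∞ g V)
    (hgf : ∀ y ∈ U, f y ∈ V → g (f y) = y) (hfg : ∀ y ∈ V, g y ∈ U → f (g y) = y) :
    IsLocalDiffeomorphAt I₁ I₂ ∞ f x := by
  refine ⟨⟨⟨f, g, U ∩ f ⁻¹' V, V ∩ g ⁻¹' U, ?_, ?_, ?_, ?_⟩, ?_, ?_, ?_, ?_⟩, ⟨hxU, hxV⟩,
    fun _ _ => rfl⟩
  · exact fun y hy => ⟨hy.2, by rw [mem_preimage, hgf y hy.1 hy.2]; exact hy.1⟩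
  · exact fun y hy => ⟨hy.2, by rw [mem_preimage, hfg y hy.1 hy.2]; exact hy.1⟩
  · exact fun y hy => hgf y hy.1 hy.2
  · exact fun y hy => hfg y hy.1 hy.2
  · exact hf.continuousOn.isOpen_inter_preimage hU hV
  · exact hg.continuousOn.isOpen_inter_preimage hV hU
  · exact hf.mono inter_subset_left
  · exact hg.mono inter_subset_left

theorem IsLocalDiffeomorphAt.congr_of_eventuallyEq {f g : M₁ → M₂} {x : M₁}
    (hf : IsLocalDiffeomorphAt I₁ I₂ ∞ f x) (h : g =ᶠ[𝓝 x] f) :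
    IsLocalDiffeomorphAt I₁ I₂ ∞ g x := by
  obtain ⟨Φ, hx, hΦ⟩ := hf
  obtain ⟨U, hgf, hU, hxU⟩ := eventually_nhds_iff.mp h
  have hg : ∀ y ∈ Φ.source ∩ U, g y = Φ y := fun y hy => (hgf y hy.2).trans (hΦ hy.1)
  refine isLocalDiffeomorphAt_of_inverse (g := Φ.symm) (Φ.open_source.inter hU) Φ.open_target
    ⟨hx, hxU⟩ ?_ ((Φ.contMDiffOn.mono inter_subset_left).congr hg) Φ.symm.contMDiffOn ?_ ?_
  · rw [hg x ⟨hx, hxU⟩]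
    exact Φ.map_source hx
  · intro y hy _
    rw [hg y hy]
    exact Φ.left_inv hy.1
  · intro y hy hy'
    rw [hg _ hy']
    exact Φ.right_inv hy

theorem IsLocalDiffeomorphAt.prodMap {f : M₁ → M₂} {g : M₃ → M₄} {x : M₁} {y : M₃}
    (hf : IsLocalDiffeomorphAt I₁ I₂ ∞ f x) (hg : IsLocalDiffeomorphAt I₃ I₄ ∞ g y) :
    IsLocalDiffeomorphAt (I₁.prod I₃) (I₂.prod I₄) ∞ (Prod.map f g) (x, y) := by
  obtain ⟨Φ, hx, hΦ⟩ := hf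
  obtain ⟨Ψ, hy, hΨ⟩ := hg
  have hfg : ∀ q ∈ Φ.source ×ˢ Ψ.source, Prod.map f g q = Prod.map Φ Ψ q := fun q hq =>
    Prod.ext (hΦ hq.1) (hΨ hq.2)
  refine isLocalDiffeomorphAt_of_inverse (g := Prod.map Φ.symm Ψ.symm)
    (Φ.open_source.prod Ψ.open_source) (Φ.open_target.prod Ψ.open_target) ⟨hx, hy⟩ ?_ ?_ ?_ ?_ ?_
  · rw [hfg _ ⟨hx, hy⟩]
    exact ⟨Φ.map_source hx, Ψ.map_source hy⟩
  · exact (Φ.contMDiffOn.prodMap Ψ.contMDiffOn).congr hfg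
  · exact Φ.symm.contMDiffOn.prodMap Ψ.symm.contMDiffOn
  · intro q hq _
    rw [hfg q hq]
    exact Prod.ext (Φ.left_inv hq.1) (Ψ.left_inv hq.2)
  · intro q hq hq'
    rw [hfg _ hq']
    exact Prod.ext (Φ.right_inv hq.1) (Ψ.right_inv hq.2)

theorem IsLocalDiffeomorphAt.id (x : M₁) : IsLocalDiffeomorphAt I₁ I₁ ∞ (fun y : M₁ => y) x :=
  (Diffeomorph.refl I₁ M₁ ∞).isLocalDiffeomorph x

theorem isLocalDiffeomorph_circle_pow {l : ℕ} (hl : l ≠ 0) :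
    IsLocalDiffeomorph (𝓡 1) (𝓡 1) ∞ fun z : Circle => z ^ l := by
  intro z₀
  let A : Circle → ℝ := fun w => Complex.arg (w : ℂ)
  let D : Set Circle := {w | (w : ℂ) ∈ Complex.slitPlane}
  have := finrank_real_complex_fact'
  have hcoe : ContMDiff (𝓡 1) 𝓘(ℝ, ℂ) ∞ (fun w : Circle => (w : ℂ)) :=
    contMDiff_coe_sphere (E := ℂ) (n := 1)
  have hD : IsOpen D := Complex.isOpen_slitPlane.preimage (by fun_prop)
  have hA : ContMDiffOn (𝓡 1) 𝓘(ℝ, ℝ) ∞ A D := by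
    intro w hw
    have h1 : ContDiffAt ℝ ∞ Complex.arg (w : ℂ) := by
      have h2 : ContDiffAt ℝ ∞ Complex.log (w : ℂ) := (Complex.contDiffAt_log hw).restrict_scalars ℝ
      have h3 := Complex.imCLM.contDiff.contDiffAt.comp (w : ℂ) h2
      exact h3.congr_of_eventuallyEq (.of_forall fun z => (Complex.log_im z).symm)
    exact (h1.contMDiffAt.comp w hcoe.contMDiffAt).contMDiffWithinAt
  have hmul : ∀ c : Circle, ContMDiff (𝓡 1) (𝓡 1) ∞ fun w : Circle => c * w := fun c =>
    contMDiff_mul_left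
  have hexp : ContMDiff 𝓘(ℝ, ℝ) (𝓡 1) ∞ Circle.exp := contMDiff_circleExp
  have hlpos : (0 : ℝ) < l := by exact_mod_cast Nat.pos_of_ne_zero hl
  have h1D : (1 : Circle) ∈ D := by simp [D]
  have hU : IsOpen ((fun z => z₀⁻¹ * z) ⁻¹' (D ∩ A ⁻¹' Ioo (-(Real.pi / l)) (Real.pi / l))) := by
    refine IsOpen.preimage (by fun_prop) ?_
    exact hA.continuousOn.isOpen_inter_preimage hD isOpen_Ioo
  refine isLocalDiffeomorphAt_of_inverse (g := fun w => z₀ * Circle.exp (A ((z₀ ^ l)⁻¹ * w) / l))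
    (U := (fun z => z₀⁻¹ * z) ⁻¹' (D ∩ A ⁻¹' Ioo (-(Real.pi / l)) (Real.pi / l)))
    (V := (fun w => (z₀ ^ l)⁻¹ * w) ⁻¹' D) hU (hD.preimage (by fun_prop)) ?_ ?_ ?_ ?_ ?_ ?_
  · have : 0 < Real.pi / l := by positivity
    simp only [mem_preimage, inv_mul_cancel]
    exact ⟨h1D, by simpa [A] using this⟩
  · simpa only [mem_preimage, inv_mul_cancel] using h1D
  · exact (contMDiff_pow l).contMDiffOn
  · have h1 : ContMDiffOn (𝓡 1) 𝓘(ℝ, ℝ) ∞ (fun w => A ((z₀ ^ l)⁻¹ * w))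
        ((fun w => (z₀ ^ l)⁻¹ * w) ⁻¹' D) :=
      hA.comp (hmul _).contMDiffOn fun w hw => hw
    have h2 : ContMDiff 𝓘(ℝ, ℝ) 𝓘(ℝ, ℝ) ∞ fun t : ℝ => t / l :=
      (contDiff_id.div_const _).contMDiff
    exact ((hmul z₀).comp (hexp.comp h2)).comp_contMDiffOn h1
  · rintro z ⟨hz1, hz2⟩ -
    have h1 : Circle.exp (A (z₀⁻¹ * z)) = z₀⁻¹ * z := Circle.exp_arg _
    have h2 : (z₀ ^ l)⁻¹ * z ^ l = Circle.exp (l * A (z₀⁻¹ * z)) := by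
      rw [← inv_pow, ← mul_pow, ← h1, ← Circle.exp_nsmul, nsmul_eq_mul, h1]
    have h3 : A (Circle.exp (l * A (z₀⁻¹ * z))) = l * A (z₀⁻¹ * z) := by
      refine Circle.arg_exp ?_ ?_
      · have := mul_lt_mul_of_pos_left hz2.1 hlpos
        rwa [mul_neg, mul_div_cancel₀ _ hlpos.ne'] at this
      · have := mul_lt_mul_of_pos_left hz2.2 hlpos
        rw [mul_div_cancel₀ _ hlpos.ne'] at this
        exact this.le
    rw [h2, h3, mul_div_cancel_left₀ _ hlpos.ne', h1, mul_inv_cancel_left]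
  · intro w _ _
    rw [mul_pow, ← Circle.exp_nsmul, nsmul_eq_mul, mul_div_cancel₀ _ hlpos.ne',
      show Circle.exp (A ((z₀ ^ l)⁻¹ * w)) = (z₀ ^ l)⁻¹ * w from Circle.exp_arg _,
      mul_inv_cancel_left]

end LocalDiffeo

/-! ### Pushing a manifold off a core -/

section Push

open Topology

/-- A diffeomorphism of the line that takes the positive numbers to the numbers greater than one and
fixes all large numbers. -/
theorem exists_push_homeomorph : ∃ (R : ℝ ≃ₜ ℝ) (c : ℝ), 0 < c ∧ ContDiff ℝ ∞ R ∧
    ContDiff ℝ ∞ R.symm ∧ StrictMono R ∧ R 0 = 1 ∧ ∀ r, c ≤ r → R r = r := by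
  let T := Real.smoothTransition
  have hT : ContDiff ℝ ∞ T := Real.smoothTransition.contDiff
  have hTd : Continuous (deriv T) := hT.continuous_deriv (by simp)
  obtain ⟨B, hB⟩ := isCompact_Icc.exists_bound_of_continuousOn (s := Icc (0 : ℝ) 1) hTd.continuousOn
  have hbound : ∀ x, |deriv T x| ≤ max B 0 := by
    intro x
    by_cases hx : x ∈ Icc (0 : ℝ) 1
    · exact (hB x hx).trans (le_max_left _ _)
    · have : deriv T x = 0 := by
        rw [mem_Icc, not_and_or, not_le, not_le] at hx
        rcases hx with hx | hx
        · have : T =ᶠ[𝓝 x] fun _ => 0 := by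
            filter_upwards [Iio_mem_nhds hx] with y hy
            exact Real.smoothTransition.zero_of_nonpos (le_of_lt hy)
          rw [this.deriv_eq, deriv_const]
        · have : T =ᶠ[𝓝 x] fun _ => 1 := by
            filter_upwards [Ioi_mem_nhds hx] with y hy
            exact Real.smoothTransition.one_of_one_le (le_of_lt hy)
          rw [this.deriv_eq, deriv_const]
      rw [this, abs_zero]
      exact le_max_right _ _
  let c : ℝ := max B 0 + 1
  have hc : 0 < c := by positivity
  let R : ℝ → ℝ := fun r => r + 1 - T (r / c)
  have hRc : ContDiff ℝ ∞ R :=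
    (contDiff_id.add contDiff_const).sub (hT.comp (contDiff_id.div_const c))
  have hR' : ∀ r, HasDerivAt R (1 - deriv T (r / c) * (1 / c)) r := by
    intro r
    have h1 : HasDerivAt T (deriv T (r / c)) (r / c) :=
      (hT.differentiable (by simp)).differentiableAt.hasDerivAt
    have h2 : HasDerivAt (fun r : ℝ => r / c) (1 / c) r := (hasDerivAt_id r).div_const c
    exact ((hasDerivAt_id r).add_const 1).sub (HasDerivAt.comp (h₂ := T) r h1 h2)
  have hpos : ∀ r, 0 < 1 - deriv T (r / c) * (1 / c) := by
    intro r
    have h1 := (abs_le.mp (hbound (r / c))).2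
    have : deriv T (r / c) * (1 / c) < 1 := by
      rw [mul_one_div, div_lt_one hc]
      exact lt_of_le_of_lt h1 (lt_add_one _)
    linarith
  have hmono : StrictMono R := strictMono_of_deriv_pos fun r => by
    rw [(hR' r).deriv]
    exact hpos r
  have hlarge : ∀ r, c ≤ r → R r = r := by
    intro r hr
    have : T (r / c) = 1 := Real.smoothTransition.one_of_one_le ((one_le_div hc).mpr hr)
    simp [R, this]
  have hsmall : ∀ r ≤ 0, R r = r + 1 := by
    intro r hr
    have : T (r / c) = 0 :=
      Real.smoothTransition.zero_of_nonpos (div_nonpos_of_nonpos_of_nonneg hr hc.le)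
    simp [R, this]
  have hsurj : Function.Surjective R := by
    refine hRc.continuous.surjective ?_ ?_
    · refine Filter.tendsto_id.congr' ?_
      filter_upwards [Filter.eventually_ge_atTop c] with r hr
      exact (hlarge r hr).symm
    · have h1 : Filter.Tendsto (fun r : ℝ => r + 1) Filter.atBot Filter.atBot :=
        Filter.tendsto_atBot_add_const_right _ _ Filter.tendsto_id
      refine h1.congr' ?_
      filter_upwards [Filter.eventually_le_atBot 0] with r hr
      exact (hsmall r hr).symm
  let Rh : ℝ ≃ₜ ℝ := (hmono.orderIsoOfSurjective R hsurj).toHomeomorph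
  refine ⟨Rh, c, hc, hRc, ?_, hmono, ?_, hlarge⟩
  · exact Rh.contDiff_symm_deriv (fun r => (hpos r).ne') hR' hRc
  · change R 0 = 1
    rw [hsmall 0 le_rfl, zero_add]

/-- The map of the plane that preserves directions and acts on the radius by `R`. -/
noncomputable def radialMap (R : ℝ → ℝ) (u : ℂ) : ℂ := (R ‖u‖ / ‖u‖) • u

theorem norm_radialMap {R : ℝ → ℝ} {u : ℂ} (hu : u ≠ 0) (hR : 0 ≤ R ‖u‖) :
    ‖radialMap R u‖ = R ‖u‖ := by
  have : ‖u‖ ≠ 0 := norm_ne_zero_iff.mpr hu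
  rw [radialMap, norm_smul, Real.norm_of_nonneg (by positivity), div_mul_cancel₀ _ this]

theorem radialMap_mul {R : ℝ → ℝ} {s : ℝ} (hs : 0 < s) (z : Circle) :
    radialMap R (s * z) = R s * z := by
  have : ‖(s : ℂ) * z‖ = s := by
    rw [norm_mul, Circle.norm_coe, mul_one, Complex.norm_real, Real.norm_of_nonneg hs.le]
  rw [radialMap, this, Complex.real_smul, Complex.ofReal_div]
  have : (s : ℂ) ≠ 0 := by exact_mod_cast hs.ne'
  field_simp

theorem exists_polar {u : ℂ} (hu : u ≠ 0) : ∃ z : Circle, u = ‖u‖ * (z : ℂ) := by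
  have : ‖u‖ ≠ 0 := norm_ne_zero_iff.mpr hu
  refine ⟨⟨u / ‖u‖, mem_sphere_zero_iff_norm.mpr ?_⟩, ?_⟩
  · rw [norm_div, Complex.norm_real, norm_norm, div_self this]
  · change u = ‖u‖ * (u / ‖u‖)
    rw [mul_div_cancel₀]
    exact_mod_cast this

theorem contDiffAt_radialMap {R : ℝ → ℝ} (hR : ContDiff ℝ ∞ R) {u : ℂ} (hu : u ≠ 0) :
    ContDiffAt ℝ ∞ (radialMap R) u := by
  have h1 : ContDiffAt ℝ ∞ (fun v : ℂ => ‖v‖) u := contDiffAt_norm ℝ hu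
  exact ((hR.contDiffAt.comp u h1).div h1 (norm_ne_zero_iff.mpr hu)).smul contDiffAt_id

theorem radialMap_radialMap {R Q : ℝ → ℝ} {u : ℂ} (hu : u ≠ 0) (hQ : 0 < Q ‖u‖)
    (h : R (Q ‖u‖) = ‖u‖) : radialMap R (radialMap Q u) = u := by
  obtain ⟨z, hz⟩ := exists_polar hu
  have hpos : 0 < ‖u‖ := norm_pos_iff.mpr hu
  conv_lhs => rw [hz]
  rw [radialMap_mul hpos, radialMap_mul hQ, h, ← hz]

variable {ES HS S E₁ H₁ M₁ : Type*}
  [NormedAddCommGroup ES] [NormedSpace ℝ ES] [TopologicalSpace HS]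
  [NormedAddCommGroup E₁] [NormedSpace ℝ E₁] [TopologicalSpace H₁]
  [TopologicalSpace S] [ChartedSpace HS S] [TopologicalSpace M₁] [ChartedSpace H₁ M₁]
  {IS : ModelWithCorners ℝ ES HS} {I₁ : ModelWithCorners ℝ E₁ H₁}

/-- The complement of the core of a tube is diffeomorphic to the complement of the closed tube of
radius one. -/
theorem exists_push_off_core [CompactSpace S] [T2Space M₁] {R : ℝ ≃ₜ ℝ} {c : ℝ}
    (hR : ContDiff ℝ ∞ R) (hRs : ContDiff ℝ ∞ R.symm) (hmono : StrictMono R) (h0 : R 0 = 1)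
    (hlarge : ∀ r, c ≤ r → R r = r) {t : S × ℂ → M₁}
    (ht : SmoothEmbOn (IS.prod 𝓘(ℝ, ℂ)) I₁ t univ) :
    ∃ Φ : M₁ → M₁, (∀ x u, u ≠ 0 → Φ (t (x, u)) = t (x, radialMap R u)) ∧
      SmoothEmbOn I₁ I₁ Φ (range fun x => t (x, 0))ᶜ ∧
      Φ '' (range fun x => t (x, 0))ᶜ = (t '' {p | ‖p.2‖ ≤ 1})ᶜ := by
  have hto := ht.isOpenEmbedding
  have hinj := hto.injective
  have hR1 : ∀ u : ℂ, u ≠ 0 → 1 < R ‖u‖ := fun u hu => by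
    rw [← h0]
    exact hmono (norm_pos_iff.mpr hu)
  have hRs0 : ∀ u : ℂ, 1 < ‖u‖ → 0 < R.symm ‖u‖ := fun u hu => by
    rw [← hmono.lt_iff_lt, h0, R.apply_symm_apply]
    exact hu
  have hnorm : ∀ u : ℂ, u ≠ 0 → ‖radialMap R u‖ = R ‖u‖ := fun u hu =>
    norm_radialMap hu (zero_le_one.trans (hR1 u hu).le)
  have hleft : ∀ u : ℂ, u ≠ 0 → radialMap R.symm (radialMap R u) = u := fun u hu =>
    radialMap_radialMap hu (zero_lt_one.trans (hR1 u hu)) (R.symm_apply_apply _)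
  have hright : ∀ u : ℂ, 1 < ‖u‖ → radialMap R (radialMap R.symm u) = u := fun u hu =>
    radialMap_radialMap (norm_pos_iff.mp (zero_lt_one.trans hu)) (hRs0 u hu) (R.apply_symm_apply _)
  have hnorms : ∀ u : ℂ, 1 < ‖u‖ → radialMap R.symm u ≠ 0 := fun u hu => by
    rw [← norm_pos_iff, norm_radialMap (norm_pos_iff.mp (zero_lt_one.trans hu)) (hRs0 u hu).le]
    exact hRs0 u hu
  let Φ : M₁ → M₁ := Function.extend t (fun p => t (p.1, radialMap R p.2)) id
  have hΦt : ∀ p, Φ (t p) = t (p.1, radialMap R p.2) := fun p => hinj.extend_apply _ _ p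
  have hΦoff : ∀ m ∉ range t, Φ m = m := fun m hm => Function.extend_apply' _ _ _ hm
  have hrad : ∀ u : ℂ, c ≤ ‖u‖ → u ≠ 0 → radialMap R u = u := fun u hu hu0 => by
    rw [radialMap, hlarge _ hu, div_self (norm_ne_zero_iff.mpr hu0), one_smul]
  have hlocal : ∀ u : ℂ, u ≠ 0 → IsLocalDiffeomorphAt 𝓘(ℝ, ℂ) 𝓘(ℝ, ℂ) ∞ (radialMap R) u := by
    intro u hu
    refine isLocalDiffeomorphAt_of_inverse (g := radialMap R.symm) (U := {u | u ≠ 0})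
      (V := {u | 1 < ‖u‖}) isOpen_ne (isOpen_lt continuous_const continuous_norm) hu ?_ ?_ ?_ ?_ ?_
    · change 1 < ‖_‖
      rw [hnorm u hu]
      exact hR1 u hu
    · exact fun v hv => (contDiffAt_radialMap hR hv).contMDiffAt.contMDiffWithinAt
    · exact fun v hv => (contDiffAt_radialMap hRs
        (norm_pos_iff.mp (zero_lt_one.trans hv))).contMDiffAt.contMDiffWithinAt
    · exact fun v hv _ => hleft v hv
    · exact fun v hv _ => hright v hv
  have hclosed : IsClosed (t '' (univ ×ˢ Metric.closedBall 0 (max c 1))) :=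
    ((isCompact_univ.prod (isCompact_closedBall _ _)).image hto.continuous).isClosed
  refine ⟨Φ, fun x u _ => hΦt _, ⟨?_, ?_⟩, ?_⟩
  · intro m hm m' hm' h
    by_cases hmt : m ∈ range t <;> by_cases hmt' : m' ∈ range t
    · obtain ⟨⟨x, u⟩, rfl⟩ := hmt
      obtain ⟨⟨x', u'⟩, rfl⟩ := hmt'
      have hu : u ≠ 0 := by rintro rfl; exact hm ⟨x, rfl⟩
      have hu' : u' ≠ 0 := by rintro rfl; exact hm' ⟨x', rfl⟩
      rw [hΦt, hΦt] at h
      have := hinj h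
      simp only [Prod.mk.injEq] at this
      have h2 := congrArg (radialMap R.symm) this.2
      rw [hleft u hu, hleft u' hu'] at h2
      rw [this.1, h2]
    · obtain ⟨p, rfl⟩ := hmt
      rw [hΦt, hΦoff m' hmt'] at h
      exact absurd ⟨_, h⟩ hmt'
    · obtain ⟨p, rfl⟩ := hmt'
      rw [hΦt, hΦoff m hmt] at h
      exact absurd ⟨_, h.symm⟩ hmt
    · rwa [hΦoff m hmt, hΦoff m' hmt'] at h
  · rintro ⟨m, hm⟩
    by_cases hmt : m ∈ range t
    · obtain ⟨⟨x, u⟩, rfl⟩ := hmt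
      have hu : u ≠ 0 := by rintro rfl; exact hm ⟨x, rfl⟩
      have ht1 : IsLocalDiffeomorphAt (IS.prod 𝓘(ℝ, ℂ)) I₁ ∞ t (x, u) := ht.2 ⟨_, trivial⟩
      have ht2 : IsLocalDiffeomorphAt (IS.prod 𝓘(ℝ, ℂ)) I₁ ∞ t (x, radialMap R u) :=
        ht.2 ⟨_, trivial⟩
      have hback : ht1.localInverse (t (x, u)) = (x, u) :=
        ht1.localInverse_left_inv ht1.localInverse_mem_target
      have h1 := (IsLocalDiffeomorphAt.id (I₁ := IS) x).prodMap (hlocal u hu)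
      have h2 := h1.comp (K := I₁) (P := M₁) (g := t) (hg := ht2)
      have h3 := ht1.localInverse_isLocalDiffeomorphAt
      rw [← hback] at h2
      have h4 := h3.comp (K := I₁) (P := M₁) (hg := h2)
      refine h4.congr_of_eventuallyEq ?_
      filter_upwards [ht1.localInverse_eventuallyEq_right] with m' hm'
      have hm'' : t (ht1.localInverse m') = m' := hm'
      conv_lhs => rw [← hm'', hΦt]
      rfl
    · refine (IsLocalDiffeomorphAt.id m).congr_of_eventuallyEq ?_
      have hm2 : m ∈ (t '' (univ ×ˢ Metric.closedBall 0 (max c 1)))ᶜ := by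
        rintro ⟨p, -, rfl⟩
        exact hmt (mem_range_self p)
      filter_upwards [hclosed.isOpen_compl.mem_nhds hm2] with m' hm'
      by_cases hmt' : m' ∈ range t
      · obtain ⟨⟨x, u⟩, rfl⟩ := hmt'
        have hu : max c 1 < ‖u‖ := by
          by_contra! hu
          exact hm' ⟨_, ⟨trivial, by simpa using hu⟩, rfl⟩
        rw [hΦt]
        simp only
        rw [hrad u ((le_max_left _ _).trans hu.le)
          (norm_pos_iff.mp (zero_lt_one.trans ((le_max_right _ _).trans_lt hu)))]
      · exact hΦoff m' hmt'
  · ext m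
    constructor
    · rintro ⟨m, hm, rfl⟩ ⟨⟨x', u'⟩, hu', h⟩
      by_cases hmt : m ∈ range t
      · obtain ⟨⟨x, u⟩, rfl⟩ := hmt
        have hu : u ≠ 0 := by rintro rfl; exact hm ⟨x, rfl⟩
        rw [hΦt] at h
        have := hinj h
        simp only [Prod.mk.injEq] at this
        have h1 : ‖u'‖ ≤ 1 := hu'
        rw [this.2, hnorm u hu] at h1
        exact absurd (hR1 u hu) (not_lt.mpr h1)
      · rw [hΦoff m hmt] at h
        exact hmt ⟨_, h⟩
    · intro hm
      by_cases hmt : m ∈ range t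
      · obtain ⟨⟨x, u⟩, rfl⟩ := hmt
        have hu : 1 < ‖u‖ := by
          by_contra! hu
          exact hm ⟨_, hu, rfl⟩
        refine ⟨t (x, radialMap R.symm u), ?_, ?_⟩
        · rintro ⟨x', h⟩
          have := hinj h
          simp only [Prod.mk.injEq] at this
          exact hnorms u hu this.2.symm
        · rw [hΦt]
          simp only
          rw [hright u hu]
      · refine ⟨m, ?_, hΦoff m hmt⟩
        rintro ⟨x, rfl⟩
        exact hmt (mem_range_self _)

end Push

/-! ### Normal connected sums as unions of complements of cores -/

section NormalForm

open Topology

/-- The plane as the open unit disc. -/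
theorem isOpenEmbedding_squash :
    IsOpenEmbedding (fun w : ℂ => ((1 + ‖w‖ : ℝ)⁻¹ : ℝ) • w) ∧
      range (fun w : ℂ => ((1 + ‖w‖ : ℝ)⁻¹ : ℝ) • w) = Metric.ball 0 1 := by
  have hpos : ∀ w : ℂ, 0 < 1 + ‖w‖ := fun w => by positivity
  have hnorm : ∀ w : ℂ, ‖((1 + ‖w‖ : ℝ)⁻¹ : ℝ) • w‖ = ‖w‖ / (1 + ‖w‖) := fun w => by
    rw [norm_smul, Real.norm_of_nonneg (by positivity), div_eq_inv_mul]
  have hlt : ∀ w : ℂ, ‖((1 + ‖w‖ : ℝ)⁻¹ : ℝ) • w‖ < 1 := fun w => by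
    rw [hnorm, div_lt_one (hpos w)]
    linarith
  let e : OpenPartialHomeomorph ℂ ℂ :=
    { toFun := fun w => ((1 + ‖w‖ : ℝ)⁻¹ : ℝ) • w
      invFun := fun y => ((1 - ‖y‖ : ℝ)⁻¹ : ℝ) • y
      source := univ
      target := Metric.ball 0 1
      map_source' := fun w _ => by simpa using hlt w
      map_target' := fun _ _ => trivial
      left_inv' := fun w _ => by
        rw [hnorm, smul_smul]
        have h1 : 1 - ‖w‖ / (1 + ‖w‖) = (1 + ‖w‖)⁻¹ := by
          have := (hpos w).ne'
          field_simp
          ring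
        rw [h1, inv_inv, mul_inv_cancel₀ (hpos w).ne', one_smul]
      right_inv' := fun y hy => by
        rw [mem_ball_zero_iff] at hy
        have h0 : 0 < 1 - ‖y‖ := by linarith
        rw [norm_smul, Real.norm_of_nonneg (by positivity), smul_smul]
        have h1 : 1 + (1 - ‖y‖)⁻¹ * ‖y‖ = (1 - ‖y‖)⁻¹ := by
          field_simp
          ring
        rw [h1, inv_inv, mul_inv_cancel₀ h0.ne', one_smul]
      open_source := isOpen_univ
      open_target := Metric.isOpen_ball
      continuousOn_toFun := by
        have : Continuous fun w : ℂ => ((1 + ‖w‖ : ℝ)⁻¹ : ℝ) • w :=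
          (Continuous.inv₀ (by fun_prop) fun w => (hpos w).ne').smul continuous_id
        exact this.continuousOn
      continuousOn_invFun := by
        have h1 : ContinuousOn (fun y : ℂ => 1 - ‖y‖) (Metric.ball 0 1) := by fun_prop
        refine (h1.inv₀ fun y hy => ?_).smul continuousOn_id
        rw [mem_ball_zero_iff] at hy
        linarith }
  exact ⟨e.isOpenEmbedding rfl, by
    rw [← image_univ]
    exact e.image_source_eq_target⟩

/-- The identification of the punctured plane with the open annulus `1 < |v| < 2`. -/
noncomputable def toAnnulus (w : ℂ) : ℂ := radialMap (fun s => 1 + s / (1 + s)) w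

theorem toAnnulus_mul {s : ℝ} (hs : 0 < s) (z : Circle) :
    toAnnulus (s * z) = ((1 + s / (1 + s) : ℝ) : ℂ) * z :=
  radialMap_mul hs z

theorem norm_toAnnulus {w : ℂ} (hw : w ≠ 0) : 1 < ‖toAnnulus w‖ ∧ ‖toAnnulus w‖ < 2 := by
  have hpos : 0 < ‖w‖ := norm_pos_iff.mpr hw
  rw [toAnnulus, norm_radialMap hw (by positivity)]
  constructor
  · have : 0 < ‖w‖ / (1 + ‖w‖) := by positivity
    linarith
  · have : ‖w‖ / (1 + ‖w‖) < 1 := by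
      rw [div_lt_one (by positivity)]
      linarith
    linarith

theorem exists_toAnnulus {v : ℂ} (h1 : 1 < ‖v‖) (h2 : ‖v‖ < 2) :
    ∃ w ≠ 0, toAnnulus w = v := by
  obtain ⟨z, hz⟩ := exists_polar (norm_pos_iff.mp (zero_lt_one.trans h1))
  have h2' : 0 < 2 - ‖v‖ := by linarith
  have hs : 0 < (‖v‖ - 1) / (2 - ‖v‖) := div_pos (by linarith) h2'
  refine ⟨((‖v‖ - 1) / (2 - ‖v‖) : ℝ) * (z : ℂ), ?_, ?_⟩
  · rw [← norm_ne_zero_iff, norm_mul, Circle.norm_coe, mul_one, Complex.norm_real,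
      Real.norm_of_nonneg hs.le]
    exact hs.ne'
  · rw [toAnnulus_mul hs]
    conv_rhs => rw [hz]
    congr 2
    have : 1 + (‖v‖ - 1) / (2 - ‖v‖) = 1 / (2 - ‖v‖) := by
      field_simp
      ring
    rw [this]
    field_simp
    ring

/-- The inversion of the plane in the unit circle. -/
noncomputable def circleInversion (v : ℂ) : ℂ := (starRingEnd ℂ v)⁻¹

theorem circleInversion_circleInversion (v : ℂ) : circleInversion (circleInversion v) = v := by
  simp [circleInversion]

theorem norm_circleInversion (v : ℂ) : ‖circleInversion v‖ = ‖v‖⁻¹ := by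
  simp [circleInversion]

theorem circleInversion_ne_zero {v : ℂ} (hv : v ≠ 0) : circleInversion v ≠ 0 := by
  simpa [circleInversion] using hv

theorem circleInversion_mul (s : ℝ) (z : Circle) :
    circleInversion (s * z) = ((s⁻¹ : ℝ) : ℂ) * z := by
  simp [circleInversion, ← Circle.coe_inv_eq_conj, mul_comm]

theorem circleInversion_of_norm_eq_one {v : ℂ} (hv : ‖v‖ = 1) : circleInversion v = v := by
  obtain ⟨z, hz⟩ := exists_polar (norm_pos_iff.mp (hv ▸ zero_lt_one))
  rw [hz, circleInversion_mul, hv, inv_one]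

theorem continuousOn_circleInversion : ContinuousOn circleInversion {v | v ≠ 0} := by
  refine ContinuousOn.inv₀ (by fun_prop) fun v hv => ?_
  simpa using hv

/-- Inversion in the circle corresponds to the exchange of the ends of the annulus. -/
theorem radialMap_toAnnulus_circleInversion {w : ℂ} (hw : w ≠ 0) :
    radialMap (fun s => 3 - s) (toAnnulus (circleInversion w)) = toAnnulus w := by
  obtain ⟨z, hz⟩ := exists_polar hw
  have hpos : 0 < ‖w‖ := norm_pos_iff.mpr hw
  rw [hz, circleInversion_mul, toAnnulus_mul hpos, toAnnulus_mul (inv_pos.mpr hpos),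
    radialMap_mul (by positivity)]
  congr 2
  field_simp
  ring

theorem circle_surjective_of_injective {f : Circle → Circle} (hf : Continuous f)
    (hinj : Function.Injective f) : Function.Surjective f := by
  intro p
  by_contra! hp
  -- otherwise `f` takes values in an arc, and agrees at two antipodal points
  let a : Circle → ℝ := fun z => Complex.arg ((-p)⁻¹ * f z : Circle)
  have hslit : ∀ z, (((-p)⁻¹ * f z : Circle) : ℂ) ∈ Complex.slitPlane := by
    intro z
    rw [Complex.mem_slitPlane_iff_arg]
    refine ⟨fun h => hp z ?_, Circle.coe_ne_zero _⟩
    have h1 := Circle.exp_arg ((-p)⁻¹ * f z)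
    rw [h, show Circle.exp Real.pi = -1 from Circle.ext (by simp [Circle.coe_exp])] at h1
    have h2 : f z = -p * -1 := by rw [h1, mul_inv_cancel_left]
    rw [h2, neg_mul_neg, mul_one]
  have ha : Continuous a := by
    rw [continuous_iff_continuousAt]
    intro z
    refine ContinuousAt.comp (g := Complex.arg) (Complex.continuousAt_arg (hslit z)) ?_
    exact Continuous.continuousAt (by fun_prop)
  have hainj : ∀ z w, a z = a w → z = w := fun z w h =>
    hinj (mul_left_cancel (Circle.injective_arg h))
  obtain ⟨z, hz⟩ := mem_range_of_exists_le_of_exists_ge (c := (0 : ℝ))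
    (f := fun z => a z - a (-z)) (by fun_prop)
    (by
      rcases le_total (a 1) (a (-1)) with h | h
      · exact ⟨1, by linarith⟩
      · exact ⟨-1, by rw [neg_neg]; linarith⟩)
    (by
      rcases le_total (a 1) (a (-1)) with h | h
      · exact ⟨-1, by rw [neg_neg]; linarith⟩
      · exact ⟨1, by linarith⟩)
  have h1 : z = -z := hainj _ _ (sub_eq_zero.mp hz)
  have h2 : (z : ℂ) = -z := congrArg Subtype.val h1
  exact Circle.coe_ne_zero z (self_eq_neg.mp h2)

variable {S : Type*} [TopologicalSpace S] [CompactSpace S] [T2Space S]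

/-- A fibrewise injective map of annuli that takes the circle of radius `a` into the circle of
radius `b` maps no other point into that circle, since an injective map of a circle to a circle is
onto. -/
theorem norm_eq_of_annulus_map {S : Type*} [TopologicalSpace S] {H : S × ℂ → ℂ}
    (hH : ContinuousOn H (annulusBundle S))
    (hinj : ∀ p ∈ annulusBundle S, ∀ q ∈ annulusBundle S, p.1 = q.1 → H p = H q → p = q)
    {a b : ℝ} (ha : a ∈ Icc (1 : ℝ) 2) (hb : 0 < b) (hab : ∀ p : S × ℂ, ‖p.2‖ = a → ‖H p‖ = b)
    {p : S × ℂ} (hp : p ∈ annulusBundle S) (hHp : ‖H p‖ = b) : ‖p.2‖ = a := by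
  have hnorm : ∀ z : Circle, ‖(a : ℂ) * z‖ = a := fun z => by
    rw [norm_mul, Circle.norm_coe, mul_one, Complex.norm_real,
      Real.norm_of_nonneg (by linarith [ha.1])]
  have hmem : ∀ z : Circle, (p.1, (a : ℂ) * z) ∈ annulusBundle S := fun z => by
    refine ⟨?_, ?_⟩ <;> simp only <;> rw [hnorm]
    exacts [ha.1, ha.2]
  have hb' : (b : ℂ) ≠ 0 := by exact_mod_cast hb.ne'
  have hfm : ∀ z : Circle, H (p.1, (a : ℂ) * z) / b ∈ Submonoid.unitSphere ℂ := fun z => by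
    refine mem_sphere_zero_iff_norm.mpr ?_
    rw [norm_div, hab _ (hnorm z), Complex.norm_real, Real.norm_of_nonneg hb.le, div_self hb.ne']
  have hc : Continuous fun z : Circle => H (p.1, (a : ℂ) * z) :=
    hH.comp_continuous (by fun_prop) hmem
  obtain ⟨z, hz⟩ := circle_surjective_of_injective
    (f := fun z => (⟨H (p.1, (a : ℂ) * z) / b, hfm z⟩ : Circle))
    ((hc.div_const _).subtype_mk _) (by
      intro z w h
      have h1 : H (p.1, (a : ℂ) * z) / b = H (p.1, (a : ℂ) * w) / b := congrArg Subtype.val h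
      rw [div_left_inj' hb'] at h1
      have h2 := hinj _ (hmem z) _ (hmem w) rfl h1
      have h3 : (a : ℂ) * z = a * w := congrArg Prod.snd h2
      have : (a : ℂ) ≠ 0 := by
        have := ha.1
        exact_mod_cast (by linarith : a ≠ 0)
      exact Circle.ext (mul_left_cancel₀ this h3))
    ⟨H p / b, mem_sphere_zero_iff_norm.mpr (by
      rw [norm_div, hHp, Complex.norm_real, Real.norm_of_nonneg hb.le, div_self hb.ne'])⟩
  have h1 : H (p.1, (a : ℂ) * z) / b = H p / b := congrArg Subtype.val hz
  rw [div_left_inj' hb'] at h1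
  rw [← hinj _ (hmem z) _ hp rfl h1]
  exact hnorm z

/-- A fibrewise homeomorphism `H` of the closed annulus bundle preserving the boundary components,
conjugated by the identifications of the annulus with the punctured planes, extends over the zero
section. -/
theorem exists_tube_of_annulus_map {R : ℝ ≃ₜ ℝ} (hmono : StrictMono R) (h0 : R 0 = 1)
    {H : S × ℂ → ℂ} (hH : ContinuousOn H (annulusBundle S))
    (hmaps : ∀ p ∈ annulusBundle S, (p.1, H p) ∈ annulusBundle S)
    (hinj : ∀ p ∈ annulusBundle S, ∀ q ∈ annulusBundle S, p.1 = q.1 → H p = H q → p = q)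
    (hsurj : ∀ p ∈ annulusBundle S, ∃ v, (p.1, v) ∈ annulusBundle S ∧ H (p.1, v) = p.2)
    (hone : ∀ p : S × ℂ, ‖p.2‖ = 1 → ‖H p‖ = 1) (htwo : ∀ p : S × ℂ, ‖p.2‖ = 2 → ‖H p‖ = 2) :
    ∃ θ : S × ℂ → ℂ, IsOpenEmbedding (fun p : S × ℂ => (p.1, θ p)) ∧ (∀ x, θ (x, 0) = 0) ∧
      ∀ x w, w ≠ 0 → θ (x, w) ≠ 0 ∧ radialMap R (θ (x, w)) = H (x, toAnnulus w) := by
  have hRs0 : R.symm 1 = 0 := by rw [← h0, R.symm_apply_apply]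
  have hsmono : StrictMono R.symm := fun a b hab => by
    rwa [← hmono.lt_iff_lt, R.apply_symm_apply, R.apply_symm_apply]
  let ρ : ℂ → ℂ := radialMap R.symm
  have hρc : ∀ u : ℂ, u ≠ 0 → ContinuousAt ρ u := fun u hu => by
    have h1 : ContinuousAt (fun v : ℂ => ‖v‖) u := continuous_norm.continuousAt
    exact ((R.symm.continuous.continuousAt.comp h1).div h1 (norm_ne_zero_iff.mpr hu)).smul
      continuousAt_id
  have hρn : ∀ u : ℂ, 1 ≤ ‖u‖ → ‖ρ u‖ = R.symm ‖u‖ := fun u hu => by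
    refine norm_radialMap (norm_pos_iff.mp (zero_lt_one.trans_le hu)) ?_
    rw [← hRs0]
    exact hsmono.monotone hu
  have hρ1 : ∀ u : ℂ, ‖u‖ = 1 → ρ u = 0 := fun u hu => by
    rw [← norm_eq_zero, hρn u hu.ge, hu, hRs0]
  have hρ0 : ∀ u : ℂ, 1 < ‖u‖ → ρ u ≠ 0 := fun u hu => by
    rw [← norm_pos_iff, hρn u hu.le, ← hRs0]
    exact hsmono hu
  have hRρ : ∀ u : ℂ, 1 < ‖u‖ → radialMap R (ρ u) = u := fun u hu =>
    radialMap_radialMap (norm_pos_iff.mp (zero_lt_one.trans hu)) (by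
      rw [← hRs0]; exact hsmono hu) (R.apply_symm_apply _)
  have hρR : ∀ u : ℂ, u ≠ 0 → ρ (radialMap R u) = u := fun u hu =>
    radialMap_radialMap hu (by
      have := hmono (norm_pos_iff.mpr hu)
      rw [h0] at this
      linarith) (R.symm_apply_apply _)
  have hnormA : ∀ (r : unitInterval) (z : Circle), ‖((1 + r : ℝ) : ℂ) * (z : ℂ)‖ = 1 + r :=
    fun r z => by
      rw [norm_mul, Circle.norm_coe, mul_one, Complex.norm_real,
        Real.norm_of_nonneg (by linarith [r.2.1])]
  have hA : ∀ (x : S) (r : unitInterval) (z : Circle),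
      (x, ((1 + r : ℝ) : ℂ) * (z : ℂ)) ∈ annulusBundle S := fun x r z => by
    refine ⟨?_, ?_⟩ <;> simp only <;> rw [hnormA]
    · linarith [r.2.1]
    · linarith [r.2.2]
  have hone' : ∀ p ∈ annulusBundle S, ‖H p‖ = 1 → ‖p.2‖ = 1 := fun p hp hHp =>
    norm_eq_of_annulus_map hH hinj ⟨le_rfl, one_le_two⟩ zero_lt_one hone hp hHp
  have htwo' : ∀ p ∈ annulusBundle S, ‖H p‖ = 2 → ‖p.2‖ = 2 := fun p hp hHp =>
    norm_eq_of_annulus_map hH hinj ⟨one_le_two, le_rfl⟩ zero_lt_two htwo hp hHp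
  let B := Metric.closedBall (0 : ℂ) 1
  let Q : C(S × (unitInterval × Circle), S × B) :=
    ⟨fun q => (q.1, ⟨((q.2.1 : ℝ) : ℂ) * (q.2.2 : ℂ), by
      rw [mem_closedBall_zero_iff, norm_mul, Circle.norm_coe, mul_one, Complex.norm_real,
        Real.norm_of_nonneg q.2.1.2.1]
      exact q.2.1.2.2⟩), by fun_prop⟩
  have hQs : Function.Surjective Q := by
    rintro ⟨x, y, hy⟩
    rw [mem_closedBall_zero_iff] at hy
    by_cases h : y = 0
    · refine ⟨(x, 0, 1), ?_⟩
      simp [Q, h]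
    · obtain ⟨z, hz⟩ := exists_polar h
      exact ⟨(x, ⟨‖y‖, norm_nonneg y, hy⟩, z), Prod.ext rfl (Subtype.ext hz.symm)⟩
  have hQq : IsQuotientMap Q := Q.continuous.isClosedMap.isQuotientMap Q.continuous hQs
  let κ₀ : C(S × (unitInterval × Circle), S × ℂ) :=
    ⟨fun q => (q.1, ρ (H (q.1, ((1 + (q.2.1 : ℝ) : ℝ) : ℂ) * (q.2.2 : ℂ)))), by
      refine continuous_fst.prodMk ?_
      have h1 : Continuous fun q : S × (unitInterval × Circle) =>
          H (q.1, ((1 + (q.2.1 : ℝ) : ℝ) : ℂ) * (q.2.2 : ℂ)) :=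
        hH.comp_continuous (by fun_prop) fun q => hA _ _ _
      rw [continuous_iff_continuousAt]
      intro q
      refine ContinuousAt.comp (g := ρ) (hρc _ ?_) h1.continuousAt
      exact norm_pos_iff.mp (zero_lt_one.trans_le (hmaps _ (hA q.1 q.2.1 q.2.2)).1)⟩
  have hzero : ∀ x z, κ₀ (x, 0, z) = (x, 0) := by
    intro x z
    refine Prod.ext rfl (hρ1 _ (hone _ ?_))
    have := hnormA 0 z
    simpa using this
  have hκeq : ∀ q q', Q q = Q q' → κ₀ q = κ₀ q' := by
    rintro ⟨x, r, z⟩ ⟨x', r', z'⟩ h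
    have hx : x = x' := congrArg Prod.fst h
    have hrz : ((r : ℝ) : ℂ) * z = ((r' : ℝ) : ℂ) * z' :=
      congrArg (fun y : S × B => (y.2 : ℂ)) h
    have hr : r = r' := by
      have := congrArg norm hrz
      rw [norm_mul, norm_mul, Circle.norm_coe, Circle.norm_coe, mul_one, mul_one,
        Complex.norm_real, Complex.norm_real, Real.norm_of_nonneg r.2.1,
        Real.norm_of_nonneg r'.2.1] at this
      exact Subtype.ext this
    subst hx hr
    by_cases h0 : r = 0
    · subst h0
      rw [hzero, hzero]
    · have : ((r : ℝ) : ℂ) ≠ 0 := by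
        intro h1
        exact h0 (Subtype.ext (by exact_mod_cast h1))
      rw [Circle.ext (mul_left_cancel₀ this hrz)]
  let κ : C(S × B, S × ℂ) := hQq.lift κ₀ hκeq
  have hκ : ∀ q, κ (Q q) = κ₀ q := fun q => DFunLike.congr_fun (hQq.lift_comp κ₀ hκeq) q
  have hκinj : Function.Injective κ := by
    intro y y' h
    obtain ⟨⟨x, r, z⟩, rfl⟩ := hQs y
    obtain ⟨⟨x', r', z'⟩, rfl⟩ := hQs y'
    rw [hκ, hκ] at h
    have hx : x = x' := congrArg Prod.fst h
    subst hx
    have hρeq : ρ (H (x, ((1 + r : ℝ) : ℂ) * z)) = ρ (H (x, ((1 + r' : ℝ) : ℂ) * z')) :=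
      congrArg Prod.snd h
    have key : ∀ (r : unitInterval) (z : Circle), ρ (H (x, ((1 + r : ℝ) : ℂ) * z)) = 0 → r = 0 := by
      intro r z h
      have h1 : ‖H (x, ((1 + r : ℝ) : ℂ) * z)‖ = 1 := by
        by_contra hne
        exact hρ0 _ (lt_of_le_of_ne (hmaps _ (hA x r z)).1 (Ne.symm hne)) h
      have h2 := hone' _ (hA x r z) h1
      simp only at h2
      rw [hnormA] at h2
      exact Subtype.ext (by simpa using h2)
    have hQ0 : ∀ z, Q (x, 0, z) = (x, ⟨0, by simp [B]⟩) := fun z => by simp [Q]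
    by_cases h0 : ρ (H (x, ((1 + r : ℝ) : ℂ) * z)) = 0
    · have hr := key r z h0
      have hr' := key r' z' (hρeq ▸ h0)
      rw [hr, hr', hQ0, hQ0]
    · have h1 : ∀ (r : unitInterval) (z : Circle), ρ (H (x, ((1 + r : ℝ) : ℂ) * z)) ≠ 0 →
          1 < ‖H (x, ((1 + r : ℝ) : ℂ) * z)‖ := fun r z h =>
        lt_of_le_of_ne (hmaps _ (hA x r z)).1 fun hne => h (hρ1 _ hne.symm)
      have h2 := congrArg (radialMap R) hρeq
      rw [hRρ _ (h1 r z h0), hRρ _ (h1 r' z' (hρeq ▸ h0))] at h2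
      have h3 := congrArg Prod.snd (hinj _ (hA x r z) _ (hA x r' z') rfl h2)
      simp only at h3
      have h4 := congrArg norm h3
      rw [hnormA, hnormA] at h4
      have hr : r = r' := Subtype.ext (by linarith)
      subst hr
      have h5 : ((1 + r : ℝ) : ℂ) ≠ 0 := by
        have := r.2.1
        exact_mod_cast (by linarith : (1 + r : ℝ) ≠ 0)
      rw [Circle.ext (mul_left_cancel₀ h5 h3)]
  have hκemb : IsEmbedding κ := (κ.continuous.isClosedEmbedding hκinj).isEmbedding
  obtain ⟨hsq, hsqr⟩ := isOpenEmbedding_squash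
  have hsqB : ∀ w : ℂ, ((1 + ‖w‖ : ℝ)⁻¹ : ℝ) • w ∈ B := fun w => by
    have : ((1 + ‖w‖ : ℝ)⁻¹ : ℝ) • w ∈ Metric.ball (0 : ℂ) 1 := hsqr ▸ ⟨w, rfl⟩
    exact Metric.ball_subset_closedBall this
  let s : ℂ → B := fun w => ⟨((1 + ‖w‖ : ℝ)⁻¹ : ℝ) • w, hsqB w⟩
  have hs : IsEmbedding s := hsq.isEmbedding.codRestrict B hsqB
  -- polar coordinates of the point `s w`
  have hpol : ∀ x w, w ≠ 0 → ∃ (r : unitInterval) (z : Circle), 0 < (r : ℝ) ∧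
      (x, s w) = Q (x, r, z) ∧ toAnnulus w = ((1 + r : ℝ) : ℂ) * z := by
    intro x w hw
    obtain ⟨z, hz⟩ := exists_polar hw
    have hpos : 0 < ‖w‖ := norm_pos_iff.mpr hw
    have hle : ‖w‖ / (1 + ‖w‖) ≤ 1 := by
      rw [div_le_one (by positivity)]
      linarith
    refine ⟨⟨‖w‖ / (1 + ‖w‖), by positivity, hle⟩, z, by simp only; positivity,
      Prod.ext rfl (Subtype.ext ?_), ?_⟩
    · change ((1 + ‖w‖ : ℝ)⁻¹ : ℝ) • w = ((‖w‖ / (1 + ‖w‖) : ℝ) : ℂ) * z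
      conv_lhs => rw [hz]
      rw [norm_mul, Circle.norm_coe, mul_one, Complex.norm_real, norm_norm, Complex.real_smul,
        Complex.ofReal_div, Complex.ofReal_inv]
      ring
    · conv_lhs => rw [hz]
      rw [toAnnulus_mul hpos]
  let θ : S × ℂ → ℂ := fun p => (κ (p.1, s p.2)).2
  have hκfst : ∀ y, (κ y).1 = y.1 := by
    intro y
    obtain ⟨q, rfl⟩ := hQs y
    rw [hκ]
    rfl
  have hθκ : (fun p : S × ℂ => (p.1, θ p)) = κ ∘ Prod.map id s :=
    funext fun p => Prod.ext (hκfst (p.1, s p.2)).symm rfl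
  have hθ0 : ∀ x, θ (x, 0) = 0 := by
    intro x
    have h1 : (x, s 0) = Q (x, 0, 1) := Prod.ext rfl (Subtype.ext (by simp [s, Q]))
    change (κ (x, s 0)).2 = 0
    rw [h1, hκ, hzero]
  have hθ : ∀ x w, w ≠ 0 → θ (x, w) = ρ (H (x, toAnnulus w)) := by
    intro x w hw
    obtain ⟨r, z, -, h1, h2⟩ := hpol x w hw
    change (κ (x, s w)).2 = _
    rw [h1, hκ, h2]
    rfl
  have hAn : ∀ x w, w ≠ 0 → (x, toAnnulus w) ∈ annulusBundle S := fun x w hw =>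
    ⟨(norm_toAnnulus hw).1.le, (norm_toAnnulus hw).2.le⟩
  have hHgt : ∀ x w, w ≠ 0 → 1 < ‖H (x, toAnnulus w)‖ := fun x w hw =>
    lt_of_le_of_ne (hmaps _ (hAn x w hw)).1 fun h =>
      (norm_toAnnulus hw).1.ne' (hone' _ (hAn x w hw) h.symm)
  have hHlt : ∀ x w, w ≠ 0 → ‖H (x, toAnnulus w)‖ < 2 := fun x w hw =>
    lt_of_le_of_ne (hmaps _ (hAn x w hw)).2 fun h =>
      (norm_toAnnulus hw).2.ne (htwo' _ (hAn x w hw) h)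
  refine ⟨θ, ⟨?_, ?_⟩, hθ0, fun x w hw => ?_⟩
  · rw [hθκ]
    exact hκemb.comp (IsEmbedding.id.prodMap hs)
  · have hrange : range (fun p : S × ℂ => (p.1, θ p)) = {p | ‖p.2‖ < R.symm 2} := by
      ext ⟨x, u⟩
      constructor
      · rintro ⟨⟨x', w⟩, h⟩
        simp only [Prod.mk.injEq] at h
        obtain ⟨rfl, rfl⟩ := h
        change ‖θ (x', w)‖ < R.symm 2
        by_cases hw : w = 0
        · rw [hw, hθ0, norm_zero, ← hRs0]
          exact hsmono one_lt_two
        · rw [hθ x' w hw, hρn _ (hHgt x' w hw).le]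
          exact hsmono (hHlt x' w hw)
      · intro hu
        have hu' : ‖u‖ < R.symm 2 := hu
        by_cases hu0 : u = 0
        · exact ⟨(x, 0), by simp [hθ0, hu0]⟩
        · have h1 : 1 < R ‖u‖ := by
            rw [← h0]
            exact hmono (norm_pos_iff.mpr hu0)
          have h2 : ‖radialMap R u‖ = R ‖u‖ := norm_radialMap hu0 (by linarith)
          have h3 : R ‖u‖ < 2 := by
            rw [← R.apply_symm_apply 2]
            exact hmono hu'
          obtain ⟨v, hv, hHv⟩ := hsurj (x, radialMap R u) ⟨by rw [h2]; exact h1.le,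
            by rw [h2]; exact h3.le⟩
          simp only at hv hHv
          have hv1 : 1 < ‖v‖ := lt_of_le_of_ne hv.1 fun h => by
            have := hone (x, v) h.symm
            rw [hHv, h2] at this
            linarith
          have hv2 : ‖v‖ < 2 := lt_of_le_of_ne hv.2 fun h => by
            have := htwo (x, v) h
            rw [hHv, h2] at this
            linarith
          obtain ⟨w, hw, rfl⟩ := exists_toAnnulus hv1 hv2
          refine ⟨(x, w), Prod.ext rfl ?_⟩
          change θ (x, w) = u
          rw [hθ x w hw, hHv, hρR u hu0]
    rw [hrange]
    exact isOpen_lt (by fun_prop) continuous_const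
  · rw [hθ x w hw]
    exact ⟨hρ0 _ (hHgt x w hw), hRρ _ (hHgt x w hw)⟩

section

variable {ES HS E₁ H₁ M₁ E₂ H₂ M₂ E H : Type*}
  [NormedAddCommGroup ES] [NormedSpace ℝ ES] [TopologicalSpace HS]
  [NormedAddCommGroup E₁] [NormedSpace ℝ E₁] [TopologicalSpace H₁]
  [NormedAddCommGroup E₂] [NormedSpace ℝ E₂] [TopologicalSpace H₂]
  [NormedAddCommGroup E] [NormedSpace ℝ E] [TopologicalSpace H]
  [ChartedSpace HS S]
  [TopologicalSpace M₁] [ChartedSpace H₁ M₁] [TopologicalSpace M₂] [ChartedSpace H₂ M₂]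

theorem SmoothEmbOn.comp {M₃ : Type*} [TopologicalSpace M₃] [ChartedSpace H M₃]
    {I₁ : ModelWithCorners ℝ E₁ H₁} {I₂ : ModelWithCorners ℝ E₂ H₂} {I : ModelWithCorners ℝ E H}
    {f : M₁ → M₂} {g : M₂ → M₃} {s : Set M₁} {t : Set M₂} (hg : SmoothEmbOn I₂ I g t)
    (hf : SmoothEmbOn I₁ I₂ f s) (hst : MapsTo f s t) : SmoothEmbOn I₁ I (g ∘ f) s :=
  ⟨hg.1.comp hf.1 hst, fun x => (hf.2 x).comp (K := I) (P := M₃) (hg := hg.2 ⟨_, hst x.2⟩)⟩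

/-- Composed with the reflection of the radial coordinate, a flip of the annulus bundle preserves
the boundary components. -/
theorem IsAnnulusFlip.exists_annulus_map {S : Type*} [TopologicalSpace S] [ChartedSpace HS S]
    {IS : ModelWithCorners ℝ ES HS} {h : S × ℂ → ℂ}
    (hflip : IsAnnulusFlip IS h) :
    ∃ k : S × ℂ → ℂ, ContinuousOn k (annulusBundle S) ∧
      (∀ p ∈ annulusBundle S, (p.1, k p) ∈ annulusBundle S) ∧
      (∀ p ∈ annulusBundle S, ∀ q ∈ annulusBundle S, p.1 = q.1 → k p = k q → p = q) ∧
      (∀ p ∈ annulusBundle S, ∃ v, (p.1, v) ∈ annulusBundle S ∧ k (p.1, v) = p.2) ∧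
      (∀ p : S × ℂ, ‖p.2‖ = 1 → ‖k p‖ = 1) ∧ (∀ p : S × ℂ, ‖p.2‖ = 2 → ‖k p‖ = 2) ∧
      ∀ x w, w ≠ 0 → k (x, toAnnulus (circleInversion w)) = h (x, toAnnulus w) := by
  obtain ⟨hh, ⟨h', -, hh'⟩, hbd⟩ := hflip
  have hflipn : ∀ v : ℂ, 1 ≤ ‖v‖ → ‖v‖ ≤ 2 → ‖radialMap (fun s => 3 - s) v‖ = 3 - ‖v‖ := by
    intro v h1 h2
    exact norm_radialMap (norm_pos_iff.mp (by linarith)) (by linarith)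
  have hflipf : ∀ v : ℂ, 1 ≤ ‖v‖ → ‖v‖ ≤ 2 →
      radialMap (fun s => 3 - s) (radialMap (fun s => 3 - s) v) = v := by
    intro v h1 h2
    exact radialMap_radialMap (norm_pos_iff.mp (by linarith)) (by linarith) (by ring)
  have hflipm : ∀ p ∈ annulusBundle S, (p.1, radialMap (fun s => 3 - s) p.2) ∈ annulusBundle S := by
    intro p hp
    refine ⟨?_, ?_⟩ <;> simp only <;> rw [hflipn _ hp.1 hp.2] <;> linarith [hp.1, hp.2]
  let k : S × ℂ → ℂ := fun p => h (p.1, radialMap (fun s => 3 - s) p.2)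
  refine ⟨k, ?_, fun p hp => (hh' _ (hflipm p hp)).1, ?_, ?_, ?_, ?_, ?_⟩
  · refine hh.continuousOn.comp (ContinuousOn.prodMk continuousOn_fst ?_) hflipm
    have h1 : ContinuousOn (fun p : S × ℂ => ‖p.2‖) (annulusBundle S) := by fun_prop
    have h2 : ∀ p ∈ annulusBundle S, ‖p.2‖ ≠ 0 := fun p hp => by linarith [hp.1]
    have h3 : ContinuousOn (fun p : S × ℂ => (3 - ‖p.2‖) / ‖p.2‖) (annulusBundle S) :=
      (continuousOn_const.sub h1).div h1 h2
    exact h3.smul continuousOn_snd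
  · intro p hp q hq h1 h2
    have h4 := (hh' _ (hflipm p hp)).2.1
    have h5 := (hh' _ (hflipm q hq)).2.1
    have h3 : h' (p.1, k p) = h' (q.1, k q) := by rw [h1, h2]
    have h6 := congrArg (radialMap fun s => 3 - s) ((h4.symm.trans h3).trans h5)
    simp only at h6
    rw [hflipf _ hp.1 hp.2, hflipf _ hq.1 hq.2] at h6
    exact Prod.ext h1 h6
  · intro p hp
    obtain ⟨-, -, h1, h2⟩ := hh' p hp
    refine ⟨radialMap (fun s => 3 - s) (h' p), hflipm (p.1, h' p) h1, ?_⟩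
    change h (p.1, radialMap _ (radialMap _ (h' p))) = p.2
    rw [hflipf (h' p) h1.1 h1.2, h2]
  · intro p hp
    refine (hbd _).1 ?_
    change ‖radialMap _ p.2‖ = 2
    rw [hflipn _ (by linarith) (by linarith), hp]
    norm_num
  · intro p hp
    refine (hbd _).2 ?_
    change ‖radialMap _ p.2‖ = 1
    rw [hflipn _ (by linarith) (by linarith), hp]
    norm_num
  · intro x w hw
    change h (x, radialMap _ (toAnnulus (circleInversion w))) = _
    rw [radialMap_toAnnulus_circleInversion hw]

/-- A normal connected sum is the union of the complements of the cores, where tubes with the cores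
removed are identified by inversion of the radius. -/
theorem IsNormalSum.exists_normalForm [T2Space M₁] [T2Space M₂]
    {IS : ModelWithCorners ℝ ES HS} {I₁ : ModelWithCorners ℝ E₁ H₁}
    {I₂ : ModelWithCorners ℝ E₂ H₂} {I : ModelWithCorners ℝ E H} {e₁ : S → M₁} {e₂ : S → M₂}
    {Z : Type*} [TopologicalSpace Z] [ChartedSpace H Z]
    (hZ : IsNormalSum IS I₁ I₂ I e₁ e₂ Z) :
    ∃ (τ₁ : S × ℂ → M₁) (τ₂ : S × ℂ → M₂) (j₁ : M₁ → Z) (j₂ : M₂ → Z),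
      IsOpenEmbedding τ₁ ∧ (∀ x, τ₁ (x, 0) = e₁ x) ∧ IsOpenEmbedding τ₂ ∧
      (∀ x, τ₂ (x, 0) = e₂ x) ∧ SmoothEmbOn I₁ I j₁ (range e₁)ᶜ ∧
      SmoothEmbOn I₂ I j₂ (range e₂)ᶜ ∧ j₁ '' (range e₁)ᶜ ∪ j₂ '' (range e₂)ᶜ = univ ∧
      ∀ p ∈ (range e₁)ᶜ, ∀ q ∈ (range e₂)ᶜ,
        j₁ p = j₂ q ↔ ∃ x v, v ≠ 0 ∧ p = τ₁ (x, v) ∧ q = τ₂ (x, circleInversion v) := by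
  obtain ⟨t₁, t₂, h, j₁, j₂, ht₁, he₁, ht₂, he₂, hflip, hj₁, hj₂, hcov, hglue⟩ := hZ
  obtain ⟨R, c, hc, hR, hRs, hmono, h0, hlarge⟩ := exists_push_homeomorph
  obtain ⟨Φ₁, hΦ₁, hΦ₁e, hΦ₁i⟩ := exists_push_off_core hR hRs hmono h0 hlarge ht₁
  obtain ⟨Φ₂, hΦ₂, hΦ₂e, hΦ₂i⟩ := exists_push_off_core hR hRs hmono h0 hlarge ht₂
  have hr₁ : (range fun x => t₁ (x, 0)) = range e₁ := congrArg range (funext he₁)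
  have hr₂ : (range fun x => t₂ (x, 0)) = range e₂ := congrArg range (funext he₂)
  rw [hr₁] at hΦ₁e hΦ₁i
  rw [hr₂] at hΦ₂e hΦ₂i
  have hto₁ := ht₁.isOpenEmbedding
  have hto₂ := ht₂.isOpenEmbedding
  obtain ⟨θ₁, hθ₁o, hθ₁0, hθ₁⟩ := exists_tube_of_annulus_map (S := S) (H := fun p => p.2) hmono h0
    continuousOn_snd (fun p hp => hp) (fun p _ q _ h1 h2 => Prod.ext h1 h2)
    (fun p hp => ⟨p.2, hp, rfl⟩) (fun _ hp => hp) (fun _ hp => hp)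
  obtain ⟨k, hk, hkm, hki, hks, hk1, hk2, hkh⟩ := hflip.exists_annulus_map
  obtain ⟨θ₂, hθ₂o, hθ₂0, hθ₂⟩ := exists_tube_of_annulus_map hmono h0 hk hkm hki hks hk1 hk2
  have hm₁ : ∀ p ∈ (range e₁)ᶜ, Φ₁ p ∈ (t₁ '' {p | ‖p.2‖ ≤ 1})ᶜ := fun p hp =>
    hΦ₁i ▸ mem_image_of_mem Φ₁ hp
  have hm₂ : ∀ p ∈ (range e₂)ᶜ, Φ₂ p ∈ (t₂ '' {p | ‖p.2‖ ≤ 1})ᶜ := fun p hp =>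
    hΦ₂i ▸ mem_image_of_mem Φ₂ hp
  have hoff₁ : ∀ x u, u ≠ 0 → t₁ (x, u) ∈ (range e₁)ᶜ := by
    rintro x u hu ⟨y, hy⟩
    rw [← he₁] at hy
    exact hu (congrArg Prod.snd (hto₁.injective hy)).symm
  have hoff₂ : ∀ x u, u ≠ 0 → t₂ (x, u) ∈ (range e₂)ᶜ := by
    rintro x u hu ⟨y, hy⟩
    rw [← he₂] at hy
    exact hu (congrArg Prod.snd (hto₂.injective hy)).symm
  refine ⟨fun p => t₁ (p.1, θ₁ p), fun p => t₂ (p.1, θ₂ p), j₁ ∘ Φ₁, j₂ ∘ Φ₂,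
    hto₁.comp hθ₁o, fun x => (congrArg (fun u => t₁ (x, u)) (hθ₁0 x)).trans (he₁ x),
    hto₂.comp hθ₂o, fun x => (congrArg (fun u => t₂ (x, u)) (hθ₂0 x)).trans (he₂ x),
    hj₁.comp hΦ₁e hm₁, hj₂.comp hΦ₂e hm₂, ?_, fun p hp q hq => ?_⟩
  · rw [image_comp, image_comp, hΦ₁i, hΦ₂i, hcov]
  · rw [Function.comp_apply, Function.comp_apply, hglue _ (hm₁ p hp) _ (hm₂ q hq)]
    constructor
    · rintro ⟨x, v, hv1, hv2, hpv, hqv⟩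
      obtain ⟨w, hw, rfl⟩ := exists_toAnnulus hv1 hv2
      have hw' := circleInversion_ne_zero hw
      refine ⟨x, w, hw, hΦ₁e.1 hp (hoff₁ _ _ (hθ₁ x w hw).1) ?_,
        hΦ₂e.1 hq (hoff₂ _ _ (hθ₂ x _ hw').1) ?_⟩
      · rw [hpv, hΦ₁ _ _ (hθ₁ x w hw).1, (hθ₁ x w hw).2]
      · rw [hqv, hΦ₂ _ _ (hθ₂ x _ hw').1, (hθ₂ x _ hw').2, hkh x w hw]
    · rintro ⟨x, w, hw, rfl, rfl⟩
      have hw' := circleInversion_ne_zero hw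
      refine ⟨x, toAnnulus w, (norm_toAnnulus hw).1, (norm_toAnnulus hw).2, ?_, ?_⟩
      · rw [hΦ₁ _ _ (hθ₁ x w hw).1, (hθ₁ x w hw).2]
      · rw [hΦ₂ _ _ (hθ₂ x _ hw').1, (hθ₂ x _ hw').2, hkh x w hw]

end

end NormalForm

/-! ### Gluing two spaces along open subspaces -/

section Gluing

open Topology

/-- Two local homeomorphisms to a Hausdorff space that agree on the overlap of two spaces extend to
the glued space, which is Hausdorff if the overlap is as large as possible. -/
theorem exists_gluing {V₁ V₂ A Z : Type*} [TopologicalSpace V₁] [T2Space V₁] [TopologicalSpace V₂]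
    [T2Space V₂] [TopologicalSpace A] [TopologicalSpace Z] [T2Space Z] {a₁ : A → V₁} {a₂ : A → V₂}
    (ha₁ : IsOpenEmbedding a₁) (ha₂ : IsOpenEmbedding a₂) {P₁ : V₁ → Z} {P₂ : V₂ → Z}
    (hP₁ : IsLocalHomeomorph P₁) (hP₂ : IsLocalHomeomorph P₂) (ha : ∀ a, P₁ (a₁ a) = P₂ (a₂ a))
    (hmax : ∀ v w, P₁ v = P₂ w → v ∈ range a₁) :
    ∃ (Y : Type (max u_1 u_2)) (_ : TopologicalSpace Y) (k₁ : V₁ → Y) (k₂ : V₂ → Y) (P : Y → Z),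
      T2Space Y ∧ IsOpenEmbedding k₁ ∧ IsOpenEmbedding k₂ ∧ range k₁ ∪ range k₂ = univ ∧
      (∀ v w, k₁ v = k₂ w ↔ ∃ a, v = a₁ a ∧ w = a₂ a) ∧ IsLocalHomeomorph P ∧
      (∀ v, P (k₁ v) = P₁ v) ∧ ∀ w, P (k₂ w) = P₂ w := by
  -- the equivalence class of a point of the disjoint union
  let cls : V₁ ⊕ V₂ → Set (V₁ ⊕ V₂) := Sum.elim
    (fun v => {.inl v} ∪ Sum.inr '' (a₂ '' (a₁ ⁻¹' {v})))
    (fun w => {.inr w} ∪ Sum.inl '' (a₁ '' (a₂ ⁻¹' {w})))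
  have hll : ∀ v v', cls (.inl v) = cls (.inl v') → v = v' := by
    intro v v' h
    have h1 : (.inl v : V₁ ⊕ V₂) ∈ cls (.inl v') := h ▸ .inl rfl
    simpa [cls] using h1
  have hrr : ∀ w w', cls (.inr w) = cls (.inr w') → w = w' := by
    intro w w' h
    have h1 : (.inr w : V₁ ⊕ V₂) ∈ cls (.inr w') := h ▸ .inl rfl
    simpa [cls] using h1
  have hlr : ∀ v w, cls (.inl v) = cls (.inr w) ↔ ∃ a, v = a₁ a ∧ w = a₂ a := by
    intro v w
    constructor
    · intro h
      have h1 : (.inl v : V₁ ⊕ V₂) ∈ cls (.inr w) := h ▸ .inl rfl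
      simp only [cls, Sum.elim_inr, mem_union, mem_singleton_iff, reduceCtorEq, mem_image,
        mem_preimage, Sum.inl.injEq, false_or] at h1
      obtain ⟨_, ⟨a, ha, rfl⟩, rfl⟩ := h1
      exact ⟨a, rfl, ha.symm⟩
    · rintro ⟨a, rfl, rfl⟩
      have h1 : a₁ ⁻¹' {a₁ a} = {a} := by ext; simp [ha₁.injective.eq_iff]
      have h2 : a₂ ⁻¹' {a₂ a} = {a} := by ext; simp [ha₂.injective.eq_iff]
      simp only [cls, Sum.elim_inl, Sum.elim_inr, h1, h2, image_singleton]
      exact union_comm _ _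
  let st : Setoid (V₁ ⊕ V₂) := Setoid.ker cls
  let q : V₁ ⊕ V₂ → Quotient st := Quotient.mk st
  have hq : ∀ s t, q s = q t ↔ cls s = cls t := fun s t => Quotient.eq (r := st)
  have hqm : IsQuotientMap q := isQuotientMap_quotient_mk'
  have hqs : Function.Surjective q := hqm.surjective
  let k₁ : V₁ → Quotient st := q ∘ Sum.inl
  let k₂ : V₂ → Quotient st := q ∘ Sum.inr
  have hk₁c : Continuous k₁ := hqm.continuous.comp continuous_inl
  have hk₂c : Continuous k₂ := hqm.continuous.comp continuous_inr
  have hk₁i : Function.Injective k₁ := fun v v' h => hll v v' ((hq _ _).mp h)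
  have hk₂i : Function.Injective k₂ := fun v v' h => hrr v v' ((hq _ _).mp h)
  have hk : ∀ v w, k₁ v = k₂ w ↔ ∃ a, v = a₁ a ∧ w = a₂ a := fun v w =>
    (hq _ _).trans (hlr v w)
  have hk₁o : IsOpenMap k₁ := by
    intro U hU
    rw [← hqm.isOpen_preimage, isOpen_sum_iff]
    constructor
    · have : Sum.inl ⁻¹' (q ⁻¹' (k₁ '' U)) = U := by
        ext v
        exact ⟨fun ⟨v', hv', h⟩ => hk₁i h ▸ hv', fun hv => ⟨v, hv, rfl⟩⟩
      rwa [this]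
    · have : Sum.inr ⁻¹' (q ⁻¹' (k₁ '' U)) = a₂ '' (a₁ ⁻¹' U) := by
        ext w
        constructor
        · rintro ⟨v, hv, h⟩
          obtain ⟨a, rfl, rfl⟩ := (hk v w).mp h
          exact ⟨a, hv, rfl⟩
        · rintro ⟨a, hv, rfl⟩
          exact ⟨a₁ a, hv, (hk _ _).mpr ⟨a, rfl, rfl⟩⟩
      rw [this]
      exact ha₂.isOpenMap _ (hU.preimage ha₁.continuous)
  have hk₂o : IsOpenMap k₂ := by
    intro U hU
    rw [← hqm.isOpen_preimage, isOpen_sum_iff]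
    constructor
    · have : Sum.inl ⁻¹' (q ⁻¹' (k₂ '' U)) = a₁ '' (a₂ ⁻¹' U) := by
        ext v
        constructor
        · rintro ⟨w, hw, h⟩
          obtain ⟨a, rfl, rfl⟩ := (hk v w).mp h.symm
          exact ⟨a, hw, rfl⟩
        · rintro ⟨a, hw, rfl⟩
          exact ⟨a₂ a, hw, ((hk _ _).mpr ⟨a, rfl, rfl⟩).symm⟩
      rw [this]
      exact ha₁.isOpenMap _ (hU.preimage ha₂.continuous)
    · have : Sum.inr ⁻¹' (q ⁻¹' (k₂ '' U)) = U := by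
        ext v
        exact ⟨fun ⟨v', hv', h⟩ => hk₂i h ▸ hv', fun hv => ⟨v, hv, rfl⟩⟩
      rwa [this]
  have hk₁e : IsOpenEmbedding k₁ := .of_continuous_injective_isOpenMap hk₁c hk₁i hk₁o
  have hk₂e : IsOpenEmbedding k₂ := .of_continuous_injective_isOpenMap hk₂c hk₂i hk₂o
  have hPwd : ∀ s t : V₁ ⊕ V₂, st s t → Sum.elim P₁ P₂ s = Sum.elim P₁ P₂ t := by
    rintro (v | v) (w | w) h
    · rw [hll v w h]
    · obtain ⟨a, rfl, rfl⟩ := (hlr v w).mp h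
      exact ha a
    · obtain ⟨a, rfl, rfl⟩ := (hlr w v).mp (Eq.symm h)
      exact (ha a).symm
    · rw [hrr v w h]
  let P : Quotient st → Z := Quotient.lift (Sum.elim P₁ P₂) hPwd
  have hPc : Continuous P :=
    hqm.continuous_iff.mpr (hP₁.continuous.sumElim hP₂.continuous)
  have hcover : range k₁ ∪ range k₂ = univ := by
    rw [eq_univ_iff_forall]
    intro y
    obtain ⟨v | w, rfl⟩ := hqs y
    · exact .inl ⟨v, rfl⟩
    · exact .inr ⟨w, rfl⟩
  refine ⟨Quotient st, inferInstance, k₁, k₂, P, ⟨?_⟩, hk₁e, hk₂e, hcover, hk, ?_,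
    fun _ => rfl, fun _ => rfl⟩
  · have hmixed : ∀ v w, k₁ v ≠ k₂ w →
        ∃ U U' : Set (Quotient st), IsOpen U ∧ IsOpen U' ∧ k₁ v ∈ U ∧ k₂ w ∈ U' ∧
          Disjoint U U' := by
      intro v w hvw
      by_cases hP : P₁ v = P₂ w
      · obtain ⟨a, rfl⟩ := hmax v w hP
        have h1 : k₁ (a₁ a) = k₂ (a₂ a) := (hk _ _).mpr ⟨a, rfl, rfl⟩
        rw [h1] at hvw ⊢
        obtain ⟨U, U', hU, hU', hv, hw, hd⟩ := t2_separation (fun h => hvw (congrArg k₂ h))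
        exact ⟨k₂ '' U, k₂ '' U', hk₂o _ hU, hk₂o _ hU', ⟨_, hv, rfl⟩, ⟨w, hw, rfl⟩,
          (disjoint_image_iff hk₂i).mpr hd⟩
      · obtain ⟨U, U', hU, hU', hv, hw, hd⟩ := t2_separation hP
        exact ⟨P ⁻¹' U, P ⁻¹' U', hU.preimage hPc, hU'.preimage hPc, hv, hw, hd.preimage P⟩
    intro y y' hyy
    obtain ⟨v | v, rfl⟩ := hqs y <;> obtain ⟨w | w, rfl⟩ := hqs y'
    · obtain ⟨U, U', hU, hU', hv, hw, hd⟩ := t2_separation (fun h => hyy (congrArg k₁ h))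
      exact ⟨k₁ '' U, k₁ '' U', hk₁o _ hU, hk₁o _ hU', ⟨_, hv, rfl⟩, ⟨w, hw, rfl⟩,
        (disjoint_image_iff hk₁i).mpr hd⟩
    · exact hmixed v w hyy
    · obtain ⟨U, U', hU, hU', hv, hw, hd⟩ := hmixed w v hyy.symm
      exact ⟨U', U, hU', hU, hw, hv, hd.symm⟩
    · obtain ⟨U, U', hU, hU', hv, hw, hd⟩ := t2_separation (fun h => hyy (congrArg k₂ h))
      exact ⟨k₂ '' U, k₂ '' U', hk₂o _ hU, hk₂o _ hU', ⟨_, hv, rfl⟩, ⟨w, hw, rfl⟩,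
        (disjoint_image_iff hk₂i).mpr hd⟩
  · rw [isLocalHomeomorph_iff_isLocalHomeomorphOn_univ, ← hcover]
    have h1 : IsLocalHomeomorphOn P (range k₁) := by
      rw [← image_univ]
      refine IsLocalHomeomorphOn.of_comp_right (f := k₁) ?_ ?_
      · exact isLocalHomeomorph_iff_isLocalHomeomorphOn_univ.mp hP₁
      · exact isLocalHomeomorph_iff_isLocalHomeomorphOn_univ.mp hk₁e.isLocalHomeomorph
    have h2 : IsLocalHomeomorphOn P (range k₂) := by
      rw [← image_univ]
      refine IsLocalHomeomorphOn.of_comp_right (f := k₂) ?_ ?_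
      · exact isLocalHomeomorph_iff_isLocalHomeomorphOn_univ.mp hP₂
      · exact isLocalHomeomorph_iff_isLocalHomeomorphOn_univ.mp hk₂e.isLocalHomeomorph
    exact fun y hy => hy.elim (h1 y) (h2 y)

end Gluing

/-! ### Retraction onto the bipartite graph -/

section Retraction

open Topology

variable {r l : ℕ}

/-- The point that divides the edge from the vertex `j` to the vertex `i` in the ratio
`t : 1 - t`. -/
noncomputable def edgePoint (i : Fin r) (j : Fin l) (t : ℝ) : Fin r ⊕ Fin l → ℝ :=
  (1 - t) • Pi.single (.inr j) 1 + t • Pi.single (.inl i) 1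

theorem edgePoint_inl (i : Fin r) (j : Fin l) (t : ℝ) (i' : Fin r) :
    edgePoint i j t (.inl i') = if i' = i then t else 0 := by
  simp [edgePoint, Pi.single_apply]

theorem edgePoint_inr (i : Fin r) (j : Fin l) (t : ℝ) (j' : Fin l) :
    edgePoint i j t (.inr j') = if j' = j then 1 - t else 0 := by
  simp [edgePoint, Pi.single_apply]

theorem edgePoint_mem (i : Fin r) (j : Fin l) {t : ℝ} (ht : t ∈ Icc (0 : ℝ) 1) :
    edgePoint i j t ∈ graphRealization (completeBipartiteGraph (Fin r) (Fin l)) := by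
  refine .inr ⟨.inr j, .inl i, by simp, ⟨1 - t, t, by linarith [ht.2], ht.1, by ring, rfl⟩⟩

theorem exists_edgePoint (hr : r ≠ 0) (hl : l ≠ 0) {x : Fin r ⊕ Fin l → ℝ}
    (hx : x ∈ graphRealization (completeBipartiteGraph (Fin r) (Fin l))) :
    ∃ i j, ∃ t ∈ Icc (0 : ℝ) 1, edgePoint i j t = x := by
  rcases hx with ⟨i | j, rfl⟩ | ⟨v, w, hvw, a, b, ha, hb, hab, rfl⟩
  · exact ⟨i, ⟨0, Nat.pos_of_ne_zero hl⟩, 1, by simp, by simp [edgePoint]⟩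
  · exact ⟨⟨0, Nat.pos_of_ne_zero hr⟩, j, 0, by simp, by simp [edgePoint]⟩
  · rcases v with i | j <;> rcases w with i' | j'
    · simp at hvw
    · refine ⟨i, j', a, ⟨ha, by linarith⟩, ?_⟩
      rw [edgePoint, ← hab, add_sub_cancel_left, add_comm]
    · refine ⟨i', j, b, ⟨hb, by linarith⟩, ?_⟩
      rw [edgePoint, ← hab, add_sub_cancel_right]
    · simp at hvw

theorem edgePoint_eq_iff {i i' : Fin r} {j j' : Fin l} {t t' : ℝ}
    (h : edgePoint i j t = edgePoint i' j' t') :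
    t = t' ∧ (i = i' ∨ t = 0) ∧ (j = j' ∨ t = 1) := by
  have h1 := congrFun h (.inl i)
  have h2 := congrFun h (.inl i')
  have h3 := congrFun h (.inr j)
  have h4 := congrFun h (.inr j')
  rw [edgePoint_inl, edgePoint_inl, if_pos rfl] at h1
  rw [edgePoint_inl, edgePoint_inl, if_pos rfl] at h2
  rw [edgePoint_inr, edgePoint_inr, if_pos rfl] at h3
  rw [edgePoint_inr, edgePoint_inr, if_pos rfl] at h4
  by_cases hi : i = i' <;> by_cases hj : j = j'
  · subst hi hj
    simp only [if_true] at h1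
    exact ⟨h1, .inl rfl, .inl rfl⟩
  · subst hi
    simp only [if_true] at h1
    rw [if_neg hj] at h3
    exact ⟨h1, .inl rfl, .inr (by linarith)⟩
  · subst hj
    simp only [if_true] at h3
    rw [if_neg hi] at h1
    exact ⟨by linarith, .inr h1, .inl rfl⟩
  · rw [if_neg hi] at h1
    rw [if_neg hj] at h3
    linarith

/-- Coordinates with vanishing pairwise products describe points of a star, realized in the graph
as the union of the halves of the edges at a vertex. -/
theorem exists_index_of_mul_eq_zero {n : ℕ} (hn : n ≠ 0) {u : Fin n → ℝ}
    (hu : ∀ i k, i ≠ k → u i * u k = 0) : ∃ i, ∀ k, k ≠ i → u k = 0 := by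
  by_cases h : ∃ i, u i ≠ 0
  · obtain ⟨i, hi⟩ := h
    exact ⟨i, fun k hk => by simpa [hi] using hu k i hk⟩
  · push Not at h
    exact ⟨⟨0, Nat.pos_of_ne_zero hn⟩, fun k _ => h k⟩

variable {S M₁ M₂ Y : Type*} [TopologicalSpace S] [CompactSpace S] [TopologicalSpace M₁]
  [CompactSpace M₁] [T2Space M₁] [TopologicalSpace M₂] [CompactSpace M₂] [T2Space M₂]
  [TopologicalSpace Y] [T2Space Y]

/-- A space glued from `l` copies of `M₁` and `r` copies of `M₂`, with cores of tubes removed, along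
the punctured tubes retracts onto the complete bipartite graph, if stars ending on the tubes are
given in the two pieces: the vertices of the graph are the centres of the stars, and the retraction
takes the tori in the middle of the overlaps to the midpoints of the edges. -/
theorem retractsOntoCopy_of_stars (hr : r ≠ 0) (hl : l ≠ 0) {Θ₁ : (Fin r × S) × ℂ → M₁}
    {Θ₂ : (Fin l × S) × ℂ → M₂} (hΘ₁ : IsOpenEmbedding Θ₁) (hΘ₂ : IsOpenEmbedding Θ₂)
    {k₁ : Fin l → M₁ → Y} {k₂ : Fin r → M₂ → Y}
    (hk₁ : ∀ j, ContinuousOn (k₁ j) (range fun q => Θ₁ (q, 0))ᶜ)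
    (hk₂ : ∀ i, ContinuousOn (k₂ i) (range fun q => Θ₂ (q, 0))ᶜ)
    (hk₁i : ∀ j j', ∀ m ∈ (range fun q => Θ₁ (q, 0))ᶜ, ∀ m' ∈ (range fun q => Θ₁ (q, 0))ᶜ,
      k₁ j m = k₁ j' m' → j = j' ∧ m = m')
    (hk₂i : ∀ i i', ∀ m ∈ (range fun q => Θ₂ (q, 0))ᶜ, ∀ m' ∈ (range fun q => Θ₂ (q, 0))ᶜ,
      k₂ i m = k₂ i' m' → i = i' ∧ m = m')
    (hcover : ∀ y, (∃ j, ∃ m ∈ (range fun q => Θ₁ (q, 0))ᶜ, k₁ j m = y) ∨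
      ∃ i, ∃ m ∈ (range fun q => Θ₂ (q, 0))ᶜ, k₂ i m = y)
    (hglue : ∀ j i, ∀ m ∈ (range fun q => Θ₁ (q, 0))ᶜ, ∀ m' ∈ (range fun q => Θ₂ (q, 0))ᶜ,
      k₁ j m = k₂ i m' ↔
        ∃ x v, v ≠ 0 ∧ m = Θ₁ ((i, x), v) ∧ m' = Θ₂ ((j, x), circleInversion v))
    {x₀ : S} {γ₁ : Fin r → ℝ → M₁} (hγ₁ : IsStarToTubes Θ₁ x₀ γ₁) {γ₂ : Fin l → ℝ → M₂}
    (hγ₂ : IsStarToTubes Θ₂ x₀ γ₂) :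
    CompactSpace Y ∧
      RetractsOntoCopy Y (graphRealization (completeBipartiteGraph (Fin r) (Fin l))) := by
  obtain ⟨U₁, hU₁, hU₁m, hU₁γ, hU₁Θ⟩ := hγ₁.exists_coordinates hΘ₁
  obtain ⟨U₂, hU₂, hU₂m, hU₂γ, hU₂Θ⟩ := hγ₂.exists_coordinates hΘ₂
  -- the compact pieces of which the space is the union
  let C₁ : Set M₁ := (Θ₁ '' (univ ×ˢ Metric.ball 0 1))ᶜ
  let C₂ : Set M₂ := (Θ₂ '' (univ ×ˢ Metric.ball 0 1))ᶜ
  have hC₁ : IsClosed C₁ :=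
    (hΘ₁.isOpenMap _ (isOpen_univ.prod Metric.isOpen_ball)).isClosed_compl
  have hC₂ : IsClosed C₂ :=
    (hΘ₂.isOpenMap _ (isOpen_univ.prod Metric.isOpen_ball)).isClosed_compl
  have : CompactSpace C₁ := isCompact_iff_compactSpace.mp hC₁.isCompact
  have : CompactSpace C₂ := isCompact_iff_compactSpace.mp hC₂.isCompact
  have hC₁o : C₁ ⊆ (range fun q => Θ₁ (q, 0))ᶜ := by
    rintro m hm ⟨q, rfl⟩
    exact hm ⟨_, ⟨trivial, by simp⟩, rfl⟩
  have hC₂o : C₂ ⊆ (range fun q => Θ₂ (q, 0))ᶜ := by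
    rintro m hm ⟨q, rfl⟩
    exact hm ⟨_, ⟨trivial, by simp⟩, rfl⟩
  have hmem₁ : ∀ q v, 1 ≤ ‖v‖ → Θ₁ (q, v) ∈ C₁ := by
    rintro q v hv ⟨⟨q', v'⟩, ⟨-, hv'⟩, h⟩
    have := congrArg Prod.snd (hΘ₁.injective h)
    simp only at this
    rw [mem_ball_zero_iff, this] at hv'
    linarith
  have hmem₂ : ∀ q v, 1 ≤ ‖v‖ → Θ₂ (q, v) ∈ C₂ := by
    rintro q v hv ⟨⟨q', v'⟩, ⟨-, hv'⟩, h⟩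
    have := congrArg Prod.snd (hΘ₂.injective h)
    simp only at this
    rw [mem_ball_zero_iff, this] at hv'
    linarith
  have hnorm₁ : ∀ q v, Θ₁ (q, v) ∈ C₁ → 1 ≤ ‖v‖ := by
    intro q v h
    by_contra! hv
    exact h ⟨_, ⟨trivial, by simpa using hv⟩, rfl⟩
  have hnorm₂ : ∀ q v, Θ₂ (q, v) ∈ C₂ → 1 ≤ ‖v‖ := by
    intro q v h
    by_contra! hv
    exact h ⟨_, ⟨trivial, by simpa using hv⟩, rfl⟩
  let Q : (Fin l × C₁) ⊕ (Fin r × C₂) → Y := Sum.elim (fun p => k₁ p.1 p.2) (fun p => k₂ p.1 p.2)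
  have hQ : Continuous Q := by
    refine Continuous.sumElim (continuous_prod_of_discrete_left.mpr fun j => ?_)
      (continuous_prod_of_discrete_left.mpr fun i => ?_)
    · exact (hk₁ j).comp_continuous continuous_subtype_val fun m => hC₁o m.2
    · exact (hk₂ i).comp_continuous continuous_subtype_val fun m => hC₂o m.2
  have hQs : Function.Surjective Q := by
    intro y
    rcases hcover y with ⟨j, m, hm, rfl⟩ | ⟨i, m, hm, rfl⟩
    · by_cases hmC : m ∈ C₁
      · exact ⟨.inl (j, ⟨m, hmC⟩), rfl⟩
      · obtain ⟨⟨⟨i, x⟩, v⟩, ⟨-, hv⟩, rfl⟩ := not_not.mp hmC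
        have hv0 : v ≠ 0 := by rintro rfl; exact hm ⟨_, rfl⟩
        have hv' : 1 ≤ ‖circleInversion v‖ := by
          rw [norm_circleInversion]
          exact (one_le_inv₀ (norm_pos_iff.mpr hv0)).mpr
            (by simpa using (mem_ball_zero_iff.mp hv).le)
        have hmem := hmem₂ (j, x) _ hv'
        exact ⟨.inr (i, ⟨_, hmem⟩), ((hglue j i _ hm _ (hC₂o hmem)).mpr
          ⟨x, v, hv0, rfl, rfl⟩).symm⟩
    · by_cases hmC : m ∈ C₂
      · exact ⟨.inr (i, ⟨m, hmC⟩), rfl⟩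
      · obtain ⟨⟨⟨j, x⟩, v⟩, ⟨-, hv⟩, rfl⟩ := not_not.mp hmC
        have hv0 : v ≠ 0 := by rintro rfl; exact hm ⟨_, rfl⟩
        have hv' : 1 ≤ ‖circleInversion v‖ := by
          rw [norm_circleInversion]
          exact (one_le_inv₀ (norm_pos_iff.mpr hv0)).mpr
            (by simpa using (mem_ball_zero_iff.mp hv).le)
        have hmem := hmem₁ (i, x) _ hv'
        exact ⟨.inl (j, ⟨_, hmem⟩), (hglue j i _ (hC₁o hmem) _ hm).mpr
          ⟨x, _, circleInversion_ne_zero hv0, rfl, by rw [circleInversion_circleInversion]⟩⟩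
  have hQq : IsQuotientMap Q := hQ.isClosedMap.isQuotientMap hQ hQs
  -- the retraction
  let f : (Fin l × C₁) ⊕ (Fin r × C₂) → Fin r ⊕ Fin l → ℝ := Sum.elim
    (fun p => Sum.elim (fun i => U₁ i p.2 / 2)
      (fun j => if p.1 = j then 1 - ∑ i, U₁ i p.2 / 2 else 0))
    (fun p => Sum.elim (fun i => if p.1 = i then 1 - ∑ j, U₂ j p.2 / 2 else 0)
      (fun j => U₂ j p.2 / 2))
  have hf₁ : ∀ j m i, (∀ k, k ≠ i → U₁ k m.1 = 0) →
      f (.inl (j, m)) = edgePoint i j (U₁ i m / 2) := by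
    intro j m i h
    funext v
    rcases v with i' | j'
    · rw [edgePoint_inl]
      change U₁ i' m / 2 = _
      split_ifs with hi
      · rw [hi]
      · rw [h i' hi, zero_div]
    · rw [edgePoint_inr]
      change (if j = j' then 1 - ∑ i, U₁ i m / 2 else 0) = _
      rw [Finset.sum_eq_single i (fun k _ hk => by rw [h k hk, zero_div]) (by simp)]
      simp only [eq_comm]
  have hf₂ : ∀ i m j, (∀ k, k ≠ j → U₂ k m.1 = 0) →
      f (.inr (i, m)) = edgePoint i j (1 - U₂ j m / 2) := by
    intro i m j h
    funext v
    rcases v with i' | j'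
    · rw [edgePoint_inl]
      change (if i = i' then 1 - ∑ j, U₂ j m / 2 else 0) = _
      rw [Finset.sum_eq_single j (fun k _ hk => by rw [h k hk, zero_div]) (by simp)]
      simp only [eq_comm]
    · rw [edgePoint_inr]
      change U₂ j' m / 2 = _
      split_ifs with hj
      · rw [hj, sub_sub_cancel]
      · rw [h j' hj, zero_div]
  have hfA : ∀ c, f c ∈ graphRealization (completeBipartiteGraph (Fin r) (Fin l)) := by
    rintro (⟨j, m⟩ | ⟨i, m⟩)
    · obtain ⟨i, hi⟩ := exists_index_of_mul_eq_zero hr fun i k hik => hU₁m i k m.1 hik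
      rw [hf₁ j m i hi]
      have := hU₁ i m
      exact edgePoint_mem _ _ ⟨by linarith [this.1], by linarith [this.2]⟩
    · obtain ⟨j, hj⟩ := exists_index_of_mul_eq_zero hl fun i k hik => hU₂m i k m.1 hik
      rw [hf₂ i m j hj]
      have := hU₂ j m
      exact edgePoint_mem _ _ ⟨by linarith [this.2], by linarith [this.1]⟩
  have hfc : Continuous f := by
    refine Continuous.sumElim (continuous_prod_of_discrete_left.mpr fun j => ?_)
      (continuous_prod_of_discrete_left.mpr fun i => ?_)
    · refine continuous_pi fun v => ?_
      rcases v with i' | j'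
      · exact ((U₁ i').continuous.comp continuous_subtype_val).div_const _
      · change Continuous fun m : C₁ => if j = j' then 1 - ∑ i, U₁ i m / 2 else 0
        split_ifs
        · fun_prop
        · exact continuous_const
    · refine continuous_pi fun v => ?_
      rcases v with i' | j'
      · change Continuous fun m : C₂ => if i = i' then 1 - ∑ j, U₂ j m / 2 else 0
        split_ifs
        · fun_prop
        · exact continuous_const
      · exact ((U₂ j').continuous.comp continuous_subtype_val).div_const _
  have hcross : ∀ (p : Fin l × C₁) (p' : Fin r × C₂), Q (.inl p) = Q (.inr p') →
      f (.inl p) = f (.inr p') := by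
    rintro ⟨j, m, hm⟩ ⟨i, m', hm'⟩ h
    obtain ⟨x, v, hv, rfl, rfl⟩ := (hglue j i m (hC₁o hm) m' (hC₂o hm')).mp h
    have h1 := hnorm₁ _ _ hm
    have h2 := hnorm₂ _ _ hm'
    rw [norm_circleInversion] at h2
    have hv1 : ‖v‖ ≤ 1 := (one_le_inv₀ (norm_pos_iff.mpr hv)).mp h2
    have hU1 := hU₁Θ i x v hv1
    have hU2 := hU₂Θ j x (circleInversion v) (by
      rw [norm_circleInversion]; exact inv_le_one_of_one_le₀ h1)
    rw [hf₁ j ⟨_, hm⟩ i fun k hk => by simpa [hU1] using hU₁m k i (Θ₁ ((i, x), v)) hk,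
      hf₂ i ⟨_, hm'⟩ j fun k hk => by
        simpa [hU2] using hU₂m k j (Θ₂ ((j, x), circleInversion v)) hk]
    simp only [hU1, hU2]
    norm_num
  have hfQ : ∀ c c', Q c = Q c' → f c = f c' := by
    rintro (⟨j, m⟩ | p) (⟨j', m'⟩ | p') h
    · obtain ⟨rfl, h'⟩ := hk₁i j j' m (hC₁o m.2) m' (hC₁o m'.2) h
      rw [Subtype.ext h']
    · exact hcross _ _ h
    · exact (hcross _ _ h.symm).symm
    · obtain ⟨h', h''⟩ := hk₂i _ _ p.2 (hC₂o p.2.2) p'.2 (hC₂o p'.2.2) h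
      rw [show p = p' from Prod.ext h' (Subtype.ext h'')]
  let F : C((Fin l × C₁) ⊕ (Fin r × C₂),
      graphRealization (completeBipartiteGraph (Fin r) (Fin l))) :=
    ⟨fun c => ⟨f c, hfA c⟩, hfc.subtype_mk _⟩
  have hFQ : ∀ c c', Q c = Q c' → F c = F c' := fun c c' h => Subtype.ext (hfQ c c' h)
  let ρ : C(Y, graphRealization (completeBipartiteGraph (Fin r) (Fin l))) :=
    IsQuotientMap.lift (f := ⟨Q, hQ⟩) hQq F hFQ
  have hρ : ∀ c, ρ (Q c) = F c := fun c =>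
    DFunLike.congr_fun (IsQuotientMap.lift_comp (f := ⟨Q, hQ⟩) hQq F hFQ) c
  -- the graph in the glued space
  have hγC₁ : ∀ i, ∀ s ∈ Icc (0 : ℝ) 1, γ₁ i s ∈ C₁ := by
    rintro i s hs ⟨⟨⟨k, x⟩, v⟩, ⟨-, hv⟩, h⟩
    rw [mem_ball_zero_iff] at hv
    obtain ⟨-, -, -, rfl⟩ := hγ₁.avoid i k x v s hs h.symm hv.le
    simp at hv
  have hγC₂ : ∀ i, ∀ s ∈ Icc (0 : ℝ) 1, γ₂ i s ∈ C₂ := by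
    rintro i s hs ⟨⟨⟨k, x⟩, v⟩, ⟨-, hv⟩, h⟩
    rw [mem_ball_zero_iff] at hv
    obtain ⟨-, -, -, rfl⟩ := hγ₂.avoid i k x v s hs h.symm hv.le
    simp at hv
  have hmin₁ : ∀ t : unitInterval, min (2 * (t : ℝ)) 1 ∈ Icc (0 : ℝ) 1 := fun t =>
    ⟨le_min (by linarith [t.2.1]) zero_le_one, min_le_right _ _⟩
  have hmin₂ : ∀ t : unitInterval, min (2 - 2 * (t : ℝ)) 1 ∈ Icc (0 : ℝ) 1 := fun t =>
    ⟨le_min (by linarith [t.2.2]) zero_le_one, min_le_right _ _⟩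
  let s : Fin r × Fin l × unitInterval → Y := fun p =>
    if (p.2.2 : ℝ) ≤ 1 / 2 then k₁ p.2.1 (γ₁ p.1 (min (2 * p.2.2) 1))
    else k₂ p.1 (γ₂ p.2.1 (min (2 - 2 * p.2.2) 1))
  have hmid : ∀ i j, k₁ j (γ₁ i 1) = k₂ i (γ₂ j 1) := by
    intro i j
    refine (hglue j i _ (hC₁o (hγC₁ i 1 ⟨zero_le_one, le_rfl⟩)) _
      (hC₂o (hγC₂ j 1 ⟨zero_le_one, le_rfl⟩))).mpr
      ⟨x₀, 1, one_ne_zero, hγ₁.last i, ?_⟩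
    rw [hγ₂.last, circleInversion_of_norm_eq_one norm_one]
  have hs₁ : ∀ i j (t : unitInterval), (t : ℝ) ≤ 1 / 2 → s (i, j, t) = k₁ j (γ₁ i (2 * t)) := by
    intro i j t ht
    have h : s (i, j, t) = k₁ j (γ₁ i (min (2 * t) 1)) := if_pos ht
    rw [h, min_eq_left (by linarith)]
  have hs₂ : ∀ i j (t : unitInterval), 1 / 2 ≤ (t : ℝ) →
      s (i, j, t) = k₂ i (γ₂ j (2 - 2 * t)) := by
    intro i j t ht
    rcases ht.eq_or_lt with h | h
    · rw [hs₁ i j t h.ge, ← h]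
      norm_num
      exact hmid i j
    · have h' : s (i, j, t) = k₂ i (γ₂ j (min (2 - 2 * t) 1)) := if_neg (not_le.mpr h)
      rw [h', min_eq_left (by linarith)]
  have hsc : Continuous s := by
    refine continuous_prod_of_discrete_left.mpr fun i =>
      continuous_prod_of_discrete_left.mpr fun j => ?_
    refine Continuous.if_le (f := fun t : unitInterval => (t : ℝ)) (g := fun _ => 1 / 2)
      ?_ ?_ (by fun_prop) continuous_const ?_
    · exact (hk₁ j).comp_continuous ((hγ₁.continuous i).comp (by fun_prop))
        fun t => hC₁o (hγC₁ i _ (hmin₁ t))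
    · exact (hk₂ i).comp_continuous ((hγ₂.continuous j).comp (by fun_prop))
        fun t => hC₂o (hγC₂ j _ (hmin₂ t))
    · intro t ht
      simp only
      rw [ht]
      norm_num
      exact hmid i j
  have hρs : ∀ i j t, (ρ (s (i, j, t)) : Fin r ⊕ Fin l → ℝ) = edgePoint i j t := by
    intro i j t
    rcases le_total (t : ℝ) (1 / 2) with ht | ht
    · have h2t : 2 * (t : ℝ) ∈ Icc (0 : ℝ) 1 := ⟨by linarith [t.2.1], by linarith⟩
      have hC := hγC₁ i _ h2t
      have h1 : s (i, j, t) = Q (.inl (j, ⟨_, hC⟩)) := hs₁ i j t ht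
      rw [h1, hρ]
      change f (.inl (j, ⟨_, hC⟩)) = _
      rw [hf₁ j ⟨_, hC⟩ i fun k hk => by rw [hU₁γ k i _ h2t, if_neg hk]]
      simp only [hU₁γ i i _ h2t, if_true]
      rw [mul_div_cancel_left₀ _ two_ne_zero]
    · have h2t : 2 - 2 * (t : ℝ) ∈ Icc (0 : ℝ) 1 := ⟨by linarith [t.2.2], by linarith⟩
      have hC := hγC₂ j _ h2t
      have h1 : s (i, j, t) = Q (.inr (i, ⟨_, hC⟩)) := hs₂ i j t ht
      rw [h1, hρ]
      change f (.inr (i, ⟨_, hC⟩)) = _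
      rw [hf₂ i ⟨_, hC⟩ j fun k hk => by rw [hU₂γ k j _ h2t, if_neg hk]]
      simp only [hU₂γ j j _ h2t, if_true]
      congr 1
      ring
  let G : C(Fin r × Fin l × unitInterval,
      graphRealization (completeBipartiteGraph (Fin r) (Fin l))) :=
    ⟨fun p => ⟨edgePoint p.1 p.2.1 p.2.2, edgePoint_mem _ _ p.2.2.2⟩, by
      refine Continuous.subtype_mk ?_ _
      refine continuous_prod_of_discrete_left.mpr fun i =>
        continuous_prod_of_discrete_left.mpr fun j => ?_
      unfold edgePoint
      fun_prop⟩
  have hGs : Function.Surjective G := by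
    rintro ⟨x, hx⟩
    obtain ⟨i, j, t, ht, h⟩ := exists_edgePoint hr hl hx
    exact ⟨(i, j, ⟨t, ht⟩), Subtype.ext h⟩
  have hGq : IsQuotientMap G := G.continuous.isClosedMap.isQuotientMap G.continuous hGs
  have hsG : ∀ p p', G p = G p' → s p = s p' := by
    rintro ⟨i, j, t⟩ ⟨i', j', t'⟩ h
    obtain ⟨h1, h2, h3⟩ := edgePoint_eq_iff (congrArg Subtype.val h)
    obtain rfl : t = t' := Subtype.ext h1
    rcases h2 with rfl | h2
    · rcases h3 with rfl | h3
      · rfl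
      · rw [hs₂ i j t (by rw [h3]; norm_num), hs₂ i j' t (by rw [h3]; norm_num), h3]
        norm_num
        rw [hγ₂.start j j']
    · rcases h3 with rfl | h3
      · rw [hs₁ i j t (by rw [h2]; norm_num), hs₁ i' j t (by rw [h2]; norm_num), h2, mul_zero,
          hγ₁.start i i']
      · rw [h2] at h3
        exact absurd h3 zero_ne_one
  let ι : C(graphRealization (completeBipartiteGraph (Fin r) (Fin l)), Y) :=
    hGq.lift ⟨s, hsc⟩ hsG
  have hι : ∀ p, ι (G p) = s p := fun p => DFunLike.congr_fun (hGq.lift_comp ⟨s, hsc⟩ hsG) p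
  refine ⟨⟨?_⟩, ι, ρ, ι.continuous, ρ.continuous, fun a => ?_⟩
  · rw [← hQs.range_eq]
    exact isCompact_range hQ
  · obtain ⟨⟨i, j, t⟩, rfl⟩ := hGs a
    rw [hι]
    exact Subtype.ext (hρs i j t)

end Retraction

/-! ### Smooth structures on covering spaces -/

section

open Topology

variable {E H M E' H' M' : Type*} [NormedAddCommGroup E] [NormedSpace ℝ E] [TopologicalSpace H]
  [NormedAddCommGroup E'] [NormedSpace ℝ E'] [TopologicalSpace H']
  [TopologicalSpace M] [ChartedSpace H M] [TopologicalSpace M'] [ChartedSpace H' M']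
  {I : ModelWithCorners ℝ E H} {I' : ModelWithCorners ℝ E' H'}

/-- The smooth structure of a manifold pulls back along a local homeomorphism. -/
theorem IsLocalHomeomorph.exists_smooth_structure [IsManifold I ∞ M] {Y : Type*}
    [TopologicalSpace Y] {P : Y → M} (hP : IsLocalHomeomorph P) :
    ∃ _ : ChartedSpace H Y, IsManifold I ∞ Y ∧ IsLocalDiffeomorph I I ∞ P := by
  choose φ hφ hφP using hP
  let _ : ChartedSpace H Y :=
    { atlas := range fun y => (φ y).trans (chartAt H (P y))
      chartAt := fun y => (φ y).trans (chartAt H (P y))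
      mem_chart_source := fun y => by
        rw [OpenPartialHomeomorph.trans_source]
        exact ⟨hφ y, by rw [← hφP y]; exact mem_chart_source H _⟩
      chart_mem_atlas := fun y => ⟨y, rfl⟩ }
  have hPφ : ∀ y x, φ y x = P x := fun y x => by rw [← hφP y]
  have hM : IsManifold I ∞ Y := by
    refine isManifold_of_contDiffOn I ∞ Y ?_
    rintro _ _ ⟨y, rfl⟩ ⟨y', rfl⟩
    have h := I.contDiffOn_extendCoordChange
      (IsManifold.chart_mem_maximalAtlas (I := I) (n := ∞) (P y))
      (IsManifold.chart_mem_maximalAtlas (I := I) (n := ∞) (P y'))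
    -- coordinate changes of the total space are restrictions of those of the base
    have key : ∀ x ∈ (((φ y).trans (chartAt H (P y))).symm.trans
        ((φ y').trans (chartAt H (P y')))).source,
        x ∈ (chartAt H (P y)).target ∧ (chartAt H (P y)).symm x ∈ (chartAt H (P y')).source ∧
        P ((φ y).symm ((chartAt H (P y)).symm x)) = (chartAt H (P y)).symm x := by
      intro x hx
      simp only [OpenPartialHomeomorph.trans_source, OpenPartialHomeomorph.symm_source,
        OpenPartialHomeomorph.trans_symm_eq_symm_trans_symm,
        OpenPartialHomeomorph.coe_trans, mem_inter_iff, mem_preimage, Function.comp_apply,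
        hPφ] at hx
      have h1 : P ((φ y).symm ((chartAt H (P y)).symm x)) = (chartAt H (P y)).symm x := by
        rw [← hPφ y, (φ y).right_inv hx.1.2]
      exact ⟨hx.1.1, by simpa only [h1] using hx.2.2, h1⟩
    refine (h.mono ?_).congr ?_
    · rintro x ⟨hx, x, rfl⟩
      rw [mem_preimage, I.left_inv] at hx
      obtain ⟨h1, h2, -⟩ := key x hx
      simp [PartialEquiv.trans_source, h1, h2]
    · rintro x ⟨hx, x, rfl⟩
      rw [mem_preimage, I.left_inv] at hx
      obtain ⟨-, -, h3⟩ := key x hx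
      simp [hPφ, h3]
  refine ⟨inferInstance, hM, fun y => ?_⟩
  have he : (φ y).trans (chartAt H (P y)) ∈ IsManifold.maximalAtlas I ∞ Y :=
    IsManifold.chart_mem_maximalAtlas (I := I) (n := ∞) y
  have hc := IsManifold.chart_mem_maximalAtlas (I := I) (n := ∞) (P y)
  have hy : y ∈ ((φ y).trans (chartAt H (P y))).source := mem_chart_source H y
  have hV := ((chartAt H (P y)).isOpen_inter_preimage
    ((φ y).trans (chartAt H (P y))).open_target)
  refine isLocalDiffeomorphAt_of_inverse
    (g := fun w => ((φ y).trans (chartAt H (P y))).symm (chartAt H (P y) w))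
    ((φ y).trans (chartAt H (P y))).open_source hV hy ?_ ?_ ?_ ?_ ?_
  · refine ⟨mem_chart_source H _, ?_⟩
    have := ((φ y).trans (chartAt H (P y))).map_source hy
    rwa [OpenPartialHomeomorph.coe_trans, Function.comp_apply, hPφ] at this
  · refine ((contMDiffOn_symm_of_mem_maximalAtlas hc).comp
      (contMDiffOn_of_mem_maximalAtlas he) fun x hx =>
        (((φ y).trans (chartAt H (P y))).map_source hx).1).congr fun x hx => ?_
    rw [OpenPartialHomeomorph.trans_source, mem_inter_iff, mem_preimage, hPφ] at hx
    simp [hPφ, (chartAt H (P y)).left_inv hx.2]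
  · exact (contMDiffOn_symm_of_mem_maximalAtlas he).comp
      ((contMDiffOn_of_mem_maximalAtlas hc).mono inter_subset_left) fun x hx => hx.2
  · intro x hx _
    have := ((φ y).trans (chartAt H (P y))).left_inv hx
    rwa [OpenPartialHomeomorph.coe_trans, Function.comp_apply, hPφ] at this
  · intro w hw _
    have := ((φ y).trans (chartAt H (P y))).right_inv hw.2
    rw [OpenPartialHomeomorph.coe_trans, Function.comp_apply, hPφ] at this
    refine (chartAt H (P y)).injOn ?_ hw.1 this
    have := ((φ y).trans (chartAt H (P y))).map_target hw.2
    rw [OpenPartialHomeomorph.trans_source, mem_inter_iff, mem_preimage, hPφ] at this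
    exact this.2

/-- A continuous lift of a local diffeomorphism along a local diffeomorphism is a local
diffeomorphism. -/
theorem IsLocalDiffeomorphAt.of_comp {E'' H'' M'' : Type*} [NormedAddCommGroup E'']
    [NormedSpace ℝ E''] [TopologicalSpace H''] [TopologicalSpace M''] [ChartedSpace H'' M'']
    {I'' : ModelWithCorners ℝ E'' H''} {f : M → M'} {P : M' → M''} {x : M}
    (hf : ContinuousAt f x) (hP : IsLocalDiffeomorphAt I' I'' ∞ P (f x))
    (h : IsLocalDiffeomorphAt I I'' ∞ (fun y => P (f y)) x) :
    IsLocalDiffeomorphAt I I' ∞ f x := by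
  obtain ⟨Φ, hx, hΦ⟩ := hP
  have hsymm : IsLocalDiffeomorphAt I'' I' ∞ Φ.symm (P (f x)) :=
    Φ.symm.isLocalDiffeomorphAt _ _ _ (by
      rw [hΦ hx]
      exact Φ.map_source hx)
  refine (h.comp (K := I') (P := M') (hg := hsymm)).congr_of_eventuallyEq ?_
  filter_upwards [hf.preimage_mem_nhds (Φ.open_source.mem_nhds hx)] with y hy
  rw [Function.comp_apply, hΦ hy]
  exact (Φ.left_inv hy).symm

end

/-! ### The covering of a normal sum assembled from coverings of its summands -/

section

open Topology

/-- The number of sheets of a covering of a connected space is constant. -/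
theorem IsCoveringMap.encard_fibre_eq {E X : Type*} [TopologicalSpace E] [TopologicalSpace X]
    [PreconnectedSpace X] {p : E → X} (hp : IsCoveringMap p) (x y : X) :
    (p ⁻¹' {x}).encard = (p ⁻¹' {y}).encard := by
  refine IsLocallyConstant.apply_eq_of_preconnectedSpace (f := fun x => (p ⁻¹' {x}).encard)
    ((IsLocallyConstant.iff_exists_open _).mpr fun x => ?_) x y
  obtain ⟨-, U, hxU, hU, -, H, hH⟩ := hp x
  have key : ∀ z ∈ U, (p ⁻¹' {z}).encard = (univ : Set (p ⁻¹' {x})).encard := by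
    intro z hz
    have hinj : Function.Injective fun i : p ⁻¹' {x} => (H.symm (⟨z, hz⟩, i) : E) := fun i i' h =>
      congrArg Prod.snd (H.symm.injective (Subtype.ext h))
    rw [← hinj.injOn.encard_image, image_univ]
    congr 1
    ext e
    constructor
    · rintro rfl
      refine ⟨(H ⟨e, hz⟩).2, ?_⟩
      have : ((⟨p e, hz⟩, (H ⟨e, hz⟩).2) : U × p ⁻¹' {x}) = H ⟨e, hz⟩ :=
        Prod.ext (Subtype.ext (hH ⟨e, hz⟩).symm) rfl
      simp only [this, Homeomorph.symm_apply_apply]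
    · rintro ⟨i, rfl⟩
      change p _ = z
      rw [← hH, Homeomorph.apply_symm_apply]
  exact ⟨U, hU, hxU, fun z hz => (key z hz).trans (key x hxU).symm⟩

theorem isLocalHomeomorph_comp_snd {D V Z : Type*} [TopologicalSpace D] [DiscreteTopology D]
    [TopologicalSpace V] [TopologicalSpace Z] {f : V → Z} (hf : IsLocalHomeomorph f) :
    IsLocalHomeomorph fun p : D × V => f p.2 := by
  refine hf.comp (f := Prod.snd) (isLocalHomeomorph_iff_isOpenEmbedding_restrict.mpr fun p => ?_)
  have hU : IsOpen ({p.1} ×ˢ univ : Set (D × V)) := (isOpen_discrete _).prod isOpen_univ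
  refine ⟨_, hU.mem_nhds ⟨rfl, trivial⟩, .of_continuous_injective_isOpenMap
    (by fun_prop) ?_ (isOpenMap_snd.domRestrict hU)⟩
  rintro ⟨⟨d, v⟩, hd, _⟩ ⟨⟨d', v'⟩, hd', _⟩ h
  exact Subtype.ext (Prod.ext (hd.trans hd'.symm) h)

/-- The complements of the cores in the tubes, in several copies of the complement of the cores. -/
theorem exists_isOpenEmbedding_tubes {n m : ℕ} {S M : Type*} [TopologicalSpace S]
    [TopologicalSpace M] {Θ : (Fin m × S) × ℂ → M} (hΘ : IsOpenEmbedding Θ) :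
    ∃ a : (Fin n × Fin m) × (S × {v : ℂ // v ≠ 0}) →
        Fin n × ((range fun q => Θ (q, 0))ᶜ : Set M),
      IsOpenEmbedding a ∧ ∀ d i x v,
        (a ((d, i), (x, v))).1 = d ∧ ((a ((d, i), (x, v))).2 : M) = Θ ((i, x), v) := by
  have hoff : ∀ q (v : {v : ℂ // v ≠ 0}), Θ (q, v) ∈ (range fun q => Θ (q, 0))ᶜ := by
    rintro q v ⟨q', h⟩
    exact v.2 (congrArg Prod.snd (hΘ.injective h)).symm
  refine ⟨fun c => (c.1.1, ⟨Θ ((c.1.2, c.2.1), c.2.2), hoff _ _⟩), ?_, fun _ _ _ _ => ⟨rfl, rfl⟩⟩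
  have hv : IsOpenEmbedding (Subtype.val : {v : ℂ // v ≠ 0} → ℂ) :=
    (isOpen_ne (x := (0 : ℂ))).isOpenEmbedding_subtypeVal
  refine .of_continuous_injective_isOpenMap ?_ ?_ ?_
  · have := hΘ.continuous
    exact (by fun_prop : Continuous fun c : (Fin n × Fin m) × (S × {v : ℂ // v ≠ 0}) =>
      c.1.1).prodMk (Continuous.subtype_mk (by fun_prop) _)
  · rintro ⟨⟨d, i⟩, x, v⟩ ⟨⟨d', i'⟩, x', v'⟩ h
    obtain ⟨rfl, h2⟩ := Prod.mk.inj h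
    have h3 := hΘ.injective (Subtype.ext_iff.mp h2)
    simp only [Prod.mk.injEq] at h3
    obtain ⟨⟨rfl, rfl⟩, h4⟩ := h3
    rw [Subtype.ext h4]
  · have h1 : IsOpenMap fun c : (Fin n × Fin m) × (S × {v : ℂ // v ≠ 0}) =>
        (c.1.1, ((c.1.2, c.2.1), (c.2.2 : ℂ))) := by
      have h2 := (IsOpenMap.id (X := Fin n)).prodMap (((IsOpenMap.id (X := Fin m × S)).prodMap
        hv.isOpenMap).comp (Homeomorph.prodAssoc (Fin m) S {v : ℂ // v ≠ 0}).symm.isOpenMap)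
      exact h2.comp (Homeomorph.prodAssoc (Fin n) (Fin m) _).isOpenMap
    have h2 := ((IsOpenMap.id (X := Fin n)).prodMap hΘ.isOpenMap).comp h1
    intro U hU
    have h3 := h2 U hU
    have h4 : Continuous (Prod.map id Subtype.val :
        Fin n × ((range fun q => Θ (q, 0))ᶜ : Set M) → Fin n × M) := by fun_prop
    convert h3.preimage h4 using 1
    ext ⟨d, m⟩
    constructor
    · rintro ⟨c, hc, h⟩
      exact ⟨c, hc, by rw [← h]; rfl⟩
    · rintro ⟨c, hc, h⟩
      obtain ⟨h5, h6⟩ := Prod.mk.inj h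
      exact ⟨c, hc, Prod.ext h5 (Subtype.ext h6)⟩

/-- Inversion in the unit circle, as a homeomorphism. -/
noncomputable def circleInversionHomeomorph : {v : ℂ // v ≠ 0} ≃ₜ {v : ℂ // v ≠ 0} where
  toFun v := ⟨circleInversion v, circleInversion_ne_zero v.2⟩
  invFun v := ⟨circleInversion v, circleInversion_ne_zero v.2⟩
  left_inv _ := Subtype.ext (circleInversion_circleInversion _)
  right_inv _ := Subtype.ext (circleInversion_circleInversion _)
  continuous_toFun := (continuousOn_circleInversion.domRestrict).subtype_mk _
  continuous_invFun := (continuousOn_circleInversion.domRestrict).subtype_mk _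

/-- Let `Z` be the union of `M₁` and `M₂` minus the cores of the tubes `τ₁` and `τ₂`, glued along
the tubes, and let `cᵢ : Mtᵢ → Mᵢ` be coverings for which the preimages of the tubes are
families of `r` and `l` tubes, all covering the tubes downstairs in the same way. Then `l` copies
of `Mt₁` and `r` copies of `Mt₂`, minus the cores, glued in the pattern of the complete
bipartite graph, form a covering of `Z`. -/
theorem exists_glued_covering {r l n : ℕ} (hr : r ≠ 0) (hl : l ≠ 0) {S M₁ M₂ Z : Type*}
    [TopologicalSpace S] [CompactSpace S] [ConnectedSpace S] [TopologicalSpace M₁]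
    [TopologicalSpace M₂] [TopologicalSpace Z] [T2Space Z]
    {Mt₁ : Type u₁} [TopologicalSpace Mt₁] [T2Space Mt₁] [CompactSpace Mt₁] [ConnectedSpace Mt₁]
    {Mt₂ : Type u₂} [TopologicalSpace Mt₂] [T2Space Mt₂] [CompactSpace Mt₂] [ConnectedSpace Mt₂]
    {τ₁ : S × ℂ → M₁} {τ₂ : S × ℂ → M₂} {j₁ : M₁ → Z} {j₂ : M₂ → Z}
    (hτ₁ : Function.Injective τ₁) (hτ₂ : Function.Injective τ₂)
    (hj₁ : IsLocalHomeomorphOn j₁ (range fun x => τ₁ (x, 0))ᶜ)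
    (hj₂ : IsLocalHomeomorphOn j₂ (range fun x => τ₂ (x, 0))ᶜ)
    (hj₂i : InjOn j₂ (range fun x => τ₂ (x, 0))ᶜ)
    (hcover : j₁ '' (range fun x => τ₁ (x, 0))ᶜ ∪ j₂ '' (range fun x => τ₂ (x, 0))ᶜ = univ)
    (hglue : ∀ p ∈ (range fun x => τ₁ (x, 0))ᶜ, ∀ q ∈ (range fun x => τ₂ (x, 0))ᶜ,
      j₁ p = j₂ q ↔ ∃ x v, v ≠ 0 ∧ p = τ₁ (x, v) ∧ q = τ₂ (x, circleInversion v))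
    {c₁ : Mt₁ → M₁} {c₂ : Mt₂ → M₂} (hc₁ : IsLocalHomeomorph c₁) (hc₁s : Function.Surjective c₁)
    (hc₂ : IsLocalHomeomorph c₂) (hc₂n : ∀ q, (c₂ ⁻¹' {q}).encard = n) (hn : n ≠ 0) {κ : S → S}
    {Θ₁ : (Fin r × S) × ℂ → Mt₁} {Θ₂ : (Fin l × S) × ℂ → Mt₂}
    (hΘ₁ : IsOpenEmbedding Θ₁) (hΘ₂ : IsOpenEmbedding Θ₂)
    (hcΘ₁ : ∀ i x v, c₁ (Θ₁ ((i, x), v)) = τ₁ (κ x, v))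
    (hcΘ₂ : ∀ j x v, c₂ (Θ₂ ((j, x), v)) = τ₂ (κ x, v))
    (hΘ₁r : range Θ₁ = c₁ ⁻¹' range τ₁) (hΘ₂r : range Θ₂ = c₂ ⁻¹' range τ₂)
    {x₀ : S} {γ₁ : Fin r → ℝ → Mt₁} (hγ₁ : IsStarToTubes Θ₁ x₀ γ₁) {γ₂ : Fin l → ℝ → Mt₂}
    (hγ₂ : IsStarToTubes Θ₂ x₀ γ₂) :
    ∃ (Y : Type (max u₁ u₂)) (_ : TopologicalSpace Y) (k : Mt₁ → Y) (P : Y → Z),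
      T2Space Y ∧ ConnectedSpace Y ∧ IsCoveringMap P ∧ (∀ z, (P ⁻¹' {z}).encard = (r * n : ℕ)) ∧
      ContinuousOn k (range fun q => Θ₁ (q, 0))ᶜ ∧ InjOn k (range fun q => Θ₁ (q, 0))ᶜ ∧
      (∀ m ∈ (range fun q => Θ₁ (q, 0))ᶜ, P (k m) = j₁ (c₁ m)) ∧
      RetractsOntoCopy Y (graphRealization (completeBipartiteGraph (Fin r) (Fin l))) := by
  set C₁ : Set Mt₁ := (range fun q => Θ₁ (q, 0))ᶜ with hC₁
  set C₂ : Set Mt₂ := (range fun q => Θ₂ (q, 0))ᶜ with hC₂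
  have hC₁o : IsOpen C₁ := by
    have := hΘ₁.continuous
    exact (isCompact_range (by fun_prop)).isClosed.isOpen_compl
  have hC₂o : IsOpen C₂ := by
    have := hΘ₂.continuous
    exact (isCompact_range (by fun_prop)).isClosed.isOpen_compl
  have hm₁ : MapsTo c₁ C₁ (range fun x => τ₁ (x, 0))ᶜ := by
    rintro m hm ⟨x, hx⟩
    obtain ⟨⟨⟨i, x'⟩, v⟩, rfl⟩ : m ∈ range Θ₁ := hΘ₁r ▸ (⟨(x, 0), hx⟩ : c₁ m ∈ range τ₁)
    rw [hcΘ₁] at hx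
    obtain rfl : 0 = v := congrArg Prod.snd (hτ₁ hx)
    exact hm ⟨(i, x'), rfl⟩
  have hm₂ : MapsTo c₂ C₂ (range fun x => τ₂ (x, 0))ᶜ := by
    rintro m hm ⟨x, hx⟩
    obtain ⟨⟨⟨j, x'⟩, v⟩, rfl⟩ : m ∈ range Θ₂ := hΘ₂r ▸ (⟨(x, 0), hx⟩ : c₂ m ∈ range τ₂)
    rw [hcΘ₂] at hx
    obtain rfl : 0 = v := congrArg Prod.snd (hτ₂ hx)
    exact hm ⟨(j, x'), rfl⟩
  have hm₁' : ∀ m, c₁ m ∈ (range fun x => τ₁ (x, 0))ᶜ → m ∈ C₁ := by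
    rintro m hm ⟨⟨i, x⟩, rfl⟩
    exact hm ⟨κ x, (hcΘ₁ i x 0).symm⟩
  have hm₂' : ∀ m, c₂ m ∈ (range fun x => τ₂ (x, 0))ᶜ → m ∈ C₂ := by
    rintro m hm ⟨⟨j, x⟩, rfl⟩
    exact hm ⟨κ x, (hcΘ₂ j x 0).symm⟩
  obtain ⟨a₁, ha₁, ha₁v⟩ := exists_isOpenEmbedding_tubes (n := l) hΘ₁
  obtain ⟨a₂', ha₂', ha₂v'⟩ := exists_isOpenEmbedding_tubes (n := r) hΘ₂
  let s : (Fin l × Fin r) × (S × {v : ℂ // v ≠ 0}) ≃ₜ (Fin r × Fin l) × (S × {v : ℂ // v ≠ 0}) :=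
    (Homeomorph.prodComm _ _).prodCongr ((Homeomorph.refl S).prodCongr circleInversionHomeomorph)
  have ha₂ : IsOpenEmbedding (a₂' ∘ s) := ha₂'.comp s.isOpenEmbedding
  have ha₂v : ∀ j i x v, ((a₂' ∘ s) ((j, i), (x, v))).1 = i ∧
      (((a₂' ∘ s) ((j, i), (x, v))).2 : Mt₂) = Θ₂ ((j, x), circleInversion v) :=
    fun j i x v => ha₂v' i j x (circleInversionHomeomorph v)
  have hP₁ : IsLocalHomeomorph fun p : Fin l × C₁ => j₁ (c₁ p.2) := by
    refine isLocalHomeomorph_comp_snd (f := fun m : C₁ => j₁ (c₁ m)) ?_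
    rw [isLocalHomeomorph_iff_isLocalHomeomorphOn_univ]
    exact hj₁.comp (hc₁.comp hC₁o.isOpenEmbedding_subtypeVal.isLocalHomeomorph).isLocalHomeomorphOn
      fun m _ => hm₁ m.2
  have hP₂ : IsLocalHomeomorph fun p : Fin r × C₂ => j₂ (c₂ p.2) := by
    refine isLocalHomeomorph_comp_snd (f := fun m : C₂ => j₂ (c₂ m)) ?_
    rw [isLocalHomeomorph_iff_isLocalHomeomorphOn_univ]
    exact hj₂.comp (hc₂.comp hC₂o.isOpenEmbedding_subtypeVal.isLocalHomeomorph).isLocalHomeomorphOn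
      fun m _ => hm₂ m.2
  have ha : ∀ a, j₁ (c₁ (a₁ a).2) = j₂ (c₂ ((a₂' ∘ s) a).2) := by
    rintro ⟨⟨j, i⟩, x, v⟩
    rw [hglue _ (hm₁ (a₁ _).2.2) _ (hm₂ ((a₂' ∘ s) _).2.2), (ha₁v j i x v).2, (ha₂v j i x v).2,
      hcΘ₁, hcΘ₂]
    exact ⟨κ x, v, v.2, rfl, rfl⟩
  have hmax₁ : ∀ v w, j₁ (c₁ (v : Fin l × C₁).2) = j₂ (c₂ (w : Fin r × C₂).2) → v ∈ range a₁ := by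
    rintro ⟨j, m, hm⟩ ⟨i, m', hm'⟩ h
    obtain ⟨x, v, hv, h1, -⟩ := (hglue _ (hm₁ hm) _ (hm₂ hm')).mp h
    obtain ⟨⟨⟨i', x'⟩, v'⟩, rfl⟩ : m ∈ range Θ₁ := hΘ₁r ▸ (⟨(x, v), h1.symm⟩ : c₁ m ∈ range τ₁)
    rw [hcΘ₁] at h1
    obtain rfl : v' = v := congrArg Prod.snd (hτ₁ h1)
    exact ⟨((j, i'), (x', ⟨v', hv⟩)), Prod.ext (ha₁v _ _ _ _).1 (Subtype.ext (ha₁v _ _ _ _).2)⟩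
  have hmax₂ : ∀ v w, j₁ (c₁ (v : Fin l × C₁).2) = j₂ (c₂ (w : Fin r × C₂).2) →
      w ∈ range (a₂' ∘ s) := by
    rintro ⟨j, m, hm⟩ ⟨i, m', hm'⟩ h
    obtain ⟨x, v, hv, -, h1⟩ := (hglue _ (hm₁ hm) _ (hm₂ hm')).mp h
    obtain ⟨⟨⟨j', x'⟩, v'⟩, rfl⟩ : m' ∈ range Θ₂ := hΘ₂r ▸ (⟨_, h1.symm⟩ : c₂ m' ∈ range τ₂)
    rw [hcΘ₂] at h1
    obtain rfl : v' = circleInversion v := congrArg Prod.snd (hτ₂ h1)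
    exact ⟨((j', i), (x', ⟨v, hv⟩)), Prod.ext (ha₂v _ _ _ _).1 (Subtype.ext (ha₂v _ _ _ _).2)⟩
  obtain ⟨Y, _, k₁, k₂, P, hY, hk₁, hk₂, hk, hkk, hP, hPk₁, hPk₂⟩ :=
    exists_gluing ha₁ ha₂ hP₁ hP₂ ha hmax₁
  have hkk' : ∀ j i (m : C₁) (m' : C₂), k₁ (j, m) = k₂ (i, m') ↔
      ∃ x v, v ≠ 0 ∧ (m : Mt₁) = Θ₁ ((i, x), v) ∧ (m' : Mt₂) = Θ₂ ((j, x), circleInversion v) := by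
    intro j i m m'
    rw [hkk]
    constructor
    · rintro ⟨⟨⟨j', i'⟩, x, v⟩, h1, h2⟩
      have h3 := ha₁v j' i' x v
      have h4 := ha₂v j' i' x v
      rw [← h1] at h3
      rw [← h2] at h4
      obtain ⟨rfl, h3⟩ := h3
      obtain ⟨rfl, h4⟩ := h4
      exact ⟨x, v, v.2, h3, h4⟩
    · rintro ⟨x, v, hv, h1, h2⟩
      have h3 := ha₁v j i x ⟨v, hv⟩
      have h4 := ha₂v j i x ⟨v, hv⟩
      exact ⟨((j, i), (x, ⟨v, hv⟩)), Prod.ext h3.1.symm (Subtype.ext (h1.trans h3.2.symm)),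
        Prod.ext h4.1.symm (Subtype.ext (h2.trans h4.2.symm))⟩
  let j₀ : Fin l := ⟨0, Nat.pos_of_ne_zero hl⟩
  let i₀ : Fin r := ⟨0, Nat.pos_of_ne_zero hr⟩
  -- a point in the common part of the `j`-th and the `i`-th piece
  have hmeet : ∀ j i, ∃ (m : C₁) (m' : C₂), k₁ (j, m) = k₂ (i, m') := fun j i =>
    ⟨(a₁ ((j, i), (x₀, ⟨1, one_ne_zero⟩))).2, ((a₂' ∘ s) ((j, i), (x₀, ⟨1, one_ne_zero⟩))).2,
      (hkk' _ _ _ _).mpr ⟨x₀, 1, one_ne_zero, (ha₁v _ _ _ _).2, (ha₂v _ _ _ _).2⟩⟩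
  have hcon₁ : ∀ j, IsPreconnected (range fun m => k₁ (j, m)) := by
    intro j
    have : PreconnectedSpace C₁ := isPreconnected_iff_preconnectedSpace.mp
      (isPreconnected_compl_cores hΘ₁)
    exact isPreconnected_range (hk₁.continuous.comp (by fun_prop))
  have hcon₂ : ∀ i, IsPreconnected (range fun m => k₂ (i, m)) := by
    intro i
    have : PreconnectedSpace C₂ := isPreconnected_iff_preconnectedSpace.mp
      (isPreconnected_compl_cores hΘ₂)
    exact isPreconnected_range (hk₂.continuous.comp (by fun_prop))
  have hcon : ∀ j i, IsPreconnected ((range fun m => k₁ (j, m)) ∪ range fun m => k₂ (i, m)) := by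
    intro j i
    obtain ⟨m, m', h⟩ := hmeet j i
    exact (hcon₁ j).union _ ⟨m, rfl⟩ ⟨m', h.symm⟩ (hcon₂ i)
  obtain ⟨m₀, m₀', hm₀⟩ := hmeet j₀ i₀
  have hYc : ConnectedSpace Y := by
    have hpre : PreconnectedSpace Y := by
      refine ⟨?_⟩
      have := isPreconnected_iUnion (s := fun p : Fin l × Fin r =>
        ((range fun m => k₁ (j₀, m)) ∪ range fun m => k₂ (p.2, m)) ∪
          ((range fun m => k₁ (p.1, m)) ∪ range fun m => k₂ (p.2, m)))
        ⟨k₁ (j₀, m₀), mem_iInter.mpr fun p => .inl (.inl ⟨m₀, rfl⟩)⟩ fun p => by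
          obtain ⟨m, m', h⟩ := hmeet j₀ p.2
          exact (hcon _ _).union (k₂ (p.2, m')) (.inr ⟨m', rfl⟩) (.inr ⟨m', rfl⟩) (hcon _ _)
      convert this
      refine (eq_univ_iff_forall.mpr fun y => ?_).symm
      rcases (hk ▸ mem_univ y : y ∈ range k₁ ∪ range k₂) with ⟨⟨j, m⟩, rfl⟩ | ⟨⟨i, m⟩, rfl⟩
      · exact mem_iUnion.mpr ⟨(j, i₀), .inr (.inl ⟨m, rfl⟩)⟩
      · exact mem_iUnion.mpr ⟨(j₀, i), .inr (.inr ⟨m, rfl⟩)⟩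
    exact { hpre with toNonempty := ⟨k₁ (j₀, m₀)⟩ }
  -- the embeddings of the pieces, extended by a constant over the cores
  let e₁ : Fin l → Mt₁ → Y := fun j =>
    Function.extend Subtype.val (fun m : C₁ => k₁ (j, m)) fun _ => k₁ (j₀, m₀)
  let e₂ : Fin r → Mt₂ → Y := fun i =>
    Function.extend Subtype.val (fun m : C₂ => k₂ (i, m)) fun _ => k₁ (j₀, m₀)
  have he₁ : ∀ j m (hm : m ∈ C₁), e₁ j m = k₁ (j, ⟨m, hm⟩) := fun j m hm =>
    Subtype.val_injective.extend_apply _ _ (⟨m, hm⟩ : C₁)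
  have he₂ : ∀ i m (hm : m ∈ C₂), e₂ i m = k₂ (i, ⟨m, hm⟩) := fun i m hm =>
    Subtype.val_injective.extend_apply _ _ (⟨m, hm⟩ : C₂)
  have he₁c : ∀ j, ContinuousOn (e₁ j) C₁ := by
    intro j
    rw [continuousOn_iff_continuous_domRestrict]
    have : C₁.domRestrict (e₁ j) = fun m => k₁ (j, m) := funext fun m => he₁ j m m.2
    rw [this]
    exact hk₁.continuous.comp (by fun_prop)
  have he₂c : ∀ i, ContinuousOn (e₂ i) C₂ := by
    intro i
    rw [continuousOn_iff_continuous_domRestrict]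
    have : C₂.domRestrict (e₂ i) = fun m => k₂ (i, m) := funext fun m => he₂ i m m.2
    rw [this]
    exact hk₂.continuous.comp (by fun_prop)
  have he₁i : ∀ j j', ∀ m ∈ C₁, ∀ m' ∈ C₁, e₁ j m = e₁ j' m' → j = j' ∧ m = m' := by
    intro j j' m hm m' hm' h
    rw [he₁ j m hm, he₁ j' m' hm'] at h
    have := Prod.mk.inj (hk₁.injective h)
    exact ⟨this.1, congrArg Subtype.val this.2⟩
  have he₂i : ∀ j j', ∀ m ∈ C₂, ∀ m' ∈ C₂, e₂ j m = e₂ j' m' → j = j' ∧ m = m' := by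
    intro j j' m hm m' hm' h
    rw [he₂ j m hm, he₂ j' m' hm'] at h
    have := Prod.mk.inj (hk₂.injective h)
    exact ⟨this.1, congrArg Subtype.val this.2⟩
  obtain ⟨hYcpt, hret⟩ := retractsOntoCopy_of_stars hr hl hΘ₁ hΘ₂ he₁c he₂c he₁i he₂i
    (fun y => by
      rcases (hk ▸ mem_univ y : y ∈ range k₁ ∪ range k₂) with ⟨⟨j, m, hm⟩, rfl⟩ | ⟨⟨i, m, hm⟩, rfl⟩
      · exact .inl ⟨j, m, hm, he₁ j m hm⟩
      · exact .inr ⟨i, m, hm, he₂ i m hm⟩)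
    (fun j i m hm m' hm' => by rw [he₁ j m hm, he₂ i m' hm', hkk']) hγ₁ hγ₂
  have hPcov : IsCoveringMap P := isLocalHomeomorph_iff_isCoveringMap.mp hP
  have hcount : ∀ q ∈ (range fun x => τ₂ (x, 0))ᶜ, (P ⁻¹' {j₂ q}).encard = (r * n : ℕ) := by
    intro q hq
    let φ : Fin r × (c₂ ⁻¹' {q}) → Y := fun p =>
      k₂ (p.1, ⟨p.2, hm₂' p.2 (by rw [show c₂ p.2 = q from p.2.2]; exact hq)⟩)
    have hφ : Function.Injective φ := by
      intro p p' h
      have := Prod.mk.inj (hk₂.injective h)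
      exact Prod.ext this.1 (Subtype.ext (congrArg (fun m : C₂ => (m : Mt₂)) this.2))
    have hran : P ⁻¹' {j₂ q} = range φ := by
      have hr₂ : ∀ w, P (k₂ w) = j₂ q → k₂ w ∈ range φ := by
        rintro ⟨i, m, hm⟩ h
        rw [hPk₂] at h
        exact ⟨(i, ⟨m, hj₂i (hm₂ hm) hq h⟩), rfl⟩
      ext y
      constructor
      · intro hy
        rcases (hk ▸ mem_univ y : y ∈ range k₁ ∪ range k₂) with ⟨v, rfl⟩ | ⟨w, rfl⟩
        · obtain ⟨m', hm'⟩ : (c₂ ⁻¹' {q}).Nonempty := by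
            rw [← encard_ne_zero, hc₂n]
            exact_mod_cast hn
          obtain ⟨a, rfl⟩ := hmax₁ v (i₀, ⟨m', hm₂' m' (by
            rw [show c₂ m' = q from hm']; exact hq)⟩) (by
              rw [← hPk₁]
              exact hy.trans (congrArg j₂ hm').symm)
          have h : k₁ (a₁ a) = k₂ ((a₂' ∘ s) a) := (hkk _ _).mpr ⟨a, rfl, rfl⟩
          rw [h] at hy ⊢
          exact hr₂ _ hy
        · exact hr₂ w hy
      · rintro ⟨⟨i, m, hm⟩, rfl⟩
        exact (hPk₂ _).trans (congrArg j₂ hm)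
    rw [hran, ← image_univ, hφ.injOn.encard_image, encard_univ, ENat.card_prod]
    have : ENat.card (c₂ ⁻¹' {q}) = n := hc₂n q
    rw [this]
    simp
  have hPs : Function.Surjective P := by
    intro z
    rcases (hcover ▸ mem_univ z : z ∈ _ ∪ _) with ⟨p, hp, rfl⟩ | ⟨q, hq, rfl⟩
    · obtain ⟨m, rfl⟩ := hc₁s p
      exact ⟨k₁ (j₀, ⟨m, hm₁' m hp⟩), hPk₁ _⟩
    · have : (P ⁻¹' {j₂ q}).Nonempty := by
        rw [← encard_ne_zero, hcount q hq]
        exact_mod_cast mul_ne_zero hr hn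
      exact this
  have : ConnectedSpace Z := hPs.connectedSpace hP.continuous
  refine ⟨Y, inferInstance, e₁ j₀, P, hY, hYc, hPcov, fun z => ?_, he₁c j₀,
    fun m hm m' hm' h => (he₁i j₀ j₀ m hm m' hm' h).2, fun m hm => by rw [he₁ j₀ m hm, hPk₁], hret⟩
  rw [hPcov.encard_fibre_eq z (j₂ (c₂ m₀')), hcount _ (hm₂ m₀'.2)]

end

/-! ### The covering of the normal sum of a torus bundle and a zero surgery -/

section

open Topology

theorem isLocalHomeomorph_torus_pow {l : ℕ} (hl : l ≠ 0) :
    IsLocalHomeomorph fun x : Circle × Circle => x ^ l :=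
  (isLocalHomeomorph_circle_pow hl).prodMap_of (isLocalHomeomorph_circle_pow hl)

theorem RetractsOntoCopy.of_homeomorph {Y Y' A : Type*} [TopologicalSpace Y] [TopologicalSpace Y']
    [TopologicalSpace A] (h : RetractsOntoCopy Y A) (e : Y' ≃ₜ Y) : RetractsOntoCopy Y' A := by
  obtain ⟨i, ρ, hi, hρ, hρi⟩ := h
  exact ⟨e.symm ∘ i, ρ ∘ e, e.symm.continuous.comp hi, hρ.comp e.continuous, fun a => by
    simp [hρi]⟩

/-- The preimage of a tube `τ` about `S¹ × K'` under the covering `(z, n) ↦ (z ^ l, p₀ n)` consists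
of `r` tubes, which cover `τ` by the `l`-th power map of the torus, and there is a star ending on
their cores. -/
theorem exists_tubes_circle_prod {N₀ Nt₀ : Type*} [TopologicalSpace N₀] [T2Space N₀]
    [TopologicalSpace Nt₀] [T2Space Nt₀] [CompactSpace Nt₀] [ConnectedSpace Nt₀]
    [ChartedSpace (EuclideanSpace ℝ (Fin 3)) Nt₀] {σ : Circle × ℂ → N₀} (hσ : IsOpenEmbedding σ)
    {p₀ : Nt₀ → N₀} (hp₀ : IsCoveringMap p₀) {r l : ℕ} (hl : l ≠ 0) {Λ : Fin r × Circle → Nt₀}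
    (hΛ : Continuous Λ) (hΛi : Function.Injective Λ) (hΛr : range Λ = p₀ ⁻¹' dualKnot σ)
    (hΛp : ∀ i z, p₀ (Λ (i, z)) = σ (z ^ l, 0)) {τ : (Circle × Circle) × ℂ → Circle × N₀}
    (hτ : IsOpenEmbedding τ) (hτ0 : ∀ x, τ (x, 0) = (x.1, σ (x.2, 0))) :
    ∃ Θ : (Fin r × (Circle × Circle)) × ℂ → Circle × Nt₀, IsOpenEmbedding Θ ∧
      (∀ i x v, Prod.map (· ^ l) p₀ (Θ ((i, x), v)) = τ (x ^ l, v)) ∧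
      (∀ i x, Θ ((i, x), 0) = (x.1, Λ (i, x.2))) ∧
      range Θ = Prod.map (· ^ l) p₀ ⁻¹' range τ ∧ ∃ Γ, IsStarToCores Θ Γ := by
  have hc : IsCoveringMap (Prod.map (· ^ l) p₀ : Circle × Nt₀ → Circle × N₀) :=
    isLocalHomeomorph_iff_isCoveringMap.mp
      ((isLocalHomeomorph_circle_pow hl).prodMap_of hp₀.isLocalHomeomorph)
  obtain ⟨ϑ, hϑ, -, hϑ0, -⟩ := hp₀.exists_lift_tube hσ (c := fun β : Fin r × Circle => β.2 ^ l)
    (isLocalHomeomorph_comp_snd (isLocalHomeomorph_circle_pow hl)) hΛ hΛi (fun β => hΛp β.1 β.2)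
    (fun y z hy => hΛr ▸ (⟨z, hy.symm⟩ : p₀ y ∈ dualKnot σ))
  obtain ⟨Θ, hΘ, hΘτ, hΘ0, hΘr⟩ := hc.exists_lift_tube hτ
    (c := fun β : Fin r × (Circle × Circle) => β.2 ^ l)
    (isLocalHomeomorph_comp_snd (isLocalHomeomorph_torus_pow hl))
    (Θ₀ := fun β => (β.2.1, Λ (β.1, β.2.2))) (by fun_prop)
    (by
      rintro ⟨i, z, w⟩ ⟨i', z', w'⟩ h
      obtain ⟨rfl, h⟩ := Prod.mk.inj h
      obtain ⟨rfl, rfl⟩ := Prod.mk.inj (hΛi h)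
      rfl)
    (by
      rintro ⟨i, z, w⟩
      rw [hτ0]
      exact Prod.ext rfl (hΛp i w))
    (by
      rintro ⟨z, n⟩ b h
      rw [hτ0] at h
      obtain ⟨⟨i, w⟩, rfl⟩ : n ∈ range Λ :=
        hΛr ▸ (⟨b.2, (Prod.mk.inj h).2.symm⟩ : p₀ n ∈ dualKnot σ)
      exact ⟨(i, (z, w)), rfl⟩)
  have : LocallyPathConnectedSpace Nt₀ :=
    ChartedSpace.locallyPathConnectedSpace (EuclideanSpace ℝ (Fin 3)) Nt₀
  refine ⟨Θ, hΘ, fun i x v => hΘτ _ _, fun i x => hΘ0 _, hΘr, ?_⟩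
  refine exists_isStarToCores_circle_prod
    (locallyModelled_of_chartedSpace (EuclideanSpace ℝ (Fin 3)) Nt₀) ?_ hϑ fun i z w => ?_
  · rw [← Module.finrank_eq_rank, finrank_euclideanSpace_fin]
    exact_mod_cast (by norm_num : 1 < 3)
  · rw [hΘ0, hϑ0]

/-- The preimage of a fibre `f (T²)` of a torus bundle under the covering of degree `l³` consists
of `l` fibres, which are the cores of tubes covering a tube `τ` about `f (T²)`, and there is a star
ending on these fibres. -/
theorem exists_torusBundle_covering_tubes {F X : Type*} [TopologicalSpace F] [T2Space F]
    [ChartedSpace (EuclideanSpace ℝ (Fin 2)) F] [TopologicalSpace X] [T2Space X] {g : ℕ}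
    (hg : 1 ≤ g) (e : F ≃ₜ GenusSurface g) {π : X → F} (hπ : LocallyTrivial (Circle × Circle) π)
    {l : ℕ} (hl : l ≠ 0) {b : F} {f : Circle × Circle → X} (hf : Continuous f)
    (hfi : Function.Injective f) (hfT : range f = π ⁻¹' {b}) {τ : (Circle × Circle) × ℂ → X}
    (hτ : IsOpenEmbedding τ) (hτ0 : ∀ x, τ (x, 0) = f x) :
    ∃ (Xt : Type) (_ : TopologicalSpace Xt) (c : Xt → X)
      (Θ : (Fin l × (Circle × Circle)) × ℂ → Xt), CompactSpace Xt ∧ T2Space Xt ∧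
      ConnectedSpace Xt ∧ IsCoveringMap c ∧ (∀ x, (c ⁻¹' {x}).encard = (l ^ 3 : ℕ)) ∧
      IsOpenEmbedding Θ ∧ (∀ j x v, c (Θ ((j, x), v)) = τ (x ^ l, v)) ∧
      range Θ = c ⁻¹' range τ ∧ ∃ Γ, IsStarToCores Θ Γ := by
  have : NeZero l := ⟨hl⟩
  obtain ⟨Xt, Ft, _, _, c, q, ϖ, hXt, hXt', hXt'', hFt, hFt', hFt'', hc, hcn, hq, hqn, hϖ, hcomm,
    hfib⟩ := exists_torusBundle_covering hg e hπ l
  have hϖs : Function.Surjective ϖ := by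
    intro y
    obtain ⟨U, -, hyU, Ψ, hΨ, hΨf⟩ := hπ (q y)
    obtain ⟨Φ, -, -, hΦ, -⟩ := hfib (q y) (fun t => Ψ (q y, t))
      (hΨ.comp_continuous (by fun_prop) fun t => ⟨hyU, trivial⟩) (hΨf _ hyU).1 (hΨf _ hyU).2 y rfl
    exact ⟨Φ 1, (hΦ ▸ ⟨1, rfl⟩ : Φ 1 ∈ ϖ ⁻¹' {y})⟩
  have hJ : Nat.card (q ⁻¹' {b}) = l := by
    rw [Nat.card_coe_set_eq, ncard_def, hqn, ENat.toNat_natCast]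
  have : Finite (q ⁻¹' {b}) := Nat.finite_of_card_ne_zero (by rw [hJ]; exact hl)
  let y : Fin l ≃ q ⁻¹' {b} := (Finite.equivFinOfCardEq hJ).symm
  choose Φ hΦ hΦi hΦr hΦf using fun j => hfib b f hf hfi hfT (y j) (y j).2
  have hϖΦ : ∀ j x, ϖ (Φ j x) = y j := fun j x =>
    (hΦr j ▸ ⟨x, rfl⟩ : Φ j x ∈ ϖ ⁻¹' {(y j : Ft)})
  obtain ⟨Θ, hΘ, hΘτ, hΘ0, hΘr⟩ := hc.exists_lift_tube hτ
    (c := fun β : Fin l × (Circle × Circle) => β.2 ^ l)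
    (isLocalHomeomorph_comp_snd (isLocalHomeomorph_torus_pow hl))
    (Θ₀ := fun β => Φ β.1 β.2) (continuous_prod_of_discrete_left.mpr hΦ)
    (by
      rintro ⟨j, x⟩ ⟨j', x'⟩ h
      have h' : Φ j x = Φ j' x' := h
      obtain rfl : j = j' := y.injective (Subtype.ext (by rw [← hϖΦ j x, h', hϖΦ]))
      rw [hΦi j h'])
    (fun β => by rw [hτ0]; exact hΦf _ _)
    (by
      intro m x h
      rw [hτ0] at h
      have hm : ϖ m ∈ q ⁻¹' {b} := by
        rw [mem_preimage, hcomm, h]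
        exact (hfT ▸ ⟨x, rfl⟩ : f x ∈ π ⁻¹' {b})
      obtain ⟨j, hj⟩ := y.surjective ⟨ϖ m, hm⟩
      obtain ⟨x', rfl⟩ : m ∈ range (Φ j) := by
        rw [hΦr, hj]
        rfl
      exact ⟨(j, x'), rfl⟩)
  refine ⟨Xt, inferInstance, c, Θ, hXt, hXt', hXt'', hc, hcn, hΘ, fun j x v => hΘτ _ _, hΘr, ?_⟩
  have hmod : LocallyModelled ℂ Ft :=
    ((locallyModelled_of_chartedSpace (EuclideanSpace ℝ (Fin 2)) F).congr
      Complex.orthonormalBasisOneI.repr.toContinuousLinearEquiv).of_isLocalHomeomorph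
      hq.isLocalHomeomorph
  refine hπ.exists_isStarToCores hmod hq hc hϖ hϖs hcomm (y := fun j => (y j : Ft))
    (Subtype.val_injective.comp y.injective) fun j => ?_
  rw [← hΦr j]
  exact congrArg range (funext fun x => hΘ0 (j, x))

end

theorem proposition5p1
    -- the closed surface `F` of genus `g ≥ 1`, the torus bundle `π : X → F`, the fibre over `b`
    {F : Type u₁} [TopologicalSpace F] [T2Space F] [CompactSpace F] [ConnectedSpace F]
    [ChartedSpace (EuclideanSpace ℝ (Fin 2)) F] [IsManifold (𝓡 2) ∞ F]
    (g : ℕ) (hg : 1 ≤ g) (hF : Nonempty (F ≃ₜ GenusSurface g))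
    {X : Type u₂} [TopologicalSpace X] [T2Space X]
    [ChartedSpace (EuclideanSpace ℝ (Fin 4)) X] [IsManifold (𝓡 4) ∞ X]
    (π : X → F) (hπ : IsTorusBundle π) (b : F)
    -- the knot `K`, its zero surgery `N₀`, a tubular neighbourhood `σ` of the dual knot
    (K : Circle → Sphere3) (hK : Manifold.IsSmoothEmbedding (𝓡 1) (𝓡 3) ∞ K)
    {N₀ : Type u₃} [TopologicalSpace N₀] [T2Space N₀]
    [ChartedSpace (EuclideanSpace ℝ (Fin 3)) N₀] [IsManifold (𝓡 3) ∞ N₀]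
    (σ : Circle × ℂ → N₀) (hσ : IsZeroSurgery K σ)
    -- the diffeomorphism `f` from `S¹ × K'` to the fibre over `b`
    (f : Circle × Circle → X)
    (hf : Manifold.IsSmoothEmbedding ((𝓡 1).prod (𝓡 1)) (𝓡 4) ∞ f)
    (hfT : range f = π ⁻¹' {b})
    -- the normal connected sum `X_K`
    {XK : Type u₄} [TopologicalSpace XK] [T2Space XK]
    [ChartedSpace (EuclideanSpace ℝ (Fin 4)) XK] [IsManifold (𝓡 4) ∞ XK]
    (hXK : IsNormalSum ((𝓡 1).prod (𝓡 1)) ((𝓡 1).prod (𝓡 3)) (𝓡 4) (𝓡 4)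
      (fun p : Circle × Circle => (p.1, σ (p.2, 0))) f XK)
    -- the covering `p₀` of `N₀` corresponding to the kernel of `α`
    {Nt₀ : Type u₅} [TopologicalSpace Nt₀] [T2Space Nt₀] [ConnectedSpace Nt₀]
    [ChartedSpace (EuclideanSpace ℝ (Fin 3)) Nt₀] [IsManifold (𝓡 3) ∞ Nt₀]
    (p₀ : C(Nt₀, N₀)) (hp₀ : IsSmoothCovering (𝓡 3) (𝓡 3) p₀)
    {G : Type u₆} [Group G] [Finite G] (x₀ : Nt₀)
    (α : FundamentalGroup N₀ (p₀ x₀) →* G) (hα : Function.Surjective α)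
    (hker : (FundamentalGroup.map p₀ x₀).range = α.ker)
    -- the preimage of the dual knot has `r` components
    (r : ℕ) (hr : ENat.card (ConnectedComponents (p₀ ⁻¹' dualKnot σ)) = r) :
    -- each component covers the dual knot with the same degree `l`
    ∃ l : ℕ,
      (∀ x ∈ p₀ ⁻¹' dualKnot σ, ∀ y ∈ dualKnot σ,
        {z | z ∈ connectedComponentIn (p₀ ⁻¹' dualKnot σ) x ∧ p₀ z = y}.encard = l) ∧
      ∃ (Y : Type u₄) (_ : TopologicalSpace Y) (_ : T2Space Y) (_ : ConnectedSpace Y)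
        (_ : ChartedSpace (EuclideanSpace ℝ (Fin 4)) Y) (_ : IsManifold (𝓡 4) ∞ Y)
        (P : Y → XK),
        IsSmoothCovering (𝓡 4) (𝓡 4) P ∧
        (∀ y, (P ⁻¹' {y}).encard = r * l ^ 3) ∧
        (∃ ι : Circle × Nt₀ → Y,
          SmoothEmbOn ((𝓡 1).prod (𝓡 3)) (𝓡 4) ι (univ ×ˢ (p₀ ⁻¹' solidTorusExterior σ))) ∧
        RetractsOntoCopy Y (graphRealization (completeBipartiteGraph (Fin r) (Fin l))) := by
  obtain ⟨e⟩ := hF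
  obtain ⟨_, hp₀s, hr0, l, hl, hdeg, Λ, hΛ, hΛi, hΛr, hΛp⟩ :=
    exists_dualKnot_lift hσ hp₀.1 x₀ α hker hr
  have : NeZero l := ⟨hl⟩
  obtain ⟨τ₁, τ₂, j₁, j₂, hτ₁, hτ₁0, hτ₂, hτ₂0, hj₁, hj₂, hcover, hglue⟩ := hXK.exists_normalForm
  obtain ⟨Θ₁, hΘ₁, hΘ₁τ, hΘ₁0, hΘ₁r, Γ₁, hΓ₁⟩ :=
    exists_tubes_circle_prod hσ.isOpenEmbedding hp₀.1 hl hΛ hΛi hΛr hΛp hτ₁ hτ₁0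
  obtain ⟨Xt, _, c, Θ₂, _, _, _, hc, hcn, hΘ₂, hΘ₂τ, hΘ₂r, Γ₂, hΓ₂⟩ :=
    exists_torusBundle_covering_tubes hg e hπ.locallyTrivial hl hf.isEmbedding.continuous
      hf.isEmbedding.injective hfT hτ₂ hτ₂0
  obtain ⟨γ₁, hγ₁⟩ := hΓ₁.exists_isStarToTubes hΘ₁ (1 : Circle × Circle)
  obtain ⟨γ₂, hγ₂⟩ := hΓ₂.exists_isStarToTubes hΘ₂ (1 : Circle × Circle)
  have hr₁ : range (fun p : Circle × Circle => (p.1, σ (p.2, 0))) =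
    range fun x => τ₁ (x, 0) := congrArg range (funext fun x => (hτ₁0 x).symm)
  have hr₂ : range f = range fun x => τ₂ (x, 0) := congrArg range (funext fun x => (hτ₂0 x).symm)
  rw [hr₁] at hj₁ hcover hglue
  rw [hr₂] at hj₂ hcover hglue
  have hpow : IsLocalDiffeomorph ((𝓡 1).prod (𝓡 3)) ((𝓡 1).prod (𝓡 3)) ∞
      (Prod.map (· ^ l) p₀ : Circle × Nt₀ → Circle × N₀) := fun x =>
    (isLocalDiffeomorph_circle_pow hl x.1).prodMap (hp₀.2 x.2)
  obtain ⟨Y, _, k, P, _, _, hP, hPn, hk, hki, hPk, hret⟩ :=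
    exists_glued_covering hr0 hl hτ₁.injective hτ₂.injective hj₁.2.isLocalHomeomorphOn
      hj₂.2.isLocalHomeomorphOn hj₂.1 hcover hglue hpow.isLocalHomeomorph
      ((circle_pow_surjective (l := l)).prodMap hp₀s) hc.isLocalHomeomorph hcn (pow_ne_zero 3 hl)
      hΘ₁ hΘ₂ hΘ₁τ hΘ₂τ hΘ₁r hΘ₂r hγ₁ hγ₂
  -- a covering space with finite fibres fits into the universe of its base
  have hfin : ∀ z, Finite {y // P y = z} := fun z => finite_of_encard_eq_coe (hPn z)
  have : Small.{u₄} Y := small_map (Equiv.sigmaFiberEquiv P).symm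
  let h : Shrink.{u₄} Y ≃ₜ Y := (Shrink.homeomorph Y).symm
  have hT2 : T2Space (Shrink.{u₄} Y) := h.symm.t2Space
  have hconn : ConnectedSpace (Shrink.{u₄} Y) := h.symm.surjective.connectedSpace h.symm.continuous
  have hPh : IsCoveringMap (P ∘ h) := hP.comp_homeomorph h
  obtain ⟨_, hman, hdiff⟩ := hPh.isLocalHomeomorph.exists_smooth_structure (I := 𝓡 4)
  refine ⟨l, hdeg, Shrink.{u₄} Y, inferInstance, hT2, hconn, inferInstance, hman, P ∘ h,
    ⟨hPh, hdiff⟩, fun z => ?_, ⟨h.symm ∘ k, ?_⟩, hret.of_homeomorph h⟩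
  · rw [preimage_comp, ← h.image_symm, h.symm.injective.injOn.encard_image, hPn]
    push_cast
    rfl
  · have hoff : (univ ×ˢ (p₀ ⁻¹' solidTorusExterior σ) : Set (Circle × Nt₀)) ⊆
        (range fun q => Θ₁ (q, 0))ᶜ := by
      rintro _ ⟨-, hx⟩ ⟨⟨i, x⟩, rfl⟩
      refine hx ⟨(x.2 ^ l, 0), by simp, ?_⟩
      simp only [hΘ₁0, hΛp]
    have hopen : IsOpen (range fun q => Θ₁ (q, 0))ᶜ := by
      have := hΘ₁.continuous
      exact (isCompact_range (by fun_prop)).isClosed.isOpen_compl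
    refine ⟨h.symm.injective.comp_injOn (hki.mono hoff), fun x => ?_⟩
    have hx := hoff x.2
    refine IsLocalDiffeomorphAt.of_comp (I'' := 𝓡 4) (P := P ∘ h)
      (h.symm.continuous.continuousAt.comp (hk.continuousAt (hopen.mem_nhds hx))) (hdiff _) ?_
    have hcx : Prod.map (· ^ l) p₀ (x : Circle × Nt₀) ∈ (range fun x => τ₁ (x, 0))ᶜ := by
      rintro ⟨y, hy⟩
      exact x.2.2 ⟨(y.2, 0), by simp, (Prod.mk.inj ((hτ₁0 y).symm.trans hy)).2⟩
    refine ((hpow x).comp (K := 𝓡 4) (P := XK) (hg := hj₁.2 ⟨_, hcx⟩)).congr_of_eventuallyEq ?_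
    filter_upwards [hopen.mem_nhds hx] with m hm
    simp [hPk m hm]
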